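/- Let $a,A>0$ and let $\Omega\subset\mathbb R^3$ be compact with $0\in\mathring\Omega$ and piecewise $C^1$ boundary: $\partial\Omega$ is covered by finitely many $C^1$ images of the unit square and, away from finitely many $C^1$ curves (edges, vertices), $\Omega$ is locally $\{g\le 0\}$ with $g$ of class $C^1$, $\nabla g\neq0$. Suppose that $\Omega$ has the cone property: there are $\alpha\in(0,\pi/2)$ and $r>0$ such that every $y\in\Omega$ is the vertex of a cone $C_y$ of half-angle $\alpha$ with $B(y,r)\cap C_y\subset\Omega$. For $n\in\mathbb N^*$ let $\mathcal L_{n,\Omega}=\frac an\mathbb Z^3\cap\Omega$, $W_n=(\mathbb R^3)^{\mathcal L_{n,\Omega}}$, $W=\prod_{n\ge1}W_n$; let $N_{n,\Omega,x}$ be the set of those of the six nearest neighbours of $x$ in $\frac an\mathbb Z^3$ that lie in $\Omega$, and $$\mathcal E_{n,\mathrm{ex}}(\mu_n)=\frac an\sum_{x\in\mathcal L_{n,\Omega}}\ \sum_{y\in N_{n,\Omega,x}}A\,|\mu_{n,y}-\mu_{n,x}|^2 ,\qquad \mathcal E_{\infty,\mathrm{ex}}(m)=2A\int_\Omega|\nabla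 m|^2\,dx\quad(m\in H^1(\Omega;\mathbb R^3)).$$ Let $W^{\mathfrak h}$ be the set of near-aligned sequences: those $\mu=(\mu_n)\in W$ for which there are $c>0$, sets $l_n\subset\mathcal L_{n,\Omega}$ of defects with $\# l_n=O(n)$, and $c_n\to0$ such that for all $n$, all $x\in\mathcal L_{n,\Omega}$ and all $y\in N_{n,\Omega,x}$ one has $|\mu_{n,x}-\mu_{n,y}|^2\le c/n^2$ if $x\notin l_n$, and $|\mu_{n,x}-\mu_{n,y}|^2\le c_n$ if $x\in l_n$. Let $W_1$ be the set of $\mu\in W$ with $|\mu_{n,x}|=1$ for all $n$ and $x$. Cut each cell of $\frac an\mathbb Z^3$ into five tetrahedra: a center one, whose vertices are the four vertices $\frac an k$ of the cell with $k_1+k_2+k_3$ odd, and the four corner tetrahedra spanned by one of the other vertices of the cell and its three neighbours in the cell. Let $P_n(\mu_n)$ be equal to $\mu_n$ at the vertices of, and affine on, every such tetrahedron contained in $\Omega$, and zero elsewhere in $\Omega$. Write $\mu_n\to m\in H^1(\Omega;\mathbb R^3)$ if $P_n(\mu_n)\rightharpoonup m$ weakly in $H^1$, in the sense that $P_n(\mu_n)\rightharpoonup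 m$ and $\nabla P_n(\mu_n)\rightharpoonup\nabla m$ weakly in $L^2(\Omega)$, where $\nabla P_n(\mu_n)$ is computed on each tetrahedron and is zero off the tetrahedra. Then $\mathcal E_{n,\mathrm{ex}}$ $\Gamma$-converges to $\mathcal E_{\infty,\mathrm{ex}}$ for this convergence, compatibly with the unit-norm constraint: 1. If $\mu\in W$ (in particular if $\mu\in W^{\mathfrak h}$) and $\mu_n\to m\in H^1(\Omega;\mathbb R^3)$, then $\liminf_n\mathcal E_{n,\mathrm{ex}}(\mu_n)\ge\mathcal E_{\infty,\mathrm{ex}}(m)$. 2. For every $m\in H^1(\Omega;\mathbb R^3)$ there is $\mu\in W$ with $\mu_n\to m$ and $\limsup_n\mathcal E_{n,\mathrm{ex}}(\mu_n)\le\mathcal E_{\infty,\mathrm{ex}}(m)$. If $m$ is Lipschitz on $\Omega$ (after modification on a null set), one can take $\mu\in W^{\mathfrak h}$. 3. If $\mu\in W_1$ and $\mu_n\to m\in H^1(\Omega;\mathbb R^3)$, then $|m|=1$ a.e. in $\Omega$. Conversely, if $m\in H^1(\Omega;\mathbb R^3)$ and $|m|=1$ a.e. in $\Omega$, then $\mu$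 in 2 can be taken in $W_1$, and in $W_1\cap W^{\mathfrak h}$ if $m$ is moreover Lipschitz. -/

import Mathlib

open MeasureTheory Filter Topology
open scoped ContDiff

noncomputable section

/-- Euclidean three-space, used both for positions and for spins. -/
abbrev E3 : Type := EuclideanSpace ℝ (Fin 3)

/-! ### The domain -/

/-- Near the point `p`, the closed set `Ω` is the sublevel set `{g ≤ 0}` of a `C¹` function whose
differential does not vanish at `p`. -/
def IsC1BoundaryPoint (Ω : Set E3) (p : E3) : Prop :=
  ∃ g : E3 → ℝ, ContDiff ℝ 1 g ∧ g p = 0 ∧ fderiv ℝ g p ≠ 0 ∧ ∀ᶠ x in 𝓝 p, (x ∈ Ω ↔ g x ≤ 0)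

/-- Piecewise `C¹` boundary: the boundary is made of finitely many `C¹` patches (`C¹` images of the
unit square), and it is a `C¹` hypersurface with `Ω` on one side, except on finitely many `C¹`
curves (the edges; a vertex is a constant curve). -/
def HasPiecewiseC1Boundary (Ω : Set E3) : Prop :=
  (∃ (N : ℕ) (φ : Fin N → EuclideanSpace ℝ (Fin 2) → E3), (∀ j, ContDiff ℝ 1 (φ j)) ∧
    frontier Ω ⊆ ⋃ j, φ j '' {s | ∀ i, s i ∈ Set.Icc (0 : ℝ) 1}) ∧
  (∃ (M : ℕ) (γ : Fin M → ℝ → E3), (∀ j, ContDiff ℝ 1 (γ j)) ∧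
    ∀ p ∈ frontier Ω, p ∉ (⋃ j, γ j '' Set.Icc (0 : ℝ) 1) → IsC1BoundaryPoint Ω p)

/-- Cone property: there are a half-angle `α` and a radius `r` such that every point `y` of `Ω` is
the vertex of a cone of half-angle `α`, with some axis `v`, whose part in the ball `B(y, r)` lies
in `Ω`. -/
def HasConeProperty (Ω : Set E3) : Prop :=
  ∃ α r : ℝ, 0 < α ∧ α < Real.pi / 2 ∧ 0 < r ∧ ∀ y ∈ Ω, ∃ v : E3, ‖v‖ = 1 ∧
    ∀ z ∈ Metric.ball y r, Real.cos α * ‖z - y‖ ≤ inner ℝ (z - y) v → z ∈ Ω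

/-! ### The shrunk cubic lattice -/

/-- The point of index `k` of the shrunk lattice `(a/n) ℤ³`. -/
def latticePoint (a : ℝ) (n : ℕ+) (k : Fin 3 → ℤ) : E3 :=
  WithLp.toLp 2 fun i => a / ((n : ℕ) : ℝ) * (k i : ℝ)

/-- The (indices of the) points of the shrunk lattice that belong to `Ω`. -/
abbrev Node (a : ℝ) (Ω : Set E3) (n : ℕ+) : Type :=
  {k : Fin 3 → ℤ // latticePoint a n k ∈ Ω}

/-- There are finitely many nodes in a bounded set, so that the sums below are finite sums. -/
theorem finite_node {a : ℝ} (ha : 0 < a) {Ω : Set E3} (hΩ : Bornology.IsBounded Ω) (n : ℕ+) :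
    Finite (Node a Ω n) := by
  obtain ⟨R, hR⟩ := hΩ.exists_norm_le
  have hn : (0 : ℝ) < ((n : ℕ) : ℝ) := by exact_mod_cast n.pos
  have hh : 0 < a / ((n : ℕ) : ℝ) := div_pos ha hn
  obtain ⟨B, hB⟩ := exists_nat_ge (R / (a / ((n : ℕ) : ℝ)))
  have : {k : Fin 3 → ℤ | latticePoint a n k ∈ Ω} ⊆
      Set.Icc (fun _ => -(B : ℤ)) (fun _ => (B : ℤ)) := by
    intro k hk
    have key : ∀ i, |k i| ≤ (B : ℤ) := by
      intro i
      have h1 : ‖latticePoint a n k i‖ ≤ R := (PiLp.norm_apply_le _ i).trans (hR _ hk)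
      have h2 : latticePoint a n k i = a / ((n : ℕ) : ℝ) * (k i : ℝ) := rfl
      rw [h2, Real.norm_eq_abs, abs_mul, abs_of_pos hh] at h1
      have h3 : |(k i : ℝ)| ≤ R / (a / ((n : ℕ) : ℝ)) := by
        rw [le_div_iff₀ hh]; linarith [mul_comm (a / ((n : ℕ) : ℝ)) |(k i : ℝ)|]
      exact_mod_cast h3.trans hB
    exact ⟨fun i => (abs_le.1 (key i)).1, fun i => (abs_le.1 (key i)).2⟩
  exact ((Set.finite_Icc _ _).subset this).to_subtype

/-- Nearest neighbours in the cubic lattice (each point has six). -/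
def Adj (k l : Fin 3 → ℤ) : Prop := ∑ i, |k i - l i| = 1

/-- The space of fields of magnetic moments on the nodes in `Ω` of the `n`-th lattice. -/
abbrev SpinField (a : ℝ) (Ω : Set E3) (n : ℕ+) : Type := Node a Ω n → E3

/-- Discrete exchange energy: every node interacts with its nearest neighbours in `Ω`. -/
def discreteExchangeEnergy (a A : ℝ) (Ω : Set E3) (n : ℕ+) (μ : SpinField a Ω n) : ℝ :=
  a / ((n : ℕ) : ℝ) *
    ∑ᶠ (x : Node a Ω n) (y : Node a Ω n) (_ : Adj x.1 y.1), A * ‖μ y - μ x‖ ^ 2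

/-- Near-alignment: neighbouring moments satisfy `|μ x - μ y|² ≤ c / n²`, except at `O(n)` nodes
`x`, the defects, where one only has `|μ x - μ y|² ≤ cₙ` with `cₙ → 0`. -/
def NearAligned (a : ℝ) (Ω : Set E3) (μ : ∀ n, SpinField a Ω n) : Prop :=
  ∃ c : ℝ, 0 < c ∧ ∃ l : ∀ n, Set (Node a Ω n),
    (∃ C : ℝ, ∀ n : ℕ+, (l n).Finite ∧ ((l n).ncard : ℝ) ≤ C * ((n : ℕ) : ℝ)) ∧
    (∀ n : ℕ+, ∀ x ∉ l n, ∀ y, Adj x.1 y.1 → ‖μ n x - μ n y‖ ^ 2 ≤ c / ((n : ℕ) : ℝ) ^ 2) ∧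
    ∃ cseq : ℕ+ → ℝ, Tendsto cseq atTop (𝓝 0) ∧
      ∀ n : ℕ+, ∀ x ∈ l n, ∀ y, Adj x.1 y.1 → ‖μ n x - μ n y‖ ^ 2 ≤ cseq n

/-- All the moments have unit norm. -/
def UnitSpins (a : ℝ) (Ω : Set E3) (μ : ∀ n, SpinField a Ω n) : Prop :=
  ∀ n x, ‖μ n x‖ = 1

/-! ### The five-tetrahedra partition and the P1 interpolation -/

/-- The eight vertices of the lattice cell with smallest vertex `c`. -/
def cellVertices (c : Fin 3 → ℤ) : Set (Fin 3 → ℤ) := {k | ∀ i, k i = c i ∨ k i = c i + 1}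

/-- The tetrahedra (given by their vertices) of the partition. Each cell is cut into the center
tetrahedron, spanned by its four vertices whose sum of coordinates is odd, and four corner
tetrahedra, spanned by one of the other vertices `v` and its three neighbours in the cell. So the
cuts of adjacent cells are mirror images of each other and match on the common face. -/
def IsTetrahedron (T : Set (Fin 3 → ℤ)) : Prop :=
  ∃ c, T = {k ∈ cellVertices c | Odd (∑ i, k i)} ∨
    ∃ v ∈ cellVertices c, Even (∑ i, v i) ∧ T = {k ∈ cellVertices c | k = v ∨ Adj v k}

/-- The solid tetrahedron in the shrunk lattice. -/
def solid (a : ℝ) (n : ℕ+) (T : Set (Fin 3 → ℤ)) : Set E3 :=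
  convexHull ℝ (latticePoint a n '' T)

/-- `T` is a tetrahedron of the partition that is contained in `Ω` and contains `x`. -/
def IsElementAt (a : ℝ) (Ω : Set E3) (n : ℕ+) (x : E3) (T : Set (Fin 3 → ℤ)) : Prop :=
  IsTetrahedron T ∧ solid a n T ⊆ Ω ∧ x ∈ solid a n T

open Classical in
/-- The affine map that takes the values `μ` at the vertices of `T` (which determine it). -/
def affineOn (a : ℝ) (Ω : Set E3) (n : ℕ+) (μ : SpinField a Ω n) (T : Set (Fin 3 → ℤ)) :
    E3 →ᵃ[ℝ] E3 :=
  if h : ∃ L : E3 →ᵃ[ℝ] E3, ∀ k : Node a Ω n, k.1 ∈ T → L (latticePoint a n k.1) = μ k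
  then h.choose else 0

open Classical in
/-- The P1 interpolant: affine on every tetrahedron of the partition that is contained in `Ω`,
equal to `μ` at its vertices, and zero off these tetrahedra. -/
def interp (a : ℝ) (Ω : Set E3) (n : ℕ+) (μ : SpinField a Ω n) (x : E3) : E3 :=
  if h : ∃ T, IsElementAt a Ω n x T then affineOn a Ω n μ h.choose x else 0

open Classical in
/-- The `i`-th partial derivative of the P1 interpolant, computed on every tetrahedron (it is
constant there, and is determined off the faces, a null set), and zero off the tetrahedra. -/
def interpPartial (a : ℝ) (Ω : Set E3) (n : ℕ+) (μ : SpinField a Ω n) (i : Fin 3) (x : E3) : E3 :=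
  if h : ∃ T, IsElementAt a Ω n x T
  then (affineOn a Ω n μ h.choose).linear (EuclideanSpace.single i 1) else 0

/-! ### The Sobolev space, the convergence, and the limit energy -/

/-- The elements of `H¹(Ω; ℝ³)`: a square-integrable field on `Ω`, with its square-integrable
partial derivatives, in the weak sense in the interior of `Ω`. -/
structure SobolevH1 (Ω : Set E3) where
  toFun : E3 → E3
  pd : Fin 3 → E3 → E3
  memLp_toFun : MemLp toFun 2 (volume.restrict Ω)
  memLp_pd : ∀ i, MemLp (pd i) 2 (volume.restrict Ω)
  integral_by_parts : ∀ φ : E3 → ℝ, ContDiff ℝ ∞ φ → HasCompactSupport φ →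
    tsupport φ ⊆ interior Ω → ∀ i,
      ∫ x in Ω, fderiv ℝ φ x (EuclideanSpace.single i 1) • toFun x = -∫ x in Ω, φ x • pd i x

/-- Continuum exchange energy. -/
def continuumExchangeEnergy (A : ℝ) {Ω : Set E3} (m : SobolevH1 Ω) : ℝ :=
  2 * A * ∫ x in Ω, ∑ i, ‖m.pd i x‖ ^ 2

/-- Convergence of spin fields to `m`: the P1 interpolants converge weakly in `H¹`, that is, the
interpolants and their partial derivatives converge weakly in `L²(Ω; ℝ³)` to those of `m`. -/
def ConvergesTo (a : ℝ) (Ω : Set E3) (μ : ∀ n, SpinField a Ω n) (m : SobolevH1 Ω) : Prop :=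
  ∀ f : E3 → E3, MemLp f 2 (volume.restrict Ω) →
    Tendsto (fun n => ∫ x in Ω, inner ℝ (interp a Ω n (μ n) x) (f x)) atTop
      (𝓝 (∫ x in Ω, inner ℝ (m.toFun x) (f x))) ∧
    ∀ i, Tendsto (fun n => ∫ x in Ω, inner ℝ (interpPartial a Ω n (μ n) i x) (f x)) atTop
      (𝓝 (∫ x in Ω, inner ℝ (m.pd i x) (f x)))

/-- `m` has unit norm almost everywhere in `Ω`. -/
def UnitNorm {Ω : Set E3} (m : SobolevH1 Ω) : Prop :=
  ∀ᵐ x ∂(volume.restrict Ω), ‖m.toFun x‖ = 1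

/-- `m` is Lipschitz on `Ω`, up to a modification on a null set. -/
def IsLipschitz {Ω : Set E3} (m : SobolevH1 Ω) : Prop :=
  ∃ (K : NNReal) (u : E3 → E3), LipschitzOnWith K u Ω ∧ m.toFun =ᵐ[volume.restrict Ω] u

/-- `μ` converges to `m` and satisfies the upper bound of Γ-convergence. -/
def IsRecoverySequence (a A : ℝ) (Ω : Set E3) (μ : ∀ n, SpinField a Ω n) (m : SobolevH1 Ω) :
    Prop :=
  ConvergesTo a Ω μ m ∧
    limsup (fun n => (discreteExchangeEnergy a A Ω n (μ n) : EReal)) atTop ≤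
      (continuumExchangeEnergy A m : EReal)

end

/-! Let h = a/n. A lattice field u is identified with the function x ↦ u (cell h x), constant on the
half-open lattice cells, and its forward difference quotients `dq` are functions of the same kind. A
cell has volume h³, so the discrete energy equals 2A ∑ᵢ ∫ |dq i|² over the cells whose lower corner
and its i-th successor lie in Ω (`ofReal_discreteExchangeEnergy`). The theorem thereby becomes a
statement about difference quotients in L².

Comparison with the interpolant. On every tetrahedron the gradient of the interpolant is a bounded
combination of the difference quotients around the cell (`norm_linear_sub_le`). Conversely, every
edge joins an even vertex to an odd one and is therefore an edge of the corner tetrahedron at its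
even end, where the derivative of the interpolant is the difference quotient
(`interpPartial_eq_of_mem_nearBox`). Hence a bound on the gradients bounds `dq` in L² on sets well
inside Ω, and there the piecewise constant field is within O(h) of the interpolant.

Lower bound (`ConvergesTo.energy_le_liminf`). Weak convergence bounds the interpolants by uniform
boundedness. The piecewise constant fields then have the same weak limit locally, summation by parts
gives dq i ⇀ ∂ᵢm against test functions, and 2⟨dq, ψ⟩ - |ψ|² ≤ |dq|² with ψ close to ∂ᵢm gives the
inequality.

Unit norm of the limit (`UnitSpins.unitNorm`). The difference between the piecewise constant fields
and m tends weakly to zero and its translations are equicontinuous in L¹, because both gradients are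
bounded. So it tends to zero in L¹ on balls, and the constraint passes to the limit.

Criterion for recovery (`EnergyBound.isRecoverySequence`). If u_n → m in L²(Ω) as piecewise constant
functions and the energy on a 4h-neighbourhood of Ω is asymptotically at most the Dirichlet energy,
then weak convergence together with convergence of norms gives dq i → ∂ᵢm strongly, hence strong
convergence of the interpolants.

Construction of such fields. The mean over all translations of the lattice of the energy of samples
of m is at most the Dirichlet energy, with constant exactly one
(`SobolevH1.lintegral_unitCell_dq_le`); some translation is at least as good as the mean. This
settles the interior. A Lipschitz m extends to the space, and the layer near ∂Ω is negligible
because its volume tends to zero. For general m no extension is used: near regular boundary points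
the samples are taken at points displaced into Ω by a vector field (`exists_inward_field`), which
costs only a constant factor in a region where m has little energy (`SobolevH1.exists_samples`). The
singular curves have tubes of volume O(r²), hence zero capacity, and are removed by a cut-off of
small energy (`exists_cutoff`), after truncating m to make it bounded.

For unit fields the samples are joined near the curves to a constant e of the unit ball, and the
result is normalized. The loss is the factor |t p + (1 - t) e|⁻², whose mean over e is bounded
because |x|⁻² is integrable in dimension three (`exists_lintegral_ball_inv_sq_le`), so a suitable e
exists. -/

open scoped ENNReal

/-! ### The cubic lattice of spacing `h` -/

/-- The lattice point of index `k` in `h ℤ³`. -/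
noncomputable def pt (h : ℝ) (k : Fin 3 → ℤ) : E3 := WithLp.toLp 2 fun i => h * (k i : ℝ)

/-- The index of the lower corner of the half-open lattice cell that contains `x`. -/
noncomputable def cell (h : ℝ) (x : E3) : Fin 3 → ℤ := fun i => ⌊x i / h⌋

/-- The unit step in direction `i`. -/
abbrev stp (i : Fin 3) : Fin 3 → ℤ := Pi.single i 1

/-- The `i`-th basis vector. -/
noncomputable abbrev bz (i : Fin 3) : E3 := EuclideanSpace.single i 1

/-- The forward difference quotient of a lattice field, as a piecewise constant function. -/
noncomputable def dq (h : ℝ) (u : (Fin 3 → ℤ) → E3) (i : Fin 3) (x : E3) : E3 :=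
  h⁻¹ • (u (cell h x + stp i) - u (cell h x))

theorem pt_apply (h : ℝ) (k : Fin 3 → ℤ) (i : Fin 3) : pt h k i = h * (k i : ℝ) := rfl

theorem latticePoint_eq_pt (a : ℝ) (n : ℕ+) (k : Fin 3 → ℤ) :
    latticePoint a n k = pt (a / ((n : ℕ) : ℝ)) k := rfl

theorem pt_add (h : ℝ) (k l : Fin 3 → ℤ) : pt h (k + l) = pt h k + pt h l := by
  ext i; simp [pt_apply, mul_add]

theorem pt_sub (h : ℝ) (k l : Fin 3 → ℤ) : pt h (k - l) = pt h k - pt h l := by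
  ext i; simp [pt_apply, mul_sub]

theorem pt_stp (h : ℝ) (i : Fin 3) : pt h (stp i) = h • bz i := by
  ext j; by_cases hj : j = i <;> simp [pt_apply, hj]

theorem cell_add_pt {h : ℝ} (hh : 0 < h) (x : E3) (k : Fin 3 → ℤ) :
    cell h (x + pt h k) = cell h x + k := by
  ext i
  have : (x i + h * (k i : ℝ)) / h = x i / h + (k i : ℝ) := by field_simp
  simp [cell, pt_apply, this]

theorem cell_add_smul_bz {h : ℝ} (hh : 0 < h) (x : E3) (i : Fin 3) :
    cell h (x + h • bz i) = cell h x + stp i := by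
  rw [← pt_stp, cell_add_pt hh]

theorem cell_eq_iff {h : ℝ} (hh : 0 < h) (x : E3) (k : Fin 3 → ℤ) :
    cell h x = k ↔ ∀ i, h * (k i : ℝ) ≤ x i ∧ x i < h * ((k i : ℝ) + 1) := by
  rw [funext_iff]
  refine forall_congr' fun i => ?_
  rw [cell, Int.floor_eq_iff, le_div_iff₀ hh, div_lt_iff₀ hh, mul_comm h, mul_comm h]

theorem sub_pt_cell {h : ℝ} (hh : 0 < h) (x : E3) (i : Fin 3) :
    0 ≤ (x - pt h (cell h x)) i ∧ (x - pt h (cell h x)) i < h := by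
  have := (cell_eq_iff hh x (cell h x)).1 rfl i
  simp only [PiLp.sub_apply, pt_apply]
  constructor <;> nlinarith [this.1, this.2]

/-- The sharp factor is √3; the integer 2 is used for all diameters of cells below. -/
theorem norm_le_of_forall_abs_le {x : E3} {r : ℝ} (hr : ∀ i, |x i| ≤ r) :
    ‖x‖ ≤ 2 * r := by
  have h0 : 0 ≤ r := (abs_nonneg _).trans (hr 0)
  rw [EuclideanSpace.norm_eq, Fin.sum_univ_three]
  refine Real.sqrt_le_iff.2 ⟨by positivity, ?_⟩
  have h1 : ∀ i, ‖x i‖ ^ 2 ≤ r ^ 2 := fun i => by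
    rw [Real.norm_eq_abs]; exact pow_le_pow_left₀ (abs_nonneg _) (hr i) 2
  nlinarith [h1 0, h1 1, h1 2]

theorem abs_apply_le_norm (x : E3) (i : Fin 3) : |x i| ≤ ‖x‖ :=
  PiLp.norm_apply_le x i

theorem norm_bz (i : Fin 3) : ‖bz i‖ = 1 := by simp

theorem norm_sub_pt_cell_le {h : ℝ} (hh : 0 < h) (x : E3) : ‖x - pt h (cell h x)‖ ≤ 2 * h :=
  norm_le_of_forall_abs_le fun i => by
    have := sub_pt_cell hh x i
    rw [abs_of_nonneg this.1]; exact this.2.le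

theorem dist_pt_cell_le {h : ℝ} (hh : 0 < h) (x : E3) : dist x (pt h (cell h x)) ≤ 2 * h := by
  rw [dist_eq_norm]; exact norm_sub_pt_cell_le hh x

theorem dist_pt_add_stp {h : ℝ} (hh : 0 < h) (k : Fin 3 → ℤ) (i : Fin 3) :
    dist (pt h (k + stp i)) (pt h k) = h := by
  rw [dist_eq_norm, pt_add, pt_stp, add_sub_cancel_left, norm_smul, norm_bz,
    Real.norm_of_nonneg hh.le, mul_one]

@[fun_prop]
theorem measurable_cell (h : ℝ) : Measurable (cell h) := by
  unfold cell
  refine measurable_pi_lambda _ fun i => Int.measurable_floor.comp ?_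
  fun_prop

theorem measurable_comp_cell {β : Type*} [MeasurableSpace β] (h : ℝ) (F : (Fin 3 → ℤ) → β) :
    Measurable fun x => F (cell h x) :=
  (measurable_from_top (f := F)).comp (measurable_cell h |>.mono le_rfl (by
    intro s _; exact (Set.to_countable s).measurableSet))

theorem measurable_dq (h : ℝ) (u : (Fin 3 → ℤ) → E3) (i : Fin 3) : Measurable (dq h u i) :=
  measurable_comp_cell h fun k => h⁻¹ • (u (k + stp i) - u k)

theorem volume_cell_eq {h : ℝ} (hh : 0 < h) (k : Fin 3 → ℤ) :
    volume {x : E3 | cell h x = k} = ENNReal.ofReal (h ^ 3) := by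
  have hm := EuclideanSpace.volume_preserving_symm_measurableEquiv_toLp (Fin 3)
  have : {x : E3 | cell h x = k} = (MeasurableEquiv.toLp 2 (Fin 3 → ℝ)).symm ⁻¹'
      (Set.pi Set.univ fun i => Set.Ico (h * (k i : ℝ)) (h * ((k i : ℝ) + 1))) := by
    ext x
    simp [cell_eq_iff hh, Set.mem_pi]
  rw [this, hm.measure_preimage
    (MeasurableSet.univ_pi fun i => measurableSet_Ico).nullMeasurableSet, Real.volume_pi_Ico]
  simp [mul_add, ENNReal.ofReal_pow hh.le]

theorem lintegral_cell {h : ℝ} (hh : 0 < h) (F : (Fin 3 → ℤ) → ℝ≥0∞) :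
    ∫⁻ x, F (cell h x) = ENNReal.ofReal (h ^ 3) * ∑' k, F k := by
  have h1 : ∀ x, F (cell h x) = ∑' k, {y : E3 | cell h y = k}.indicator (fun _ => F k) x := by
    intro x
    rw [tsum_eq_single (cell h x)]
    · simp
    · intro k hk
      simp [hk.symm]
  have h2 : ∀ k, MeasurableSet {y : E3 | cell h y = k} := fun k =>
    measurable_cell h (measurableSet_singleton k)
  simp_rw [h1]
  rw [lintegral_tsum fun k => (measurable_const.indicator (h2 k)).aemeasurable]
  simp_rw [lintegral_indicator_const (h2 _), volume_cell_eq hh]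
  rw [ENNReal.tsum_mul_right, mul_comm]

theorem adj_iff (k l : Fin 3 → ℤ) : Adj k l ↔ ∃ i, l = k + stp i ∨ k = l + stp i := by
  simp only [Adj, Fin.sum_univ_three, Fin.exists_fin_succ, funext_iff, Fin.forall_fin_succ]
  simp [Pi.single_apply]
  constructor
  · intro h
    rcases abs_cases (k 0 - l 0) with h0 | h0 <;> rcases abs_cases (k 1 - l 1) with h1 | h1 <;>
    rcases abs_cases (k 2 - l 2) with h2 | h2 <;> omega
  · intro h
    rcases abs_cases (k 0 - l 0) with h0 | h0 <;> rcases abs_cases (k 1 - l 1) with h1 | h1 <;>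
    rcases abs_cases (k 2 - l 2) with h2 | h2 <;> omega

/-! ### The discrete energy as an integral -/

/-- The points in the cells whose lower corner and its `i`-th successor are nodes in `Ω`. -/
def edgeSet (h : ℝ) (Ω : Set E3) (i : Fin 3) : Set E3 :=
  {x | pt h (cell h x) ∈ Ω ∧ pt h (cell h x + stp i) ∈ Ω}

theorem measurableSet_edgeSet (h : ℝ) (Ω : Set E3) (i : Fin 3) :
    MeasurableSet (edgeSet h Ω i) :=
  measurable_cell h (Set.to_countable
    {k : Fin 3 → ℤ | pt h k ∈ Ω ∧ pt h (k + stp i) ∈ Ω}).measurableSet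

-- Each edge is met from both of its ends, which accounts for the factor 2 in the limit energy.
open Classical in
theorem sum_adj_eq {S : Set (Fin 3 → ℤ)} [Fintype S] (u : (Fin 3 → ℤ) → E3) :
    ∑ x : S, ∑ y : S, (if Adj x.1 y.1 then ‖u y - u x‖ ^ 2 else 0) =
      2 * ∑ i, ∑ x : S, ∑ y : S, (if y.1 = x.1 + stp i then ‖u y - u x‖ ^ 2 else 0) := by
  have key : ∀ x y : S, (if Adj x.1 y.1 then ‖u y - u x‖ ^ 2 else 0) =
      ∑ i, ((if y.1 = x.1 + stp i then ‖u y - u x‖ ^ 2 else 0) +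
        (if x.1 = y.1 + stp i then ‖u x - u y‖ ^ 2 else 0)) := by
    intro x y
    by_cases h : Adj x.1 y.1
    · rw [if_pos h]
      obtain ⟨i, hi⟩ := (adj_iff _ _).1 h
      rw [Finset.sum_eq_single i]
      · rcases hi with hi | hi
        · have : ¬ x.1 = y.1 + stp i := by
            intro h'
            have := congrFun (hi.trans (by rw [h'])) i
            simp at this
            omega
          rw [if_pos hi, if_neg this, add_zero]
        · have : ¬ y.1 = x.1 + stp i := by
            intro h'
            have := congrFun (hi.trans (by rw [h'])) i
            simp at this
            omega
          rw [if_pos hi, if_neg this, zero_add, norm_sub_rev]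
      · intro j _ hj
        have h1 : ¬ y.1 = x.1 + stp j := by
          intro h'
          rcases hi with hi | hi
          · have := congrFun (hi.symm.trans h') j
            simp [hj] at this
          · have := congrFun (hi.trans (by rw [h'])) j
            simp [hj] at this
        have h2 : ¬ x.1 = y.1 + stp j := by
          intro h'
          rcases hi with hi | hi
          · have := congrFun (hi.trans (by rw [h'])) j
            simp [hj] at this
          · have := congrFun (hi.symm.trans h') j
            simp [hj] at this
        rw [if_neg h1, if_neg h2, add_zero]
      · simp
    · rw [if_neg h, Finset.sum_eq_zero]
      intro i _
      rw [if_neg fun h' => h ((adj_iff _ _).2 ⟨i, Or.inl h'⟩),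
        if_neg fun h' => h ((adj_iff _ _).2 ⟨i, Or.inr h'⟩), add_zero]
  simp_rw [key, Finset.sum_add_distrib]
  have e1 : ∑ x : S, ∑ y : S, ∑ i, (if y.1 = x.1 + stp i then ‖u y - u x‖ ^ 2 else 0) =
      ∑ i, ∑ x : S, ∑ y : S, (if y.1 = x.1 + stp i then ‖u y - u x‖ ^ 2 else 0) := by
    rw [Finset.sum_comm]
    rw [Finset.sum_comm' (t' := Finset.univ) (s' := fun _ => Finset.univ) (by simp)]
    simp_rw [Finset.sum_comm (s := (Finset.univ : Finset S)) (t := (Finset.univ : Finset (Fin 3)))]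
  have e2 : ∑ x : S, ∑ y : S, ∑ i, (if x.1 = y.1 + stp i then ‖u x - u y‖ ^ 2 else 0) =
      ∑ i, ∑ x : S, ∑ y : S, (if y.1 = x.1 + stp i then ‖u y - u x‖ ^ 2 else 0) := by
    rw [← e1, Finset.sum_comm]
  rw [e1, e2]; ring

/-- An edge is assigned to the cell at its lower end. On that cell |dq|² is h⁻² times the squared
difference and the volume is h³, which leaves the weight h = a/n of the energy. The extension `u` of
μ off the nodes is arbitrary, since `edgeSet` keeps only edges between nodes. -/
theorem ofReal_discreteExchangeEnergy {a A : ℝ} (ha : 0 < a) (hA : 0 < A) {Ω : Set E3}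
    (hΩ : Bornology.IsBounded Ω) (n : ℕ+) (μ : SpinField a Ω n) (u : (Fin 3 → ℤ) → E3)
    (hu : ∀ x : Node a Ω n, u x.1 = μ x) :
    ENNReal.ofReal (discreteExchangeEnergy a A Ω n μ) = ENNReal.ofReal (2 * A) *
      ∑ i, ∫⁻ x in edgeSet (a / ((n : ℕ) : ℝ)) Ω i, ‖dq (a / ((n : ℕ) : ℝ)) u i x‖ₑ ^ 2 := by
  classical
  have hn : (0 : ℝ) < ((n : ℕ) : ℝ) := by exact_mod_cast n.pos
  set h : ℝ := a / ((n : ℕ) : ℝ) with hdef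
  have hh : 0 < h := div_pos ha hn
  have := finite_node ha hΩ n
  let S : Set (Fin 3 → ℤ) := {k | pt h k ∈ Ω}
  have : Fintype S := @Fintype.ofFinite S (finite_node ha hΩ n)
  have hE : discreteExchangeEnergy a A Ω n μ = h * (A * (2 * ∑ i, ∑ x : S, ∑ y : S,
      (if y.1 = x.1 + stp i then ‖u y - u x‖ ^ 2 else 0))) := by
    rw [← sum_adj_eq, discreteExchangeEnergy]
    congr 1
    have : ∀ x : Node a Ω n, ∑ᶠ (y : Node a Ω n) (_ : Adj x.1 y.1), A * ‖μ y - μ x‖ ^ 2 =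
        ∑ y : S, A * (if Adj x.1 y.1 then ‖u y - u x‖ ^ 2 else 0) := by
      intro x
      refine (finsum_eq_sum_of_fintype (α := S) _).trans (Finset.sum_congr rfl fun y _ => ?_)
      rw [finsum_eq_if, hu x, hu y]
      split_ifs <;> simp
    simp_rw [this, ← Finset.mul_sum]
    exact (finsum_eq_sum_of_fintype (α := S) _).trans (Finset.mul_sum _ _ _).symm
  have hI : ∀ i, ∫⁻ x in edgeSet h Ω i, ‖dq h u i x‖ₑ ^ 2 = ENNReal.ofReal (h * ∑ x : S, ∑ y : S,
      (if y.1 = x.1 + stp i then ‖u y - u x‖ ^ 2 else 0)) := by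
    intro i
    rw [← lintegral_indicator (measurableSet_edgeSet h Ω i)]
    have e : ∀ x, (edgeSet h Ω i).indicator (fun x => ‖dq h u i x‖ₑ ^ 2) x =
        S.indicator (fun k => if pt h (k + stp i) ∈ Ω then
          ‖h⁻¹ • (u (k + stp i) - u k)‖ₑ ^ 2 else 0) (cell h x) := by
      intro x
      by_cases h1 : cell h x ∈ S <;> by_cases h2 : pt h (cell h x + stp i) ∈ Ω
      · rw [Set.indicator_of_mem (show x ∈ edgeSet h Ω i from ⟨h1, h2⟩), Set.indicator_of_mem h1,
          if_pos h2]; rfl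
      · rw [Set.indicator_of_notMem (fun hx => h2 hx.2), Set.indicator_of_mem h1, if_neg h2]
      · rw [Set.indicator_of_notMem (fun hx => h1 hx.1), Set.indicator_of_notMem h1]
      · rw [Set.indicator_of_notMem (fun hx => h1 hx.1), Set.indicator_of_notMem h1]
    simp_rw [e]
    rw [lintegral_cell hh, ← tsum_subtype, tsum_fintype, ENNReal.ofReal_mul hh.le,
      ENNReal.ofReal_sum_of_nonneg, Finset.mul_sum, Finset.mul_sum]
    · refine Finset.sum_congr rfl fun x _ => ?_
      by_cases h2 : pt h (x.1 + stp i) ∈ Ω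
      · rw [if_pos h2, Finset.sum_eq_single (⟨x.1 + stp i, h2⟩ : S), if_pos rfl, ← ofReal_norm,
          ← ENNReal.ofReal_pow (norm_nonneg _), ← ENNReal.ofReal_mul (by positivity),
          ← ENNReal.ofReal_mul hh.le, norm_smul, norm_inv, Real.norm_of_nonneg hh.le]
        · congr 1; field_simp
        · intro y _ hy
          rw [if_neg fun h' => hy (Subtype.ext h')]
        · simp
      · rw [if_neg h2, Finset.sum_eq_zero]
        · simp
        · intro y _
          rw [if_neg]
          intro h'
          exact h2 (h' ▸ y.2)
    · intro x _
      exact Finset.sum_nonneg fun y _ => by split_ifs <;> positivity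
  simp_rw [hI]
  rw [hE, ← ENNReal.ofReal_sum_of_nonneg, ← Finset.mul_sum, ← ENNReal.ofReal_mul (by positivity)]
  · congr 1; ring
  · intro i _
    exact mul_nonneg hh.le (Finset.sum_nonneg fun x _ => Finset.sum_nonneg fun y _ => by
      split_ifs <;> positivity)

theorem discreteExchangeEnergy_nonneg {a A : ℝ} (ha : 0 < a) (hA : 0 < A) {Ω : Set E3} (n : ℕ+)
    (μ : SpinField a Ω n) : 0 ≤ discreteExchangeEnergy a A Ω n μ :=
  mul_nonneg (by positivity) (finsum_nonneg fun _ => finsum_nonneg fun _ =>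
    finsum_nonneg fun _ => by positivity)

/-! ### Bounded overlap -/

/-- Balls around the points of a lattice distorted by a bounded factor have bounded overlap. -/
theorem tsum_setLIntegral_ball_le {h R : ℝ} (hh : 0 < h) (N : ℕ) (hRN : 4 * R ≤ N)
    (p : (Fin 3 → ℤ) → E3)
    (hp : ∀ k l i, h / 2 * |((k i - l i : ℤ) : ℝ)| ≤ dist (p k) (p l))
    (S : Set (Fin 3 → ℤ)) (W : Set E3)
    (hS : ∀ k ∈ S, Metric.ball (p k) (R * h) ⊆ W)
    (F : E3 → ℝ≥0∞) (hF : AEMeasurable F (volume.restrict W)) :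
    ∑' k : S, ∫⁻ x in Metric.ball (p k) (R * h), F x ≤
      ((2 * N + 1) ^ 3 : ℕ) * ∫⁻ x in W, F x := by
  classical
  have h1 : ∀ k : S, ∫⁻ x in Metric.ball (p k) (R * h), F x =
      ∫⁻ x in W, (Metric.ball (p k) (R * h)).indicator F x := by
    intro k
    rw [lintegral_indicator Metric.isOpen_ball.measurableSet,
      Measure.restrict_restrict Metric.isOpen_ball.measurableSet,
      Set.inter_eq_left.2 (hS k k.2)]
  simp_rw [h1]
  rw [← lintegral_tsum fun k => hF.indicator Metric.isOpen_ball.measurableSet,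
    ← lintegral_const_mul' _ _ (ENNReal.natCast_ne_top _)]
  refine lintegral_mono fun x => ?_
  by_cases hne : ∃ k0 : S, x ∈ Metric.ball (p k0) (R * h)
  · obtain ⟨k0, hk0⟩ := hne
    -- If x lies in the balls of indices k and k0, their centres are less than 2Rh apart, so the
    -- indices differ by less than 4R ≤ N in every coordinate. At most (2N + 1)³ balls contain x.
    let B : Finset (Fin 3 → ℤ) := Finset.Icc (fun i => k0.1 i - N) (fun i => k0.1 i + N)
    have hB : B.card = (2 * N + 1) ^ 3 := by
      rw [Pi.card_Icc]
      simp only [Int.card_Icc, Fin.prod_univ_three]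
      have : ∀ z : ℤ, (z + N + 1 - (z - N)).toNat = 2 * N + 1 := fun z => by omega
      simp only [this]; ring
    have hmem : ∀ k : S, x ∈ Metric.ball (p k) (R * h) → k.1 ∈ B := by
      intro k hk
      rw [Finset.mem_Icc, Pi.le_def, Pi.le_def, ← forall_and]
      intro i
      have h2 := hp k k0 i
      have h3 : dist (p k) (p k0) < 2 * (R * h) := by
        have := dist_triangle_left (p k) (p k0) x
        rw [Metric.mem_ball] at hk hk0
        linarith
      have h4 : |((k.1 i - k0.1 i : ℤ) : ℝ)| ≤ N := by
        have : h * |((k.1 i - k0.1 i : ℤ) : ℝ)| < h * (4 * R) := by linarith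
        exact (lt_of_mul_lt_mul_left this hh.le).le.trans hRN
      have h5 : |k.1 i - k0.1 i| ≤ (N : ℤ) := by exact_mod_cast h4
      rw [abs_le] at h5
      constructor <;> linarith [h5.1, h5.2]
    calc ∑' k : S, (Metric.ball (p k) (R * h)).indicator F x
        ≤ ∑' k : S, (B : Set (Fin 3 → ℤ)).indicator (fun _ => F x) k.1 := by
          refine ENNReal.tsum_le_tsum fun k => ?_
          by_cases hk : x ∈ Metric.ball (p k) (R * h)
          · rw [Set.indicator_of_mem hk, Set.indicator_of_mem (hmem k hk)]
          · rw [Set.indicator_of_notMem hk]; exact zero_le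
      _ ≤ ∑' k, (B : Set (Fin 3 → ℤ)).indicator (fun _ => F x) k :=
          ENNReal.tsum_comp_le_tsum_of_injective Subtype.val_injective _
      _ = ((2 * N + 1) ^ 3 : ℕ) * F x := by
          rw [← tsum_subtype, Finset.tsum_subtype' B (fun _ => F x), Finset.sum_const, hB,
            nsmul_eq_mul]
  · push Not at hne
    rw [ENNReal.tsum_eq_zero.2 fun k => Set.indicator_of_notMem (hne k) _]
    exact zero_le

/-! ### The tetrahedra -/

/-- The direction from the vertex `v` of the cell `c` into the cell. -/
def sg (c v : Fin 3 → ℤ) : Fin 3 → ℤ := fun i => 1 + 2 * (c i - v i)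

/-- The vertex `v` and its neighbours in the directions `σ`. -/
def cornerSet (v σ : Fin 3 → ℤ) : Set (Fin 3 → ℤ) := {k | k = v ∨ ∃ i, k = v + Pi.single i (σ i)}

/-- The vertex `o` and the opposite vertices of the three faces through `o`. -/
def centerSet (o σ : Fin 3 → ℤ) : Set (Fin 3 → ℤ) :=
  {k | k = o ∨ ∃ i, k = o + σ - Pi.single i (σ i)}

/-- The sign vector `sg c v` treats all positions of v in the cell at once, and reduces the claim to
linear integer arithmetic. -/
theorem corner_eq {c v : Fin 3 → ℤ} (hv : v ∈ cellVertices c) :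
    {k ∈ cellVertices c | k = v ∨ Adj v k} = cornerSet v (sg c v) := by
  ext k
  simp only [cellVertices, Set.mem_ofPred_eq, cornerSet, adj_iff, sg, funext_iff,
    Fin.forall_fin_succ, Fin.exists_fin_succ] at hv ⊢
  simp [Pi.single_apply] at hv ⊢
  omega

/-- Flipping two coordinates of a vertex keeps the parity of the sum. The four odd vertices are thus
any one of them together with its double flips, and o + σ - σᵢeᵢ flips the two coordinates other
than i. -/
theorem center_eq {c o : Fin 3 → ℤ} (ho : o ∈ cellVertices c) (hodd : Odd (∑ i, o i)) :
    {k ∈ cellVertices c | Odd (∑ i, k i)} = centerSet o (sg c o) := by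
  ext k
  simp only [cellVertices, Set.mem_ofPred_eq, centerSet, sg, funext_iff, Fin.sum_univ_three,
    Fin.forall_fin_succ, Fin.exists_fin_succ, Int.odd_iff] at ho hodd ⊢
  simp [Pi.single_apply, sg] at ho hodd ⊢
  obtain ⟨h0, h1, h2⟩ := ho
  constructor
  · rintro ⟨⟨k0, k1, k2⟩, hk⟩
    replace k0 : k 0 = o 0 ∨ k 0 = o 0 + (1 + 2 * (c 0 - o 0)) := by omega
    replace k1 : k 1 = o 1 ∨ k 1 = o 1 + (1 + 2 * (c 1 - o 1)) := by omega
    replace k2 : k 2 = o 2 ∨ k 2 = o 2 + (1 + 2 * (c 2 - o 2)) := by omega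
    rcases k0 with k0 | k0 <;> rcases k1 with k1 | k1 <;> rcases k2 with k2 | k2 <;>
    first
    | (exfalso; omega)
    | (left; refine ⟨?_, ?_, ?_⟩ <;> omega)
    | (right; left; refine ⟨?_, ?_, ?_⟩ <;> omega)
    | (right; right; left; refine ⟨?_, ?_, ?_⟩ <;> omega)
    | (right; right; right; refine ⟨?_, ?_, ?_⟩ <;> omega)
  · rintro (h | h | h | h) <;> obtain ⟨k0, k1, k2⟩ := h <;>
      refine ⟨⟨?_, ?_, ?_⟩, ?_⟩ <;> omega

theorem exists_odd_vertex (c : Fin 3 → ℤ) : ∃ o ∈ cellVertices c, Odd (∑ i, o i) := by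
  rcases Int.even_or_odd (∑ i, c i) with h | h
  · refine ⟨c + stp 0, fun i => ?_, ?_⟩
    · by_cases hi : i = 0 <;> simp [hi]
    · simpa [Fin.sum_univ_three, Int.odd_iff, Int.even_iff] using (by
        simp only [Fin.sum_univ_three, Int.even_iff] at h; omega : (c 0 + 1 + c 1 + c 2) % 2 = 1)
  · exact ⟨c, fun i => Or.inl rfl, h⟩

theorem sg_eq {c v : Fin 3 → ℤ} (hv : v ∈ cellVertices c) (i : Fin 3) :
    (v i = c i ∧ sg c v i = 1) ∨ (v i = c i + 1 ∧ sg c v i = -1) := by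
  have := hv i
  simp only [sg]
  omega

theorem sg_sq {c v : Fin 3 → ℤ} (hv : v ∈ cellVertices c) (i : Fin 3) :
    (sg c v i : ℝ) * sg c v i = 1 := by
  rcases sg_eq hv i with h | h <;> simp [h.2]

/-- The two shapes of an element of the partition. -/
theorem IsTetrahedron.cases {T : Set (Fin 3 → ℤ)} (hT : IsTetrahedron T) :
    ∃ c, T ⊆ cellVertices c ∧ ∃ v ∈ cellVertices c,
      (Even (∑ i, v i) ∧ T = cornerSet v (sg c v)) ∨
      (Odd (∑ i, v i) ∧ T = centerSet v (sg c v) ∧ ∀ k ∈ T, Odd (∑ i, k i)) := by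
  obtain ⟨c, h | ⟨v, hv, he, h⟩⟩ := hT
  · obtain ⟨o, ho, hodd⟩ := exists_odd_vertex c
    refine ⟨c, h ▸ fun k hk => hk.1, o, ho, Or.inr ⟨hodd, ?_, h ▸ fun k hk => hk.2⟩⟩
    rw [h, center_eq ho hodd]
  · exact ⟨c, h ▸ fun k hk => hk.1, v, hv, Or.inl ⟨he, h ▸ corner_eq hv⟩⟩

theorem isTetrahedron_corner {c v : Fin 3 → ℤ} (hv : v ∈ cellVertices c)
    (he : Even (∑ i, v i)) : IsTetrahedron (cornerSet v (sg c v)) :=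
  ⟨c, Or.inr ⟨v, hv, he, (corner_eq hv).symm⟩⟩

theorem isTetrahedron_center {c o : Fin 3 → ℤ} (ho : o ∈ cellVertices c)
    (hodd : Odd (∑ i, o i)) : IsTetrahedron (centerSet o (sg c o)) :=
  ⟨c, Or.inl (center_eq ho hodd).symm⟩

/-- The affine map with value `b` at the origin and partial derivatives `g`. -/
noncomputable def affineOfPartials (b : E3) (g : Fin 3 → E3) : E3 →ᵃ[ℝ] E3 :=
  AffineMap.const ℝ E3 b +
    (∑ i, ((EuclideanSpace.proj i : E3 →L[ℝ] ℝ).smulRight (g i) : E3 →ₗ[ℝ] E3)).toAffineMap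

theorem affineOfPartials_apply (b : E3) (g : Fin 3 → E3) (x : E3) :
    affineOfPartials b g x = b + ∑ i, x i • g i := by
  simp [affineOfPartials]

theorem exists_affine_corner {h : ℝ} (hh : 0 < h) {c v : Fin 3 → ℤ} (hv : v ∈ cellVertices c)
    (w : (Fin 3 → ℤ) → E3) :
    ∃ L : E3 →ᵃ[ℝ] E3, ∀ k ∈ cornerSet v (sg c v), L (pt h k) = w k := by
  -- The gradient is read off from the three edges at v; dividing by the sign is multiplying by it,
  -- as its square is 1.
  let g : Fin 3 → E3 := fun i =>
    ((sg c v i : ℝ) / h) • (w (v + Pi.single i (sg c v i)) - w v)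
  refine ⟨affineOfPartials (w v - ∑ i, (h * (v i : ℝ)) • g i) g, ?_⟩
  rintro k (rfl | ⟨i, rfl⟩)
  · simp [affineOfPartials_apply, pt_apply]
  · have h1 : (h * (sg c v i : ℝ)) • g i = w (v + Pi.single i (sg c v i)) - w v := by
      simp only [g]
      rw [smul_smul]
      have : h * (sg c v i : ℝ) * ((sg c v i : ℝ) / h) = 1 := by
        rw [← sg_sq hv i]; field_simp
      rw [this, one_smul]
    have h2 : ∀ j, (pt h (v + Pi.single i (sg c v i))) j • g j =
        (h * (v j : ℝ)) • g j + if j = i then (h * (sg c v i : ℝ)) • g i else 0 := by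
      intro j
      by_cases hj : j = i
      · subst hj; simp [pt_apply, mul_add, add_smul]
      · simp [pt_apply, hj]
    rw [affineOfPartials_apply]
    simp_rw [h2]
    rw [Finset.sum_add_distrib]
    simp only [h1, Finset.sum_ite_eq', Finset.mem_univ, if_true]
    abel

theorem exists_affine_center {h : ℝ} (hh : 0 < h) {c v : Fin 3 → ℤ} (hv : v ∈ cellVertices c)
    (w : (Fin 3 → ℤ) → E3) :
    ∃ L : E3 →ᵃ[ℝ] E3, ∀ k ∈ centerSet v (sg c v), L (pt h k) = w k := by
  let p : Fin 3 → E3 := fun i => w (v + sg c v - Pi.single i (sg c v i)) - w v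
  -- With Gᵢ = h σᵢ gᵢ, the increment of an affine map along the face diagonal opposite to i is pᵢ =
  -- Gⱼ + Gₖ. Solving these three equations gives Gᵢ = (∑ p - 2 pᵢ) / 2.
  let g : Fin 3 → E3 := fun i => ((sg c v i : ℝ) / (2 * h)) • ((∑ j, p j) - (2 : ℝ) • p i)
  refine ⟨affineOfPartials (w v - ∑ i, (h * (v i : ℝ)) • g i) g, ?_⟩
  have h1 : ∀ i, (h * (sg c v i : ℝ)) • g i = (2 : ℝ)⁻¹ • ((∑ j, p j) - (2 : ℝ) • p i) := by
    intro i
    simp only [g]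
    rw [smul_smul]
    have : h * (sg c v i : ℝ) * ((sg c v i : ℝ) / (2 * h)) = 2⁻¹ := by
      have := sg_sq hv i
      field_simp; linarith
    rw [this]
  rintro k (rfl | ⟨i, rfl⟩)
  · simp [affineOfPartials_apply, pt_apply]
  · have h2 : ∀ j, (pt h (v + sg c v - Pi.single i (sg c v i))) j • g j =
        (h * (v j : ℝ)) • g j + ((h * (sg c v j : ℝ)) • g j -
          if j = i then (h * (sg c v i : ℝ)) • g i else 0) := by
      intro j
      by_cases hj : j = i
      · subst hj; simp [pt_apply]
      · simp [pt_apply, hj, mul_add, add_smul]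
    rw [affineOfPartials_apply]
    simp_rw [h2]
    rw [Finset.sum_add_distrib, Finset.sum_sub_distrib]
    simp_rw [h1]
    have h3 : w (v + sg c v - Pi.single i (sg c v i)) = p i + w v := by simp [p]
    rw [h3]
    simp only [Finset.sum_ite_eq', Finset.mem_univ, if_true, Fin.sum_univ_three]
    module

theorem IsTetrahedron.exists_affine {h : ℝ} (hh : 0 < h) {T : Set (Fin 3 → ℤ)}
    (hT : IsTetrahedron T) (w : (Fin 3 → ℤ) → E3) :
    ∃ L : E3 →ᵃ[ℝ] E3, ∀ k ∈ T, L (pt h k) = w k := by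
  obtain ⟨c, -, v, hv, ⟨-, rfl⟩ | ⟨-, rfl, -⟩⟩ := hT.cases
  · exact exists_affine_corner hh hv w
  · exact exists_affine_center hh hv w

/-! ### Gradients on the tetrahedra against difference quotients -/

/-- The forward difference quotient at the node `k`. -/
noncomputable abbrev gq (h : ℝ) (u : (Fin 3 → ℤ) → E3) (i : Fin 3) (k : Fin 3 → ℤ) : E3 :=
  h⁻¹ • (u (k + stp i) - u k)

/-- The deviation of the difference quotients in the cell `c` and its upper neighbours
from `q`. -/
noncomputable def cellError (h : ℝ) (u : (Fin 3 → ℤ) → E3) (q : Fin 3 → E3) (c : Fin 3 → ℤ) : ℝ :=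
  ∑ b ∈ Finset.Icc (0 : Fin 3 → ℤ) 1, ∑ i, ‖gq h u i (c + b) - q i‖

theorem cellError_nonneg (h : ℝ) (u : (Fin 3 → ℤ) → E3) (q : Fin 3 → E3) (c : Fin 3 → ℤ) :
    0 ≤ cellError h u q c :=
  Finset.sum_nonneg fun _ _ => Finset.sum_nonneg fun _ _ => norm_nonneg _

theorem norm_gq_sub_le_cellError (h : ℝ) (u : (Fin 3 → ℤ) → E3) (q : Fin 3 → E3)
    {c k : Fin 3 → ℤ} (hk : k ∈ cellVertices c) (i : Fin 3) :
    ‖gq h u i k - q i‖ ≤ cellError h u q c := by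
  have hb : k - c ∈ Finset.Icc (0 : Fin 3 → ℤ) 1 := by
    rw [Finset.mem_Icc]
    constructor <;> intro j <;> have := hk j <;> simp <;> omega
  have h1 : ‖gq h u i k - q i‖ = ‖gq h u i (c + (k - c)) - q i‖ := by rw [add_sub_cancel]
  rw [h1]
  refine (Finset.single_le_sum (f := fun i => ‖gq h u i (c + (k - c)) - q i‖)
    (fun _ _ => norm_nonneg _) (Finset.mem_univ i)).trans ?_
  exact Finset.single_le_sum (f := fun b => ∑ i, ‖gq h u i (c + b) - q i‖)
    (fun _ _ => Finset.sum_nonneg fun _ _ => norm_nonneg _) hb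

/-- The difference quotient along an edge of the cell `c`, with sign. -/
theorem norm_edge_sub_le {h : ℝ} (u : (Fin 3 → ℤ) → E3) (q : Fin 3 → E3)
    {c v k : Fin 3 → ℤ} (hv : v ∈ cellVertices c) (hk : k ∈ cellVertices c) (i : Fin 3)
    (hki : k i = v i) :
    ‖h⁻¹ • (u (k + Pi.single i (sg c v i)) - u k) - (sg c v i : ℝ) • q i‖ ≤
      cellError h u q c := by
  rcases sg_eq hv i with ⟨h1, h2⟩ | ⟨h1, h2⟩
  · rw [h2]
    simpa using norm_gq_sub_le_cellError h u q hk i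
  · rw [h2]
    have hk' : k + Pi.single i (-1) ∈ cellVertices c := by
      intro j
      by_cases hj : j = i
      · subst hj; left; simp; omega
      · simpa [hj] using hk j
    have := norm_gq_sub_le_cellError h u q hk' i
    rw [gq, add_assoc, stp, ← Pi.single_add, neg_add_cancel, Pi.single_zero, add_zero] at this
    rw [← norm_neg]
    refine le_of_eq_of_le ?_ this
    congr 1
    simp only [Int.cast_neg, Int.cast_one]
    module

/-- In a corner tetrahedron the partial derivatives are difference quotients of edges, up to sign.
In the center tetrahedron the derivative along a face diagonal is a sum of two edge quotients, hence
has error at most 2 `cellError`; inverting the relation as in `exists_affine_center` costs half of a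
sum of three such errors, and ½ · 3 · 2 = 3. -/
theorem norm_linear_sub_le {h : ℝ} (hh : 0 < h) {T : Set (Fin 3 → ℤ)}
    {c v : Fin 3 → ℤ} (hv : v ∈ cellVertices c)
    (hT : T = cornerSet v (sg c v) ∨ T = centerSet v (sg c v)) (u : (Fin 3 → ℤ) → E3)
    (L : E3 →ᵃ[ℝ] E3) (hL : ∀ k ∈ T, L (pt h k) = u k) (q : Fin 3 → E3) (i : Fin 3) :
    ‖L.linear (bz i) - q i‖ ≤ 3 * cellError h u q c := by
  have h0 := cellError_nonneg h u q c
  have hs : ∀ i, ‖(sg c v i : ℝ)‖ = 1 := fun i => by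
    rcases sg_eq hv i with h | h <;> simp [h.2]
  have hpt : ∀ i (s : ℤ), pt h (Pi.single i s) = (h * (s : ℝ)) • bz i := by
    intro i s; ext j; by_cases hj : j = i
    · subst hj; simp [pt_apply]
    · simp [pt_apply, hj]
  rcases hT with rfl | rfl
  · have h1 : (sg c v i : ℝ) • L.linear (bz i) =
        h⁻¹ • (u (v + Pi.single i (sg c v i)) - u v) := by
      have e1 : L (pt h (v + Pi.single i (sg c v i))) = u (v + Pi.single i (sg c v i)) :=
        hL _ (Or.inr ⟨i, rfl⟩)
      rw [← hL v (Or.inl rfl), ← e1, ← vsub_eq_sub, ← L.linearMap_vsub, vsub_eq_sub, pt_add, add_sub_cancel_left, hpt, map_smul,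
        smul_smul]
      congr 1; field_simp
    have h2 : ‖L.linear (bz i) - q i‖ = ‖(sg c v i : ℝ) • (L.linear (bz i) - q i)‖ := by
      rw [norm_smul, hs, one_mul]
    rw [h2, smul_sub, h1]
    linarith [norm_edge_sub_le (h := h) u q hv hv i rfl]
  · let p : Fin 3 → E3 := fun i => h⁻¹ • (u (v + sg c v - Pi.single i (sg c v i)) - u v)
    let Q : E3 := ∑ j, (sg c v j : ℝ) • q j
    let P : E3 := ∑ j, (sg c v j : ℝ) • L.linear (bz j)
    have hsum : pt h (sg c v) = ∑ j, (h * (sg c v j : ℝ)) • bz j := by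
      ext j; fin_cases j <;> simp [pt_apply, Fin.sum_univ_three]
    have h1 : ∀ i, P - (sg c v i : ℝ) • L.linear (bz i) = p i := by
      intro i
      simp only [p]
      have e1 : L (pt h (v + sg c v - Pi.single i (sg c v i))) =
          u (v + sg c v - Pi.single i (sg c v i)) := hL _ (Or.inr ⟨i, rfl⟩)
      rw [← hL v (Or.inl rfl), ← e1, ← vsub_eq_sub (L _), ← L.linearMap_vsub, vsub_eq_sub, pt_sub, pt_add, hpt, hsum,
        add_sub_assoc, add_sub_cancel_left, map_sub, map_sum]
      simp only [map_smul, P, smul_sub, Finset.smul_sum, smul_smul]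
      have : ∀ r : ℝ, h⁻¹ * (h * r) = r := fun r => by field_simp
      simp only [this]
    have h2 : ∀ i, ‖p i - (Q - (sg c v i : ℝ) • q i)‖ ≤ 2 * cellError h u q c := by
      intro i
      -- The face diagonal opposite to i is replaced by the path of two edges in the other
      -- directions j and k.
      obtain ⟨j, k, hji, hki, hjk, hsm⟩ : ∃ j k : Fin 3, j ≠ i ∧ k ≠ i ∧ k ≠ j ∧
          ∀ f : Fin 3 → E3, ∑ l, f l = f i + f j + f k := by
        fin_cases i
        · exact ⟨1, 2, by simp, by simp, by simp, fun f => by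
            rw [Fin.sum_univ_three]; rfl⟩
        · exact ⟨0, 2, by simp, by simp, by simp, fun f => by
            rw [Fin.sum_univ_three]; simp only [Fin.mk_one]; abel⟩
        · exact ⟨0, 1, by simp, by simp, by simp, fun f => by
            rw [Fin.sum_univ_three]; simp only [Fin.reduceFinMk]; abel⟩
      have hv1 : v + Pi.single j (sg c v j) ∈ cellVertices c := by
        intro l
        by_cases hl : l = j
        · subst hl; rcases sg_eq hv l with h | h <;> simp [h.1, h.2]
        · simpa [hl] using hv l
      have e1 := norm_edge_sub_le (h := h) u q hv hv j rfl
      have e2 := norm_edge_sub_le (h := h) u q hv hv1 k (by simp [hjk])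
      have e3 : v + Pi.single j (sg c v j) + Pi.single k (sg c v k) =
          v + sg c v - Pi.single i (sg c v i) := by
        have e4 : ∀ l : Fin 3, l = i ∨ l = j ∨ l = k := by
          intro l
          fin_cases i <;> fin_cases j <;> fin_cases k <;> fin_cases l <;> simp_all
        ext l
        rcases e4 l with rfl | rfl | rfl
        · simp [hji.symm, hki.symm]
        · simp [hji, hjk.symm]
        · simp [hki, hjk]
      rw [e3] at e2
      have e5 : p i - (Q - (sg c v i : ℝ) • q i) =
          (h⁻¹ • (u (v + Pi.single j (sg c v j)) - u v) - (sg c v j : ℝ) • q j) +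
          (h⁻¹ • (u (v + sg c v - Pi.single i (sg c v i)) - u (v + Pi.single j (sg c v j))) -
            (sg c v k : ℝ) • q k) := by
        simp only [p, Q, hsm fun l => (sg c v l : ℝ) • q l]
        module
      rw [e5]
      refine (norm_add_le _ _).trans ?_
      linarith
    have h3 : (sg c v i : ℝ) • (L.linear (bz i) - q i) = (2 : ℝ)⁻¹ •
        ((∑ j, (p j - (Q - (sg c v j : ℝ) • q j))) -
          (2 : ℝ) • (p i - (Q - (sg c v i : ℝ) • q i))) := by
      simp_rw [← h1]
      simp only [Fin.sum_univ_three, P, Q]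
      module
    have h4 : ‖L.linear (bz i) - q i‖ = ‖(sg c v i : ℝ) • (L.linear (bz i) - q i)‖ := by
      rw [norm_smul, hs, one_mul]
    -- Subtracting twice the i-th term only changes its sign in the sum, so the norm is bounded by
    -- three terms and not by five.
    have h5 : (∑ j, (p j - (Q - (sg c v j : ℝ) • q j))) -
          (2 : ℝ) • (p i - (Q - (sg c v i : ℝ) • q i)) =
        ∑ j, (if j = i then (-1 : ℝ) else 1) • (p j - (Q - (sg c v j : ℝ) • q j)) := by
      have : ∀ j, (if j = i then (-1 : ℝ) else 1) • (p j - (Q - (sg c v j : ℝ) • q j)) =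
          (p j - (Q - (sg c v j : ℝ) • q j)) -
            if j = i then (2 : ℝ) • (p i - (Q - (sg c v i : ℝ) • q i)) else 0 := by
        intro j
        split_ifs with hj
        · subst hj; module
        · module
      simp_rw [this]
      rw [Finset.sum_sub_distrib]
      simp
    rw [h4, h3, h5, norm_smul]
    have h6 : ‖∑ j, (if j = i then (-1 : ℝ) else 1) • (p j - (Q - (sg c v j : ℝ) • q j))‖ ≤
        ∑ _j : Fin 3, 2 * cellError h u q c := by
      refine norm_sum_le_of_le _ fun j _ => ?_
      rw [norm_smul]
      have : ‖(if j = i then (-1 : ℝ) else 1)‖ = 1 := by split_ifs <;> simp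
      rw [this, one_mul]
      exact h2 j
    simp only [Finset.sum_const, Finset.card_univ, Fintype.card_fin, nsmul_eq_mul] at h6
    norm_num at h6 ⊢
    linarith

/-! ### Cells, faces, and the covering of a cell by its tetrahedra -/

/-- The closed lattice cell with lower corner `c`. -/
def closedCube (h : ℝ) (c : Fin 3 → ℤ) : Set E3 :=
  {x | ∀ i, h * (c i : ℝ) ≤ x i ∧ x i ≤ h * ((c i : ℝ) + 1)}

theorem convex_closedCube (h : ℝ) (c : Fin 3 → ℤ) : Convex ℝ (closedCube h c) := by
  intro x hx y hy s t hs ht hst i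
  have h1 := hx i
  have h2 := hy i
  simp only [PiLp.add_apply, PiLp.smul_apply, smul_eq_mul]
  obtain rfl : t = 1 - s := by linarith
  constructor <;> nlinarith [h1.1, h1.2, h2.1, h2.2]

theorem solid_subset_closedCube {a : ℝ} (ha : 0 < a) (n : ℕ+) {T : Set (Fin 3 → ℤ)}
    {c : Fin 3 → ℤ} (hT : T ⊆ cellVertices c) :
    solid a n T ⊆ closedCube (a / ((n : ℕ) : ℝ)) c := by
  have hh : 0 < a / ((n : ℕ) : ℝ) := div_pos ha (by exact_mod_cast n.pos)
  refine convexHull_min ?_ (convex_closedCube _ _)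
  rintro _ ⟨k, hk, rfl⟩ i
  rw [latticePoint_eq_pt, pt_apply]
  rcases hT hk i with h | h <;> rw [h] <;> push_cast <;> constructor <;> nlinarith

/-- `x` is not on the faces of the lattice cells. -/
def OffFaces (h : ℝ) (x : E3) : Prop := ∀ (i : Fin 3) (z : ℤ), x i ≠ h * (z : ℝ)

theorem ae_offFaces (h : ℝ) : ∀ᵐ x : E3, OffFaces h x := by
  simp only [OffFaces]
  rw [ae_all_iff]; intro i
  rw [ae_all_iff]; intro z
  have hm := EuclideanSpace.volume_preserving_symm_measurableEquiv_toLp (Fin 3)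
  have : {x : E3 | ¬ x i ≠ h * (z : ℝ)} = (MeasurableEquiv.toLp 2 (Fin 3 → ℝ)).symm ⁻¹'
      {f | f i = h * (z : ℝ)} := by
    ext x; simp
  rw [ae_iff, this, hm.measure_preimage]
  · exact Measure.pi_hyperplane _ i _
  · exact (measurableSet_eq_fun (by fun_prop) (by fun_prop)).nullMeasurableSet

/-- Off the faces only one closed cell contains x. Whichever element `interp` has chosen at x, it
therefore lies in the cell of x. -/
theorem OffFaces.cell_eq {h : ℝ} (hh : 0 < h) {x : E3} (hx : OffFaces h x) {c : Fin 3 → ℤ}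
    (hc : x ∈ closedCube h c) : cell h x = c := by
  rw [cell_eq_iff hh]
  intro i
  refine ⟨(hc i).1, lt_of_le_of_ne (hc i).2 ?_⟩
  have := hx i (c i + 1)
  push_cast at this
  exact this

theorem mem_closedCube_cell {h : ℝ} (hh : 0 < h) (x : E3) : x ∈ closedCube h (cell h x) :=
  fun i => ⟨((cell_eq_iff hh x _).1 rfl i).1, ((cell_eq_iff hh x _).1 rfl i).2.le⟩

theorem closedCube_subset_closedBall {h : ℝ} (hh : 0 < h) (x : E3) :
    closedCube h (cell h x) ⊆ Metric.closedBall x (2 * h) := by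
  intro y hy
  rw [Metric.mem_closedBall, dist_eq_norm]
  refine norm_le_of_forall_abs_le fun i => ?_
  have h1 := hy i
  have h2 := mem_closedCube_cell hh x i
  rw [PiLp.sub_apply, abs_le]
  constructor <;> nlinarith [h1.1, h1.2, h2.1, h2.2]

theorem mem_convexHull_of_weights {h : ℝ} {T : Set (Fin 3 → ℤ)} {x : E3}
    (v : Fin 3 → ℤ) (w : Fin 3 → Fin 3 → ℤ) (hv : v ∈ T) (hw : ∀ i, w i ∈ T)
    (l : Fin 3 → ℝ) (hl : ∀ i, 0 ≤ l i) (hl1 : ∑ i, l i ≤ 1)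
    (hx : ∀ j, x j = h * (v j + ∑ i, l i * ((w i j : ℝ) - v j))) :
    x ∈ convexHull ℝ (pt h '' T) := by
  have h1 : (convexHull ℝ (pt h '' T)).Nonempty := ⟨_, subset_convexHull _ _ ⟨v, hv, rfl⟩⟩
  have h2 := (convex_convexHull ℝ (pt h '' T)).sum_mem (t := (Finset.univ : Finset (Option (Fin 3))))
    (w := fun o => o.elim (1 - ∑ i, l i) l) (z := fun o => o.elim (pt h v) fun i => pt h (w i))
    (by rintro (_ | i) -
        · simpa using hl1
        · exact hl i)
    (by simp [Fintype.sum_option])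
    (by rintro (_ | i) -
        · exact subset_convexHull _ _ ⟨v, hv, rfl⟩
        · exact subset_convexHull _ _ ⟨w i, hw i, rfl⟩)
  convert h2 using 1
  ext j
  rw [hx j, Fintype.sum_option]
  simp [Fin.sum_univ_three, pt_apply]
  ring

/-- With coordinates in [0, 1] measured from a vertex towards the cell, the corner tetrahedron there
is {∑ t ≤ 1}. If x is in none of the four corners, let t be its coordinates from an odd vertex o.
The failure at the neighbours of o gives 2tᵢ ≤ ∑ t, and the failure at the vertex opposite to o
gives ∑ t ≤ 2. This is the nonnegativity of the barycentric coordinates (∑ t - 2tᵢ)/2 and 1 - (∑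
t)/2 in the center tetrahedron. -/
theorem exists_tetrahedron_mem {h : ℝ} (hh : 0 < h) (x : E3) :
    ∃ T, IsTetrahedron T ∧ T ⊆ cellVertices (cell h x) ∧ x ∈ convexHull ℝ (pt h '' T) := by
  set c := cell h x with hc
  obtain ⟨o, ho, hodd⟩ := exists_odd_vertex c
  have hx : ∀ i, (c i : ℝ) ≤ x i / h ∧ x i / h ≤ c i + 1 := fun i => by
    have := (cell_eq_iff hh x c).1 rfl i
    rw [le_div_iff₀ hh, div_le_iff₀ hh]
    constructor <;> nlinarith [this.1, this.2]
  by_cases hcor : ∃ v ∈ cellVertices c, Even (∑ i, v i) ∧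
      ∑ i, (sg c v i : ℝ) * (x i / h - v i) ≤ 1
  · obtain ⟨v, hv, he, hsum⟩ := hcor
    refine ⟨_, isTetrahedron_corner hv he, ?_, ?_⟩
    · rw [← corner_eq hv]; exact fun k hk => hk.1
    · refine mem_convexHull_of_weights v (fun i => v + Pi.single i (sg c v i)) (Or.inl rfl)
        (fun i => Or.inr ⟨i, rfl⟩) (fun i => (sg c v i : ℝ) * (x i / h - v i)) ?_ hsum ?_
      · intro i
        have := hx i
        rcases sg_eq hv i with ⟨h1, h2⟩ | ⟨h1, h2⟩ <;> simp [h1, h2] <;> linarith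
      · intro j
        have h1 : ∀ i, (((v + Pi.single i (sg c v i) : Fin 3 → ℤ) j : ℤ) : ℝ) - v j =
            if i = j then (sg c v j : ℝ) else 0 := by
          intro i
          by_cases hij : i = j
          · subst hij; simp
          · have hji : j ≠ i := fun h => hij h.symm
            simp [hij, hji]
        simp_rw [h1]
        simp only [mul_ite, mul_zero, Finset.sum_ite_eq', Finset.mem_univ, if_true]
        have := sg_sq hv j
        have h2 : (sg c v j : ℝ) * (x j / h - v j) * (sg c v j : ℝ) = x j / h - v j := by
          linear_combination (x j / h - v j) * this
        rw [h2]; field_simp; ring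
  · push Not at hcor
    refine ⟨_, isTetrahedron_center ho hodd, ?_, ?_⟩
    · rw [← center_eq ho hodd]; exact fun k hk => hk.1
    have hso : ∀ i, (sg c o i : ℝ) = 1 + 2 * (c i - o i) := fun i => by simp [sg]
    have hsq := fun i => sg_sq ho i
    set t : Fin 3 → ℝ := fun i => (sg c o i : ℝ) * (x i / h - o i) with ht
    have h3 : ∀ i, 2 * t i ≤ ∑ j, t j := by
      intro i
      have hv : o + Pi.single i (sg c o i) ∈ cellVertices c := by
        intro j
        by_cases hj : j = i
        · subst hj; rcases sg_eq ho j with h | h <;> simp [h.1, h.2]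
        · simpa [hj] using ho j
      have he : Even (∑ j, (o + Pi.single i (sg c o i) : Fin 3 → ℤ) j) := by
        simp only [Pi.add_apply, Finset.sum_add_distrib, Finset.sum_pi_single', Finset.mem_univ,
          if_true]
        refine hodd.add_odd ?_
        rcases sg_eq ho i with h | h <;> rw [h.2] <;> decide
      have := hcor _ hv he
      have e : ∀ j, (sg c (o + Pi.single i (sg c o i) : Fin 3 → ℤ) j : ℝ) *
          (x j / h - ((o + Pi.single i (sg c o i) : Fin 3 → ℤ) j : ℤ)) = if j = i then 1 - t j else t j := by
        intro j
        have e1 : (sg c (o + Pi.single i (sg c o i) : Fin 3 → ℤ) j : ℝ) =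
            1 + 2 * (c j - ((o + Pi.single i (sg c o i) : Fin 3 → ℤ) j : ℤ)) := by simp [sg]
        rw [e1]
        by_cases hj : j = i
        · subst hj
          rw [if_pos rfl]
          simp only [Pi.add_apply, Pi.single_eq_same, Int.cast_add, ht]
          rcases sg_eq ho j with ⟨h1, h2⟩ | ⟨h1, h2⟩ <;> rw [h1, h2] <;> push_cast <;> ring
        · rw [if_neg hj]
          simp only [Pi.add_apply, Pi.single_eq_of_ne hj, Int.cast_add, ht, hso j]
          push_cast; ring
      simp_rw [e] at this
      have e2 : ∑ j, (if j = i then 1 - t j else t j) = (∑ j, t j) + (1 - 2 * t i) := by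
        have : ∀ j, (if j = i then 1 - t j else t j) = t j + if j = i then 1 - 2 * t i else 0 := by
          intro j; split_ifs with hj
          · subst hj; ring
          · ring
        simp_rw [this]
        rw [Finset.sum_add_distrib]; simp
      linarith
    have h4 : ∑ j, t j ≤ 2 := by
      have hv : o + sg c o ∈ cellVertices c := by
        intro j
        rcases sg_eq ho j with h | h <;> simp [h.1, h.2]
      have he : Even (∑ j, (o + sg c o) j) := by
        rw [Int.even_iff]
        rw [Int.odd_iff] at hodd
        simp only [Pi.add_apply, Fin.sum_univ_three] at hodd ⊢
        simp only [sg]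
        omega
      have := hcor _ hv he
      have e : ∀ j, (sg c (o + sg c o) j : ℝ) *
          (x j / h - ((o + sg c o) j : ℤ)) = 1 - t j := by
        intro j
        have e1 : (sg c (o + sg c o) j : ℝ) =
            1 + 2 * (c j - ((o + sg c o) j : ℤ)) := by simp [sg]
        rw [e1]
        simp only [Pi.add_apply, Int.cast_add, ht]
        rcases sg_eq ho j with ⟨h1, h2⟩ | ⟨h1, h2⟩ <;> rw [h1, h2] <;> push_cast <;> ring
      simp_rw [e] at this
      simp only [Finset.sum_sub_distrib, Finset.sum_const, Finset.card_univ, Fintype.card_fin,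
        nsmul_eq_mul] at this
      norm_num at this
      linarith
    refine mem_convexHull_of_weights o (fun i => o + sg c o - Pi.single i (sg c o i)) (Or.inl rfl)
      (fun i => Or.inr ⟨i, rfl⟩) (fun i => ((∑ j, t j) - 2 * t i) / 2) ?_ ?_ ?_
    · intro i; have := h3 i; linarith
    · simp only [Fin.sum_univ_three] at h4 ⊢
      linarith
    · intro j
      have h1 : ∀ i, (((o + sg c o - Pi.single i (sg c o i) : Fin 3 → ℤ) j : ℤ) : ℝ) - o j =
          (sg c o j : ℝ) - if i = j then (sg c o j : ℝ) else 0 := by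
        intro i
        by_cases hij : i = j
        · subst hij; simp
        · have hji : j ≠ i := fun h => hij h.symm
          simp [hij, hji]
      simp_rw [h1, mul_sub]
      rw [Finset.sum_sub_distrib, ← Finset.sum_mul]
      simp only [mul_ite, mul_zero, Finset.sum_ite_eq', Finset.mem_univ, if_true]
      have h2 : ∑ i, ((∑ j, t j) - 2 * t i) / 2 = (∑ j, t j) / 2 := by
        simp only [Fin.sum_univ_three]; ring
      rw [h2]
      have h5 : t j * (sg c o j : ℝ) = x j / h - o j := by
        simp only [ht]
        linear_combination (x j / h - o j) * hsq j
      have : x j = h * (o j + t j * (sg c o j : ℝ)) := by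
        rw [h5]; field_simp; ring
      rw [this]; ring

/-- Changing one coordinate at a time leads from c to w along at most three edges, and each costs h
times a difference quotient. -/
theorem norm_sub_le_cellError {h : ℝ} (hh : 0 < h) (u : (Fin 3 → ℤ) → E3) {c w : Fin 3 → ℤ}
    (hw : w ∈ cellVertices c) : ‖u w - u c‖ ≤ 3 * (h * cellError h u 0 c) := by
  have step : ∀ (k : Fin 3 → ℤ) (i : Fin 3), k ∈ cellVertices c → k i = c i →
      ‖u (Function.update k i (w i)) - u k‖ ≤ h * cellError h u 0 c := by
    intro k i hk hki
    rcases hw i with h1 | h1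
    · rw [h1, ← hki, Function.update_eq_self, sub_self, norm_zero]
      exact mul_nonneg hh.le (cellError_nonneg _ _ _ _)
    · have h2 : Function.update k i (w i) = k + stp i := by
        ext j; by_cases hj : j = i
        · subst hj; simp [h1, hki]
        · simp [hj]
      have h3 := norm_gq_sub_le_cellError h u 0 hk i
      rw [Pi.zero_apply, sub_zero, gq, norm_smul, norm_inv, Real.norm_of_nonneg hh.le,
        inv_mul_le_iff₀ hh] at h3
      rwa [h2]
  have hup : ∀ (k : Fin 3 → ℤ) (i : Fin 3), k ∈ cellVertices c →
      Function.update k i (w i) ∈ cellVertices c := by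
    intro k i hk j
    by_cases hj : j = i
    · subst hj; simpa using hw j
    · simpa [hj] using hk j
  have h0 : c ∈ cellVertices c := fun i => Or.inl rfl
  have e : w = Function.update (Function.update (Function.update c 0 (w 0)) 1 (w 1)) 2 (w 2) := by
    ext j; fin_cases j <;> simp
  have s0 := step c 0 h0 rfl
  have s1 := step _ 1 (hup c 0 h0) (by simp)
  have s2 := step _ 2 (hup _ 1 (hup c 0 h0)) (by simp)
  rw [← e] at s2
  have t1 := norm_sub_le_norm_sub_add_norm_sub (u w)
    (u (Function.update (Function.update c 0 (w 0)) 1 (w 1))) (u c)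
  have t2 := norm_sub_le_norm_sub_add_norm_sub
    (u (Function.update (Function.update c 0 (w 0)) 1 (w 1))) (u (Function.update c 0 (w 0))) (u c)
  linarith

/-! ### The interpolant on the cell of a point -/

section Interp

variable {a : ℝ} {Ω : Set E3} {n : ℕ+} {μ : SpinField a Ω n} {u : (Fin 3 → ℤ) → E3}

theorem affineOn_spec (ha : 0 < a) (hu : ∀ x : Node a Ω n, u x.1 = μ x) {T : Set (Fin 3 → ℤ)}
    (hT : IsTetrahedron T) (hΩ : solid a n T ⊆ Ω) :
    ∀ k ∈ T, affineOn a Ω n μ T (pt (a / ((n : ℕ) : ℝ)) k) = u k := by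
  have hh : 0 < a / ((n : ℕ) : ℝ) := div_pos ha (by exact_mod_cast n.pos)
  have hex : ∃ L : E3 →ᵃ[ℝ] E3, ∀ k : Node a Ω n, k.1 ∈ T → L (latticePoint a n k.1) = μ k := by
    obtain ⟨L, hL⟩ := hT.exists_affine hh u
    exact ⟨L, fun k hk => by rw [latticePoint_eq_pt, hL _ hk, hu]⟩
  intro k hk
  have hk' : latticePoint a n k ∈ Ω := hΩ (subset_convexHull _ _ ⟨k, hk, rfl⟩)
  rw [affineOn, dif_pos hex, ← latticePoint_eq_pt]
  exact (hex.choose_spec ⟨k, hk'⟩ hk).trans (hu ⟨k, hk'⟩).symm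

theorem norm_interpPartial_sub_le (ha : 0 < a) (hu : ∀ x : Node a Ω n, u x.1 = μ x) {x : E3}
    (hx : OffFaces (a / ((n : ℕ) : ℝ)) x) (hex : ∃ T, IsElementAt a Ω n x T) (q : Fin 3 → E3)
    (i : Fin 3) :
    ‖interpPartial a Ω n μ i x - q i‖ ≤ 3 * cellError (a / ((n : ℕ) : ℝ)) u q
      (cell (a / ((n : ℕ) : ℝ)) x) := by
  have hh : 0 < a / ((n : ℕ) : ℝ) := div_pos ha (by exact_mod_cast n.pos)
  obtain ⟨hT, hΩ, hxT⟩ := hex.choose_spec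
  obtain ⟨c, hTc, v, hv, hs⟩ := hT.cases
  rw [interpPartial, dif_pos hex, hx.cell_eq hh (solid_subset_closedCube ha n hTc hxT)]
  exact norm_linear_sub_le hh hv (hs.imp (fun h => h.2) (fun h => h.2.1)) u _
    (affineOn_spec ha hu hT hΩ) q i

theorem norm_interp_sub_le (ha : 0 < a) (hu : ∀ x : Node a Ω n, u x.1 = μ x) {x : E3}
    (hx : OffFaces (a / ((n : ℕ) : ℝ)) x) (hex : ∃ T, IsElementAt a Ω n x T) :
    ‖interp a Ω n μ x - u (cell (a / ((n : ℕ) : ℝ)) x)‖ ≤ 3 * (a / ((n : ℕ) : ℝ) *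
      cellError (a / ((n : ℕ) : ℝ)) u 0 (cell (a / ((n : ℕ) : ℝ)) x)) := by
  have hh : 0 < a / ((n : ℕ) : ℝ) := div_pos ha (by exact_mod_cast n.pos)
  obtain ⟨hT, hΩ, hxT⟩ := hex.choose_spec
  obtain ⟨c, hTc, -⟩ := hT.cases
  rw [interp, dif_pos hex, hx.cell_eq hh (solid_subset_closedCube ha n hTc hxT)]
  have hL := affineOn_spec ha hu hT hΩ
  set L := affineOn a Ω n μ hex.choose
  -- The value of an affine map at a point of the element is a convex combination of the vertex
  -- values, all of which lie in one ball around u c.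
  have h1 : L x ∈ convexHull ℝ (L '' (latticePoint a n '' hex.choose)) := by
    rw [← AffineMap.image_convexHull]
    exact ⟨x, hxT, rfl⟩
  have h2 : convexHull ℝ (L '' (latticePoint a n '' hex.choose)) ⊆ Metric.closedBall (u c)
      (3 * (a / ((n : ℕ) : ℝ) * cellError (a / ((n : ℕ) : ℝ)) u 0 c)) := by
    refine convexHull_min ?_ (convex_closedBall _ _)
    rintro _ ⟨_, ⟨k, hk, rfl⟩, rfl⟩
    rw [latticePoint_eq_pt, hL k hk, Metric.mem_closedBall, dist_eq_norm]
    exact norm_sub_le_cellError hh u (hTc hk)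
  have := h2 h1
  rwa [Metric.mem_closedBall, dist_eq_norm] at this

theorem exists_isElementAt (ha : 0 < a) {x : E3}
    (hx : Metric.closedBall x (2 * (a / ((n : ℕ) : ℝ))) ⊆ Ω) : ∃ T, IsElementAt a Ω n x T := by
  have hh : 0 < a / ((n : ℕ) : ℝ) := div_pos ha (by exact_mod_cast n.pos)
  obtain ⟨T, hT, hTc, hxT⟩ := exists_tetrahedron_mem hh x
  exact ⟨T, hT, ((solid_subset_closedCube ha n hTc).trans
    (closedCube_subset_closedBall hh x)).trans hx, hxT⟩

theorem interp_eq_zero {x : E3} (hex : ¬ ∃ T, IsElementAt a Ω n x T) :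
    interp a Ω n μ x = 0 := by rw [interp, dif_neg hex]

theorem interpPartial_eq_zero {x : E3} (hex : ¬ ∃ T, IsElementAt a Ω n x T) (i : Fin 3) :
    interpPartial a Ω n μ i x = 0 := by rw [interpPartial, dif_neg hex]

end Interp

/-! ### Difference quotients as derivatives of the interpolant -/

theorem sg_smul_linear_corner {h : ℝ} (hh : 0 < h) {c v : Fin 3 → ℤ} (u : (Fin 3 → ℤ) → E3)
    (L : E3 →ᵃ[ℝ] E3) (hL : ∀ k ∈ cornerSet v (sg c v), L (pt h k) = u k) (i : Fin 3) :
    (sg c v i : ℝ) • L.linear (bz i) = h⁻¹ • (u (v + Pi.single i (sg c v i)) - u v) := by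
  have hpt : pt h (Pi.single i (sg c v i)) = (h * (sg c v i : ℝ)) • bz i := by
    ext j; by_cases hj : j = i
    · subst hj; simp [pt_apply]
    · simp [pt_apply, hj]
  have e1 : L (pt h (v + Pi.single i (sg c v i))) = u (v + Pi.single i (sg c v i)) :=
    hL _ (Or.inr ⟨i, rfl⟩)
  rw [← hL v (Or.inl rfl), ← e1, ← vsub_eq_sub, ← L.linearMap_vsub, vsub_eq_sub, pt_add,
    add_sub_cancel_left, hpt, map_smul, smul_smul]
  congr 1; field_simp

open Classical in
/-- The lower corner, in lattice units, of a small cube in the cell `k`, near the endpoint with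
even coordinate sum of the edge from `k` to `k + stp i`. -/
noncomputable def nearCorner (k : Fin 3 → ℤ) (i j : Fin 3) : ℝ :=
  k j + if Odd (∑ l, k l) ∧ j = i then 3 / 4 else 0

/-- A small cube in the cell `k`, near the endpoint with even coordinate sum of the edge from `k`
to `k + stp i`; it lies in the corner tetrahedron at this endpoint. -/
def nearBox (h : ℝ) (k : Fin 3 → ℤ) (i : Fin 3) : Set E3 :=
  {x | ∀ j, h * nearCorner k i j < x j ∧ x j < h * (nearCorner k i j + 1 / 4)}

theorem nearCorner_bounds (k : Fin 3 → ℤ) (i j : Fin 3) :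
    (k j : ℝ) ≤ nearCorner k i j ∧ nearCorner k i j ≤ k j + 3 / 4 := by
  rw [nearCorner]; split_ifs <;> constructor <;> linarith

theorem nearBox_subset_cell {h : ℝ} (hh : 0 < h) (k : Fin 3 → ℤ) (i : Fin 3) :
    nearBox h k i ⊆ {x | cell h x = k} := by
  intro x hx
  change cell h x = k
  rw [cell_eq_iff hh]
  intro j
  have h1 := hx j
  have h2 := nearCorner_bounds k i j
  constructor <;> nlinarith [h1.1, h1.2]

theorem volume_nearBox {h : ℝ} (hh : 0 < h) (k : Fin 3 → ℤ) (i : Fin 3) :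
    volume (nearBox h k i) = ENNReal.ofReal ((h / 4) ^ 3) := by
  have hm := EuclideanSpace.volume_preserving_symm_measurableEquiv_toLp (Fin 3)
  have : nearBox h k i = (MeasurableEquiv.toLp 2 (Fin 3 → ℝ)).symm ⁻¹'
      (Set.pi Set.univ fun j =>
        Set.Ioo (h * nearCorner k i j) (h * (nearCorner k i j + 1 / 4))) := by
    ext x
    simp [nearBox, Set.mem_pi]
  rw [this, hm.measure_preimage
    (MeasurableSet.univ_pi fun i => measurableSet_Ioo).nullMeasurableSet, Real.volume_pi_Ioo]
  have e : ∀ r : ℝ, h * (r + 1 / 4) - h * r = h / 4 := fun r => by ring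
  simp only [e, Finset.prod_const, Finset.card_univ, Fintype.card_fin,
    ENNReal.ofReal_pow (by positivity : 0 ≤ h / 4)]

theorem measurableSet_nearBox (h : ℝ) (k : Fin 3 → ℤ) (i : Fin 3) :
    MeasurableSet (nearBox h k i) := by
  have : nearBox h k i = ⋂ j, {x | h * nearCorner k i j < x j ∧
      x j < h * (nearCorner k i j + 1 / 4)} := by ext; simp [nearBox]
  rw [this]
  refine MeasurableSet.iInter fun j => ?_
  have hm : Measurable fun x : E3 => x j := by fun_prop
  exact (measurableSet_lt measurable_const hm).inter (measurableSet_lt hm measurable_const)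

/-- One end v0 of the edge is even. Measured from v0, every coordinate of x is below 1/4, so that
their sum is below 1 and x is strictly on the side of v0 of the plane through the neighbours of v0.
Only the corner tetrahedron at v0 reaches that side; it contains the edge, and its derivative along
the edge is the difference quotient. -/
theorem interpPartial_eq_of_mem_nearBox {a : ℝ} {Ω : Set E3} {n : ℕ+} {μ : SpinField a Ω n}
    {u : (Fin 3 → ℤ) → E3} (ha : 0 < a) (hu : ∀ x : Node a Ω n, u x.1 = μ x) {x : E3}
    (hx : Metric.closedBall x (2 * (a / ((n : ℕ) : ℝ))) ⊆ Ω) {k : Fin 3 → ℤ} {i : Fin 3}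
    (hxk : x ∈ nearBox (a / ((n : ℕ) : ℝ)) k i) :
    interpPartial a Ω n μ i x = gq (a / ((n : ℕ) : ℝ)) u i k := by
  have hh : 0 < a / ((n : ℕ) : ℝ) := div_pos ha (by exact_mod_cast n.pos)
  have hex := exists_isElementAt (n := n) ha hx
  rw [interpPartial, dif_pos hex]
  obtain ⟨hT, hΩ, hxT⟩ := hex.choose_spec
  have hL := affineOn_spec ha hu hT hΩ
  set L := affineOn a Ω n μ hex.choose
  set T := hex.choose
  set h := a / ((n : ℕ) : ℝ)
  obtain ⟨c, hTc, v, hv, hs⟩ := hT.cases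
  obtain rfl : c = k := by
    have h1 := solid_subset_closedCube ha n hTc hxT
    ext j
    have h2 := h1 j
    have h3 := hxk j
    have h4 := nearCorner_bounds k i j
    have h5 : (c j : ℝ) < k j + 1 := by
      have : h * (c j : ℝ) < h * (k j + 1) := by nlinarith [h2.1, h3.2]
      exact lt_of_mul_lt_mul_left this hh.le
    have h6 : (k j : ℝ) < c j + 1 := by
      have : h * (k j : ℝ) < h * (c j + 1) := by nlinarith [h2.2, h3.1]
      exact lt_of_mul_lt_mul_left this hh.le
    have h7 : c j < k j + 1 := by exact_mod_cast h5
    have h8 : k j < c j + 1 := by exact_mod_cast h6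
    omega
  obtain ⟨v0, hv0, heven, hclose, hres⟩ : ∃ v0 ∈ cellVertices c, Even (∑ j, v0 j) ∧
      ∑ j, (sg c v0 j : ℝ) * (x j / h - v0 j) < 1 ∧
      ∀ w : E3, (sg c v0 i : ℝ) • w = h⁻¹ • (u (v0 + Pi.single i (sg c v0 i)) - u v0) →
        w = gq h u i c := by
    rcases Int.even_or_odd (∑ j, c j) with hc | hc
    · refine ⟨c, fun j => Or.inl rfl, hc, ?_, ?_⟩
      · have : ∀ j, (sg c c j : ℝ) * (x j / h - c j) < 1 / 4 := by
          intro j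
          have h1 := (hxk j).2
          rw [nearCorner, if_neg (fun h => Int.not_even_iff_odd.2 h.1 hc), add_zero, mul_comm,
            ← div_lt_iff₀ hh] at h1
          simp [sg]; linarith
        rw [Fin.sum_univ_three]
        linarith [this 0, this 1, this 2]
      · intro w hw
        simpa [sg] using hw
    · have hst : c + stp i ∈ cellVertices c := fun j => by
        by_cases hj : j = i
        · subst hj; right; simp
        · left; simp [hj]
      refine ⟨c + stp i, hst, ?_, ?_, ?_⟩
      · simp only [Pi.add_apply, Finset.sum_add_distrib, Finset.sum_pi_single', Finset.mem_univ,
          if_true]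
        exact hc.add_one
      · have : ∀ j, (sg c (c + stp i) j : ℝ) * (x j / h - ((c + stp i : Fin 3 → ℤ) j : ℤ))
            < 1 / 4 := by
          intro j
          have h1 := (hxk j).1
          have h2 := (hxk j).2
          by_cases hj : j = i
          · subst hj
            rw [nearCorner, if_pos ⟨hc, rfl⟩, mul_comm, ← lt_div_iff₀ hh] at h1
            simp [sg]; linarith
          · rw [nearCorner, if_neg (fun h => hj h.2), add_zero, mul_comm, ← div_lt_iff₀ hh] at h2
            simp [sg, hj]; linarith
        rw [Fin.sum_univ_three]
        linarith [this 0, this 1, this 2]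
      · intro w hw
        have h1 : sg c (c + stp i) i = -1 := by simp [sg]
        rw [h1, add_assoc, stp, ← Pi.single_add, add_neg_cancel, Pi.single_zero, add_zero] at hw
        rw [gq, ← neg_sub (u c), smul_neg, ← hw]
        simp
  refine hres _ ?_
  -- Every vertex of the cell other than v0 has coordinate sum at least 1 measured from v0. An
  -- element without the vertex v0 would lie in that half-space, which does not contain x.
  have hv0T : v0 ∈ T := by
    by_contra hnot
    have hconv : Convex ℝ {y : E3 | 1 ≤ ∑ j, (sg c v0 j : ℝ) * (y j / h - v0 j)} := by
      intro y hy z hz s t hs ht hst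
      simp only [Set.mem_ofPred_eq, Fin.sum_univ_three, PiLp.add_apply, PiLp.smul_apply,
        smul_eq_mul] at hy hz ⊢
      obtain rfl : t = 1 - s := by linarith
      simp only [add_div, mul_div_assoc]
      nlinarith
    have hsub : latticePoint a n '' T ⊆ {y : E3 | 1 ≤ ∑ j, (sg c v0 j : ℝ) * (y j / h - v0 j)} := by
      rintro _ ⟨w, hw, rfl⟩
      have hw' := hTc hw
      have h1 : ∀ j, (latticePoint a n w) j / h = w j := fun j => by
        rw [latticePoint_eq_pt, pt_apply]; exact mul_div_cancel_left₀ _ hh.ne'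
      simp only [Set.mem_ofPred_eq, h1]
      have h2 : (1 : ℤ) ≤ ∑ j, sg c v0 j * (w j - v0 j) := by
        have h3 : ∀ j, sg c v0 j * (w j - v0 j) = if w j = v0 j then 0 else 1 := by
          intro j
          split_ifs with hj
          · rw [hj, sub_self, mul_zero]
          · rcases sg_eq hv0 j with h | h <;> rw [h.2] <;> have := hw' j <;> omega
        have h4 : ∃ j, w j ≠ v0 j := by
          by_contra hall
          push Not at hall
          exact hnot ((funext hall : w = v0) ▸ hw)
        obtain ⟨j, hj⟩ := h4
        calc (1 : ℤ) = sg c v0 j * (w j - v0 j) := by rw [h3, if_neg hj]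
          _ ≤ _ := Finset.single_le_sum (f := fun j => sg c v0 j * (w j - v0 j))
            (fun j _ => by rw [h3]; split_ifs <;> simp) (Finset.mem_univ j)
      exact_mod_cast h2
    have h3 : x ∈ {y : E3 | 1 ≤ ∑ j, (sg c v0 j : ℝ) * (y j / h - v0 j)} :=
      convexHull_min hsub hconv hxT
    exact absurd hclose (not_lt.2 h3)
  rcases hs with ⟨hve, hTv⟩ | ⟨-, -, hodd⟩
  -- The three neighbours of the even vertex v are odd, so v is the only even vertex of the corner
  -- tetrahedron.
  · have : v0 = v := by
      rw [hTv] at hv0T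
      rcases hv0T with h1 | ⟨j, hj⟩
      · exact h1
      · exfalso
        have h2 : ∑ l, v0 l = ∑ l, v l + sg c v j := by
          rw [hj]
          simp only [Pi.add_apply, Finset.sum_add_distrib, Finset.sum_pi_single', Finset.mem_univ,
            if_true]
        rw [Int.even_iff] at heven hve
        have h3 := sg_eq hv j
        omega
    subst this
    exact sg_smul_linear_corner hh u L (fun k hk => hL k (hTv ▸ hk)) i
  · exact absurd heven (Int.not_even_iff_odd.2 (hodd v0 hv0T))

/-! ### Integrability of the interpolant -/

theorem finite_elements {a : ℝ} (ha : 0 < a) {Ω : Set E3} (hΩ : Bornology.IsBounded Ω) (n : ℕ+) :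
    {T | IsTetrahedron T ∧ solid a n T ⊆ Ω}.Finite := by
  have hf : {k : Fin 3 → ℤ | latticePoint a n k ∈ Ω}.Finite :=
    @Set.toFinite _ _ (finite_node ha hΩ n)
  refine hf.finite_subsets.subset ?_
  rintro T ⟨-, hT⟩ k hk
  exact hT (subset_convexHull _ _ ⟨k, hk, rfl⟩)

theorem IsTetrahedron.isClosed_solid {a : ℝ} {n : ℕ+} {T : Set (Fin 3 → ℤ)}
    (hT : IsTetrahedron T) : IsClosed (solid a n T) := by
  have hf : T.Finite := by
    obtain ⟨c, hTc, -⟩ := hT.cases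
    refine (Set.finite_Icc (c : Fin 3 → ℤ) (c + 1)).subset fun k hk => ?_
    constructor <;> intro j <;> have := hTc hk j <;> simp <;> omega
  exact ((hf.image _).isCompact_convexHull ℝ).isClosed

/-- A function that depends continuously on the point, and otherwise only on the elements that
contain it, is square-integrable. -/
theorem memLp_of_elements {a : ℝ} (ha : 0 < a) {Ω : Set E3} (hΩ : IsCompact Ω) (n : ℕ+)
    (Ψ : (Set (Fin 3 → ℤ) → Prop) → E3 → E3) (hΨ : ∀ p, Continuous (Ψ p)) :
    MemLp (fun x => Ψ (IsElementAt a Ω n x) x) 2 (volume.restrict Ω) := by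
  classical
  set 𝒯 := {T | IsTetrahedron T ∧ solid a n T ⊆ Ω}
  have hfin : 𝒯.Finite := finite_elements ha hΩ.isBounded n
  -- The element that `interp` chooses at x depends on x only through the predicate `IsElementAt a Ω
  -- n x`. That predicate takes finitely many values, each on a measurable set, which is why Ψ is a
  -- function of predicates.
  have hfin2 : {p : Set (Fin 3 → ℤ) → Prop | ∀ T, p T → T ∈ 𝒯}.Finite := hfin.finite_subsets
  have hmeas : ∀ p : Set (Fin 3 → ℤ) → Prop, MeasurableSet {x | IsElementAt a Ω n x = p} := by
    intro p
    by_cases hp : ∀ T, p T → T ∈ 𝒯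
    · have : {x | IsElementAt a Ω n x = p} = ⋂ T ∈ 𝒯, {x | x ∈ solid a n T ↔ p T} := by
        ext x
        simp only [Set.mem_iInter, Set.mem_ofPred_eq]
        constructor
        · rintro rfl T hT
          exact ⟨fun h => ⟨hT.1, hT.2, h⟩, fun h => h.2.2⟩
        · intro h
          ext T
          constructor
          · intro hT; exact (h T ⟨hT.1, hT.2.1⟩).1 hT.2.2
          · intro hT; exact ⟨(hp T hT).1, (hp T hT).2, (h T (hp T hT)).2 hT⟩
      rw [this]
      refine hfin.measurableSet_biInter fun T hT => ?_
      by_cases h : p T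
      · simpa [h] using hT.1.isClosed_solid.measurableSet
      · have : {x | x ∈ solid a n T ↔ p T} = (solid a n T)ᶜ := by ext; simp [h]
        rw [this]
        exact hT.1.isClosed_solid.measurableSet.compl
    · convert MeasurableSet.empty
      ext x
      simp only [Set.mem_ofPred_eq, Set.mem_empty_iff_false, iff_false]
      rintro rfl
      exact hp fun T hT => ⟨hT.1, hT.2.1⟩
  have hsum : (fun x => Ψ (IsElementAt a Ω n x) x) = fun x => ∑ p ∈ hfin2.toFinset,
      {x | IsElementAt a Ω n x = p}.indicator (Ψ p) x := by
    ext1 x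
    rw [Finset.sum_eq_single (IsElementAt a Ω n x)]
    · simp
    · intro p _ hp
      exact Set.indicator_of_notMem (fun h => hp h.symm) _
    · intro h
      exact absurd (hfin2.mem_toFinset.2 fun T hT => ⟨hT.1, hT.2.1⟩) h
  rw [hsum]
  refine memLp_finsetSum _ fun p _ => MemLp.indicator (hmeas p) ?_
  obtain ⟨C, hC⟩ := hΩ.exists_bound_of_continuousOn (hΨ p).continuousOn
  have : IsFiniteMeasure (volume.restrict Ω) := ⟨by simpa using hΩ.measure_lt_top⟩
  exact MemLp.of_bound (hΨ p).aestronglyMeasurable C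
    ((ae_restrict_iff' hΩ.measurableSet).2 (Eventually.of_forall hC))

theorem memLp_interp {a : ℝ} (ha : 0 < a) {Ω : Set E3} (hΩ : IsCompact Ω) (n : ℕ+)
    (μ : SpinField a Ω n) : MemLp (interp a Ω n μ) 2 (volume.restrict Ω) := by
  classical
  refine memLp_of_elements ha hΩ n
    (fun p x => if h : ∃ T, p T then affineOn a Ω n μ h.choose x else 0) fun p => ?_
  by_cases h : ∃ T, p T
  · simp only [dif_pos h]
    exact AffineMap.continuous_of_finiteDimensional _
  · simp only [dif_neg h]
    exact continuous_const

theorem memLp_interpPartial {a : ℝ} (ha : 0 < a) {Ω : Set E3} (hΩ : IsCompact Ω) (n : ℕ+)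
    (μ : SpinField a Ω n) (i : Fin 3) :
    MemLp (interpPartial a Ω n μ i) 2 (volume.restrict Ω) := by
  classical
  refine memLp_of_elements ha hΩ n (fun p _ => if h : ∃ T, p T then
    (affineOn a Ω n μ h.choose).linear (EuclideanSpace.single i 1) else 0) fun p => ?_
  exact continuous_const

/-! ### Square-integrable functions -/

theorem ennreal_sum_sq_le {ι : Type*} (s : Finset ι) (f : ι → ℝ≥0∞) :
    (∑ i ∈ s, f i) ^ 2 ≤ s.card * ∑ i ∈ s, f i ^ 2 := by
  have := ENNReal.rpow_sum_le_const_mul_sum_rpow s f (p := 2) (by norm_num)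
  norm_num at this
  exact this

theorem ennreal_add_sq_le (a b : ℝ≥0∞) : (a + b) ^ 2 ≤ 2 * a ^ 2 + 2 * b ^ 2 := by
  have := ennreal_sum_sq_le Finset.univ ![a, b]
  simpa [Fin.sum_univ_two, mul_add] using this

theorem ennreal_add_add_sq_le (a b c : ℝ≥0∞) :
    (a + b + c) ^ 2 ≤ 3 * a ^ 2 + 3 * b ^ 2 + 3 * c ^ 2 := by
  have := ennreal_sum_sq_le Finset.univ ![a, b, c]
  simpa [Fin.sum_univ_three, mul_add] using this

section L2

variable {α : Type*} [MeasurableSpace α] {ν : Measure α} {F : Type*} [NormedAddCommGroup F]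

theorem enorm_sq_add_le (x y : F) : ‖x + y‖ₑ ^ 2 ≤ 2 * ‖x‖ₑ ^ 2 + 2 * ‖y‖ₑ ^ 2 :=
  (pow_le_pow_left₀ zero_le (enorm_add_le x y) 2).trans (ennreal_add_sq_le _ _)

theorem eLpNorm_two_sq (f : α → F) : eLpNorm f 2 ν ^ 2 = ∫⁻ x, ‖f x‖ₑ ^ 2 ∂ν := by
  have := eLpNorm_nnreal_pow_eq_lintegral (μ := ν) (f := f) (p := 2) (by norm_num)
  norm_num at this
  exact this

theorem memLp_two_iff {f : α → F} :
    MemLp f 2 ν ↔ AEStronglyMeasurable f ν ∧ ∫⁻ x, ‖f x‖ₑ ^ 2 ∂ν < ⊤ := by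
  rw [← eLpNorm_two_sq, MemLp]
  simp [ENNReal.pow_lt_top_iff]

theorem MemLp.lintegral_sq_ne_top {f : α → F} (hf : MemLp f 2 ν) :
    ∫⁻ x, ‖f x‖ₑ ^ 2 ∂ν ≠ ⊤ := (memLp_two_iff.1 hf).2.ne

theorem MemLp.ofReal_norm_toLp_sq {f : α → F} (hf : MemLp f 2 ν) :
    ENNReal.ofReal (‖hf.toLp f‖ ^ 2) = ∫⁻ x, ‖f x‖ₑ ^ 2 ∂ν := by
  rw [Lp.norm_toLp, ← eLpNorm_two_sq, ENNReal.ofReal_pow ENNReal.toReal_nonneg,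
    ENNReal.ofReal_toReal hf.eLpNorm_ne_top]

theorem ofReal_integral_norm_sq {f : α → F} (hf : MemLp f 2 ν) :
    ENNReal.ofReal (∫ x, ‖f x‖ ^ 2 ∂ν) = ∫⁻ x, ‖f x‖ₑ ^ 2 ∂ν := by
  rw [ofReal_integral_eq_lintegral_ofReal hf.norm.integrable_sq
    (Eventually.of_forall fun x => by positivity)]
  refine lintegral_congr fun x => ?_
  rw [ENNReal.ofReal_pow (norm_nonneg _), ofReal_norm]

theorem MemLp.norm_toLp_sq {f : α → F} (hf : MemLp f 2 ν) :
    ‖hf.toLp f‖ ^ 2 = ∫ x, ‖f x‖ ^ 2 ∂ν := by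
  rw [← ENNReal.ofReal_eq_ofReal_iff (by positivity) (integral_nonneg fun x => by positivity),
    MemLp.ofReal_norm_toLp_sq, ofReal_integral_norm_sq hf]

variable [InnerProductSpace ℝ F]

theorem MemLp.inner_toLp {f g : α → F} (hf : MemLp f 2 ν) (hg : MemLp g 2 ν) :
    inner ℝ (hf.toLp f) (hg.toLp g) = ∫ x, inner ℝ (f x) (g x) ∂ν := by
  rw [L2.inner_def]
  refine integral_congr_ae ?_
  filter_upwards [hf.coeFn_toLp, hg.coeFn_toLp] with x h1 h2
  rw [h1, h2]

theorem MemLp.integrable_inner_two {f g : α → F} (hf : MemLp f 2 ν) (hg : MemLp g 2 ν) :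
    Integrable (fun x => (inner ℝ (f x) (g x) : ℝ)) ν := by
  refine (L2.integrable_inner (𝕜 := ℝ) (hf.toLp f) (hg.toLp g)).congr ?_
  filter_upwards [hf.coeFn_toLp, hg.coeFn_toLp] with x h1 h2
  rw [h1, h2]

/-- A function with bounded pairings is bounded in norm, by density. -/
theorem lintegral_sq_le_of_inner_le {g : α → F} (hg : MemLp g 2 ν) {B : ℝ} (hB : 0 ≤ B)
    (P : (α → F) → Prop) (hP : ∀ ψ, P ψ → MemLp ψ 2 ν)
    (hdense : ∀ ε > 0, ∃ ψ, P ψ ∧ ∫⁻ x, ‖g x - ψ x‖ₑ ^ 2 ∂ν ≤ ENNReal.ofReal ε)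
    (hle : ∀ ψ, ∀ hψ : P ψ, ∫ x, inner ℝ (ψ x) (g x) ∂ν ≤ B * ‖(hP ψ hψ).toLp ψ‖) :
    ∫⁻ x, ‖g x‖ₑ ^ 2 ∂ν ≤ ENNReal.ofReal (B ^ 2) := by
  rw [← MemLp.ofReal_norm_toLp_sq hg]
  refine ENNReal.ofReal_le_ofReal (pow_le_pow_left₀ (norm_nonneg _) ?_ 2)
  set G := hg.toLp g
  -- Split ‖G‖² = ⟨ψ, G⟩ + ⟨G - ψ, G⟩ with ‖G - ψ‖ ≤ δ: the hypothesis bounds the first term,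
  -- Cauchy–Schwarz the second.
  have key : ∀ δ > 0, ‖G‖ ^ 2 ≤ B * ‖G‖ + (B + ‖G‖) * δ := by
    intro δ hδ
    obtain ⟨ψ, hψ, hd⟩ := hdense (δ ^ 2) (by positivity)
    have hψ2 := hP ψ hψ
    have h1 : ‖G - hψ2.toLp ψ‖ ≤ δ := by
      rw [← MemLp.toLp_sub hg hψ2]
      have := MemLp.ofReal_norm_toLp_sq (hg.sub hψ2)
      simp only [Pi.sub_apply] at this
      rw [← this, ENNReal.ofReal_le_ofReal_iff (by positivity)] at hd
      exact (sq_le_sq₀ (norm_nonneg _) hδ.le).1 hd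
    have h2 : ‖hψ2.toLp ψ‖ ≤ ‖G‖ + δ := by
      have := norm_sub_norm_le (hψ2.toLp ψ) G
      rw [norm_sub_rev] at this
      linarith
    have h3 : ‖G‖ ^ 2 = inner ℝ (hψ2.toLp ψ) G + inner ℝ (G - hψ2.toLp ψ) G := by
      rw [← inner_add_left, add_sub_cancel, real_inner_self_eq_norm_sq]
    have h4 : (inner ℝ (hψ2.toLp ψ) G : ℝ) ≤ B * ‖hψ2.toLp ψ‖ := by
      rw [MemLp.inner_toLp hψ2 hg]; exact hle ψ hψ
    have h5 := real_inner_le_norm (G - hψ2.toLp ψ) G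
    have h6 : B * ‖hψ2.toLp ψ‖ ≤ B * (‖G‖ + δ) := mul_le_mul_of_nonneg_left h2 hB
    have h7 : ‖G - hψ2.toLp ψ‖ * ‖G‖ ≤ δ * ‖G‖ := mul_le_mul_of_nonneg_right h1 (norm_nonneg _)
    linarith
  have h8 : ‖G‖ ^ 2 ≤ B * ‖G‖ := by
    refine le_of_forall_pos_le_add fun ε hε => ?_
    have hpos : 0 < B + ‖G‖ + 1 := by positivity
    refine (key (ε / (B + ‖G‖ + 1)) (by positivity)).trans ?_
    have : (B + ‖G‖) * (ε / (B + ‖G‖ + 1)) ≤ ε := by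
      rw [mul_div_assoc', div_le_iff₀ hpos]; nlinarith
    linarith
  rcases (norm_nonneg G).eq_or_lt with h | h
  · rw [← h]; exact hB
  · rw [sq] at h8
    exact le_of_mul_le_mul_right h8 h

/-- A sequence of square-integrable functions with convergent pairings is bounded. -/
theorem exists_bound_of_tendsto_inner [CompleteSpace F] {f : ℕ+ → α → F} (hf : ∀ n, MemLp (f n) 2 ν)
    (h : ∀ g : α → F, MemLp g 2 ν →
      ∃ l, Tendsto (fun n => ∫ x, inner ℝ (f n x) (g x) ∂ν) atTop (𝓝 l)) :
    ∃ C : ℝ, 0 ≤ C ∧ ∀ n, ∫⁻ x, ‖f n x‖ₑ ^ 2 ∂ν ≤ ENNReal.ofReal C := by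
  -- Each pairing converges and is therefore bounded along the sequence, so the functionals ⟨f n, ·⟩
  -- are uniformly bounded; their norms are those of f n.
  obtain ⟨C, hC⟩ := banach_steinhaus (g := fun n => innerSL ℝ ((hf n).toLp (f n))) (by
    intro G
    obtain ⟨l, hl⟩ := h G (Lp.memLp G)
    have hb := Metric.isBounded_range_of_tendsto
      (fun m : ℕ => ∫ x, inner ℝ (f m.succPNat x) (G x) ∂ν)
      (hl.comp (tendsto_atTop_atTop.2 fun b => ⟨b, fun m hm => by
        rw [← PNat.coe_le_coe]; simp; omega⟩))
    obtain ⟨C, hC⟩ := hb.exists_norm_le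
    refine ⟨C, fun n => ?_⟩
    have := hC _ ⟨n.natPred, rfl⟩
    simp only [PNat.succPNat_natPred] at this
    have e := MemLp.inner_toLp (hf n) (Lp.memLp G)
    rw [Lp.toLp_coeFn] at e
    rw [innerSL_apply_apply, e]
    exact this)
  refine ⟨C ^ 2, by positivity, fun n => ?_⟩
  rw [← MemLp.ofReal_norm_toLp_sq (hf n)]
  refine ENNReal.ofReal_le_ofReal (pow_le_pow_left₀ (norm_nonneg _) ?_ 2)
  have := hC n
  rwa [innerSL_apply_norm] at this

end L2

/-! ### Cut-offs and density of test functions -/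

theorem exists_contDiff_cutoff {K U : Set E3} (hK : IsCompact K) (hU : IsOpen U) (hKU : K ⊆ U) :
    ∃ χ : E3 → ℝ, ContDiff ℝ ∞ χ ∧ HasCompactSupport χ ∧ tsupport χ ⊆ U ∧
      (∀ x ∈ K, χ x = 1) ∧ ∀ x, 0 ≤ χ x ∧ χ x ≤ 1 := by
  obtain ⟨L, hL, hKL, hLU⟩ := exists_compact_between hK hU hKU
  obtain ⟨f, hf0, hf1, hf⟩ := exists_contMDiffMap_zero_one_of_isClosed (n := ⊤)
    (modelWithCornersSelf ℝ E3) (s := (interior L)ᶜ) (t := K)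
    isOpen_interior.isClosed_compl hK.isClosed
    (Set.disjoint_compl_left_iff_subset.2 hKL)
  have hsupp : tsupport f ⊆ L := by
    refine closure_minimal ?_ hL.isClosed
    intro x hx
    by_contra hxL
    exact hx (hf0 fun h => hxL (interior_subset h))
  exact ⟨f, f.contMDiff.contDiff, hL.of_isClosed_subset (isClosed_tsupport _) hsupp,
    hsupp.trans hLU, fun x hx => hf1 hx, fun x => hf x⟩

/-- Smooth functions with compact support in `U` are dense in `L²(U)`. -/
theorem exists_contDiff_approx {F : Type*} [NormedAddCommGroup F] [NormedSpace ℝ F] {U : Set E3}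
    (hU : IsOpen U) {f : E3 → F} (hf : MemLp f 2 (volume.restrict U)) {ε : ℝ} (hε : 0 < ε) :
    ∃ ψ : E3 → F, ContDiff ℝ ∞ ψ ∧ HasCompactSupport ψ ∧ tsupport ψ ⊆ U ∧
      ∫⁻ x in U, ‖f x - ψ x‖ₑ ^ 2 ≤ ENNReal.ofReal ε := by
  -- Inner regularity of the finite measure |f|² dx on U gives a compact K ⊆ U that carries almost
  -- all of the L² norm of f.
  set ν := (volume.restrict U).withDensity fun x => ‖f x‖ₑ ^ 2
  have hνfin : IsFiniteMeasure ν := ⟨by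
    simpa [ν] using (MemLp.lintegral_sq_ne_top hf).lt_top⟩
  obtain ⟨K, hKU, hK, hKν⟩ := hU.measurableSet.exists_isCompact_sdiff_lt (measure_ne_top ν U)
    (ε := ENNReal.ofReal (ε / 4)) (by positivity)
  have hKm := hK.measurableSet
  have hdiff : ∫⁻ x in U \ K, ‖f x‖ₑ ^ 2 ≤ ENNReal.ofReal (ε / 4) := by
    have : ν (U \ K) = ∫⁻ x in U \ K, ‖f x‖ₑ ^ 2 := by
      rw [withDensity_apply _ (hU.measurableSet.diff hKm),
        Measure.restrict_restrict (hU.measurableSet.diff hKm),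
        Set.inter_eq_left.2 Set.sdiff_subset]
    rw [← this]; exact hKν.le
  have hfK : MemLp (K.indicator f) 2 volume := by
    rw [memLp_indicator_iff_restrict hKm]
    exact hf.mono_measure (Measure.restrict_mono hKU le_rfl)
  obtain ⟨g, hgc, hgs, hg⟩ := hfK.exist_eLpNorm_sub_le (by norm_num) (by norm_num)
    (ε := Real.sqrt (ε / 4)) (by positivity)
  have hg' : ∫⁻ x, ‖K.indicator f x - g x‖ₑ ^ 2 ≤ ENNReal.ofReal (ε / 4) := by
    have := eLpNorm_two_sq (ν := volume) (K.indicator f - g)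
    simp only [Pi.sub_apply] at this
    rw [← this]
    refine (pow_le_pow_left₀ zero_le hg 2).trans ?_
    rw [← ENNReal.ofReal_pow (Real.sqrt_nonneg _), Real.sq_sqrt (by positivity)]
  obtain ⟨χ, hχs, hχc, hχU, hχ1, hχ⟩ := exists_contDiff_cutoff hK hU hKU
  refine ⟨fun x => χ x • g x, hχs.smul hgs, hχc.smul_right,
    (tsupport_smul_subset_left χ g).trans hχU, ?_⟩
  -- The smooth function g approximates f on K and zero elsewhere. The cut-off χ is 1 on K, so it
  -- brings the support into U without spoiling g on K, and off K the only new error is f itself.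
  have hpt : ∀ x ∈ U, ‖f x - χ x • g x‖ₑ ^ 2 ≤ 2 * ‖K.indicator f x - g x‖ₑ ^ 2 +
      (U \ K).indicator (fun x => 2 * ‖f x‖ₑ ^ 2) x := by
    intro x hx
    have hc : ‖χ x • (K.indicator f x - g x)‖ₑ ≤ ‖K.indicator f x - g x‖ₑ := by
      rw [enorm_smul]
      refine mul_le_of_le_one_left zero_le ?_
      rw [← ofReal_norm, ENNReal.ofReal_le_one, Real.norm_of_nonneg (hχ x).1]
      exact (hχ x).2
    by_cases hxK : x ∈ K
    · have e : f x - χ x • g x = χ x • (K.indicator f x - g x) := by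
        rw [Set.indicator_of_mem hxK, hχ1 x hxK, one_smul, one_smul]
      rw [e, Set.indicator_of_notMem (s := U \ K) (fun h => h.2 hxK), add_zero]
      calc _ ≤ ‖K.indicator f x - g x‖ₑ ^ 2 := pow_le_pow_left₀ zero_le hc 2
        _ ≤ _ := by rw [two_mul]; exact le_self_add
    · have e : f x - χ x • g x = χ x • (K.indicator f x - g x) + f x := by
        rw [Set.indicator_of_notMem hxK, zero_sub, smul_neg]; abel
      rw [e, Set.indicator_of_mem (s := U \ K) ⟨hx, hxK⟩]
      refine (enorm_sq_add_le _ _).trans ?_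
      gcongr
  calc ∫⁻ x in U, ‖f x - χ x • g x‖ₑ ^ 2
      ≤ ∫⁻ x in U, (2 * ‖K.indicator f x - g x‖ₑ ^ 2 +
        (U \ K).indicator (fun x => 2 * ‖f x‖ₑ ^ 2) x) :=
        setLIntegral_mono' hU.measurableSet hpt
    _ = (∫⁻ x in U, 2 * ‖K.indicator f x - g x‖ₑ ^ 2) + ∫⁻ x in U \ K, 2 * ‖f x‖ₑ ^ 2 := by
        rw [lintegral_add_left', lintegral_indicator (hU.measurableSet.diff hKm),
          Measure.restrict_restrict (hU.measurableSet.diff hKm),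
          Set.inter_eq_left.2 Set.sdiff_subset]
        refine (((hfK.aestronglyMeasurable.sub hgs.continuous.aestronglyMeasurable).enorm.pow_const
          2).const_mul 2).restrict
    _ ≤ 2 * ENNReal.ofReal (ε / 4) + 2 * ENNReal.ofReal (ε / 4) := by
        rw [lintegral_const_mul' _ _ (by norm_num), lintegral_const_mul' _ _ (by norm_num)]
        gcongr
        exact (setLIntegral_le_lintegral _ _).trans hg'
    _ = ENNReal.ofReal ε := by
        rw [← two_mul, ← mul_assoc, show (2 : ℝ≥0∞) * 2 = ENNReal.ofReal 4 by norm_num,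
          ← ENNReal.ofReal_mul (by norm_num)]
        congr 1; ring

/-! ### Sobolev functions -/

theorem inner_eq_sum_mul (v w : E3) : inner ℝ v w = ∑ c, v c * w c := by
  rw [PiLp.inner_apply]
  exact Finset.sum_congr rfl fun c _ => by simp [mul_comm]

/-- Integration by parts against a vector-valued test function. -/
theorem SobolevH1.integral_inner_fderiv {Ω : Set E3} (m : SobolevH1 Ω) {ψ : E3 → E3}
    (hψ : ContDiff ℝ ∞ ψ) (hc : HasCompactSupport ψ) (hs : tsupport ψ ⊆ interior Ω) (i : Fin 3) :
    ∫ x in Ω, inner ℝ (fderiv ℝ ψ x (bz i)) (m.toFun x) = -∫ x in Ω, inner ℝ (ψ x) (m.pd i x) := by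
  have hd : Differentiable ℝ ψ := hψ.differentiable (by simp)
  let φ : Fin 3 → E3 → ℝ := fun c x => ψ x c
  have hφ : ∀ c, ContDiff ℝ ∞ (φ c) := fun c =>
    (EuclideanSpace.proj c : E3 →L[ℝ] ℝ).contDiff.comp hψ
  have hφc : ∀ c, HasCompactSupport (φ c) := fun c =>
    hc.comp_left (g := fun v : E3 => v c) (by simp)
  have hφs : ∀ c, tsupport (φ c) ⊆ interior Ω := fun c =>
    (closure_mono (Function.support_comp_subset (g := fun v : E3 => v c) (by simp) ψ)).trans hs
  have hφd : ∀ c x, fderiv ℝ (φ c) x (bz i) = (fderiv ℝ ψ x (bz i)) c := by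
    intro c x
    have : HasFDerivAt (φ c) ((EuclideanSpace.proj c : E3 →L[ℝ] ℝ).comp (fderiv ℝ ψ x)) x :=
      (EuclideanSpace.proj c : E3 →L[ℝ] ℝ).hasFDerivAt.comp x (hd x).hasFDerivAt
    rw [this.fderiv]; rfl
  have hI : ∀ (f : E3 → ℝ) (g : E3 → E3), Continuous f → HasCompactSupport f →
      MemLp g 2 (volume.restrict Ω) → Integrable (fun x => f x • g x) (volume.restrict Ω) := by
    intro f g hf hfc hg
    have hf2 : MemLp f 2 (volume.restrict Ω) :=
      (hf.memLp_of_hasCompactSupport hfc).restrict Ω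
    exact memLp_one_iff_integrable.1 (hg.smul hf2)
  have hcd : ∀ c, Continuous fun x => fderiv ℝ (φ c) x (bz i) := fun c =>
    ((hφ c).continuous_fderiv (by simp)).clm_apply continuous_const
  have hcc : ∀ c, HasCompactSupport fun x => fderiv ℝ (φ c) x (bz i) := fun c =>
    ((hφc c).fderiv ℝ).comp_left (g := fun L : E3 →L[ℝ] ℝ => L (bz i)) (by simp)
  have hcomp : ∀ c, ∫ x in Ω, (fderiv ℝ ψ x (bz i)) c * m.toFun x c =
      -∫ x in Ω, ψ x c * m.pd i x c := by
    intro c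
    have h := congrArg (EuclideanSpace.proj c : E3 →L[ℝ] ℝ)
      (m.integral_by_parts (φ c) (hφ c) (hφc c) (hφs c) i)
    rw [map_neg, ← ContinuousLinearMap.integral_comp_comm _ (hI _ _ (hcd c) (hcc c) m.memLp_toFun),
      ← ContinuousLinearMap.integral_comp_comm _
        (hI _ _ (hφ c).continuous (hφc c) (m.memLp_pd i))] at h
    simpa [hφd] using h
  have hI2 : ∀ (f : E3 → ℝ) (g : E3 → E3) (c : Fin 3), Continuous f → HasCompactSupport f →
      MemLp g 2 (volume.restrict Ω) → Integrable (fun x => f x * g x c) (volume.restrict Ω) := by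
    intro f g c hf hfc hg
    have := (EuclideanSpace.proj c : E3 →L[ℝ] ℝ).integrable_comp (hI f g hf hfc hg)
    simpa using this
  simp_rw [inner_eq_sum_mul]
  rw [integral_finsetSum, integral_finsetSum, ← Finset.sum_neg_distrib]
  · exact Finset.sum_congr rfl fun c _ => hcomp c
  · exact fun c _ => hI2 _ _ c (hφ c).continuous (hφc c) (m.memLp_pd i)
  · intro c _
    have := hI2 _ _ c (hcd c) (hcc c) m.memLp_toFun
    simpa only [hφd] using this

theorem memLp_translate {Ω U : Set E3} {f : E3 → E3} {p : ℝ≥0∞} (hΩ : MeasurableSet Ω)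
    (hU : MeasurableSet U) (hf : MemLp f p (volume.restrict Ω)) (v : E3)
    (hv : ∀ x ∈ U, x + v ∈ Ω) : MemLp (fun x => f (x + v)) p (volume.restrict U) := by
  have h1 : MemLp (Ω.indicator f) p volume := (memLp_indicator_iff_restrict hΩ).2 hf
  have h2 : MemLp (fun x => Ω.indicator f (x + v)) p volume :=
    h1.comp_measurePreserving (measurePreserving_add_right volume v)
  refine (h2.restrict U).ae_eq ?_
  filter_upwards [ae_restrict_mem hU] with x hx
  exact Set.indicator_of_mem (hv x hx) f

theorem MemLp.norm_toLp_le_norm_toLp {α β F G : Type*} [MeasurableSpace α] [MeasurableSpace β]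
    [NormedAddCommGroup F] [NormedAddCommGroup G] {ν : Measure α} {ν' : Measure β} {f : α → F}
    {g : β → G} (hf : MemLp f 2 ν) (hg : MemLp g 2 ν')
    (h : ∫⁻ x, ‖f x‖ₑ ^ 2 ∂ν ≤ ∫⁻ x, ‖g x‖ₑ ^ 2 ∂ν') : ‖hf.toLp f‖ ≤ ‖hg.toLp g‖ := by
  rw [← MemLp.ofReal_norm_toLp_sq hf, ← MemLp.ofReal_norm_toLp_sq hg,
    ENNReal.ofReal_le_ofReal_iff (by positivity)] at h
  exact (sq_le_sq₀ (norm_nonneg _) (norm_nonneg _)).1 h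

/-- The increments of a Sobolev function in a coordinate direction are controlled by the partial
derivative. -/
theorem SobolevH1.lintegral_sub_sq_le {Ω : Set E3} (hΩ : IsCompact Ω) (m : SobolevH1 Ω) (i : Fin 3)
    (t : ℝ) {U W : Set E3} (hU : IsOpen U) (hWΩ : W ⊆ interior Ω)
    (hUW : ∀ x ∈ U, ∀ s ∈ Set.Icc (0 : ℝ) 1, x + (s * t) • bz i ∈ W) :
    ∫⁻ x in U, ‖m.toFun (x + t • bz i) - m.toFun x‖ₑ ^ 2 ≤
      ENNReal.ofReal (t ^ 2) * ∫⁻ x in W, ‖m.pd i x‖ₑ ^ 2 := by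
  have hΩm := hΩ.measurableSet
  have hWΩ' : W ⊆ Ω := hWΩ.trans interior_subset
  have hU0 : ∀ x ∈ U, x ∈ W := fun x hx => by simpa using hUW x hx 0 (by simp)
  have hU1 : ∀ x ∈ U, x + t • bz i ∈ W := fun x hx => by simpa using hUW x hx 1 (by simp)
  have hUΩ : U ⊆ Ω := fun x hx => hWΩ' (hU0 x hx)
  have hpdW : MemLp (m.pd i) 2 (volume.restrict W) :=
    (m.memLp_pd i).mono_measure (Measure.restrict_mono hWΩ' le_rfl)
  have hmU : MemLp m.toFun 2 (volume.restrict U) :=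
    m.memLp_toFun.mono_measure (Measure.restrict_mono hUΩ le_rfl)
  have hmtU : MemLp (fun x => m.toFun (x + t • bz i)) 2 (volume.restrict U) :=
    memLp_translate hΩm hU.measurableSet m.memLp_toFun _ fun x hx => hWΩ' (hU1 x hx)
  have hg : MemLp (fun x => m.toFun (x + t • bz i) - m.toFun x) 2 (volume.restrict U) :=
    hmtU.sub hmU
  have hfin : IsFiniteMeasure (volume.restrict Ω) := ⟨by simpa using hΩ.measure_lt_top⟩
  -- The extension by zero lets all integrals run over the space; the translates of ψ used below are
  -- supported in W, so the jump of M across ∂Ω is not seen.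
  let M : E3 → E3 := Ω.indicator m.toFun
  have hM : MemLp M 2 volume := (memLp_indicator_iff_restrict hΩm).2 m.memLp_toFun
  have hM1 : Integrable M :=
    (integrable_indicator_iff hΩm).2 (m.memLp_toFun.integrable (by norm_num))
  have hB : 0 ≤ |t| * ‖hpdW.toLp (m.pd i)‖ := by positivity
  have main := lintegral_sq_le_of_inner_le hg hB
    (fun ψ => ContDiff ℝ ∞ ψ ∧ HasCompactSupport ψ ∧ tsupport ψ ⊆ U)
    (fun ψ hψ => (hψ.1.continuous.memLp_of_hasCompactSupport hψ.2.1).restrict U)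
    (fun ε hε => by
      obtain ⟨ψ, h1, h2, h3, h4⟩ := exists_contDiff_approx hU hg hε
      exact ⟨ψ, ⟨h1, h2, h3⟩, h4⟩) ?_
  · refine main.trans_eq ?_
    rw [mul_pow, sq_abs, ENNReal.ofReal_mul (by positivity), MemLp.ofReal_norm_toLp_sq]
  rintro ψ ⟨hψ, hψc, hψU⟩
  have hψd : Differentiable ℝ ψ := hψ.differentiable (by simp)
  have hψ2 : MemLp ψ 2 volume := hψ.continuous.memLp_of_hasCompactSupport hψc
  -- F 1 - F 0 is the pairing of ψ with the increment of m. The translation is carried by the smooth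
  -- ψ, so that F can be differentiated under the integral and its derivative rewritten with the
  -- weak derivative; m itself is never mollified.
  let F : ℝ → ℝ := fun s => ∫ x, inner ℝ (ψ (x - (s * t) • bz i)) (M x)
  obtain ⟨C, hC⟩ := (hψ.continuous_fderiv (by simp)).bounded_above_of_compact_support
    (hψc.fderiv ℝ)
  obtain ⟨C', hC'⟩ := hψ.continuous.bounded_above_of_compact_support hψc
  have hcont : ∀ v : E3, Continuous fun x => ψ (x - v) := fun v =>
    hψ.continuous.comp (continuous_id.sub continuous_const)
  have hderiv : ∀ s, HasDerivAt F
      (∫ x, inner ℝ (fderiv ℝ ψ (x - (s * t) • bz i) (-(t • bz i))) (M x)) s := by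
    intro s
    refine (hasDerivAt_integral_of_dominated_loc_of_deriv_le (s := Set.univ) (x₀ := s)
      (F := fun s x => (inner ℝ (ψ (x - (s * t) • bz i)) (M x) : ℝ))
      (F' := fun s x => (inner ℝ (fderiv ℝ ψ (x - (s * t) • bz i) (-(t • bz i))) (M x) : ℝ))
      (bound := fun x => C * |t| * ‖M x‖) univ_mem ?_ ?_ ?_ ?_ ?_ ?_).2
    · exact Eventually.of_forall fun s =>
        (hcont _).aestronglyMeasurable.inner hM.aestronglyMeasurable
    · refine (hM1.norm.const_mul C').mono'
        ((hcont _).aestronglyMeasurable.inner hM.aestronglyMeasurable) ?_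
      refine Eventually.of_forall fun x => (norm_inner_le_norm _ _).trans ?_
      gcongr
      exact hC' _
    · refine Continuous.aestronglyMeasurable ?_ |>.inner hM.aestronglyMeasurable
      exact ((hψ.continuous_fderiv (by simp)).comp (continuous_id.sub continuous_const)).clm_apply
        continuous_const
    · refine Eventually.of_forall fun x s _ => (norm_inner_le_norm _ _).trans ?_
      gcongr
      refine (ContinuousLinearMap.le_opNorm _ _).trans ?_
      rw [norm_neg, norm_smul, norm_bz, mul_one, Real.norm_eq_abs]
      gcongr
      exact hC _
    · exact hM1.norm.const_mul _
    · refine Eventually.of_forall fun x s _ => ?_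
      have h1 : HasDerivAt (fun s : ℝ => x - (s * t) • bz i) (-(t • bz i)) s := by
        have := ((hasDerivAt_id s).mul_const t).smul_const (bz i)
        simpa using this.const_sub x
      have h2 := (hψd (x - (s * t) • bz i)).hasFDerivAt.comp_hasDerivAt s h1
      simpa using h2.inner ℝ (hasDerivAt_const s (M x))
  -- Integration by parts turns the derivative of F into t times the pairing of the translate of ψ
  -- with ∂ᵢm on W; Cauchy–Schwarz and the translation invariance of the L² norm of ψ conclude.
  have hbound : ∀ s ∈ Set.Icc (0 : ℝ) 1,
      ‖∫ x, inner ℝ (fderiv ℝ ψ (x - (s * t) • bz i) (-(t • bz i))) (M x)‖ ≤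
        |t| * ‖hpdW.toLp (m.pd i)‖ * ‖(hψ2.restrict U).toLp ψ‖ := by
    intro s hs
    let ψs : E3 → E3 := fun x => ψ (x - (s * t) • bz i)
    have hψs : ContDiff ℝ ∞ ψs := hψ.comp (contDiff_id.sub contDiff_const)
    have hψsc : HasCompactSupport ψs :=
      hψc.comp_homeomorph (Homeomorph.subRight ((s * t) • bz i))
    have hψsW : tsupport ψs ⊆ W := by
      intro x hx
      have h1 : x - (s * t) • bz i ∈ tsupport ψ :=
        tsupport_comp_subset_preimage ψ (continuous_id.sub continuous_const) hx
      simpa using hUW _ (hψU h1) s hs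
    have hfd : ∀ x, fderiv ℝ ψs x (bz i) = fderiv ℝ ψ (x - (s * t) • bz i) (bz i) := by
      intro x
      have : HasFDerivAt ψs (fderiv ℝ ψ (x - (s * t) • bz i)) x := by
        have h2 := (hψd (x - (s * t) • bz i)).hasFDerivAt.comp x
          ((hasFDerivAt_id x).sub_const ((s * t) • bz i))
        rw [ContinuousLinearMap.comp_id] at h2
        exact h2
      rw [this.fderiv]
    have hibp := m.integral_inner_fderiv hψs hψsc (hψsW.trans hWΩ) i
    have h1 : ∫ x, inner ℝ (fderiv ℝ ψ (x - (s * t) • bz i) (-(t • bz i))) (M x) =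
        t * ∫ x in W, inner ℝ (ψs x) (m.pd i x) := by
      have h2 : ∀ x, (inner ℝ (fderiv ℝ ψ (x - (s * t) • bz i) (-(t • bz i))) (M x) : ℝ) =
          Ω.indicator (fun x => -t * inner ℝ (fderiv ℝ ψs x (bz i)) (m.toFun x)) x := by
        intro x
        by_cases hx : x ∈ Ω
        · rw [Set.indicator_of_mem hx, hfd]
          simp only [M]
          rw [Set.indicator_of_mem hx, map_neg, map_smul, inner_neg_left, real_inner_smul_left]
          ring
        · rw [Set.indicator_of_notMem hx]
          simp only [M]
          rw [Set.indicator_of_notMem hx, inner_zero_right]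
      simp_rw [h2]
      rw [integral_indicator hΩm, integral_const_mul, hibp]
      have h3 : ∫ x in Ω, inner ℝ (ψs x) (m.pd i x) = ∫ x in W, inner ℝ (ψs x) (m.pd i x) := by
        refine setIntegral_eq_of_subset_of_forall_sdiff_eq_zero hΩm hWΩ' fun x hx => ?_
        rw [image_eq_zero_of_notMem_tsupport fun h => hx.2 (hψsW h), inner_zero_left]
      rw [h3]; ring
    have hψs2 : MemLp ψs 2 (volume.restrict W) :=
      (hψs.continuous.memLp_of_hasCompactSupport hψsc).restrict W
    rw [h1, norm_mul, Real.norm_eq_abs, mul_assoc, ← MemLp.inner_toLp hψs2 hpdW]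
    refine mul_le_mul_of_nonneg_left ?_ (abs_nonneg t)
    refine (norm_inner_le_norm _ _).trans ?_
    rw [mul_comm]
    refine mul_le_mul_of_nonneg_left ?_ (norm_nonneg _)
    refine MemLp.norm_toLp_le_norm_toLp _ _ ?_
    calc ∫⁻ x in W, ‖ψs x‖ₑ ^ 2 ≤ ∫⁻ x, ‖ψs x‖ₑ ^ 2 := setLIntegral_le_lintegral _ _
      _ = ∫⁻ x, ‖ψ x‖ₑ ^ 2 := lintegral_sub_right_eq_self (fun x => ‖ψ x‖ₑ ^ 2) _
      _ = ∫⁻ x in U, ‖ψ x‖ₑ ^ 2 := by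
        rw [← lintegral_indicator hU.measurableSet]
        refine lintegral_congr fun x => ?_
        by_cases hx : x ∈ U
        · rw [Set.indicator_of_mem hx]
        · rw [Set.indicator_of_notMem hx, image_eq_zero_of_notMem_tsupport fun h => hx (hψU h)]
          simp
  have hmv := (convex_Icc (0 : ℝ) 1).norm_image_sub_le_of_norm_hasDerivWithin_le
    (fun s hs => (hderiv s).hasDerivWithinAt) hbound (Set.left_mem_Icc.2 zero_le_one)
    (Set.right_mem_Icc.2 zero_le_one)
  rw [sub_zero, norm_one, mul_one] at hmv
  refine le_trans (le_of_eq ?_) ((Real.le_norm_self _).trans hmv)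
  have e0 : F 0 = ∫ x in U, inner ℝ (ψ x) (m.toFun x) := by
    simp only [F, zero_mul, zero_smul, sub_zero]
    rw [← setIntegral_eq_integral_of_forall_compl_eq_zero (s := U)]
    · refine setIntegral_congr_fun hU.measurableSet fun x hx => ?_
      simp only [M]
      rw [Set.indicator_of_mem (hUΩ hx)]
    · intro x hx
      rw [image_eq_zero_of_notMem_tsupport fun h => hx (hψU h), inner_zero_left]
  have e1 : F 1 = ∫ x in U, inner ℝ (ψ x) (m.toFun (x + t • bz i)) := by
    simp only [F, one_mul]
    rw [← integral_add_right_eq_self _ (t • bz i)]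
    simp only [add_sub_cancel_right]
    rw [← setIntegral_eq_integral_of_forall_compl_eq_zero (s := U)]
    · refine setIntegral_congr_fun hU.measurableSet fun x hx => ?_
      simp only [M]
      rw [Set.indicator_of_mem (hWΩ' (hU1 x hx))]
    · intro x hx
      rw [image_eq_zero_of_notMem_tsupport fun h => hx (hψU h), inner_zero_left]
  rw [e0, e1, ← integral_sub (MemLp.integrable_inner_two (hψ2.restrict U) hmtU)
    (MemLp.integrable_inner_two (hψ2.restrict U) hmU)]
  exact integral_congr_ae (Eventually.of_forall fun x => by simp only [inner_sub_right])

/-! ### Lattice fields as piecewise constant functions -/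

theorem finite_cell_image {h : ℝ} (hh : 0 < h) {K : Set E3} (hK : Bornology.IsBounded K) :
    (cell h '' K).Finite := by
  obtain ⟨R, hR⟩ := hK.exists_norm_le
  obtain ⟨B, hB⟩ := exists_nat_ge (R / h + 1)
  refine (Set.finite_Icc (fun _ => -(B : ℤ)) (fun _ => (B : ℤ))).subset ?_
  rintro _ ⟨x, hx, rfl⟩
  have h1 : ∀ i, |x i / h| ≤ R / h := fun i => by
    rw [abs_div, abs_of_pos hh]
    exact div_le_div_of_nonneg_right ((abs_apply_le_norm x i).trans (hR x hx)) hh.le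
  constructor <;> intro i
  · have := (abs_le.1 (h1 i)).1
    exact Int.le_floor.2 (by push_cast; linarith)
  · have := (abs_le.1 (h1 i)).2
    have h2 := Int.floor_le (x i / h)
    have h3 : ((⌊x i / h⌋ : ℤ) : ℝ) ≤ (B : ℤ) := by push_cast; linarith
    exact_mod_cast h3

theorem memLp_comp_cell {h : ℝ} (hh : 0 < h) {K : Set E3} (hK : Bornology.IsBounded K)
    (hKm : MeasurableSet K) (F : (Fin 3 → ℤ) → E3) {p : ℝ≥0∞} :
    MemLp (fun x => F (cell h x)) p (volume.restrict K) := by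
  have : IsFiniteMeasure (volume.restrict K) := ⟨by simpa using hK.measure_lt_top⟩
  obtain ⟨C, hC⟩ := ((finite_cell_image hh hK).image fun k => ‖F k‖).bddAbove
  refine MemLp.of_bound (measurable_comp_cell h F).aestronglyMeasurable C ?_
  filter_upwards [ae_restrict_mem hKm] with x hx
  exact hC ⟨_, ⟨x, hx, rfl⟩, rfl⟩

theorem memLp_dq {h : ℝ} (hh : 0 < h) {K : Set E3} (hK : Bornology.IsBounded K)
    (hKm : MeasurableSet K) (u : (Fin 3 → ℤ) → E3) (i : Fin 3) :
    MemLp (dq h u i) 2 (volume.restrict K) :=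
  memLp_comp_cell hh hK hKm fun k => h⁻¹ • (u (k + stp i) - u k)

theorem cellError_cell {h : ℝ} (hh : 0 < h) (u : (Fin 3 → ℤ) → E3) (q : Fin 3 → E3) (x : E3) :
    cellError h u q (cell h x) =
      ∑ b ∈ Finset.Icc (0 : Fin 3 → ℤ) 1, ∑ i, ‖dq h u i (x + pt h b) - q i‖ := by
  simp only [cellError, dq, cell_add_pt hh]

theorem card_Icc_zero_one : (Finset.Icc (0 : Fin 3 → ℤ) 1).card = 8 := by
  rw [Pi.card_Icc]; simp

/-- Cauchy–Schwarz for the 8 · 3 = 24 terms of the sum. -/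
theorem ofReal_cellError_sq_le {h : ℝ} (hh : 0 < h) (u : (Fin 3 → ℤ) → E3) (q : Fin 3 → E3)
    (x : E3) : ENNReal.ofReal (cellError h u q (cell h x)) ^ 2 ≤
      24 * ∑ b ∈ Finset.Icc (0 : Fin 3 → ℤ) 1, ∑ i, ‖dq h u i (x + pt h b) - q i‖ₑ ^ 2 := by
  rw [cellError_cell hh, ENNReal.ofReal_sum_of_nonneg
    fun _ _ => Finset.sum_nonneg fun _ _ => norm_nonneg _]
  refine (ennreal_sum_sq_le _ _).trans ?_
  rw [card_Icc_zero_one, Finset.mul_sum, Finset.mul_sum]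
  refine Finset.sum_le_sum fun b _ => ?_
  rw [ENNReal.ofReal_sum_of_nonneg fun _ _ => norm_nonneg _]
  simp_rw [ofReal_norm]
  calc (8 : ℕ) * (∑ i, ‖dq h u i (x + pt h b) - q i‖ₑ) ^ 2
      ≤ (8 : ℕ) * ((3 : ℕ) * ∑ i, ‖dq h u i (x + pt h b) - q i‖ₑ ^ 2) := by
        gcongr
        simpa using ennreal_sum_sq_le Finset.univ fun i => ‖dq h u i (x + pt h b) - q i‖ₑ
    _ = 24 * ∑ i, ‖dq h u i (x + pt h b) - q i‖ₑ ^ 2 := by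
        rw [← mul_assoc]; norm_num

theorem norm_pt_le {h : ℝ} (hh : 0 < h) {b : Fin 3 → ℤ}
    (hb : b ∈ Finset.Icc (0 : Fin 3 → ℤ) 1) : ‖pt h b‖ ≤ 2 * h := by
  refine norm_le_of_forall_abs_le fun i => ?_
  rw [Finset.mem_Icc] at hb
  have h1 : (0 : ℤ) ≤ b i := hb.1 i
  have h2 : b i ≤ 1 := hb.2 i
  have h3 : (0 : ℝ) ≤ b i := by exact_mod_cast h1
  have h4 : (b i : ℝ) ≤ 1 := by exact_mod_cast h2
  rw [pt_apply, abs_of_nonneg (by positivity)]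
  nlinarith

theorem setLIntegral_add_right {S : Set E3} (hS : MeasurableSet S) (f : E3 → ℝ≥0∞) (v : E3) :
    ∫⁻ x in S, f (x + v) = ∫⁻ x in (fun x => x - v) ⁻¹' S, f x := by
  rw [← lintegral_indicator hS, ← lintegral_indicator (hS.preimage (measurable_sub_const v)),
    ← lintegral_sub_right_eq_self _ v]
  refine lintegral_congr fun x => ?_
  by_cases hx : x - v ∈ S
  · rw [Set.indicator_of_mem hx,
      Set.indicator_of_mem (show x ∈ (fun x => x - v) ⁻¹' S from hx), sub_add_cancel]
  · rw [Set.indicator_of_notMem hx,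
      Set.indicator_of_notMem (show x ∉ (fun x => x - v) ⁻¹' S from hx)]

section Corner

variable {a : ℝ} {Ω : Set E3} {n : ℕ+} {μ : SpinField a Ω n} {u : (Fin 3 → ℤ) → E3}

/-- The difference quotients are controlled by the gradient of the interpolant in the corner
tetrahedra. -/
theorem setLIntegral_dq_sq_le (ha : 0 < a) (hu : ∀ x : Node a Ω n, u x.1 = μ x)
    {S : Set E3} (hSm : MeasurableSet S)
    (hS : ∀ x ∈ S, Metric.closedBall x (8 * (a / ((n : ℕ) : ℝ))) ⊆ Ω) (i : Fin 3) :
    ∫⁻ x in S, ‖dq (a / ((n : ℕ) : ℝ)) u i x‖ₑ ^ 2 ≤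
      64 * ∫⁻ x in Ω, ‖interpPartial a Ω n μ i x‖ₑ ^ 2 := by
  have hh : 0 < a / ((n : ℕ) : ℝ) := div_pos ha (by exact_mod_cast n.pos)
  set h := a / ((n : ℕ) : ℝ)
  set J : Set (Fin 3 → ℤ) := cell h '' S
  -- Two points of the same cell are at distance at most 4h, and 4h + 2h is within the margin 8h. So
  -- the whole cell of every point of S is well inside Ω.
  have hball : ∀ k ∈ J, ∀ y, cell h y = k → Metric.closedBall y (2 * h) ⊆ Ω := by
    rintro _ ⟨x, hx, rfl⟩ y hy
    refine (Metric.closedBall_subset_closedBall' ?_).trans (hS x hx)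
    have h1 := dist_pt_cell_le hh x
    have h2 := dist_pt_cell_le hh y
    rw [hy] at h2
    have := dist_triangle_right y x (pt h (cell h x))
    linarith
  have h1 : ∫⁻ x in S, ‖dq h u i x‖ₑ ^ 2 ≤
      ∫⁻ x, J.indicator (fun k => ‖gq h u i k‖ₑ ^ 2) (cell h x) := by
    rw [← lintegral_indicator hSm]
    refine lintegral_mono fun x => ?_
    by_cases hx : x ∈ S
    · rw [Set.indicator_of_mem hx, Set.indicator_of_mem (show cell h x ∈ J from ⟨x, hx, rfl⟩)]
      exact le_rfl
    · rw [Set.indicator_of_notMem hx]; exact zero_le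
  refine h1.trans ?_
  rw [lintegral_cell hh, ← tsum_subtype, ← ENNReal.tsum_mul_left]
  -- The box `nearBox` fills the fraction 1/64 of the cell, and on it the derivative of the
  -- interpolant is the difference quotient of the cell.
  have h2 : ∀ k : J, ENNReal.ofReal (h ^ 3) * ‖gq h u i k‖ₑ ^ 2 =
      64 * ∫⁻ x in nearBox h k i, ‖interpPartial a Ω n μ i x‖ₑ ^ 2 := by
    intro k
    have : ∫⁻ x in nearBox h k i, ‖interpPartial a Ω n μ i x‖ₑ ^ 2 =
        ∫⁻ x in nearBox h k i, ‖gq h u i k‖ₑ ^ 2 := by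
      refine setLIntegral_congr_fun (measurableSet_nearBox h k i) fun x hx => ?_
      rw [interpPartial_eq_of_mem_nearBox ha hu
        (hball k k.2 x (nearBox_subset_cell hh _ _ hx)) hx]
    rw [this, setLIntegral_const, volume_nearBox hh, mul_comm (‖gq h u i k‖ₑ ^ 2), ← mul_assoc]
    congr 1
    rw [show (64 : ℝ≥0∞) = ENNReal.ofReal 64 by norm_num, ← ENNReal.ofReal_mul (by norm_num)]
    congr 1; ring
  simp_rw [h2]
  rw [ENNReal.tsum_mul_left]
  gcongr
  rw [← lintegral_iUnion (fun k : J => measurableSet_nearBox h k i)]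
  · refine lintegral_mono_set (Set.iUnion_subset fun k x hx => ?_)
    exact hball k k.2 x (nearBox_subset_cell hh _ _ hx) (Metric.mem_closedBall_self (by positivity))
  · intro k l hkl
    refine Set.disjoint_left.2 fun x hx hx' => hkl (Subtype.ext ?_)
    exact (nearBox_subset_cell hh _ _ hx : cell h x = k).symm.trans
      (nearBox_subset_cell hh _ _ hx')

/-- The interpolant is close to the piecewise constant function. -/
theorem setLIntegral_interp_sub_sq_le (ha : 0 < a) (hu : ∀ x : Node a Ω n, u x.1 = μ x)
    {S : Set E3} (hSm : MeasurableSet S)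
    (hS : ∀ x ∈ S, Metric.closedBall x (10 * (a / ((n : ℕ) : ℝ))) ⊆ Ω) :
    ∫⁻ x in S, ‖interp a Ω n μ x - u (cell (a / ((n : ℕ) : ℝ)) x)‖ₑ ^ 2 ≤
      ENNReal.ofReal ((a / ((n : ℕ) : ℝ)) ^ 2) *
        (110592 * ∑ i, ∫⁻ x in Ω, ‖interpPartial a Ω n μ i x‖ₑ ^ 2) := by
  have hh : 0 < a / ((n : ℕ) : ℝ) := div_pos ha (by exact_mod_cast n.pos)
  set h := a / ((n : ℕ) : ℝ) with hdef
  -- Here 216 = 3² · 24. The final constant is 216 · 8 · 64 = 110592, with 8 upper neighbours of a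
  -- cell and the 64 of `setLIntegral_dq_sq_le`.
  have h1 : ∀ᵐ x ∂(volume.restrict S), ‖interp a Ω n μ x - u (cell h x)‖ₑ ^ 2 ≤
      ENNReal.ofReal (h ^ 2) * (216 *
        ∑ b ∈ Finset.Icc (0 : Fin 3 → ℤ) 1, ∑ i, ‖dq h u i (x + pt h b)‖ₑ ^ 2) := by
    filter_upwards [ae_restrict_of_ae (ae_offFaces h), ae_restrict_mem hSm] with x hx hxS
    have hex := exists_isElementAt (n := n) ha
      ((Metric.closedBall_subset_closedBall (by linarith)).trans (hS x hxS))
    have h2 := norm_interp_sub_le ha hu hx hex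
    have h3 : ‖interp a Ω n μ x - u (cell h x)‖ₑ ≤
        ENNReal.ofReal (3 * h) * ENNReal.ofReal (cellError h u 0 (cell h x)) := by
      rw [← ofReal_norm, ← ENNReal.ofReal_mul (by positivity), mul_assoc]
      exact ENNReal.ofReal_le_ofReal h2
    refine (pow_le_pow_left₀ zero_le h3 2).trans ?_
    rw [mul_pow]
    refine (mul_le_mul_right (ofReal_cellError_sq_le hh u 0 x) _).trans_eq ?_
    simp only [Pi.zero_apply, sub_zero]
    rw [← ENNReal.ofReal_pow (by positivity), mul_pow, ENNReal.ofReal_mul (by positivity),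
      ← mul_assoc, ← mul_assoc, mul_comm (ENNReal.ofReal (3 ^ 2)), mul_assoc (ENNReal.ofReal _)]
    norm_num
  have hmeas : ∀ b i, Measurable fun x => ‖dq h u i (x + pt h b)‖ₑ ^ 2 := fun b i =>
    ((measurable_dq h u i).comp (measurable_add_const _)).enorm.pow_const 2
  refine (lintegral_mono_ae h1).trans ?_
  rw [lintegral_const_mul' _ _ ENNReal.ofReal_ne_top, lintegral_const_mul' _ _ (by norm_num),
    lintegral_finsetSum _ fun b _ => Finset.measurable_fun_sum _ fun i _ => hmeas b i]
  refine mul_le_mul_right ?_ _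
  calc 216 * ∑ b ∈ Finset.Icc (0 : Fin 3 → ℤ) 1,
        ∫⁻ x in S, ∑ i, ‖dq h u i (x + pt h b)‖ₑ ^ 2
      ≤ 216 * ∑ b ∈ Finset.Icc (0 : Fin 3 → ℤ) 1,
        ∑ i, 64 * ∫⁻ x in Ω, ‖interpPartial a Ω n μ i x‖ₑ ^ 2 := by
        gcongr with b hb
        rw [lintegral_finsetSum _ fun i _ => hmeas b i]
        gcongr with i _
        rw [setLIntegral_add_right hSm (fun x => ‖dq h u i x‖ₑ ^ 2)]
        refine setLIntegral_dq_sq_le ha hu (hSm.preimage (measurable_sub_const _)) ?_ i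
        intro x hx
        refine (Metric.closedBall_subset_closedBall' ?_).trans (hS _ hx)
        rw [dist_eq_norm, sub_sub_cancel]
        linarith [norm_pt_le hh hb]
    _ = 110592 * ∑ i, ∫⁻ x in Ω, ‖interpPartial a Ω n μ i x‖ₑ ^ 2 := by
        rw [Finset.sum_const, card_Icc_zero_one, ← Finset.mul_sum, nsmul_eq_mul, ← mul_assoc,
          ← mul_assoc]
        norm_num

end Corner

/-- A lattice field extended by zero off the nodes in `Ω`. -/
noncomputable def extendField {a : ℝ} {Ω : Set E3} {n : ℕ+} (μ : SpinField a Ω n) :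
    (Fin 3 → ℤ) → E3 :=
  open Classical in fun k => if hk : latticePoint a n k ∈ Ω then μ ⟨k, hk⟩ else 0

theorem extendField_node {a : ℝ} {Ω : Set E3} {n : ℕ+} (μ : SpinField a Ω n) (x : Node a Ω n) :
    extendField μ x.1 = μ x := by
  rw [extendField, dif_pos x.2]

theorem tendsto_spacing (a : ℝ) : Tendsto (fun n : ℕ+ => a / ((n : ℕ) : ℝ)) atTop (𝓝 0) := by
  refine (tendsto_const_div_atTop_nhds_zero_nat a).comp ?_
  exact tendsto_atTop_atTop.2 fun b => ⟨b.succPNat, fun n hn => by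
    have : b.succPNat ≤ n := hn
    rw [← PNat.coe_le_coe] at this
    simp at this; omega⟩

/-! ### Weak convergence of difference quotients -/

theorem abs_integral_inner_le {α : Type*} [MeasurableSpace α] {ν : Measure α} {f g : α → E3}
    (hf : MemLp f 2 ν) (hg : MemLp g 2 ν) :
    |∫ x, inner ℝ (f x) (g x) ∂ν| ≤ √(∫ x, ‖f x‖ ^ 2 ∂ν) * √(∫ x, ‖g x‖ ^ 2 ∂ν) := by
  rw [← MemLp.inner_toLp hf hg, ← MemLp.norm_toLp_sq hf, ← MemLp.norm_toLp_sq hg,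
    Real.sqrt_sq (norm_nonneg _), Real.sqrt_sq (norm_nonneg _)]
  exact abs_real_inner_le_norm _ _

theorem integral_sq_le_of_lintegral_le {α : Type*} [MeasurableSpace α] {ν : Measure α} {f : α → E3}
    (hf : MemLp f 2 ν) {C : ℝ} (hC : 0 ≤ C) (h : ∫⁻ x, ‖f x‖ₑ ^ 2 ∂ν ≤ ENNReal.ofReal C) :
    ∫ x, ‖f x‖ ^ 2 ∂ν ≤ C := by
  rwa [← ofReal_integral_norm_sq hf, ENNReal.ofReal_le_ofReal_iff hC] at h

/-- A function whose derivative has Lipschitz constant `L` is close to its first-order expansion. -/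
theorem exists_norm_taylor_le {ψ : E3 → E3} (hψ : ContDiff ℝ ∞ ψ) (hc : HasCompactSupport ψ) :
    ∃ L : ℝ, 0 ≤ L ∧ ∀ x v, ‖ψ (x + v) - ψ x - fderiv ℝ ψ x v‖ ≤ L * ‖v‖ * ‖v‖ := by
  have hd : Differentiable ℝ ψ := hψ.differentiable (by simp)
  obtain ⟨C, hC⟩ := ContDiff.lipschitzWith_of_hasCompactSupport (hc.fderiv ℝ)
    (hψ.fderiv_right (m := 1) (by norm_cast)) one_ne_zero
  refine ⟨C, C.2, fun x v => ?_⟩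
  have h2 := (convex_segment x (x + v)).norm_image_sub_le_of_norm_hasFDerivWithin_le' (f := ψ)
    (f' := fderiv ℝ ψ) (φ := fderiv ℝ ψ x) (C := C * ‖v‖)
    (fun y _ => (hd y).hasFDerivAt.hasFDerivWithinAt)
    (fun y hy => by
      rw [← dist_eq_norm]
      refine (hC.dist_le_mul y x).trans ?_
      refine mul_le_mul_of_nonneg_left ?_ C.2
      rw [segment_eq_image'] at hy
      obtain ⟨θ, hθ, rfl⟩ := hy
      rw [dist_eq_norm, add_sub_cancel_left, add_sub_cancel_left, norm_smul,
        Real.norm_of_nonneg hθ.1]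
      exact mul_le_of_le_one_left (norm_nonneg _) hθ.2)
    (left_mem_segment ℝ _ _) (right_mem_segment ℝ _ _)
  rwa [add_sub_cancel_left] at h2

/-- Summation by parts, for a test function supported well inside `K`. -/
theorem integral_inner_dq {h : ℝ} (hh : 0 < h) (u : (Fin 3 → ℤ) → E3) {ψ : E3 → E3}
    (hψ : Continuous ψ) {K : Set E3} (hK : IsCompact K)
    (hs : ∀ x ∈ tsupport ψ, ∀ y, dist y x ≤ h → y ∈ K) (i : Fin 3) :
    ∫ x in K, inner ℝ (dq h u i x) (ψ x) =
      ∫ x in K, inner ℝ (u (cell h x)) (h⁻¹ • (ψ (x - h • bz i) - ψ x)) := by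
  have hKm := hK.measurableSet
  have hsK : tsupport ψ ⊆ K := fun x hx => hs x hx x (by simpa using hh.le)
  have hc : HasCompactSupport ψ := hK.of_isClosed_subset (isClosed_tsupport _) hsK
  have hψ2 : MemLp ψ 2 volume := hψ.memLp_of_hasCompactSupport hc
  have hψt : MemLp (fun x => ψ (x - h • bz i)) 2 volume :=
    hψ2.comp_measurePreserving (measurePreserving_sub_right volume _)
  have hu : MemLp (fun x => u (cell h x)) 2 (volume.restrict K) :=
    memLp_comp_cell hh hK.isBounded hKm u
  have hut : MemLp (fun x => u (cell h x + stp i)) 2 (volume.restrict K) :=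
    memLp_comp_cell hh hK.isBounded hKm fun k => u (k + stp i)
  have e1 : ∫ x in K, inner ℝ (u (cell h x + stp i)) (ψ x) =
      ∫ x in K, inner ℝ (u (cell h x)) (ψ (x - h • bz i)) := by
    have z1 : ∀ x ∉ K, (inner ℝ (u (cell h x + stp i)) (ψ x) : ℝ) = 0 := by
      intro x hx
      rw [image_eq_zero_of_notMem_tsupport fun h' => hx (hsK h'), inner_zero_right]
    have z2 : ∀ x ∉ K, (inner ℝ (u (cell h x)) (ψ (x - h • bz i)) : ℝ) = 0 := by
      intro x hx
      have : ψ (x - h • bz i) = 0 := by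
        refine image_eq_zero_of_notMem_tsupport fun h' => hx (hs _ h' x ?_)
        rw [dist_eq_norm, sub_sub_cancel, norm_smul, norm_bz, mul_one, Real.norm_of_nonneg hh.le]
      rw [this, inner_zero_right]
    rw [setIntegral_eq_integral_of_forall_compl_eq_zero z1,
      setIntegral_eq_integral_of_forall_compl_eq_zero z2,
      ← integral_sub_right_eq_self _ (h • bz i)]
    refine integral_congr_ae (Eventually.of_forall fun x => ?_)
    simp only
    rw [← cell_add_smul_bz hh, sub_add_cancel]
  simp only [dq, real_inner_smul_left, real_inner_smul_right, inner_sub_left, inner_sub_right]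
  rw [integral_const_mul, integral_const_mul,
    integral_sub (MemLp.integrable_inner_two hut (hψ2.restrict K))
      (MemLp.integrable_inner_two hu (hψ2.restrict K)),
    integral_sub (MemLp.integrable_inner_two hu (hψt.restrict K))
      (MemLp.integrable_inner_two hu (hψ2.restrict K)), e1]

/-- If lattice fields converge weakly to `m`, locally in `Ω`, so do their difference quotients to
the partial derivatives of `m`. -/
theorem SobolevH1.tendsto_inner_dq {Ω : Set E3} (m : SobolevH1 Ω) {h : ℕ+ → ℝ}
    (hh : ∀ n, 0 < h n) (hlim : Tendsto h atTop (𝓝 0)) (u : ℕ+ → (Fin 3 → ℤ) → E3) {K : Set E3}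
    (hΩ : IsCompact Ω) (hK : IsCompact K)
    (hKΩ : K ⊆ Ω) {ψ : E3 → E3} (hψ : ContDiff ℝ ∞ ψ)
    (hψΩ : tsupport ψ ⊆ interior Ω) {δ : ℝ} (hδ : 0 < δ)
    (hs : ∀ x ∈ tsupport ψ, ∀ y, dist y x ≤ δ → y ∈ K) (i : Fin 3) {C : ℝ} (hC : 0 ≤ C)
    (hb : ∀ᶠ n in atTop, ∫⁻ x in K, ‖u n (cell (h n) x)‖ₑ ^ 2 ≤ ENNReal.ofReal C)
    (hconv : Tendsto (fun n => ∫ x in K, inner ℝ (u n (cell (h n) x)) (fderiv ℝ ψ x (bz i)))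
      atTop (𝓝 (∫ x in K, inner ℝ (m.toFun x) (fderiv ℝ ψ x (bz i))))) :
    Tendsto (fun n => ∫ x in K, inner ℝ (dq (h n) (u n) i x) (ψ x)) atTop
      (𝓝 (∫ x in K, inner ℝ (m.pd i x) (ψ x))) := by
  have hKm := hK.measurableSet
  have hsK : tsupport ψ ⊆ K := fun x hx => hs x hx x (by simpa using hδ.le)
  have hc : HasCompactSupport ψ := hK.of_isClosed_subset (isClosed_tsupport _) hsK
  have hfin : IsFiniteMeasure (volume.restrict K) := ⟨by simpa using hK.measure_lt_top⟩
  obtain ⟨L, hL0, hL⟩ := exists_norm_taylor_le hψ hc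
  have hfc : Continuous fun x => fderiv ℝ ψ x (bz i) :=
    (hψ.continuous_fderiv (by simp)).clm_apply continuous_const
  have hfcc : HasCompactSupport fun x => fderiv ℝ ψ x (bz i) :=
    (hc.fderiv ℝ).comp_left (g := fun L : E3 →L[ℝ] E3 => L (bz i)) (by simp)
  have hfs : ∀ x, x ∉ K → fderiv ℝ ψ x (bz i) = 0 := by
    intro x hx
    have : fderiv ℝ ψ x = 0 :=
      image_eq_zero_of_notMem_tsupport fun h' => hx (hsK (tsupport_fderiv_subset ℝ h'))
    rw [this]; rfl
  have hf2 : MemLp (fun x => fderiv ℝ ψ x (bz i)) 2 (volume.restrict K) :=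
    (hfc.memLp_of_hasCompactSupport hfcc).restrict K
  have hu : ∀ n, MemLp (fun x => u n (cell (h n) x)) 2 (volume.restrict K) := fun n =>
    memLp_comp_cell (hh n) hK.isBounded hKm (u n)
  have elim : ∫ x in K, inner ℝ (m.pd i x) (ψ x) =
      -∫ x in K, inner ℝ (m.toFun x) (fderiv ℝ ψ x (bz i)) := by
    have e := m.integral_inner_fderiv hψ hc hψΩ i
    have e1 : ∫ x in Ω, inner ℝ (ψ x) (m.pd i x) = ∫ x in K, inner ℝ (m.pd i x) (ψ x) := by
      simp_rw [fun x => real_inner_comm (m.pd i x) (ψ x)]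
      refine setIntegral_eq_of_subset_of_forall_sdiff_eq_zero hΩ.measurableSet hKΩ fun x hx => ?_
      rw [image_eq_zero_of_notMem_tsupport fun h' => hx.2 (hsK h'), inner_zero_right]
    have e2 : ∫ x in Ω, inner ℝ (fderiv ℝ ψ x (bz i)) (m.toFun x) =
        ∫ x in K, inner ℝ (m.toFun x) (fderiv ℝ ψ x (bz i)) := by
      simp_rw [fun x => real_inner_comm (m.toFun x) (fderiv ℝ ψ x (bz i))]
      refine setIntegral_eq_of_subset_of_forall_sdiff_eq_zero hΩ.measurableSet hKΩ fun x hx => ?_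
      rw [hfs x hx.2, inner_zero_right]
    rw [← e1, ← e2, e, neg_neg]
  -- The backward difference quotient of ψ is -∂ᵢψ + R, with R = O(h) uniformly by the second-order
  -- remainder.
  let R : ℕ+ → E3 → E3 := fun n x =>
    (h n)⁻¹ • (ψ (x - h n • bz i) - ψ x) + fderiv ℝ ψ x (bz i)
  have hRc : ∀ n, Continuous (R n) := fun n => by
    have := hψ.continuous
    fun_prop
  have hRb : ∀ n x, ‖R n x‖ ≤ L * h n := by
    intro n x
    have h1 := hL x (-(h n • bz i))
    have hn := hh n
    have h2 : R n x = (h n)⁻¹ •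
        (ψ (x + -(h n • bz i)) - ψ x - fderiv ℝ ψ x (-(h n • bz i))) := by
      simp only [R]
      rw [map_neg, map_smul, sub_neg_eq_add, smul_add, smul_smul, inv_mul_cancel₀ hn.ne', one_smul,
        ← sub_eq_add_neg]
    rw [norm_neg, norm_smul, norm_bz, mul_one, Real.norm_of_nonneg hn.le] at h1
    rw [h2, norm_smul, norm_inv, Real.norm_of_nonneg hn.le, inv_mul_le_iff₀ hn]
    linarith
  have hR2 : ∀ n, MemLp (R n) 2 (volume.restrict K) := fun n =>
    MemLp.of_bound (hRc n).aestronglyMeasurable _ (Eventually.of_forall (hRb n))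
  have hRi : ∀ n, ∫ x in K, ‖R n x‖ ^ 2 ≤ (L * h n) ^ 2 * volume.real K := by
    intro n
    have := norm_setIntegral_le_of_norm_le_const (μ := volume) (s := K) (f := fun x => ‖R n x‖ ^ 2)
      (C := (L * h n) ^ 2) hK.measure_lt_top (fun x _ => by
        rw [Real.norm_of_nonneg (by positivity)]
        exact pow_le_pow_left₀ (norm_nonneg _) (hRb n x) 2)
    exact (Real.le_norm_self _).trans this
  -- The fields are bounded in L²(K) and R tends to zero uniformly, so the remainder contributes
  -- nothing in the limit.
  have herr : Tendsto (fun n => ∫ x in K, inner ℝ (u n (cell (h n) x)) (R n x)) atTop (𝓝 0) := by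
    rw [tendsto_zero_iff_abs_tendsto_zero]
    have hz : Tendsto (fun n => √C * √((L * h n) ^ 2 * volume.real K)) atTop (𝓝 0) := by
      have : Tendsto (fun n => √C * √((L * h n) ^ 2 * volume.real K)) atTop
          (𝓝 (√C * √((L * 0) ^ 2 * volume.real K))) :=
        (((hlim.const_mul L).pow 2).mul_const _).sqrt.const_mul _
      simpa using this
    refine squeeze_zero' (Eventually.of_forall fun n => abs_nonneg _) ?_ hz
    filter_upwards [hb] with n hn
    refine (abs_integral_inner_le (hu n) (hR2 n)).trans ?_
    gcongr
    · exact integral_sq_le_of_lintegral_le (hu n) hC hn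
    · exact hRi n
  have hsum := (hconv.neg).add herr
  rw [add_zero, ← elim] at hsum
  refine hsum.congr' ?_
  filter_upwards [hlim.eventually_le_const hδ] with n hn
  rw [integral_inner_dq (hh n) (u n) hψ.continuous hK
    (fun x hx y hy => hs x hx y (hy.trans hn)) i, neg_add_eq_iff_eq_add]
  have : ∀ x, (inner ℝ (u n (cell (h n) x)) (R n x) : ℝ) =
      inner ℝ (u n (cell (h n) x)) ((h n)⁻¹ • (ψ (x - h n • bz i) - ψ x)) +
        inner ℝ (u n (cell (h n) x)) (fderiv ℝ ψ x (bz i)) := fun x => by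
    simp only [R, inner_add_right]
  have hq2 : MemLp (fun x => (h n)⁻¹ • (ψ (x - h n • bz i) - ψ x)) 2 (volume.restrict K) := by
    have : (fun x => (h n)⁻¹ • (ψ (x - h n • bz i) - ψ x)) =
        fun x => R n x - fderiv ℝ ψ x (bz i) := by
      ext1 x; simp only [R, add_sub_cancel_right]
    rw [this]
    exact (hR2 n).sub hf2
  simp_rw [this]
  rw [integral_add (MemLp.integrable_inner_two (hu n) hq2)
    (MemLp.integrable_inner_two (hu n) hf2), add_comm]

/-! ### The lower bound -/

theorem exists_closedBall_subset {K Ω : Set E3} (hK : IsCompact K) (hKΩ : K ⊆ interior Ω) :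
    ∃ δ > 0, ∀ x ∈ K, Metric.closedBall x δ ⊆ interior Ω := by
  obtain ⟨δ, hδ, h⟩ := hK.exists_cthickening_subset_open isOpen_interior hKΩ
  exact ⟨δ, hδ, fun x hx => (Metric.closedBall_subset_cthickening hx δ).trans h⟩

theorem spacing_pos {a : ℝ} (ha : 0 < a) (n : ℕ+) : 0 < a / ((n : ℕ) : ℝ) :=
  div_pos ha (by exact_mod_cast n.pos)

theorem eventually_closedBall_spacing_subset {a : ℝ} {K Ω : Set E3} (hK : IsCompact K)
    (hKΩ : K ⊆ interior Ω) (c : ℝ) :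
    ∀ᶠ n : ℕ+ in atTop, ∀ x ∈ K, Metric.closedBall x (c * (a / ((n : ℕ) : ℝ))) ⊆ Ω := by
  obtain ⟨δ, hδ, h⟩ := exists_closedBall_subset hK hKΩ
  have h1 : Tendsto (fun n : ℕ+ => c * (a / ((n : ℕ) : ℝ))) atTop (𝓝 0) := by
    simpa using (tendsto_spacing a).const_mul c
  filter_upwards [h1.eventually_le_const hδ] with n hn x hx
  exact (Metric.closedBall_subset_closedBall hn).trans ((h x hx).trans interior_subset)

theorem restrict_eq_restrict_interior {Ω : Set E3} (h0 : volume (frontier Ω) = 0) :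
    volume.restrict Ω = volume.restrict (interior Ω) := by
  refine (Measure.restrict_congr_set ?_).symm
  refine LE.le.eventuallyLE interior_subset |>.antisymm ?_
  rw [ae_le_set]
  refine measure_mono_null ?_ h0
  exact fun x hx => ⟨subset_closure hx.1, hx.2⟩

section Converges

variable {a : ℝ} {Ω : Set E3} {μ : ∀ n, SpinField a Ω n} {m : SobolevH1 Ω}

/-- By uniform boundedness, weak convergence alone bounds the gradients of the interpolants; no
bound on the discrete energies is needed. -/
theorem ConvergesTo.exists_bound (ha : 0 < a) (hΩ : IsCompact Ω) (hm : ConvergesTo a Ω μ m) :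
    ∃ C : ℝ, 0 ≤ C ∧ ∀ n, ∫⁻ x in Ω, ‖interp a Ω n (μ n) x‖ₑ ^ 2 ≤ ENNReal.ofReal C ∧
      ∑ i, ∫⁻ x in Ω, ‖interpPartial a Ω n (μ n) i x‖ₑ ^ 2 ≤ ENNReal.ofReal C := by
  obtain ⟨C0, hC0, h0⟩ := exists_bound_of_tendsto_inner (fun n => memLp_interp ha hΩ n (μ n))
    fun g hg => ⟨_, (hm g hg).1⟩
  choose C hC h using fun i => exists_bound_of_tendsto_inner
    (fun n => memLp_interpPartial ha hΩ n (μ n) i) fun g hg => ⟨_, (hm g hg).2 i⟩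
  have hs : 0 ≤ ∑ i, C i := Finset.sum_nonneg fun i _ => hC i
  refine ⟨C0 + ∑ i, C i, by positivity, fun n => ⟨(h0 n).trans ?_, ?_⟩⟩
  · exact ENNReal.ofReal_le_ofReal (by linarith)
  · refine (Finset.sum_le_sum fun i _ => h i n).trans ?_
    rw [← ENNReal.ofReal_sum_of_nonneg fun i _ => hC i]
    exact ENNReal.ofReal_le_ofReal (by linarith)

variable {K : Set E3}

/-- The squared distance is h² times the squared gradients of the interpolants, which stay bounded.
Hence locally the interpolants and the piecewise constant fields have the same limits. -/
theorem ConvergesTo.tendsto_lintegral_sub (ha : 0 < a) (hΩ : IsCompact Ω)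
    (hm : ConvergesTo a Ω μ m) (hK : IsCompact K) (hKΩ : K ⊆ interior Ω) :
    Tendsto (fun n : ℕ+ => ∫⁻ x in K, ‖interp a Ω n (μ n) x -
      extendField (μ n) (cell (a / ((n : ℕ) : ℝ)) x)‖ₑ ^ 2) atTop (𝓝 0) := by
  obtain ⟨C, hC, h⟩ := hm.exists_bound ha hΩ
  have hz : Tendsto (fun n : ℕ+ => ENNReal.ofReal ((a / ((n : ℕ) : ℝ)) ^ 2) *
      (110592 * ENNReal.ofReal C)) atTop (𝓝 0) := by
    have h1 : Tendsto (fun n : ℕ+ => ENNReal.ofReal ((a / ((n : ℕ) : ℝ)) ^ 2)) atTop (𝓝 0) := by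
      have := ENNReal.tendsto_ofReal ((tendsto_spacing a).pow 2)
      simpa using this
    have := ENNReal.Tendsto.mul_const (b := 110592 * ENNReal.ofReal C) h1
      (Or.inr (ENNReal.mul_ne_top (by norm_num) ENNReal.ofReal_ne_top))
    rwa [zero_mul] at this
  refine tendsto_of_tendsto_of_tendsto_of_le_of_le' tendsto_const_nhds hz
    (Eventually.of_forall fun n => zero_le) ?_
  filter_upwards [eventually_closedBall_spacing_subset hK hKΩ 10] with n hn
  refine (setLIntegral_interp_sub_sq_le ha (extendField_node (μ n)) hK.measurableSet hn).trans ?_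
  gcongr
  exact (h n).2

theorem ConvergesTo.eventually_lintegral_cell_le (ha : 0 < a) (hΩ : IsCompact Ω)
    (hm : ConvergesTo a Ω μ m) (hK : IsCompact K) (hKΩ : K ⊆ interior Ω) :
    ∃ C : ℝ, 0 ≤ C ∧ ∀ᶠ n : ℕ+ in atTop,
      ∫⁻ x in K, ‖extendField (μ n) (cell (a / ((n : ℕ) : ℝ)) x)‖ₑ ^ 2 ≤ ENNReal.ofReal C := by
  obtain ⟨C, hC, h⟩ := hm.exists_bound ha hΩ
  refine ⟨2 * C + 2, by positivity, ?_⟩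
  filter_upwards [(hm.tendsto_lintegral_sub ha hΩ hK hKΩ).eventually_le_const
    (show (0 : ℝ≥0∞) < 1 by norm_num)] with n hn
  have hm1 : AEMeasurable (fun x => ‖interp a Ω n (μ n) x‖ₑ ^ 2) (volume.restrict K) :=
    ((memLp_interp ha hΩ n (μ n)).aestronglyMeasurable.enorm.pow_const 2).mono_measure
      (Measure.restrict_mono (hKΩ.trans interior_subset) le_rfl)
  calc ∫⁻ x in K, ‖extendField (μ n) (cell (a / ((n : ℕ) : ℝ)) x)‖ₑ ^ 2
      ≤ ∫⁻ x in K, (2 * ‖interp a Ω n (μ n) x‖ₑ ^ 2 + 2 * ‖interp a Ω n (μ n) x -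
        extendField (μ n) (cell (a / ((n : ℕ) : ℝ)) x)‖ₑ ^ 2) := by
        refine lintegral_mono fun x => ?_
        have := enorm_sq_add_le (interp a Ω n (μ n) x)
          (-(interp a Ω n (μ n) x - extendField (μ n) (cell (a / ((n : ℕ) : ℝ)) x)))
        rw [enorm_neg] at this
        simpa using this
    _ = 2 * (∫⁻ x in K, ‖interp a Ω n (μ n) x‖ₑ ^ 2) + 2 * ∫⁻ x in K, ‖interp a Ω n (μ n) x -
        extendField (μ n) (cell (a / ((n : ℕ) : ℝ)) x)‖ₑ ^ 2 := by
        rw [lintegral_add_left' (hm1.const_mul 2), lintegral_const_mul' _ _ (by norm_num),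
          lintegral_const_mul' _ _ (by norm_num)]
    _ ≤ 2 * ENNReal.ofReal C + 2 * 1 := by
        gcongr
        exact (lintegral_mono_set (hKΩ.trans interior_subset)).trans (h n).1
    _ = ENNReal.ofReal (2 * C + 2) := by
        rw [ENNReal.ofReal_add (by positivity) (by norm_num), ENNReal.ofReal_mul (by norm_num)]
        norm_num

theorem ConvergesTo.tendsto_inner_cell (ha : 0 < a) (hΩ : IsCompact Ω)
    (hm : ConvergesTo a Ω μ m) (hK : IsCompact K) (hKΩ : K ⊆ interior Ω) {g : E3 → E3}
    (hg : MemLp g 2 (volume.restrict K)) :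
    Tendsto (fun n : ℕ+ => ∫ x in K, inner ℝ
      (extendField (μ n) (cell (a / ((n : ℕ) : ℝ)) x)) (g x)) atTop
      (𝓝 (∫ x in K, inner ℝ (m.toFun x) (g x))) := by
  have hKm := hK.measurableSet
  have hK' : K ⊆ Ω := hKΩ.trans interior_subset
  have hgΩ : MemLp (K.indicator g) 2 (volume.restrict Ω) := by
    refine MemLp.restrict Ω ?_
    exact (memLp_indicator_iff_restrict hKm).2 hg
  have hi : ∀ f : E3 → E3, ∫ x in Ω, inner ℝ (f x) (K.indicator g x) =
      ∫ x in K, inner ℝ (f x) (g x) := by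
    intro f
    have : ∀ x, (inner ℝ (f x) (K.indicator g x) : ℝ) =
        K.indicator (fun x => inner ℝ (f x) (g x)) x := by
      intro x
      by_cases hx : x ∈ K
      · rw [Set.indicator_of_mem hx, Set.indicator_of_mem hx]
      · rw [Set.indicator_of_notMem hx, Set.indicator_of_notMem hx, inner_zero_right]
    simp_rw [this]
    rw [integral_indicator hKm, Measure.restrict_restrict hKm, Set.inter_eq_left.2 hK']
  have h1 := (hm _ hgΩ).1
  simp_rw [hi] at h1
  have hP : ∀ n, MemLp (interp a Ω n (μ n)) 2 (volume.restrict K) := fun n =>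
    (memLp_interp ha hΩ n (μ n)).mono_measure (Measure.restrict_mono hK' le_rfl)
  have hu : ∀ n, MemLp (fun x => extendField (μ n) (cell (a / ((n : ℕ) : ℝ)) x)) 2
      (volume.restrict K) := fun n => memLp_comp_cell (spacing_pos ha n) hK.isBounded hKm _
  have herr : Tendsto (fun n : ℕ+ => ∫ x in K, inner ℝ (interp a Ω n (μ n) x -
      extendField (μ n) (cell (a / ((n : ℕ) : ℝ)) x)) (g x)) atTop (𝓝 0) := by
    rw [tendsto_zero_iff_abs_tendsto_zero]
    have h2 : Tendsto (fun n : ℕ+ => √(∫ x in K, ‖interp a Ω n (μ n) x -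
        extendField (μ n) (cell (a / ((n : ℕ) : ℝ)) x)‖ ^ 2) * √(∫ x in K, ‖g x‖ ^ 2))
        atTop (𝓝 0) := by
      have h3 := (ENNReal.tendsto_toReal ENNReal.zero_ne_top).comp
        (hm.tendsto_lintegral_sub ha hΩ hK hKΩ)
      have h4 := (h3.sqrt).mul_const (√(∫ x in K, ‖g x‖ ^ 2))
      simp only [ENNReal.toReal_zero, Real.sqrt_zero, zero_mul] at h4
      refine h4.congr fun n => ?_
      have := ofReal_integral_norm_sq ((hP n).sub (hu n))
      simp only [Pi.sub_apply] at this
      rw [Function.comp_apply, ← this, ENNReal.toReal_ofReal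
        (integral_nonneg fun x => by positivity)]
    exact squeeze_zero (fun n => abs_nonneg _)
      (fun n => abs_integral_inner_le ((hP n).sub (hu n)) hg) h2
  have h5 := h1.sub herr
  rw [sub_zero] at h5
  refine h5.congr fun n => ?_
  have : ∀ x, (inner ℝ (interp a Ω n (μ n) x -
      extendField (μ n) (cell (a / ((n : ℕ) : ℝ)) x)) (g x) : ℝ) =
      inner ℝ (interp a Ω n (μ n) x) (g x) -
      inner ℝ (extendField (μ n) (cell (a / ((n : ℕ) : ℝ)) x)) (g x) := fun x => by
    rw [inner_sub_left]
  simp_rw [this]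
  rw [integral_sub (MemLp.integrable_inner_two (hP n) hg) (MemLp.integrable_inner_two (hu n) hg),
    sub_sub_cancel]

theorem ConvergesTo.tendsto_inner_dq (ha : 0 < a) (hΩ : IsCompact Ω)
    (hm : ConvergesTo a Ω μ m) {ψ : E3 → E3} (hψ : ContDiff ℝ ∞ ψ) (hc : HasCompactSupport ψ)
    (hψΩ : tsupport ψ ⊆ interior Ω) (i : Fin 3) :
    ∃ K, IsCompact K ∧ K ⊆ interior Ω ∧ tsupport ψ ⊆ K ∧ Tendsto (fun n : ℕ+ => ∫ x in K, inner ℝ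
      (dq (a / ((n : ℕ) : ℝ)) (extendField (μ n)) i x) (ψ x)) atTop
      (𝓝 (∫ x in K, inner ℝ (m.pd i x) (ψ x))) := by
  obtain ⟨δ, hδ, hδΩ⟩ := hc.isCompact.exists_cthickening_subset_open isOpen_interior hψΩ
  have hK : IsCompact (Metric.cthickening δ (tsupport ψ)) := hc.isCompact.cthickening
  obtain ⟨C, hC, hb⟩ := hm.eventually_lintegral_cell_le ha hΩ hK hδΩ
  refine ⟨_, hK, hδΩ, Metric.self_subset_cthickening _, ?_⟩
  refine m.tendsto_inner_dq (spacing_pos ha) (tendsto_spacing a) (fun n => extendField (μ n)) hΩ hK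
    (hδΩ.trans interior_subset) hψ hψΩ hδ ?_ i hC hb ?_
  · intro x hx y hy
    exact Metric.closedBall_subset_cthickening hx δ hy
  · refine hm.tendsto_inner_cell ha hΩ hK hδΩ (MemLp.restrict _ ?_)
    exact ((hψ.continuous_fderiv (by simp)).clm_apply continuous_const).memLp_of_hasCompactSupport
      ((hc.fderiv ℝ).comp_left (g := fun L : E3 →L[ℝ] E3 => L (bz i)) (by simp))

/-- The lower bound of Γ-convergence. -/
theorem ConvergesTo.energy_le_liminf {A : ℝ} (ha : 0 < a) (hA : 0 < A) (hΩ : IsCompact Ω)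
    (h0 : volume (frontier Ω) = 0) (hm : ConvergesTo a Ω μ m) :
    (continuumExchangeEnergy A m : EReal) ≤
      liminf (fun n => (discreteExchangeEnergy a A Ω n (μ n) : EReal)) atTop := by
  have hΩi := restrict_eq_restrict_interior h0
  have hpd : ∀ i, MemLp (m.pd i) 2 (volume.restrict (interior Ω)) := fun i => hΩi ▸ m.memLp_pd i
  have key : ∀ ε > 0, ∀ᶠ n in atTop,
      continuumExchangeEnergy A m - ε ≤ discreteExchangeEnergy a A Ω n (μ n) := by
    intro ε hε
    -- Three directions with the factor 2A turn this into a total loss of ε/2, which leaves a strict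
    -- inequality in the limit.
    have hε' : 0 < ε / (12 * A) := by positivity
    choose ψ hψ hψc hψs hψa using fun i => exists_contDiff_approx isOpen_interior (hpd i) hε'
    choose K hK hKΩ hψK hT using fun i => hm.tendsto_inner_dq ha hΩ (hψ i) (hψc i) (hψs i) i
    have hKm := fun i => (hK i).measurableSet
    have hψ2 : ∀ i, MemLp (ψ i) 2 volume := fun i =>
      (hψ i).continuous.memLp_of_hasCompactSupport (hψc i)
    have hsum := tendsto_finsetSum Finset.univ fun i _ =>
      ((hT i).const_mul 2).sub_const (∫ x in K i, ‖ψ i x‖ ^ 2)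
    have hlim : continuumExchangeEnergy A m - ε <
        2 * A * ∑ i, (2 * (∫ x in K i, inner ℝ (m.pd i x) (ψ i x)) - ∫ x in K i, ‖ψ i x‖ ^ 2) := by
      -- The expression 2⟨∂ᵢm, ψ⟩ - |ψ|² equals |∂ᵢm|² - |∂ᵢm - ψ|².
      have h1 : ∀ i, (∫ x in Ω, ‖m.pd i x‖ ^ 2) - ε / (12 * A) ≤
          2 * (∫ x in K i, inner ℝ (m.pd i x) (ψ i x)) - ∫ x in K i, ‖ψ i x‖ ^ 2 := by
        intro i
        have hψi : MemLp (ψ i) 2 (volume.restrict (interior Ω)) := (hψ2 i).restrict _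
        have h2 : ∫ x in interior Ω, ‖m.pd i x - ψ i x‖ ^ 2 ≤ ε / (12 * A) :=
          integral_sq_le_of_lintegral_le ((hpd i).sub hψi) hε'.le (hψa i)
        have h3 : ∫ x in K i, inner ℝ (m.pd i x) (ψ i x) =
            ∫ x in interior Ω, inner ℝ (m.pd i x) (ψ i x) := by
          refine (setIntegral_eq_of_subset_of_forall_sdiff_eq_zero isOpen_interior.measurableSet
            (hKΩ i) fun x hx => ?_).symm
          rw [image_eq_zero_of_notMem_tsupport fun h' => hx.2 (hψK i h'), inner_zero_right]
        have h4 : ∫ x in K i, ‖ψ i x‖ ^ 2 = ∫ x in interior Ω, ‖ψ i x‖ ^ 2 := by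
          refine (setIntegral_eq_of_subset_of_forall_sdiff_eq_zero isOpen_interior.measurableSet
            (hKΩ i) fun x hx => ?_).symm
          rw [image_eq_zero_of_notMem_tsupport fun h' => hx.2 (hψK i h')]
          simp
        have h5 : ∫ x in interior Ω, ‖m.pd i x - ψ i x‖ ^ 2 =
            (∫ x in interior Ω, ‖m.pd i x‖ ^ 2) -
            2 * (∫ x in interior Ω, inner ℝ (m.pd i x) (ψ i x)) +
            ∫ x in interior Ω, ‖ψ i x‖ ^ 2 := by
          simp_rw [norm_sub_sq_real]
          have i1 := (hpd i).norm.integrable_sq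
          have i2 := MemLp.integrable_inner_two (hpd i) hψi
          have i3 := hψi.norm.integrable_sq
          have i4 : Integrable (fun x => ‖m.pd i x‖ ^ 2 - 2 * inner ℝ (m.pd i x) (ψ i x))
              (volume.restrict (interior Ω)) := i1.sub (i2.const_mul 2)
          rw [integral_add i4 i3, integral_sub i1 (i2.const_mul 2), integral_const_mul]
        rw [hΩi, h3, h4]
        linarith
      have h6 : continuumExchangeEnergy A m = 2 * A * ∑ i, ∫ x in Ω, ‖m.pd i x‖ ^ 2 := by
        rw [continuumExchangeEnergy, integral_finsetSum]
        exact fun i _ => (m.memLp_pd i).norm.integrable_sq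
      have h7 := Finset.sum_le_sum fun i (_ : i ∈ Finset.univ) => h1 i
      rw [Finset.sum_sub_distrib] at h7
      simp only [Finset.sum_const, Finset.card_univ, Fintype.card_fin, nsmul_eq_mul] at h7
      have h8 : 2 * A * (3 * (ε / (12 * A))) = ε / 2 := by field_simp; norm_num
      rw [h6]
      have h9 := mul_le_mul_of_nonneg_left h7 (by positivity : 0 ≤ 2 * A)
      rw [mul_sub] at h9
      push_cast at h9
      linarith
    have hev := ((hsum.const_mul (2 * A)).eventually_const_le hlim)
    have hb : ∀ i, ∀ᶠ n : ℕ+ in atTop, ∀ x ∈ K i,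
        Metric.closedBall x (4 * (a / ((n : ℕ) : ℝ))) ⊆ Ω := fun i =>
      eventually_closedBall_spacing_subset (hK i) (hKΩ i) 4
    filter_upwards [hev, eventually_all.2 hb] with n hn hbn
    refine hn.trans ?_
    have hh := spacing_pos ha n
    have e1 := ofReal_discreteExchangeEnergy ha hA hΩ.isBounded n (μ n) _ (extendField_node (μ n))
    rw [← ENNReal.ofReal_le_ofReal_iff (discreteExchangeEnergy_nonneg ha hA n (μ n)), e1,
      ENNReal.ofReal_mul (by positivity)]
    refine mul_le_mul_right ?_ _
    -- Expansion of 0 ≤ |dq - ψ|². The left side is linear in `dq` and passes to the weak limit,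
    -- which gives lower semicontinuity.
    have h10 : ∀ i, 2 * (∫ x in K i, inner ℝ (dq (a / ((n : ℕ) : ℝ)) (extendField (μ n)) i x)
        (ψ i x)) - ∫ x in K i, ‖ψ i x‖ ^ 2 ≤
        ∫ x in K i, ‖dq (a / ((n : ℕ) : ℝ)) (extendField (μ n)) i x‖ ^ 2 := by
      intro i
      have d2 : MemLp (dq (a / ((n : ℕ) : ℝ)) (extendField (μ n)) i) 2 (volume.restrict (K i)) :=
        memLp_dq hh (hK i).isBounded (hKm i) _ i
      have hψi : MemLp (ψ i) 2 (volume.restrict (K i)) := (hψ2 i).restrict _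
      have i1 := d2.norm.integrable_sq
      have i2 := MemLp.integrable_inner_two d2 hψi
      have i3 := hψi.norm.integrable_sq
      have h11 : 0 ≤ ∫ x in K i,
          ‖dq (a / ((n : ℕ) : ℝ)) (extendField (μ n)) i x - ψ i x‖ ^ 2 :=
        integral_nonneg fun x => by positivity
      simp_rw [norm_sub_sq_real] at h11
      have i4 : Integrable (fun x => ‖dq (a / ((n : ℕ) : ℝ)) (extendField (μ n)) i x‖ ^ 2 -
          2 * inner ℝ (dq (a / ((n : ℕ) : ℝ)) (extendField (μ n)) i x) (ψ i x))
          (volume.restrict (K i)) := i1.sub (i2.const_mul 2)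
      rw [integral_add i4 i3, integral_sub i1 (i2.const_mul 2), integral_const_mul] at h11
      linarith
    refine (ENNReal.ofReal_le_ofReal (Finset.sum_le_sum fun i _ => h10 i)).trans ?_
    rw [ENNReal.ofReal_sum_of_nonneg fun i _ => integral_nonneg fun x => by positivity]
    refine Finset.sum_le_sum fun i _ => ?_
    rw [ofReal_integral_norm_sq (memLp_dq hh (hK i).isBounded (hKm i) _ i)]
    -- For small h the nodes near K i are all in Ω. So K i lies in `edgeSet`, and the energy
    -- dominates the integral over K i.
    refine lintegral_mono_set fun x hx => ?_
    have h12 := hbn i x hx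
    have h13 := dist_pt_cell_le hh x
    constructor
    · refine h12 ?_
      rw [Metric.mem_closedBall, dist_comm]; linarith
    · refine h12 ?_
      have := dist_pt_add_stp hh (cell (a / ((n : ℕ) : ℝ)) x) i
      have h14 := dist_triangle (pt (a / ((n : ℕ) : ℝ)) (cell (a / ((n : ℕ) : ℝ)) x + stp i))
        (pt (a / ((n : ℕ) : ℝ)) (cell (a / ((n : ℕ) : ℝ)) x)) x
      rw [Metric.mem_closedBall]
      rw [dist_comm x] at h13
      linarith
  refine le_of_forall_lt fun c hc => ?_
  obtain ⟨r, hcr, hr⟩ := EReal.lt_iff_exists_real_btwn.1 hc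
  refine hcr.trans_le (le_liminf_of_le (by isBoundedDefault) ?_)
  have hr' : r < continuumExchangeEnergy A m := by exact_mod_cast hr
  filter_upwards [key (continuumExchangeEnergy A m - r) (by linarith)] with n hn
  rw [sub_sub_cancel] at hn
  exact_mod_cast hn

end Converges

/-! ### Strong local convergence -/

theorem cell_add_mul_smul_bz {h : ℝ} (hh : 0 < h) (x : E3) (i : Fin 3) (l : ℤ) :
    cell h (x + (h * l) • bz i) = cell h x + l • stp i := by
  rw [← cell_add_pt hh]
  congr 2
  ext j
  simp [pt_apply, Pi.single_apply]

theorem exists_cell_add_smul_bz {h t : ℝ} (hh : 0 < h) (ht : 0 ≤ t) (x : E3) (i : Fin 3) :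
    ∃ j : ℕ, j ≤ ⌈t / h⌉₊ ∧ cell h (x + t • bz i) = cell h x + (j : ℤ) • stp i := by
  have h1 : ⌊x i / h⌋ ≤ ⌊(x i + t) / h⌋ := Int.floor_le_floor (by gcongr; linarith)
  obtain ⟨j, hj⟩ := Int.eq_ofNat_of_zero_le (sub_nonneg.2 h1)
  refine ⟨j, ?_, ?_⟩
  · have h2 : ⌊(x i + t) / h⌋ < ⌊x i / h⌋ + ⌈t / h⌉₊ + 1 := by
      rw [Int.floor_lt]
      push_cast
      rw [add_div]
      linarith [Nat.le_ceil (t / h), Int.lt_floor_add_one (x i / h)]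
    omega
  · ext k
    by_cases hk : k = i
    · subst hk
      have h3 : (x + t • bz k) k = x k + t := by simp
      simp only [cell, h3, Pi.add_apply, Pi.smul_apply, Pi.single_eq_same, smul_eq_mul, mul_one]
      omega
    · simp [cell, hk]

/-- A translation by t crosses at most ⌈t/h⌉ faces in direction i. Telescoping over these steps
costs ⌈t/h⌉ h ≤ t + h times the L¹ norm of the quotient; the additional h stems from the rounding
and disappears once h is below the scale of t. -/
theorem setLIntegral_cell_translate_le {h t : ℝ} (hh : 0 < h) (ht : 0 ≤ t)
    (u : (Fin 3 → ℤ) → E3) (i : Fin 3) {U K : Set E3} (hU : MeasurableSet U)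
    (hK : ∀ x ∈ U, ∀ s ∈ Set.Icc 0 (t + h), x + s • bz i ∈ K) :
    ∫⁻ x in U, ‖u (cell h (x + t • bz i)) - u (cell h x)‖ₑ ≤
      ENNReal.ofReal (t + h) * ∫⁻ x in K, ‖dq h u i x‖ₑ := by
  set N := ⌈t / h⌉₊
  have hN : (N : ℝ) * h ≤ t + h := by
    have := Nat.ceil_lt_add_one (div_nonneg ht hh.le)
    have h2 : t / h * h = t := div_mul_cancel₀ _ hh.ne'
    nlinarith
  have hpt : ∀ x, ‖u (cell h (x + t • bz i)) - u (cell h x)‖ₑ ≤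
      ∑ l ∈ Finset.range N, ENNReal.ofReal h * ‖dq h u i (x + (h * (l : ℕ)) • bz i)‖ₑ := by
    intro x
    obtain ⟨j, hj, hc⟩ := exists_cell_add_smul_bz hh ht x i
    have h1 : ∀ l : ℕ, ENNReal.ofReal h * ‖dq h u i (x + (h * (l : ℕ)) • bz i)‖ₑ =
        ‖u (cell h x + ((l + 1 : ℕ) : ℤ) • stp i) - u (cell h x + (l : ℤ) • stp i)‖ₑ := by
      intro l
      have h2 := cell_add_mul_smul_bz hh x i l
      push_cast at h2
      rw [dq, h2, enorm_smul, ← mul_assoc, add_assoc]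
      have h3 : ENNReal.ofReal h * ‖h⁻¹‖ₑ = 1 := by
        rw [Real.enorm_eq_ofReal (inv_nonneg.2 hh.le), ← ENNReal.ofReal_mul hh.le,
          mul_inv_cancel₀ hh.ne', ENNReal.ofReal_one]
      rw [h3, one_mul]
      push_cast
      rw [add_smul, one_smul]
    calc ‖u (cell h (x + t • bz i)) - u (cell h x)‖ₑ
        = ‖∑ l ∈ Finset.range j, (u (cell h x + ((l + 1 : ℕ) : ℤ) • stp i) -
          u (cell h x + (l : ℤ) • stp i))‖ₑ := by
          rw [Finset.sum_range_sub fun l : ℕ => u (cell h x + (l : ℤ) • stp i), hc]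
          simp
      _ ≤ ∑ l ∈ Finset.range j, ENNReal.ofReal h * ‖dq h u i (x + (h * (l : ℕ)) • bz i)‖ₑ := by
          simp_rw [h1]
          exact enorm_sum_le _ _
      _ ≤ _ := Finset.sum_le_sum_of_subset (Finset.range_mono hj)
  have hm : Measurable fun x => ‖dq h u i x‖ₑ := (measurable_dq h u i).enorm
  calc ∫⁻ x in U, ‖u (cell h (x + t • bz i)) - u (cell h x)‖ₑ
      ≤ ∫⁻ x in U, ∑ l ∈ Finset.range N, ENNReal.ofReal h *
        ‖dq h u i (x + (h * (l : ℕ)) • bz i)‖ₑ := lintegral_mono hpt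
    _ = ∑ l ∈ Finset.range N, ENNReal.ofReal h *
        ∫⁻ x in U, ‖dq h u i (x + (h * (l : ℕ)) • bz i)‖ₑ := by
        have hml : ∀ l ∈ Finset.range N, Measurable fun x =>
            ENNReal.ofReal h * ‖dq h u i (x + (h * (l : ℕ)) • bz i)‖ₑ := fun l _ =>
          (hm.comp (measurable_add_const _)).const_mul _
        rw [lintegral_finsetSum _ hml]
        exact Finset.sum_congr rfl fun l _ => lintegral_const_mul' _ _ ENNReal.ofReal_ne_top
    _ ≤ ∑ l ∈ Finset.range N, ENNReal.ofReal h * ∫⁻ x in K, ‖dq h u i x‖ₑ := by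
        refine Finset.sum_le_sum fun l hl => mul_le_mul_right ?_ _
        rw [setLIntegral_add_right hU fun x => ‖dq h u i x‖ₑ]
        refine lintegral_mono_set fun x hx => ?_
        have h1 := hK _ hx (h * (l : ℕ)) ⟨by positivity, ?_⟩
        · simpa using h1
        · have h2 : ((l : ℕ) : ℝ) ≤ N := by exact_mod_cast (Finset.mem_range.1 hl).le
          nlinarith
    _ = ENNReal.ofReal (N * h) * ∫⁻ x in K, ‖dq h u i x‖ₑ := by
        rw [Finset.sum_const, Finset.card_range, nsmul_eq_mul, ← mul_assoc,
          ENNReal.ofReal_mul (by positivity), ENNReal.ofReal_natCast]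
    _ ≤ _ := by gcongr

/-- The cube of side `δ` with lowest corner `0`. -/
def cube (δ : ℝ) : Set E3 := {z | ∀ i, z i ∈ Set.Icc 0 δ}

theorem isCompact_cube (δ : ℝ) : IsCompact (cube δ) := by
  have h : cube δ = (EuclideanSpace.equiv (Fin 3) ℝ) ⁻¹' (Set.univ.pi fun _ => Set.Icc 0 δ) := by
    ext z; simp only [cube, Set.mem_preimage, Set.mem_univ_pi]; rfl
  rw [h]
  exact (EuclideanSpace.equiv (Fin 3) ℝ).toHomeomorph.isCompact_preimage.2
    (isCompact_univ_pi fun _ => isCompact_Icc)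

theorem volume_cube_pos {δ : ℝ} (hδ : 0 < δ) : 0 < volume (cube δ) := by
  have h : (EuclideanSpace.equiv (Fin 3) ℝ) ⁻¹' (Set.univ.pi fun _ => Set.Ioo 0 δ) ⊆ cube δ := by
    intro z hz i
    exact ⟨(hz i trivial).1.le, (hz i trivial).2.le⟩
  refine lt_of_lt_of_le (IsOpen.measure_pos _ ?_ ?_) (measure_mono h)
  · exact (isOpen_set_pi Set.finite_univ fun _ _ => isOpen_Ioo).preimage
      (EuclideanSpace.equiv (Fin 3) ℝ).continuous
  · refine ⟨(EuclideanSpace.equiv (Fin 3) ℝ).symm fun _ => δ / 2, ?_⟩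
    intro i _
    simp [hδ]

theorem norm_le_of_mem_cube {δ : ℝ} {z : E3} (hz : z ∈ cube δ) : ‖z‖ ≤ 2 * δ :=
  norm_le_of_forall_abs_le fun i => by
    rw [abs_of_nonneg (hz i).1]; exact (hz i).2

/-- The translation by z is made along the three axes in turn. The starting points move by at most
2δ ≤ ρ, so each step takes place in the ball of radius 2ρ. -/
theorem setLIntegral_translate_le_of_axes {F : E3 → E3} (hF : Measurable F) {p : E3} {ρ δ : ℝ}
    (hδ : 2 * δ ≤ ρ) {B : ℝ≥0∞} (hB : ∀ i, ∀ t ∈ Set.Icc 0 δ,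
      ∫⁻ x in Metric.ball p (2 * ρ), ‖F (x + t • bz i) - F x‖ₑ ≤ B) {z : E3} (hz : z ∈ cube δ) :
    ∫⁻ x in Metric.ball p ρ, ‖F (x + z) - F x‖ₑ ≤ 3 * B := by
  have hδ0 : 0 ≤ δ := (hz 0).1.trans (hz 0).2
  have hm : ∀ v w : E3, Measurable fun x => ‖F (x + v) - F (x + w)‖ₑ := fun v w =>
    ((hF.comp (measurable_add_const _)).sub (hF.comp (measurable_add_const _))).enorm
  have hstep : ∀ (v : E3) i, ‖v‖ ≤ ρ → ∫⁻ x in Metric.ball p ρ,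
      ‖F (x + (v + z i • bz i)) - F (x + v)‖ₑ ≤ B := by
    intro v i hv
    have h1 : ∀ x, ‖F (x + (v + z i • bz i)) - F (x + v)‖ₑ =
        (fun y => ‖F (y + z i • bz i) - F y‖ₑ) (x + v) := fun x => by simp only [add_assoc]
    simp_rw [h1]
    rw [setLIntegral_add_right Metric.isOpen_ball.measurableSet
      (fun y => ‖F (y + z i • bz i) - F y‖ₑ) v]
    refine (lintegral_mono_set fun x hx => ?_).trans (hB i (z i) (hz i))
    have h2 : dist (x - v) p < ρ := hx
    have h3 := dist_triangle x (x - v) p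
    rw [dist_eq_norm x (x - v), sub_sub_cancel] at h3
    rw [Metric.mem_ball]; linarith
  have hz3 : z = z 0 • bz 0 + z 1 • bz 1 + z 2 • bz 2 := by
    ext j; fin_cases j <;> simp
  have hn : ∀ i, ‖z i • bz i‖ ≤ δ := fun i => by
    rw [norm_smul, norm_bz, mul_one, Real.norm_eq_abs, abs_of_nonneg (hz i).1]
    exact (hz i).2
  have e0 := hstep 0 0 (by simpa using by linarith)
  have e1 := hstep (z 0 • bz 0) 1 ((hn 0).trans (by linarith))
  have e2 := hstep (z 0 • bz 0 + z 1 • bz 1) 2 ((norm_add_le _ _).trans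
    (by linarith [hn 0, hn 1]))
  rw [← hz3] at e2
  simp only [zero_add, add_zero] at e0
  calc ∫⁻ x in Metric.ball p ρ, ‖F (x + z) - F x‖ₑ
      ≤ ∫⁻ x in Metric.ball p ρ, (‖F (x + z 0 • bz 0) - F x‖ₑ +
        (‖F (x + (z 0 • bz 0 + z 1 • bz 1)) - F (x + z 0 • bz 0)‖ₑ +
        ‖F (x + z) - F (x + (z 0 • bz 0 + z 1 • bz 1))‖ₑ)) := by
        refine lintegral_mono fun x => ?_
        have h1 : F (x + z) - F x = (F (x + z 0 • bz 0) - F x) +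
          ((F (x + (z 0 • bz 0 + z 1 • bz 1)) - F (x + z 0 • bz 0)) +
          (F (x + z) - F (x + (z 0 • bz 0 + z 1 • bz 1)))) := by abel
        rw [h1]
        exact (enorm_add_le _ _).trans (by gcongr; exact enorm_add_le _ _)
    _ ≤ B + (B + B) := by
        have m0 : Measurable fun x => ‖F (x + z 0 • bz 0) - F x‖ₑ := by simpa using hm (z 0 • bz 0) 0
        rw [lintegral_add_left m0, lintegral_add_left (hm _ _)]
        gcongr
    _ = 3 * B := by ring

/-- Weak convergence to zero and equicontinuity of translations imply strong convergence. -/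
theorem eventually_lintegral_enorm_le {g : ℕ+ → E3 → E3} (hg : ∀ n, Measurable (g n)) {p : E3}
    {ρ : ℝ} (hg2 : ∀ n, MemLp (g n) 2 (volume.restrict (Metric.closedBall p (2 * ρ))))
    (hbdd : ∃ C : ℝ, ∀ᶠ n in atTop, ∫⁻ x in Metric.closedBall p (2 * ρ), ‖g n x‖ₑ ≤ ENNReal.ofReal C)
    (hw : ∀ S ⊆ Metric.closedBall p (2 * ρ), MeasurableSet S → ∀ v : E3,
      Tendsto (fun n => ∫ x in S, inner ℝ (g n x) v) atTop (𝓝 0))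
    {δ : ℝ} (hδ : 0 < δ) (hδρ : 2 * δ ≤ ρ) {ε : ℝ} (hε : 0 < ε)
    (ht : ∀ᶠ n in atTop, ∀ z ∈ cube δ,
      ∫⁻ x in Metric.ball p ρ, ‖g n (x + z) - g n x‖ₑ ≤ ENNReal.ofReal ε) :
    ∀ᶠ n in atTop, ∫⁻ x in Metric.ball p ρ, ‖g n x‖ₑ ≤ ENNReal.ofReal (2 * ε) := by
  set Z := cube δ
  have hZm : MeasurableSet Z := (isCompact_cube δ).measurableSet
  have hZpos : 0 < volume Z := volume_cube_pos hδ
  have hZfin : volume Z ≠ ⊤ := (isCompact_cube δ).measure_ne_top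
  have hZx : ∀ x ∈ Metric.ball p ρ, ∀ z ∈ Z, x + z ∈ Metric.closedBall p (2 * ρ) := by
    intro x hx z hz
    have h1 := norm_le_of_mem_cube hz
    have h2 := dist_triangle (x + z) x p
    rw [dist_eq_norm (x + z) x, add_sub_cancel_left] at h2
    rw [Metric.mem_ball] at hx
    rw [Metric.mem_closedBall]
    linarith
  obtain ⟨C, hC⟩ := hbdd
  have hgi : ∀ n, IntegrableOn (g n) (Metric.closedBall p (2 * ρ)) := by
    intro n
    have : IsFiniteMeasure (volume.restrict (Metric.closedBall p (2 * ρ))) :=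
      ⟨by rw [Measure.restrict_apply_univ]; exact measure_closedBall_lt_top⟩
    exact (hg2 n).integrable (by norm_num)
  have hpre : ∀ x, (fun z => x + z) ⁻¹' ((fun y => y - x) ⁻¹' Z) = Z := fun x => by
    ext z; simp
  have hgx : ∀ n, ∀ x ∈ Metric.ball p ρ, IntegrableOn (fun z => g n (x + z)) Z := by
    intro n x hx
    have h1 := ((measurePreserving_add_left volume x).integrableOn_comp_preimage
      (MeasurableEquiv.addLeft x).measurableEmbedding (f := g n)
      (s := (fun y => y - x) ⁻¹' Z)).2 ((hgi n).mono_set fun y hy => by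
        have := hZx x hx _ hy; simpa using this)
    rw [hpre] at h1
    exact h1
  -- G n x is the integral of g n over a small cube at x. Weak convergence sends it to zero at every
  -- x, and the L¹ bound makes dominated convergence available.
  set G : ℕ+ → E3 → E3 := fun n x => ∫ z in Z, g n (x + z)
  have hGx : ∀ n x, G n x = ∫ y in (fun y => y - x) ⁻¹' Z, g n y := by
    intro n x
    have h1 := (measurePreserving_add_left volume x).setIntegral_preimage_emb
      (MeasurableEquiv.addLeft x).measurableEmbedding (g n) ((fun y => y - x) ⁻¹' Z)
    rw [hpre] at h1
    exact h1
  have hGm : ∀ n, AEStronglyMeasurable (G n) (volume.restrict (Metric.ball p ρ)) := by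
    intro n
    have : StronglyMeasurable (Function.uncurry fun x z => g n (x + z)) :=
      ((hg n).comp (measurable_fst.add measurable_snd)).stronglyMeasurable
    exact this.integral_prod_right.aestronglyMeasurable
  have hGlim : ∀ x ∈ Metric.ball p ρ, Tendsto (fun n => G n x) atTop (𝓝 0) := by
    intro x hx
    have hsub : (fun y => y - x) ⁻¹' Z ⊆ Metric.closedBall p (2 * ρ) := fun y hy => by
      have := hZx x hx _ hy; simpa using this
    have h1 : ∀ c, Tendsto (fun n => (G n x) c) atTop (𝓝 0) := by
      intro c
      refine (hw _ hsub (hZm.preimage (measurable_sub_const x)) (bz c)).congr fun n => ?_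
      rw [hGx]
      have h2 := integral_inner (𝕜 := ℝ) ((hgi n).mono_set hsub) (bz c)
      simp_rw [real_inner_comm (bz c)] at h2 ⊢
      rw [h2]
      simp [EuclideanSpace.inner_single_left]
    rw [tendsto_zero_iff_norm_tendsto_zero]
    have h3 : Tendsto (fun n => 2 * ∑ c, |(G n x) c|) atTop (𝓝 0) := by
      have := (tendsto_finsetSum Finset.univ fun c _ => (h1 c).abs).const_mul 2
      simpa using this
    refine squeeze_zero (fun n => norm_nonneg _) (fun n => ?_) h3
    exact norm_le_of_forall_abs_le fun c =>
      Finset.single_le_sum (f := fun c => |(G n x) c|) (fun c _ => abs_nonneg _) (Finset.mem_univ c)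
  have hGint : Tendsto (fun n => ∫⁻ x in Metric.ball p ρ, ‖G n x‖ₑ) atTop (𝓝 0) := by
    have h1 := tendsto_lintegral_filter_of_dominated_convergence' (l := atTop)
      (μ := volume.restrict (Metric.ball p ρ)) (F := fun n x => ‖G n x‖ₑ) (f := fun _ => 0)
      (fun _ => ENNReal.ofReal C) (Eventually.of_forall fun n => (hGm n).enorm) ?_ ?_ ?_
    · simpa using h1
    · filter_upwards [hC] with n hn
      filter_upwards [ae_restrict_mem Metric.isOpen_ball.measurableSet] with x hx
      rw [hGx]
      refine (enorm_integral_le_lintegral_enorm _).trans ((lintegral_mono_set fun y hy => ?_).trans hn)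
      have := hZx x hx _ hy
      simpa using this
    · rw [lintegral_const]
      exact ENNReal.mul_ne_top ENNReal.ofReal_ne_top (by
        rw [Measure.restrict_apply_univ]; exact measure_ball_lt_top.ne)
    · filter_upwards [ae_restrict_mem Metric.isOpen_ball.measurableSet] with x hx
      have := (hGlim x hx).enorm
      simpa using this
  have hpos : 0 < volume Z * ENNReal.ofReal ε :=
    ENNReal.mul_pos hZpos.ne' (ENNReal.ofReal_pos.2 hε).ne'
  filter_upwards [ht, hGint.eventually_le_const hpos] with n hn1 hn2
  -- The value g n x differs from its mean over the cube by the mean of the increments g n (x + z) -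
  -- g n x, which are small in L¹ by equicontinuity.
  have hpt : ∀ x ∈ Metric.ball p ρ, volume Z * ‖g n x‖ₑ ≤
      ‖G n x‖ₑ + ∫⁻ z in Z, ‖g n (x + z) - g n x‖ₑ := by
    intro x hx
    have hc : IntegrableOn (fun _ : E3 => g n x) Z := integrableOn_const hZfin
    have h1 : ∫ z in Z, (g n (x + z) - g n x) = G n x - (volume Z).toReal • g n x := by
      rw [integral_sub (hgx n x hx) hc, setIntegral_const]; rfl
    have h2 : (volume Z).toReal • g n x = G n x - ∫ z in Z, (g n (x + z) - g n x) := by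
      rw [h1, sub_sub_cancel]
    have h3 : volume Z * ‖g n x‖ₑ = ‖(volume Z).toReal • g n x‖ₑ := by
      rw [enorm_smul, Real.enorm_eq_ofReal ENNReal.toReal_nonneg, ENNReal.ofReal_toReal hZfin]
    rw [h3, h2]
    exact enorm_sub_le.trans (by gcongr; exact enorm_integral_le_lintegral_enorm _)
  have hmeas : Measurable (Function.uncurry fun x z => ‖g n (x + z) - g n x‖ₑ) :=
    (((hg n).comp (measurable_fst.add measurable_snd)).sub ((hg n).comp measurable_fst)).enorm
  have h4 : volume Z * ∫⁻ x in Metric.ball p ρ, ‖g n x‖ₑ ≤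
      volume Z * ENNReal.ofReal (2 * ε) := by
    calc volume Z * ∫⁻ x in Metric.ball p ρ, ‖g n x‖ₑ
        = ∫⁻ x in Metric.ball p ρ, volume Z * ‖g n x‖ₑ := (lintegral_const_mul' _ _ hZfin).symm
      _ ≤ ∫⁻ x in Metric.ball p ρ, (‖G n x‖ₑ + ∫⁻ z in Z, ‖g n (x + z) - g n x‖ₑ) :=
          setLIntegral_mono' Metric.isOpen_ball.measurableSet hpt
      _ = (∫⁻ x in Metric.ball p ρ, ‖G n x‖ₑ) +
          ∫⁻ z in Z, ∫⁻ x in Metric.ball p ρ, ‖g n (x + z) - g n x‖ₑ := by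
          rw [lintegral_add_left' (hGm n).enorm, lintegral_lintegral_swap hmeas.aemeasurable]
      _ ≤ volume Z * ENNReal.ofReal ε + ∫⁻ z in Z, ENNReal.ofReal ε := by
          exact add_le_add hn2 (setLIntegral_mono' hZm hn1)
      _ = volume Z * ENNReal.ofReal (2 * ε) := by
          rw [setLIntegral_const, two_mul, ENNReal.ofReal_add hε.le hε.le]; ring
  exact (ENNReal.mul_le_mul_iff_right hZpos.ne' hZfin).1 h4

/-- A Sobolev function has a measurable representative, of unit norm everywhere if it has unit norm
almost everywhere. -/
theorem SobolevH1.exists_measurable_rep {Ω : Set E3} (m : SobolevH1 Ω) :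
    ∃ m' : SobolevH1 Ω, Measurable m'.toFun ∧ m'.toFun =ᵐ[volume.restrict Ω] m.toFun ∧
      m'.pd = m.pd ∧ (UnitNorm m → ∀ x, ‖m'.toFun x‖ = 1) := by
  classical
  have hm := m.memLp_toFun.aestronglyMeasurable
  let f₀ : E3 → E3 := hm.mk
  have hf₀ : Measurable f₀ := hm.stronglyMeasurable_mk.measurable
  have hae₀ : f₀ =ᵐ[volume.restrict Ω] m.toFun := hm.ae_eq_mk.symm
  let f : E3 → E3 := if UnitNorm m then fun x => if ‖f₀ x‖ = 1 then f₀ x else bz 0 else f₀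
  have hf : Measurable f := by
    by_cases hu : UnitNorm m
    · simp only [f, if_pos hu]
      exact Measurable.ite (hf₀.norm (measurableSet_singleton 1)) hf₀ measurable_const
    · simpa only [f, if_neg hu] using hf₀
  have hae : f =ᵐ[volume.restrict Ω] m.toFun := by
    by_cases hu : UnitNorm m
    · filter_upwards [hae₀, hu] with x hx h1
      simp only [f, if_pos hu]
      rw [if_pos (by rw [hx, h1]), hx]
    · simpa only [f, if_neg hu] using hae₀
  refine ⟨⟨f, m.pd, m.memLp_toFun.ae_eq hae.symm, m.memLp_pd, fun φ h1 h2 h3 i => ?_⟩, hf, hae, rfl,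
    fun hu x => ?_⟩
  · rw [← m.integral_by_parts φ h1 h2 h3 i]
    refine integral_congr_ae ?_
    filter_upwards [hae] with x hx
    rw [hx]
  · simp only [f, if_pos hu]
    split_ifs with h
    · exact h
    · exact norm_bz 0

theorem ConvergesTo.congr {a : ℝ} {Ω : Set E3} {μ : ∀ n, SpinField a Ω n} {m m' : SobolevH1 Ω}
    (hm : ConvergesTo a Ω μ m) (h : m'.toFun =ᵐ[volume.restrict Ω] m.toFun) (hpd : m'.pd = m.pd) :
    ConvergesTo a Ω μ m' := by
  intro f hf
  rw [hpd]
  refine ⟨?_, (hm f hf).2⟩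
  have : ∫ x in Ω, inner ℝ (m'.toFun x) (f x) = ∫ x in Ω, inner ℝ (m.toFun x) (f x) :=
    integral_congr_ae (by filter_upwards [h] with x hx; rw [hx])
  rw [this]
  exact (hm f hf).1

/-- This passes from L² to L¹ bounds. With s = t, the increments of a Sobolev function over a step t
get an L¹ bound of order t, as both terms then scale alike. -/
theorem enorm_le_add_mul_sq {F : Type*} [NormedAddCommGroup F] (v : F) {s : ℝ} (hs : 0 < s) :
    ‖v‖ₑ ≤ ENNReal.ofReal s + ENNReal.ofReal s⁻¹ * ‖v‖ₑ ^ 2 := by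
  rw [← ofReal_norm, ← ENNReal.ofReal_pow (norm_nonneg _), ← ENNReal.ofReal_mul (by positivity),
    ← ENNReal.ofReal_add hs.le (by positivity)]
  refine ENNReal.ofReal_le_ofReal ?_
  have h1 : s⁻¹ * s = 1 := inv_mul_cancel₀ hs.ne'
  have h2 := mul_nonneg (inv_nonneg.2 hs.le) (sq_nonneg (‖v‖ - s))
  have h3 : s⁻¹ * (‖v‖ - s) ^ 2 = s⁻¹ * ‖v‖ ^ 2 - 2 * (s⁻¹ * s) * ‖v‖ + s⁻¹ * s * s := by ring
  rw [h3, h1] at h2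
  linarith [norm_nonneg v]

theorem SobolevH1.lintegral_sub_le {Ω : Set E3} (hΩ : IsCompact Ω) (m : SobolevH1 Ω) (i : Fin 3)
    {t : ℝ} (ht : 0 ≤ t) {U W : Set E3} (hU : IsOpen U) (hWΩ : W ⊆ interior Ω)
    (hUW : ∀ x ∈ U, ∀ s ∈ Set.Icc (0 : ℝ) 1, x + (s * t) • bz i ∈ W) :
    ∫⁻ x in U, ‖m.toFun (x + t • bz i) - m.toFun x‖ₑ ≤
      ENNReal.ofReal t * (volume U + ∫⁻ x in W, ‖m.pd i x‖ₑ ^ 2) := by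
  rcases ht.eq_or_lt with rfl | ht
  · simp
  calc ∫⁻ x in U, ‖m.toFun (x + t • bz i) - m.toFun x‖ₑ
      ≤ ∫⁻ x in U, (ENNReal.ofReal t + ENNReal.ofReal t⁻¹ *
        ‖m.toFun (x + t • bz i) - m.toFun x‖ₑ ^ 2) :=
        lintegral_mono fun x => enorm_le_add_mul_sq _ ht
    _ = ENNReal.ofReal t * volume U + ENNReal.ofReal t⁻¹ *
        ∫⁻ x in U, ‖m.toFun (x + t • bz i) - m.toFun x‖ₑ ^ 2 := by
        rw [lintegral_add_left measurable_const, setLIntegral_const,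
          lintegral_const_mul' _ _ ENNReal.ofReal_ne_top]
    _ ≤ ENNReal.ofReal t * volume U + ENNReal.ofReal t⁻¹ *
        (ENNReal.ofReal (t ^ 2) * ∫⁻ x in W, ‖m.pd i x‖ₑ ^ 2) := by
        gcongr
        exact m.lintegral_sub_sq_le hΩ i t hU hWΩ hUW
    _ = _ := by
        rw [← mul_assoc, ← ENNReal.ofReal_mul (by positivity), mul_add]
        congr 4
        field_simp

theorem norm_extendField_le_one {a : ℝ} {Ω : Set E3} {n : ℕ+} {μ : SpinField a Ω n}
    (hμ : ∀ x, ‖μ x‖ = 1) (k : Fin 3 → ℤ) : ‖extendField μ k‖ ≤ 1 := by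
  rw [extendField]
  split_ifs with h
  · exact (hμ _).le
  · simp

section

variable {a : ℝ} {Ω : Set E3} {μ : ∀ n, SpinField a Ω n} {m : SobolevH1 Ω}

/-- The difference g between the piecewise constant field and m tends weakly to zero. Its increments
over the small cube are O(δ) in L¹, by the gradient bounds for the interpolants and for m. So g → 0
in L¹ on the ball, and the piecewise constant field has norm one there, the nodes being in Ω. -/
theorem UnitSpins.ae_ball (ha : 0 < a) (hΩ : IsCompact Ω) (hu : UnitSpins a Ω μ)
    (hc : ConvergesTo a Ω μ m) (hmm : Measurable m.toFun) {p : E3} {ρ : ℝ} (hρ : 0 < ρ)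
    (hp : Metric.closedBall p (4 * ρ) ⊆ interior Ω) :
    ∀ᵐ x ∂(volume.restrict (Metric.ball p ρ)), ‖m.toFun x‖ = 1 := by
  set K := Metric.closedBall p (4 * ρ)
  set K2 := Metric.closedBall p (2 * ρ)
  have hK : IsCompact K := isCompact_closedBall _ _
  have hK2 : IsCompact K2 := isCompact_closedBall _ _
  have hK2K : K2 ⊆ K := Metric.closedBall_subset_closedBall (by linarith)
  have hKΩ : K ⊆ Ω := hp.trans interior_subset
  have hVK : volume K ≠ ⊤ := hK.measure_ne_top
  obtain ⟨C, hC, hCb⟩ := hc.exists_bound ha hΩ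
  have hM : ∀ i, ∫⁻ x in K, ‖m.pd i x‖ₑ ^ 2 ≠ ⊤ := fun i =>
    ne_top_of_le_ne_top (MemLp.lintegral_sq_ne_top (m.memLp_pd i)) (lintegral_mono_set hKΩ)
  set D0 : ℝ≥0∞ := volume K + 64 * ENNReal.ofReal C + ∑ i, ∫⁻ x in K, ‖m.pd i x‖ₑ ^ 2
  have hD0 : D0 ≠ ⊤ := by
    refine ENNReal.add_ne_top.2 ⟨ENNReal.add_ne_top.2 ⟨hVK, ?_⟩, ?_⟩
    · exact ENNReal.mul_ne_top (by norm_num) ENNReal.ofReal_ne_top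
    · exact ENNReal.sum_ne_top.2 fun i _ => hM i
  set g : ℕ+ → E3 → E3 := fun n x =>
    extendField (μ n) (cell (a / ((n : ℕ) : ℝ)) x) - m.toFun x
  have hgm : ∀ n, Measurable (g n) := fun n => (measurable_comp_cell _ _).sub hmm
  have hm2 : MemLp m.toFun 2 (volume.restrict K2) :=
    m.memLp_toFun.mono_measure (Measure.restrict_mono (hK2K.trans hKΩ) le_rfl)
  have hu2 : ∀ n : ℕ+, MemLp (fun x => extendField (μ n) (cell (a / ((n : ℕ) : ℝ)) x)) 2
      (volume.restrict K2) := fun n =>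
    memLp_comp_cell (spacing_pos ha n) hK2.isBounded hK2.measurableSet _
  have hfin : IsFiniteMeasure (volume.restrict K2) :=
    ⟨by rw [Measure.restrict_apply_univ]; exact hK2.measure_lt_top⟩
  have hm1 : ∫⁻ x in K2, ‖m.toFun x‖ₑ ≠ ⊤ := (hm2.integrable (by norm_num)).2.ne
  have key : ∀ ε : ℝ, 0 < ε →
      ∫⁻ x in Metric.ball p ρ, ‖‖m.toFun x‖ - 1‖ₑ ≤ ENNReal.ofReal (2 * ε) := by
    intro ε hε
    -- 9δ D0 is three axes times the bound 3δ D0 along one axis; of the 3δ, a part 2δ ≥ t + h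
    -- belongs to the lattice field and δ to m.
    obtain ⟨δ, hδ, hδρ, hδε⟩ : ∃ δ > 0, 2 * δ ≤ ρ ∧ 9 * δ * D0.toReal ≤ ε := by
      have hd : 0 ≤ D0.toReal := ENNReal.toReal_nonneg
      refine ⟨min (ρ / 2) (ε / (9 * (D0.toReal + 1))), by positivity, ?_, ?_⟩
      · linarith [min_le_left (ρ / 2) (ε / (9 * (D0.toReal + 1)))]
      · have h1 := min_le_right (ρ / 2) (ε / (9 * (D0.toReal + 1)))
        have h0 : 0 ≤ min (ρ / 2) (ε / (9 * (D0.toReal + 1))) := by positivity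
        rw [le_div_iff₀ (by positivity)] at h1
        nlinarith
    have hconv := eventually_lintegral_enorm_le (g := g) hgm (p := p) (ρ := ρ)
      (fun n => (hu2 n).sub hm2) ?_ ?_ hδ hδρ hε ?_
    · have hlarge := eventually_closedBall_spacing_subset (a := a) hK hp 2
      obtain ⟨n, hn, hn2⟩ := (hconv.and hlarge).exists
      refine le_trans (setLIntegral_mono' Metric.isOpen_ball.measurableSet fun x hx => ?_) hn
      have hxK : x ∈ K := Metric.ball_subset_closedBall.trans
        (Metric.closedBall_subset_closedBall (by linarith)) hx
      have h1 : pt (a / ((n : ℕ) : ℝ)) (cell (a / ((n : ℕ) : ℝ)) x) ∈ Ω :=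
        hn2 x hxK (by rw [Metric.mem_closedBall, dist_comm]; exact dist_pt_cell_le (spacing_pos ha n) x)
      have h2 : ‖extendField (μ n) (cell (a / ((n : ℕ) : ℝ)) x)‖ = 1 := by
        rw [extendField, dif_pos (show latticePoint a n _ ∈ Ω from h1)]
        exact hu n _
      rw [← h2, ← ofReal_norm, ← ofReal_norm, Real.norm_eq_abs]
      refine ENNReal.ofReal_le_ofReal ((abs_norm_sub_norm_le _ _).trans_eq ?_)
      rw [norm_sub_rev]
    · refine ⟨(volume K2 + ∫⁻ x in K2, ‖m.toFun x‖ₑ).toReal, Eventually.of_forall fun n => ?_⟩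
      rw [ENNReal.ofReal_toReal (ENNReal.add_ne_top.2 ⟨hK2.measure_ne_top, hm1⟩)]
      calc ∫⁻ x in K2, ‖g n x‖ₑ ≤ ∫⁻ x in K2, (1 + ‖m.toFun x‖ₑ) := by
            refine lintegral_mono fun x => enorm_sub_le.trans ?_
            gcongr
            rw [← ofReal_norm, ← ENNReal.ofReal_one]
            exact ENNReal.ofReal_le_ofReal (norm_extendField_le_one (hu n) _)
        _ = _ := by rw [lintegral_add_left measurable_const]; simp
    · intro S hS hSm v
      have hSv : MemLp (S.indicator fun _ => v) 2 (volume.restrict K2) :=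
        (memLp_const v).indicator hSm
      have h1 := hc.tendsto_inner_cell ha hΩ hK2 (hK2K.trans hp) hSv
      have h2 := h1.sub_const (∫ x in K2, inner ℝ (m.toFun x) (S.indicator (fun _ => v) x))
      rw [sub_self] at h2
      refine h2.congr fun n => ?_
      rw [← integral_sub (MemLp.integrable_inner_two (hu2 n) hSv)
        (MemLp.integrable_inner_two hm2 hSv)]
      have h3 : ∀ x, (inner ℝ (extendField (μ n) (cell (a / ((n : ℕ) : ℝ)) x))
          (S.indicator (fun _ => v) x) : ℝ) - inner ℝ (m.toFun x) (S.indicator (fun _ => v) x) =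
          S.indicator (fun x => inner ℝ (g n x) v) x := by
        intro x
        rw [← inner_sub_left]
        by_cases hx : x ∈ S
        · rw [Set.indicator_of_mem hx, Set.indicator_of_mem hx]
        · rw [Set.indicator_of_notMem hx, Set.indicator_of_notMem hx, inner_zero_right]
      simp_rw [h3]
      rw [integral_indicator hSm, Measure.restrict_restrict hSm, Set.inter_eq_left.2 hS]
    · have hlarge := eventually_closedBall_spacing_subset (a := a) hK hp 8
      have hsmall := (tendsto_spacing a).eventually_le_const (show (0 : ℝ) < min δ ρ by positivity)
      filter_upwards [hlarge, hsmall] with n hn hsn z hz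
      have hh := spacing_pos ha n
      set h := a / ((n : ℕ) : ℝ)
      have hhδ : h ≤ δ := hsn.trans (min_le_left _ _)
      have hhρ : h ≤ ρ := hsn.trans (min_le_right _ _)
      have hax : ∀ i, ∀ t ∈ Set.Icc 0 δ, ∫⁻ x in Metric.ball p (2 * ρ),
          ‖g n (x + t • bz i) - g n x‖ₑ ≤ ENNReal.ofReal (3 * δ) * D0 := by
        intro i t ht
        have hsub : ∀ x ∈ Metric.ball p (2 * ρ), ∀ s ∈ Set.Icc 0 (t + h), x + s • bz i ∈ K := by
          intro x hx s hs
          have h1 := dist_triangle (x + s • bz i) x p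
          rw [dist_eq_norm (x + s • bz i) x, add_sub_cancel_left, norm_smul, norm_bz, mul_one,
            Real.norm_eq_abs, abs_of_nonneg hs.1] at h1
          rw [Metric.mem_ball] at hx
          rw [Metric.mem_closedBall]
          linarith [hs.2, ht.2]
        have a1 := setLIntegral_cell_translate_le hh ht.1 (extendField (μ n)) i
          Metric.isOpen_ball.measurableSet hsub
        have a2 : ∫⁻ x in K, ‖dq h (extendField (μ n)) i x‖ₑ ≤
            volume K + 64 * ENNReal.ofReal C := by
          calc ∫⁻ x in K, ‖dq h (extendField (μ n)) i x‖ₑ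
              ≤ ∫⁻ x in K, (1 + ‖dq h (extendField (μ n)) i x‖ₑ ^ 2) := by
                refine lintegral_mono fun x => ?_
                have := enorm_le_add_mul_sq (dq h (extendField (μ n)) i x) one_pos
                simpa using this
            _ = volume K + ∫⁻ x in K, ‖dq h (extendField (μ n)) i x‖ₑ ^ 2 := by
                rw [lintegral_add_left measurable_const]; simp
            _ ≤ _ := by
                gcongr
                refine (setLIntegral_dq_sq_le ha (extendField_node (μ n)) hK.measurableSet hn i).trans ?_
                gcongr
                exact (Finset.single_le_sum (f := fun i => ∫⁻ x in Ω,
                  ‖interpPartial a Ω n (μ n) i x‖ₑ ^ 2) (fun _ _ => zero_le)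
                  (Finset.mem_univ i)).trans (hCb n).2
        have a3 := m.lintegral_sub_le hΩ i ht.1 (U := Metric.ball p (2 * ρ)) Metric.isOpen_ball hp
          fun x hx s hs => hsub x hx (s * t) ⟨mul_nonneg hs.1 ht.1, by nlinarith [hs.2, ht.1]⟩
        calc ∫⁻ x in Metric.ball p (2 * ρ), ‖g n (x + t • bz i) - g n x‖ₑ
            ≤ ∫⁻ x in Metric.ball p (2 * ρ), (‖extendField (μ n) (cell h (x + t • bz i)) -
              extendField (μ n) (cell h x)‖ₑ + ‖m.toFun (x + t • bz i) - m.toFun x‖ₑ) := by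
              refine lintegral_mono fun x => ?_
              have : g n (x + t • bz i) - g n x = (extendField (μ n) (cell h (x + t • bz i)) -
                extendField (μ n) (cell h x)) - (m.toFun (x + t • bz i) - m.toFun x) := by
                simp only [g, h]; abel
              rw [this]
              exact enorm_sub_le
          _ = (∫⁻ x in Metric.ball p (2 * ρ), ‖extendField (μ n) (cell h (x + t • bz i)) -
              extendField (μ n) (cell h x)‖ₑ) + ∫⁻ x in Metric.ball p (2 * ρ),
              ‖m.toFun (x + t • bz i) - m.toFun x‖ₑ := by
              have hmc := measurable_comp_cell h (extendField (μ n))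
              have hme : Measurable fun x => ‖extendField (μ n) (cell h (x + t • bz i)) -
                  extendField (μ n) (cell h x)‖ₑ :=
                Measurable.enorm (Measurable.sub (hmc.comp (measurable_add_const _)) hmc)
              rw [lintegral_add_left hme]
          _ ≤ ENNReal.ofReal (2 * δ) * (volume K + 64 * ENNReal.ofReal C) +
              ENNReal.ofReal δ * (volume K + ∫⁻ x in K, ‖m.pd i x‖ₑ ^ 2) := by
              refine add_le_add (a1.trans ?_) (a3.trans ?_)
              · gcongr
                linarith [ht.2]
              · gcongr
                · exact ht.2
                · exact Metric.ball_subset_closedBall.trans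
                    (Metric.closedBall_subset_closedBall (by linarith))
          _ ≤ ENNReal.ofReal (2 * δ) * D0 + ENNReal.ofReal δ * D0 := by
              gcongr
              · exact le_self_add
              · simp only [D0]
                rw [add_assoc]
                gcongr
                exact (Finset.single_le_sum (f := fun i => ∫⁻ x in K, ‖m.pd i x‖ₑ ^ 2)
                  (fun _ _ => zero_le) (Finset.mem_univ i)).trans le_add_self
          _ = _ := by
              rw [← add_mul, ← ENNReal.ofReal_add (by positivity) (by positivity)]
              congr 2
              ring
      refine (setLIntegral_translate_le_of_axes (hgm n) hδρ hax hz).trans ?_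
      rw [← ENNReal.ofReal_toReal hD0, ← ENNReal.ofReal_mul (by positivity),
        show (3 : ℝ≥0∞) = ENNReal.ofReal 3 by norm_num, ← ENNReal.ofReal_mul (by norm_num)]
      exact ENNReal.ofReal_le_ofReal (by linarith)
  have hzero : ∫⁻ x in Metric.ball p ρ, ‖‖m.toFun x‖ - 1‖ₑ = 0 := by
    refine le_antisymm (ENNReal.le_of_forall_pos_le_add fun ε hε _ => ?_) zero_le
    refine (key (ε / 2) (by positivity)).trans ?_
    rw [zero_add, mul_div_cancel₀ _ two_ne_zero, ENNReal.ofReal_coe_nnreal]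
  rw [lintegral_eq_zero_iff (hmm.norm.sub_const 1).enorm] at hzero
  filter_upwards [hzero] with x hx
  have : ‖m.toFun x‖ - 1 = 0 := by simpa using hx
  linarith

theorem UnitSpins.unitNorm (ha : 0 < a) (hΩ : IsCompact Ω) (h0 : volume (frontier Ω) = 0)
    (hu : UnitSpins a Ω μ) (hc : ConvergesTo a Ω μ m) : UnitNorm m := by
  obtain ⟨m', hm', hae, hpd, -⟩ := m.exists_measurable_rep
  have hc' := hc.congr hae hpd
  have h1 : volume {x | x ∈ interior Ω ∧ ‖m'.toFun x‖ ≠ 1} = 0 := by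
    refine measure_null_of_locally_null _ fun p hp => ?_
    obtain ⟨R, hR, hRΩ⟩ := Metric.nhds_basis_closedBall.mem_iff.1
      (isOpen_interior.mem_nhds hp.1)
    have h2 := hu.ae_ball ha hΩ hc' hm' (p := p) (ρ := R / 4) (by positivity)
      (by rwa [mul_div_cancel₀ _ (by norm_num : (4 : ℝ) ≠ 0)])
    rw [ae_restrict_iff' Metric.isOpen_ball.measurableSet, ae_iff] at h2
    refine ⟨_, inter_mem_nhdsWithin _ (Metric.ball_mem_nhds p (by positivity : 0 < R / 4)),
      measure_mono_null ?_ h2⟩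
    rintro x ⟨hx1, hx2⟩ h
    exact hx1.2 (h hx2)
  have h2 : UnitNorm m' := by
    rw [UnitNorm, ae_restrict_iff' hΩ.measurableSet, ae_iff]
    refine measure_mono_null (fun x hx => ?_) (measure_union_null h1 h0)
    have hx' : x ∈ Ω ∧ ‖m'.toFun x‖ ≠ 1 := by simpa using hx
    by_cases hxi : x ∈ interior Ω
    · exact Or.inl ⟨hxi, hx'.2⟩
    · exact Or.inr ⟨subset_closure hx'.1, hxi⟩
  filter_upwards [h2, hae] with x hx hx2
  rw [← hx2, hx]

end

/-! ### A criterion for recovery sequences -/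

theorem tendsto_integral_inner_of_lintegral {ι α : Type*} [MeasurableSpace α] {ν : Measure α}
    {l : Filter ι} {f : ι → α → E3} {f₀ g : α → E3} (hf : ∀ n, MemLp (f n) 2 ν) (hf₀ : MemLp f₀ 2 ν)
    (hg : MemLp g 2 ν) (h : Tendsto (fun n => ∫⁻ x, ‖f n x - f₀ x‖ₑ ^ 2 ∂ν) l (𝓝 0)) :
    Tendsto (fun n => ∫ x, inner ℝ (f n x) (g x) ∂ν) l (𝓝 (∫ x, inner ℝ (f₀ x) (g x) ∂ν)) := by
  rw [tendsto_iff_dist_tendsto_zero]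
  have h1 : Tendsto (fun n => √(∫ x, ‖f n x - f₀ x‖ ^ 2 ∂ν) * √(∫ x, ‖g x‖ ^ 2 ∂ν)) l (𝓝 0) := by
    have h3 := (ENNReal.tendsto_toReal ENNReal.zero_ne_top).comp h
    have h4 := (h3.sqrt).mul_const (√(∫ x, ‖g x‖ ^ 2 ∂ν))
    simp only [ENNReal.toReal_zero, Real.sqrt_zero, zero_mul] at h4
    refine h4.congr fun n => ?_
    have := ofReal_integral_norm_sq ((hf n).sub hf₀)
    simp only [Pi.sub_apply] at this
    rw [Function.comp_apply, ← this, ENNReal.toReal_ofReal (integral_nonneg fun x => by positivity)]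
  refine squeeze_zero (fun n => dist_nonneg) (fun n => ?_) h1
  rw [Real.dist_eq, ← integral_sub (MemLp.integrable_inner_two (hf n) hg)
    (MemLp.integrable_inner_two hf₀ hg)]
  have h5 := abs_integral_inner_le ((hf n).sub hf₀) hg
  simp only [Pi.sub_apply, inner_sub_left] at h5
  exact h5

theorem closedBall_subset_of_lt_infDist {Ω : Set E3} {x : E3} {r : ℝ}
    (h : r < Metric.infDist x Ωᶜ) : Metric.closedBall x r ⊆ Ω := by
  intro y hy
  by_contra hyΩ
  have h1 := Metric.infDist_le_dist_of_mem (x := x) (s := Ωᶜ) hyΩ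
  rw [Metric.mem_closedBall, dist_comm] at hy
  linarith

theorem infDist_compl_pos {Ω : Set E3} (hΩ : IsCompact Ω) {x : E3} (hx : x ∈ interior Ω) :
    0 < Metric.infDist x Ωᶜ := by
  have hne : Ωᶜ.Nonempty := by
    by_contra h
    rw [Set.not_nonempty_iff_eq_empty, Set.compl_empty_iff] at h
    exact noncompact_univ E3 (h ▸ hΩ)
  rw [← Metric.infDist_closure, closure_compl]
  exact (isOpen_interior.isClosed_compl.notMem_iff_infDist_pos
    (hne.mono (Set.compl_subset_compl.2 interior_subset))).1 (by simpa using hx)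

/-- The points of `Ω` at depth at most `r`. -/
def strip (Ω : Set E3) (r : ℝ) : Set E3 := {x ∈ Ω | Metric.infDist x Ωᶜ ≤ r}

theorem measurableSet_strip {Ω : Set E3} (hΩ : IsCompact Ω) (r : ℝ) : MeasurableSet (strip Ω r) :=
  hΩ.measurableSet.inter ((Metric.continuous_infDist_pt Ωᶜ).measurable measurableSet_Iic)

/-- Interior points have positive depth, so almost every point of Ω leaves the strips as r tends to
zero. The rest is absolute continuity of the integral. -/
theorem tendsto_setLIntegral_strip {Ω : Set E3} (hΩ : IsCompact Ω) (h0 : volume (frontier Ω) = 0)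
    {F : E3 → ℝ≥0∞} (hF : ∫⁻ x in Ω, F x ≠ ⊤) :
    Tendsto (fun r => ∫⁻ x in strip Ω r, F x) (𝓝 0) (𝓝 0) := by
  have hV : Tendsto (fun r => volume.restrict Ω (strip Ω r)) (𝓝 0) (𝓝 0) := by
    have h1 := tendsto_lintegral_filter_of_dominated_convergence' (l := 𝓝 (0 : ℝ))
      (μ := volume.restrict Ω) (F := fun r => (strip Ω r).indicator 1) (f := fun _ => 0)
      (fun _ => 1) (Eventually.of_forall fun r =>
        (measurable_one.indicator (measurableSet_strip hΩ r)).aemeasurable) ?_ ?_ ?_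
    · simpa [lintegral_indicator_one (measurableSet_strip hΩ _)] using h1
    · exact Eventually.of_forall fun r => Eventually.of_forall fun x =>
        Set.indicator_le (fun _ _ => le_rfl) x
    · simpa using hΩ.measure_ne_top
    · rw [restrict_eq_restrict_interior h0]
      filter_upwards [ae_restrict_mem isOpen_interior.measurableSet] with x hx
      refine tendsto_const_nhds.congr' ?_
      filter_upwards [eventually_lt_nhds (infDist_compl_pos hΩ hx)] with r hr
      rw [Set.indicator_of_notMem]
      exact fun h => absurd h.2 (not_le.2 hr)
  have h2 := tendsto_setLIntegral_zero hF hV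
  refine h2.congr fun r => ?_
  rw [Measure.restrict_restrict (measurableSet_strip hΩ r), Set.inter_eq_left.2 fun x hx => hx.1]

section Criterion

variable {a : ℝ} {Ω : Set E3}

/-- Below depth 2h every point lies in an element, and the interpolant is compared with the value at
the lower corner. In the strip above, x may lie in no element; then the interpolant is zero and the
error is p itself. The constant is 432 = 2 · 3² · 24. -/
theorem enorm_interp_sub_sq_le (ha : 0 < a) (n : ℕ+) {μ : SpinField a Ω n} {u : (Fin 3 → ℤ) → E3}
    (hu : ∀ x : Node a Ω n, u x.1 = μ x) {x : E3} (hx : OffFaces (a / ((n : ℕ) : ℝ)) x)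
    (hxΩ : x ∈ Ω) (p : E3) :
    ‖interp a Ω n μ x - p‖ₑ ^ 2 ≤
      (strip Ω (2 * (a / ((n : ℕ) : ℝ)))).indicator (fun _ => ‖p‖ₑ ^ 2) x +
      (2 * ‖u (cell (a / ((n : ℕ) : ℝ)) x) - p‖ₑ ^ 2 +
      ENNReal.ofReal ((a / ((n : ℕ) : ℝ)) ^ 2) * (432 * ∑ b ∈ Finset.Icc (0 : Fin 3 → ℤ) 1,
        ∑ i, ‖dq (a / ((n : ℕ) : ℝ)) u i (x + pt (a / ((n : ℕ) : ℝ)) b)‖ₑ ^ 2)) := by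
  have hh := spacing_pos ha n
  by_cases hex : ∃ T, IsElementAt a Ω n x T
  · refine le_add_left ?_
    have h2 := norm_interp_sub_le ha hu hx hex
    have h4 := ofReal_cellError_sq_le hh u 0 x
    set h := a / ((n : ℕ) : ℝ)
    have h3 : ‖interp a Ω n μ x - u (cell h x)‖ₑ ≤
        ENNReal.ofReal (3 * h) * ENNReal.ofReal (cellError h u 0 (cell h x)) := by
      rw [← ofReal_norm, ← ENNReal.ofReal_mul (by positivity), mul_assoc]
      exact ENNReal.ofReal_le_ofReal h2
    simp only [Pi.zero_apply, sub_zero] at h4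
    have h5 : interp a Ω n μ x - p = (u (cell h x) - p) + (interp a Ω n μ x - u (cell h x)) := by
      abel
    rw [h5]
    refine (enorm_sq_add_le _ _).trans (add_le_add_right ?_ _)
    calc 2 * ‖interp a Ω n μ x - u (cell h x)‖ₑ ^ 2
        ≤ 2 * (ENNReal.ofReal (3 * h) * ENNReal.ofReal (cellError h u 0 (cell h x))) ^ 2 := by
          gcongr
      _ = ENNReal.ofReal (h ^ 2) * (18 * ENNReal.ofReal (cellError h u 0 (cell h x)) ^ 2) := by
          rw [mul_pow, ← ENNReal.ofReal_pow (by positivity), mul_pow,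
            ENNReal.ofReal_mul (by positivity), show ENNReal.ofReal (3 ^ 2) = 9 by norm_num]
          ring
      _ ≤ ENNReal.ofReal (h ^ 2) * (18 * (24 * ∑ b ∈ Finset.Icc (0 : Fin 3 → ℤ) 1,
            ∑ i, ‖dq h u i (x + pt h b)‖ₑ ^ 2)) := by gcongr
      _ = _ := by rw [← mul_assoc 18]; norm_num
  · rw [interp_eq_zero hex, zero_sub, enorm_neg, Set.indicator_of_mem]
    · exact le_self_add
    · refine ⟨hxΩ, not_lt.1 fun h => hex ?_⟩
      exact exists_isElementAt ha (closedBall_subset_of_lt_infDist h)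

theorem enorm_interpPartial_sub_sq_le (ha : 0 < a) (n : ℕ+) {μ : SpinField a Ω n}
    {u : (Fin 3 → ℤ) → E3} (hu : ∀ x : Node a Ω n, u x.1 = μ x) {x : E3}
    (hx : OffFaces (a / ((n : ℕ) : ℝ)) x) (hxΩ : x ∈ Ω) (q : Fin 3 → E3) (i : Fin 3) :
    ‖interpPartial a Ω n μ i x - q i‖ₑ ^ 2 ≤
      (strip Ω (2 * (a / ((n : ℕ) : ℝ)))).indicator (fun _ => ‖q i‖ₑ ^ 2) x +
      216 * ∑ b ∈ Finset.Icc (0 : Fin 3 → ℤ) 1,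
        ∑ j, ‖dq (a / ((n : ℕ) : ℝ)) u j (x + pt (a / ((n : ℕ) : ℝ)) b) - q j‖ₑ ^ 2 := by
  have hh := spacing_pos ha n
  by_cases hex : ∃ T, IsElementAt a Ω n x T
  · refine le_add_left ?_
    have h2 := norm_interpPartial_sub_le ha hu hx hex q i
    have h4 := ofReal_cellError_sq_le hh u q x
    set h := a / ((n : ℕ) : ℝ)
    have h3 : ‖interpPartial a Ω n μ i x - q i‖ₑ ≤ 3 * ENNReal.ofReal (cellError h u q (cell h x)) := by
      rw [← ofReal_norm, show (3 : ℝ≥0∞) = ENNReal.ofReal 3 by norm_num,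
        ← ENNReal.ofReal_mul (by norm_num)]
      exact ENNReal.ofReal_le_ofReal h2
    calc ‖interpPartial a Ω n μ i x - q i‖ₑ ^ 2
        ≤ (3 * ENNReal.ofReal (cellError h u q (cell h x))) ^ 2 := by gcongr
      _ = 9 * ENNReal.ofReal (cellError h u q (cell h x)) ^ 2 := by rw [mul_pow]; norm_num
      _ ≤ 9 * (24 * ∑ b ∈ Finset.Icc (0 : Fin 3 → ℤ) 1,
            ∑ j, ‖dq h u j (x + pt h b) - q j‖ₑ ^ 2) := by gcongr
      _ = _ := by rw [← mul_assoc 9]; norm_num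
  · rw [interpPartial_eq_zero hex, zero_sub, enorm_neg, Set.indicator_of_mem]
    · exact le_self_add
    · refine ⟨hxΩ, not_lt.1 fun h => hex ?_⟩
      exact exists_isElementAt ha (closedBall_subset_of_lt_infDist h)

end Criterion

section Criterion

variable {a : ℝ} {Ω : Set E3}

/-- The energy of the fields `u n` does not exceed asymptotically the Dirichlet energy of `m`. -/
def EnergyBound (a : ℝ) {Ω : Set E3} (m : SobolevH1 Ω) (u : ℕ+ → (Fin 3 → ℤ) → E3) : Prop :=
  ∀ ε > 0, ∀ᶠ n : ℕ+ in atTop,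
    ∑ i, ∫⁻ x in Metric.cthickening (4 * (a / ((n : ℕ) : ℝ))) Ω,
      ‖dq (a / ((n : ℕ) : ℝ)) (u n) i x‖ₑ ^ 2 ≤ ENNReal.ofReal ((∫ x in Ω, ∑ i, ‖m.pd i x‖ ^ 2) + ε)

variable {m : SobolevH1 Ω} {u : ℕ+ → (Fin 3 → ℤ) → E3}

theorem SobolevH1.integral_sum_eq (m : SobolevH1 Ω) :
    ∫ x in Ω, ∑ i, ‖m.pd i x‖ ^ 2 = ∑ i, ∫ x in Ω, ‖m.pd i x‖ ^ 2 :=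
  integral_finsetSum _ fun i _ => (m.memLp_pd i).norm.integrable_sq

/-- The gradient in a cell involves quotients in the upper neighbours of the cell, which may leave
Ω. This is why `EnergyBound` controls the energy on a neighbourhood of Ω of radius 4h. -/
theorem add_pt_mem_cthickening {h : ℝ} (hh : 0 < h) {b : Fin 3 → ℤ}
    (hb : b ∈ Finset.Icc (0 : Fin 3 → ℤ) 1) {x : E3} (hx : x ∈ Ω) :
    x + pt h b ∈ Metric.cthickening (4 * h) Ω := by
  refine Metric.mem_cthickening_of_dist_le _ x _ _ hx ?_
  rw [dist_eq_norm, add_sub_cancel_left]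
  linarith [norm_pt_le hh hb]

theorem setLIntegral_add_pt_le {h : ℝ} (hh : 0 < h) {b : Fin 3 → ℤ} (hΩ : IsCompact Ω)
    (hb : b ∈ Finset.Icc (0 : Fin 3 → ℤ) 1) (F : E3 → ℝ≥0∞) :
    ∫⁻ x in Ω, F (x + pt h b) ≤ ∫⁻ x in Metric.cthickening (4 * h) Ω, F x := by
  rw [setLIntegral_add_right hΩ.measurableSet]
  refine lintegral_mono_set fun x hx => ?_
  have := add_pt_mem_cthickening hh hb (show x - pt h b ∈ Ω from hx)
  rwa [sub_add_cancel] at this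

theorem EnergyBound.limsup_le {A : ℝ} (ha : 0 < a) (hA : 0 < A) (hΩ : IsCompact Ω)
    (hE : EnergyBound a m u) :
    limsup (fun n => (discreteExchangeEnergy a A Ω n (fun x => u n x.1) : EReal)) atTop ≤
      (continuumExchangeEnergy A m : EReal) := by
  have key : ∀ ε > 0, ∀ᶠ n in atTop,
      discreteExchangeEnergy a A Ω n (fun x => u n x.1) ≤ continuumExchangeEnergy A m + ε := by
    intro ε hε
    filter_upwards [hE (ε / (2 * A)) (by positivity)] with n hn
    have hh := spacing_pos ha n
    have h0 : 0 ≤ ∫ x in Ω, ∑ i, ‖m.pd i x‖ ^ 2 :=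
      integral_nonneg fun x => Finset.sum_nonneg fun i _ => by positivity
    have h1 : continuumExchangeEnergy A m + ε =
        2 * A * ((∫ x in Ω, ∑ i, ‖m.pd i x‖ ^ 2) + ε / (2 * A)) := by
      rw [continuumExchangeEnergy]; field_simp
    rw [h1, ← ENNReal.ofReal_le_ofReal_iff (by positivity),
      ofReal_discreteExchangeEnergy ha hA hΩ.isBounded n _ (u n) (fun _ => rfl),
      ENNReal.ofReal_mul (p := 2 * A) (by positivity)]
    refine mul_le_mul_right ((Finset.sum_le_sum fun i _ => ?_).trans hn) _
    refine lintegral_mono_set fun x hx => ?_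
    refine Metric.mem_cthickening_of_dist_le _ _ _ _ hx.1 ?_
    linarith [dist_pt_cell_le hh x]
  refine le_of_forall_gt_imp_ge_of_dense fun c hc => ?_
  obtain ⟨r, hr, hrc⟩ := EReal.lt_iff_exists_real_btwn.1 hc
  refine le_trans (limsup_le_of_le (by isBoundedDefault) ?_) hrc.le
  have hr' : continuumExchangeEnergy A m < r := by exact_mod_cast hr
  filter_upwards [key (r - continuumExchangeEnergy A m) (by linarith)] with n hn
  rw [add_sub_cancel] at hn
  exact_mod_cast hn

theorem memLp_contDiff {ψ : E3 → E3} (hψ : ContDiff ℝ ∞ ψ) (hc : HasCompactSupport ψ) (S : Set E3) :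
    MemLp ψ 2 (volume.restrict S) :=
  (hψ.continuous.memLp_of_hasCompactSupport hc).restrict _

/-- Convergence of norms upgrades weak to strong convergence. In |dq|² - 2⟨dq, ψ⟩ + |ψ|² the energy
bound controls the first term up to ε and weak convergence the second up to 2ε. The sum is then at
most ∑ |∂ᵢm - ψᵢ|² + 3ε ≤ 6ε. -/
theorem EnergyBound.eventually_lintegral_dq_sub_le (ha : 0 < a) (hΩ : IsCompact Ω)
    (hE : EnergyBound a m u)
    (hu : Tendsto (fun n : ℕ+ => ∫⁻ x in Ω, ‖u n (cell (a / ((n : ℕ) : ℝ)) x) - m.toFun x‖ₑ ^ 2)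
      atTop (𝓝 0)) {ψ : Fin 3 → E3 → E3} (hψ : ∀ i, ContDiff ℝ ∞ (ψ i))
    (hψc : ∀ i, HasCompactSupport (ψ i)) (hψΩ : ∀ i, tsupport (ψ i) ⊆ interior Ω) {ε : ℝ}
    (hε : 0 < ε) (hψε : ∀ i, ∫⁻ x in Ω, ‖m.pd i x - ψ i x‖ₑ ^ 2 ≤ ENNReal.ofReal ε) :
    ∀ᶠ n : ℕ+ in atTop, ∀ i, ∫⁻ x in Metric.cthickening (4 * (a / ((n : ℕ) : ℝ))) Ω,
      ‖dq (a / ((n : ℕ) : ℝ)) (u n) i x - ψ i x‖ₑ ^ 2 ≤ ENNReal.ofReal (6 * ε) := by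
  have hum : ∀ n : ℕ+, MemLp (fun x => u n (cell (a / ((n : ℕ) : ℝ)) x)) 2 (volume.restrict Ω) :=
    fun n => memLp_comp_cell (spacing_pos ha n) hΩ.isBounded hΩ.measurableSet _
  obtain ⟨C, hC, hb⟩ : ∃ C : ℝ, 0 ≤ C ∧ ∀ᶠ n : ℕ+ in atTop,
      ∫⁻ x in Ω, ‖u n (cell (a / ((n : ℕ) : ℝ)) x)‖ₑ ^ 2 ≤ ENNReal.ofReal C := by
    have hfin : 2 * 1 + 2 * ∫⁻ x in Ω, ‖m.toFun x‖ₑ ^ 2 ≠ ⊤ :=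
      ENNReal.add_ne_top.2 ⟨by norm_num, ENNReal.mul_ne_top (by norm_num)
        (MemLp.lintegral_sq_ne_top m.memLp_toFun)⟩
    refine ⟨(2 * 1 + 2 * ∫⁻ x in Ω, ‖m.toFun x‖ₑ ^ 2).toReal, ENNReal.toReal_nonneg, ?_⟩
    filter_upwards [hu.eventually_le_const (show (0 : ℝ≥0∞) < 1 by norm_num)] with n hn
    rw [ENNReal.ofReal_toReal hfin]
    calc ∫⁻ x in Ω, ‖u n (cell (a / ((n : ℕ) : ℝ)) x)‖ₑ ^ 2
        ≤ ∫⁻ x in Ω, (2 * ‖u n (cell (a / ((n : ℕ) : ℝ)) x) - m.toFun x‖ₑ ^ 2 +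
          2 * ‖m.toFun x‖ₑ ^ 2) := by
          refine lintegral_mono fun x => ?_
          have := enorm_sq_add_le (u n (cell (a / ((n : ℕ) : ℝ)) x) - m.toFun x) (m.toFun x)
          rwa [sub_add_cancel] at this
      _ = 2 * (∫⁻ x in Ω, ‖u n (cell (a / ((n : ℕ) : ℝ)) x) - m.toFun x‖ₑ ^ 2) +
          2 * ∫⁻ x in Ω, ‖m.toFun x‖ₑ ^ 2 := by
          rw [lintegral_add_right' _
            ((m.memLp_toFun.aestronglyMeasurable.enorm.pow_const 2).const_mul 2),
            lintegral_const_mul' _ _ (by norm_num), lintegral_const_mul' _ _ (by norm_num)]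
      _ ≤ _ := by gcongr
  have hT : ∀ i, Tendsto (fun n : ℕ+ => ∫ x in Ω, inner ℝ (dq (a / ((n : ℕ) : ℝ)) (u n) i x) (ψ i x))
      atTop (𝓝 (∫ x in Ω, inner ℝ (m.pd i x) (ψ i x))) := by
    intro i
    obtain ⟨δ, hδ, hδΩ⟩ := exists_closedBall_subset (hψc i).isCompact (hψΩ i)
    refine m.tendsto_inner_dq (spacing_pos ha) (tendsto_spacing a) u hΩ hΩ subset_rfl (hψ i) (hψΩ i)
      hδ (fun x hx y hy => interior_subset (hδΩ x hx hy)) i hC hb ?_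
    refine tendsto_integral_inner_of_lintegral hum m.memLp_toFun (MemLp.restrict _ ?_) hu
    exact (((hψ i).continuous_fderiv (by simp)).clm_apply continuous_const).memLp_of_hasCompactSupport
      (((hψc i).fderiv ℝ).comp_left (g := fun L : E3 →L[ℝ] E3 => L (bz i)) (by simp))
  have hsum := tendsto_finsetSum Finset.univ fun i _ => hT i
  have hlt : (∑ i, ∫ x in Ω, inner ℝ (m.pd i x) (ψ i x)) - ε <
      ∑ i, ∫ x in Ω, inner ℝ (m.pd i x) (ψ i x) := by linarith
  filter_upwards [hE ε hε, hsum.eventually_const_le hlt] with n hn1 hn2 i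
  have hh := spacing_pos ha n
  set h := a / ((n : ℕ) : ℝ)
  set S := Metric.cthickening (4 * h) Ω
  have hS : IsCompact S := hΩ.cthickening
  have hΩS : Ω ⊆ S := Metric.self_subset_cthickening _
  have hd : ∀ i, MemLp (dq h (u n) i) 2 (volume.restrict S) := fun i =>
    memLp_dq hh hS.isBounded hS.measurableSet _ i
  have hψS := fun i => memLp_contDiff (hψ i) (hψc i) S
  have hψ2 := fun i => memLp_contDiff (hψ i) (hψc i) Ω
  have hz : ∀ i, ∀ x ∈ S \ Ω, ψ i x = 0 := fun i x hx =>
    image_eq_zero_of_notMem_tsupport fun h' => hx.2 (interior_subset (hψΩ i h'))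
  have hexp : ∀ {T : Set E3} {f g : E3 → E3}, MemLp f 2 (volume.restrict T) →
      MemLp g 2 (volume.restrict T) → ∫ x in T, ‖f x - g x‖ ^ 2 =
      (∫ x in T, ‖f x‖ ^ 2) - 2 * (∫ x in T, inner ℝ (f x) (g x)) + ∫ x in T, ‖g x‖ ^ 2 := by
    intro T f g hf hg
    simp_rw [norm_sub_sq_real]
    have i1 := hf.norm.integrable_sq
    have i2 := MemLp.integrable_inner_two hf hg
    have i3 := hg.norm.integrable_sq
    have i4 : Integrable (fun x => ‖f x‖ ^ 2 - 2 * inner ℝ (f x) (g x)) (volume.restrict T) :=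
      i1.sub (i2.const_mul 2)
    rw [integral_add i4 i3, integral_sub i1 (i2.const_mul 2), integral_const_mul]
  have e1 : ∀ i, ∫ x in S, inner ℝ (dq h (u n) i x) (ψ i x) =
      ∫ x in Ω, inner ℝ (dq h (u n) i x) (ψ i x) := fun i =>
    setIntegral_eq_of_subset_of_forall_sdiff_eq_zero hS.measurableSet hΩS
      fun x hx => by rw [hz i x hx, inner_zero_right]
  have e2 : ∀ i, ∫ x in S, ‖ψ i x‖ ^ 2 = ∫ x in Ω, ‖ψ i x‖ ^ 2 := fun i =>
    setIntegral_eq_of_subset_of_forall_sdiff_eq_zero hS.measurableSet hΩS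
      fun x hx => by rw [hz i x hx]; simp
  have e3 : ∑ i, ∫ x in S, ‖dq h (u n) i x‖ ^ 2 ≤ (∑ i, ∫ x in Ω, ‖m.pd i x‖ ^ 2) + ε := by
    rw [← m.integral_sum_eq, ← ENNReal.ofReal_le_ofReal_iff
      (add_nonneg (integral_nonneg fun x => Finset.sum_nonneg fun i _ => by positivity) hε.le),
      ENNReal.ofReal_sum_of_nonneg fun i _ => integral_nonneg fun x => by positivity]
    refine le_trans (le_of_eq ?_) hn1
    exact Finset.sum_congr rfl fun i _ => ofReal_integral_norm_sq (hd i)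
  have e4 : ∀ i, ∫ x in Ω, ‖m.pd i x - ψ i x‖ ^ 2 ≤ ε := fun i =>
    integral_sq_le_of_lintegral_le ((m.memLp_pd i).sub (hψ2 i)) hε.le (hψε i)
  have e5 : ∑ i, ∫ x in S, ‖dq h (u n) i x - ψ i x‖ ^ 2 ≤ 6 * ε := by
    have h1 : ∑ i, ∫ x in S, ‖dq h (u n) i x - ψ i x‖ ^ 2 =
        (∑ i, ∫ x in S, ‖dq h (u n) i x‖ ^ 2) -
        2 * (∑ i, ∫ x in Ω, inner ℝ (dq h (u n) i x) (ψ i x)) + ∑ i, ∫ x in Ω, ‖ψ i x‖ ^ 2 := by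
      rw [Finset.mul_sum, ← Finset.sum_sub_distrib, ← Finset.sum_add_distrib]
      exact Finset.sum_congr rfl fun i _ => by rw [hexp (hd i) (hψS i), e1, e2]
    have h2 : ∑ i, ∫ x in Ω, ‖m.pd i x - ψ i x‖ ^ 2 = (∑ i, ∫ x in Ω, ‖m.pd i x‖ ^ 2) -
        2 * (∑ i, ∫ x in Ω, inner ℝ (m.pd i x) (ψ i x)) + ∑ i, ∫ x in Ω, ‖ψ i x‖ ^ 2 := by
      rw [Finset.mul_sum, ← Finset.sum_sub_distrib, ← Finset.sum_add_distrib]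
      exact Finset.sum_congr rfl fun i _ => hexp (m.memLp_pd i) (hψ2 i)
    have h3 : ∑ i, ∫ x in Ω, ‖m.pd i x - ψ i x‖ ^ 2 ≤ 3 * ε := by
      refine (Finset.sum_le_sum fun i _ => e4 i).trans_eq ?_
      simp
    linarith
  have h7 := ofReal_integral_norm_sq ((hd i).sub (hψS i))
  simp only [Pi.sub_apply] at h7
  rw [← h7]
  refine ENNReal.ofReal_le_ofReal (le_trans ?_ e5)
  exact Finset.single_le_sum (f := fun i => ∫ x in S, ‖dq h (u n) i x - ψ i x‖ ^ 2)
    (fun i _ => integral_nonneg fun x => by positivity) (Finset.mem_univ i)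

/-- The shift by a vertex of the cell is absorbed by ψ, which is uniformly continuous while ∂ᵢm is
not. The errors are dq - ψ at the shifted point, the shift of ψ, and ψ - ∂ᵢm; together 3 · 6ε + 3ε +
3ε = 24ε. -/
theorem EnergyBound.tendsto_lintegral_dq (ha : 0 < a) (hΩ : IsCompact Ω)
    (h0 : volume (frontier Ω) = 0) (hE : EnergyBound a m u)
    (hu : Tendsto (fun n : ℕ+ => ∫⁻ x in Ω, ‖u n (cell (a / ((n : ℕ) : ℝ)) x) - m.toFun x‖ₑ ^ 2)
      atTop (𝓝 0)) {b : Fin 3 → ℤ} (hb : b ∈ Finset.Icc (0 : Fin 3 → ℤ) 1) (i : Fin 3) :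
    Tendsto (fun n : ℕ+ => ∫⁻ x in Ω, ‖dq (a / ((n : ℕ) : ℝ)) (u n) i
      (x + pt (a / ((n : ℕ) : ℝ)) b) - m.pd i x‖ₑ ^ 2) atTop (𝓝 0) := by
  rw [ENNReal.tendsto_nhds_zero]
  intro η hη
  obtain ⟨ε, hε, hεη⟩ : ∃ ε : ℝ, 0 < ε ∧ ENNReal.ofReal (24 * ε) ≤ η := by
    obtain ⟨c, hc, hcη⟩ := ENNReal.lt_iff_exists_nnreal_btwn.1 hη
    refine ⟨c / 24, by have : 0 < c := by exact_mod_cast hc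
                       positivity, ?_⟩
    rw [mul_div_cancel₀ _ (by norm_num), ENNReal.ofReal_coe_nnreal]
    exact hcη.le
  have hpd : ∀ i, MemLp (m.pd i) 2 (volume.restrict (interior Ω)) := fun i =>
    restrict_eq_restrict_interior h0 ▸ m.memLp_pd i
  choose ψ hψ hψc hψs hψa using fun i => exists_contDiff_approx isOpen_interior (hpd i) hε
  rw [← restrict_eq_restrict_interior h0] at hψa
  have h1 := hE.eventually_lintegral_dq_sub_le ha hΩ hu hψ hψc hψs hε hψa
  obtain ⟨r, hr, hrψ⟩ : ∃ r > 0, ∀ x v : E3, ‖v‖ < r →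
      volume Ω * ‖ψ i (x + v) - ψ i x‖ₑ ^ 2 ≤ ENNReal.ofReal ε := by
    have huc := (hψc i).uniformContinuous_of_continuous (hψ i).continuous
    have hV : volume Ω ≠ ⊤ := hΩ.measure_ne_top
    set V := (volume Ω).toReal
    have hV0 : 0 ≤ V := ENNReal.toReal_nonneg
    obtain ⟨r, hr, h⟩ := Metric.uniformContinuous_iff.1 huc (√(ε / (V + 1))) (by positivity)
    refine ⟨r, hr, fun x v hv => ?_⟩
    have h2 := h (a := x + v) (b := x) (by rwa [dist_eq_norm, add_sub_cancel_left])
    rw [dist_eq_norm] at h2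
    have h3 : ‖ψ i (x + v) - ψ i x‖ ^ 2 ≤ ε / (V + 1) := by
      have := pow_le_pow_left₀ (norm_nonneg _) h2.le 2
      rwa [Real.sq_sqrt (by positivity)] at this
    rw [← ENNReal.ofReal_toReal hV, ← ofReal_norm, ← ENNReal.ofReal_pow (norm_nonneg _),
      ← ENNReal.ofReal_mul hV0]
    refine ENNReal.ofReal_le_ofReal ?_
    rw [le_div_iff₀ (by positivity)] at h3
    nlinarith [sq_nonneg ‖ψ i (x + v) - ψ i x‖]
  have hsmall := ((tendsto_spacing a).const_mul 2).eventually_lt_const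
    (show (2 : ℝ) * 0 < r by simpa)
  filter_upwards [h1, hsmall] with n hn1 hn2
  have hh := spacing_pos ha n
  set h := a / ((n : ℕ) : ℝ)
  refine le_trans ?_ hεη
  have hmD : Measurable fun x => ‖dq h (u n) i (x + pt h b) - ψ i (x + pt h b)‖ₑ ^ 2 :=
    ((((measurable_dq h (u n) i).sub (hψ i).continuous.measurable).comp
      (measurable_add_const (pt h b))).enorm.pow_const 2)
  have hmψ : Measurable fun x => ‖ψ i (x + pt h b) - ψ i x‖ₑ ^ 2 := by
    have h3 := (hψ i).continuous
    exact (Continuous.measurable (by fun_prop)).enorm.pow_const 2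
  calc ∫⁻ x in Ω, ‖dq h (u n) i (x + pt h b) - m.pd i x‖ₑ ^ 2
      ≤ ∫⁻ x in Ω, (3 * ‖dq h (u n) i (x + pt h b) - ψ i (x + pt h b)‖ₑ ^ 2 +
        (3 * ‖ψ i (x + pt h b) - ψ i x‖ₑ ^ 2 + 3 * ‖m.pd i x - ψ i x‖ₑ ^ 2)) := by
        refine lintegral_mono fun x => ?_
        have e1 : dq h (u n) i (x + pt h b) - m.pd i x =
            (dq h (u n) i (x + pt h b) - ψ i (x + pt h b)) + (ψ i (x + pt h b) - ψ i x) -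
            (m.pd i x - ψ i x) := by abel
        rw [e1]
        refine (pow_le_pow_left₀ zero_le (enorm_sub_le.trans
          (add_le_add_left (enorm_add_le _ _) _)) 2).trans ?_
        refine (ennreal_add_add_sq_le _ _ _).trans_eq ?_
        ring
    _ = 3 * (∫⁻ x in Ω, ‖dq h (u n) i (x + pt h b) - ψ i (x + pt h b)‖ₑ ^ 2) +
        (3 * (∫⁻ x in Ω, ‖ψ i (x + pt h b) - ψ i x‖ₑ ^ 2) +
        3 * ∫⁻ x in Ω, ‖m.pd i x - ψ i x‖ₑ ^ 2) := by
        rw [lintegral_add_left (hmD.const_mul 3), lintegral_add_left (hmψ.const_mul 3),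
          lintegral_const_mul' _ _ (by norm_num), lintegral_const_mul' _ _ (by norm_num),
          lintegral_const_mul' _ _ (by norm_num)]
    _ ≤ 3 * ENNReal.ofReal (6 * ε) + (3 * ENNReal.ofReal ε + 3 * ENNReal.ofReal ε) := by
        gcongr
        · exact (setLIntegral_add_pt_le hh hΩ hb
            fun x => ‖dq h (u n) i x - ψ i x‖ₑ ^ 2).trans (hn1 i)
        · by_cases hV : volume Ω = 0
          · rw [Measure.restrict_eq_zero.2 hV]; simp
          have hV' : volume Ω ≠ ⊤ := hΩ.measure_ne_top
          calc ∫⁻ x in Ω, ‖ψ i (x + pt h b) - ψ i x‖ₑ ^ 2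
              ≤ ∫⁻ x in Ω, ENNReal.ofReal ε / volume Ω := by
                refine lintegral_mono fun x => ?_
                rw [ENNReal.le_div_iff_mul_le (Or.inl hV) (Or.inl hV'), mul_comm]
                exact hrψ x _ ((norm_pt_le hh hb).trans_lt hn2)
            _ = ENNReal.ofReal ε := by
                rw [setLIntegral_const, ENNReal.div_mul_cancel hV hV']
        · exact hψa i
    _ = ENNReal.ofReal (24 * ε) := by
        rw [show (3 : ℝ≥0∞) = ENNReal.ofReal 3 by norm_num, ← ENNReal.ofReal_mul (by norm_num),
          ← ENNReal.ofReal_mul (by norm_num), ← ENNReal.ofReal_add (by positivity) (by positivity),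
          ← ENNReal.ofReal_add (by positivity) (by positivity)]
        congr 1; ring

end Criterion

section Criterion

variable {a : ℝ} {Ω : Set E3} {m : SobolevH1 Ω} {u : ℕ+ → (Fin 3 → ℤ) → E3}

theorem tendsto_spacing_mul (a c : ℝ) :
    Tendsto (fun n : ℕ+ => c * (a / ((n : ℕ) : ℝ))) atTop (𝓝 0) := by
  simpa using (tendsto_spacing a).const_mul c

theorem EnergyBound.tendsto_interp (ha : 0 < a) (hΩ : IsCompact Ω)
    (h0 : volume (frontier Ω) = 0) (hE : EnergyBound a m u)
    (hu : Tendsto (fun n : ℕ+ => ∫⁻ x in Ω, ‖u n (cell (a / ((n : ℕ) : ℝ)) x) - m.toFun x‖ₑ ^ 2)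
      atTop (𝓝 0)) :
    Tendsto (fun n => ∫⁻ x in Ω, ‖interp a Ω n (fun x => u n x.1) x - m.toFun x‖ₑ ^ 2) atTop
      (𝓝 0) := by
  set M := ENNReal.ofReal ((∫ x in Ω, ∑ i, ‖m.pd i x‖ ^ 2) + 1)
  have hmm : AEMeasurable (fun x => ‖m.toFun x‖ₑ ^ 2) (volume.restrict Ω) :=
    m.memLp_toFun.aestronglyMeasurable.enorm.pow_const 2
  have hlim : Tendsto (fun n : ℕ+ => (∫⁻ x in strip Ω (2 * (a / ((n : ℕ) : ℝ))), ‖m.toFun x‖ₑ ^ 2) +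
      (2 * (∫⁻ x in Ω, ‖u n (cell (a / ((n : ℕ) : ℝ)) x) - m.toFun x‖ₑ ^ 2) +
      ENNReal.ofReal ((a / ((n : ℕ) : ℝ)) ^ 2) * (432 * (8 * M)))) atTop (𝓝 0) := by
    have t1 := (tendsto_setLIntegral_strip hΩ h0
      (MemLp.lintegral_sq_ne_top m.memLp_toFun)).comp (tendsto_spacing_mul a 2)
    have t2 := ENNReal.Tendsto.const_mul (a := 2) hu (Or.inr (by norm_num))
    have t3 : Tendsto (fun n : ℕ+ => ENNReal.ofReal ((a / ((n : ℕ) : ℝ)) ^ 2)) atTop (𝓝 0) := by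
      have := ENNReal.tendsto_ofReal ((tendsto_spacing a).pow 2)
      simpa using this
    have t4 := ENNReal.Tendsto.mul_const (b := 432 * (8 * M)) t3 (Or.inr
      (ENNReal.mul_ne_top (by norm_num) (ENNReal.mul_ne_top (by norm_num) ENNReal.ofReal_ne_top)))
    have := t1.add (t2.add t4)
    simpa using this
  refine tendsto_of_tendsto_of_tendsto_of_le_of_le' tendsto_const_nhds hlim
    (Eventually.of_forall fun n => zero_le) ?_
  filter_upwards [hE 1 one_pos] with n hn
  have hh := spacing_pos ha n
  set h := a / ((n : ℕ) : ℝ)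
  have hsm := measurableSet_strip hΩ (2 * h)
  have hum : AEMeasurable (fun x => 2 * ‖u n (cell h x) - m.toFun x‖ₑ ^ 2) (volume.restrict Ω) :=
    ((((measurable_comp_cell h (u n)).aestronglyMeasurable.sub
      m.memLp_toFun.aestronglyMeasurable).enorm.pow_const 2).const_mul 2)
  calc ∫⁻ x in Ω, ‖interp a Ω n (fun x => u n x.1) x - m.toFun x‖ₑ ^ 2
      ≤ ∫⁻ x in Ω, ((strip Ω (2 * h)).indicator (fun x => ‖m.toFun x‖ₑ ^ 2) x +
        (2 * ‖u n (cell h x) - m.toFun x‖ₑ ^ 2 + ENNReal.ofReal (h ^ 2) * (432 *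
        ∑ b ∈ Finset.Icc (0 : Fin 3 → ℤ) 1, ∑ i, ‖dq h (u n) i (x + pt h b)‖ₑ ^ 2))) := by
        refine lintegral_mono_ae ?_
        filter_upwards [ae_restrict_of_ae (ae_offFaces h), ae_restrict_mem hΩ.measurableSet]
          with x hx hxΩ
        exact enorm_interp_sub_sq_le ha n (fun _ => rfl) hx hxΩ (m.toFun x)
    _ = (∫⁻ x in strip Ω (2 * h), ‖m.toFun x‖ₑ ^ 2) +
        (2 * (∫⁻ x in Ω, ‖u n (cell h x) - m.toFun x‖ₑ ^ 2) + ENNReal.ofReal (h ^ 2) * (432 *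
        ∑ b ∈ Finset.Icc (0 : Fin 3 → ℤ) 1, ∑ i, ∫⁻ x in Ω, ‖dq h (u n) i (x + pt h b)‖ₑ ^ 2)) := by
        have hmeas : ∀ b i, Measurable fun x => ‖dq h (u n) i (x + pt h b)‖ₑ ^ 2 := fun b i =>
          ((measurable_dq h (u n) i).comp (measurable_add_const _)).enorm.pow_const 2
        rw [lintegral_add_left' (hmm.indicator hsm), lintegral_add_left' hum,
          lintegral_indicator hsm, Measure.restrict_restrict hsm,
          Set.inter_eq_left.2 fun x hx => hx.1, lintegral_const_mul' _ _ (by norm_num),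
          lintegral_const_mul' _ _ ENNReal.ofReal_ne_top, lintegral_const_mul' _ _ (by norm_num),
          lintegral_finsetSum _ fun b _ => Finset.measurable_fun_sum _ fun i _ => hmeas b i]
        simp_rw [lintegral_finsetSum _ fun i _ => hmeas _ i]
    _ ≤ _ := by
        gcongr
        calc ∑ b ∈ Finset.Icc (0 : Fin 3 → ℤ) 1, ∑ i, ∫⁻ x in Ω, ‖dq h (u n) i (x + pt h b)‖ₑ ^ 2
            ≤ ∑ b ∈ Finset.Icc (0 : Fin 3 → ℤ) 1, M := by
              refine Finset.sum_le_sum fun b hb => le_trans (Finset.sum_le_sum fun i _ => ?_) hn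
              exact setLIntegral_add_pt_le hh hΩ hb fun x => ‖dq h (u n) i x‖ₑ ^ 2
          _ = 8 * M := by rw [Finset.sum_const, card_Icc_zero_one, nsmul_eq_mul]; norm_num

theorem EnergyBound.tendsto_interpPartial (ha : 0 < a) (hΩ : IsCompact Ω)
    (h0 : volume (frontier Ω) = 0) (hE : EnergyBound a m u)
    (hu : Tendsto (fun n : ℕ+ => ∫⁻ x in Ω, ‖u n (cell (a / ((n : ℕ) : ℝ)) x) - m.toFun x‖ₑ ^ 2)
      atTop (𝓝 0)) (i : Fin 3) :
    Tendsto (fun n => ∫⁻ x in Ω, ‖interpPartial a Ω n (fun x => u n x.1) i x - m.pd i x‖ₑ ^ 2) atTop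
      (𝓝 0) := by
  have hpm : ∀ i, AEMeasurable (fun x => ‖m.pd i x‖ₑ ^ 2) (volume.restrict Ω) := fun i =>
    (m.memLp_pd i).aestronglyMeasurable.enorm.pow_const 2
  have hlim : Tendsto (fun n : ℕ+ => (∫⁻ x in strip Ω (2 * (a / ((n : ℕ) : ℝ))), ‖m.pd i x‖ₑ ^ 2) +
      216 * ∑ b ∈ Finset.Icc (0 : Fin 3 → ℤ) 1, ∑ j, ∫⁻ x in Ω, ‖dq (a / ((n : ℕ) : ℝ)) (u n) j
        (x + pt (a / ((n : ℕ) : ℝ)) b) - m.pd j x‖ₑ ^ 2) atTop (𝓝 0) := by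
    have t1 := (tendsto_setLIntegral_strip hΩ h0
      (MemLp.lintegral_sq_ne_top (m.memLp_pd i))).comp (tendsto_spacing_mul a 2)
    have t2 := tendsto_finsetSum (Finset.Icc (0 : Fin 3 → ℤ) 1) fun b hb =>
      tendsto_finsetSum Finset.univ fun j _ => hE.tendsto_lintegral_dq ha hΩ h0 hu hb j
    have t3 := ENNReal.Tendsto.const_mul (a := 216) t2 (Or.inr (by norm_num))
    have := t1.add t3
    simpa using this
  refine tendsto_of_tendsto_of_tendsto_of_le_of_le tendsto_const_nhds hlim
    (fun n => zero_le) fun n => ?_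
  have hh := spacing_pos ha n
  dsimp only
  set h := a / ((n : ℕ) : ℝ)
  have hsm := measurableSet_strip hΩ (2 * h)
  have hmeas : ∀ b j, AEMeasurable (fun x => ‖dq h (u n) j (x + pt h b) - m.pd j x‖ₑ ^ 2)
      (volume.restrict Ω) := fun b j =>
    (((((measurable_dq h (u n) j).comp (measurable_add_const _)).aestronglyMeasurable).sub
      (m.memLp_pd j).aestronglyMeasurable).enorm.pow_const 2)
  calc ∫⁻ x in Ω, ‖interpPartial a Ω n (fun x => u n x.1) i x - m.pd i x‖ₑ ^ 2
      ≤ ∫⁻ x in Ω, ((strip Ω (2 * h)).indicator (fun x => ‖m.pd i x‖ₑ ^ 2) x + 216 *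
        ∑ b ∈ Finset.Icc (0 : Fin 3 → ℤ) 1, ∑ j, ‖dq h (u n) j (x + pt h b) - m.pd j x‖ₑ ^ 2) := by
        refine lintegral_mono_ae ?_
        filter_upwards [ae_restrict_of_ae (ae_offFaces h), ae_restrict_mem hΩ.measurableSet]
          with x hx hxΩ
        exact enorm_interpPartial_sub_sq_le ha n (fun _ => rfl) hx hxΩ (fun j => m.pd j x) i
    _ = _ := by
        rw [lintegral_add_left' ((hpm i).indicator hsm), lintegral_indicator hsm,
          Measure.restrict_restrict hsm, Set.inter_eq_left.2 fun x hx => hx.1,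
          lintegral_const_mul' _ _ (by norm_num), lintegral_finsetSum' _ fun b _ =>
            Finset.aemeasurable_fun_sum _ fun j _ => hmeas b j]
        simp_rw [lintegral_finsetSum' _ fun j _ => hmeas _ j]

/-- Fields that converge in `L²` with the right bound of the energy are recovery sequences. -/
theorem EnergyBound.isRecoverySequence {A : ℝ} (ha : 0 < a) (hA : 0 < A) (hΩ : IsCompact Ω)
    (h0 : volume (frontier Ω) = 0) (hE : EnergyBound a m u)
    (hu : Tendsto (fun n : ℕ+ => ∫⁻ x in Ω, ‖u n (cell (a / ((n : ℕ) : ℝ)) x) - m.toFun x‖ₑ ^ 2)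
      atTop (𝓝 0)) : IsRecoverySequence a A Ω (fun n x => u n x.1) m := by
  refine ⟨fun f hf => ⟨?_, fun i => ?_⟩, hE.limsup_le ha hA hΩ⟩
  · exact tendsto_integral_inner_of_lintegral (fun n => memLp_interp ha hΩ n _) m.memLp_toFun hf
      (hE.tendsto_interp ha hΩ h0 hu)
  · exact tendsto_integral_inner_of_lintegral (fun n => memLp_interpPartial ha hΩ n _ i)
      (m.memLp_pd i) hf (hE.tendsto_interpPartial ha hΩ h0 hu i)

theorem IsRecoverySequence.congr {A : ℝ} {μ : ∀ n, SpinField a Ω n} {m m' : SobolevH1 Ω}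
    (hm : IsRecoverySequence a A Ω μ m) (h : m'.toFun =ᵐ[volume.restrict Ω] m.toFun)
    (hpd : m'.pd = m.pd) : IsRecoverySequence a A Ω μ m' := by
  refine ⟨hm.1.congr h hpd, ?_⟩
  have : continuumExchangeEnergy A m' = continuumExchangeEnergy A m := by
    rw [continuumExchangeEnergy, continuumExchangeEnergy, hpd]
  rw [this]
  exact hm.2

/-- A sequence of objects from approximate objects. -/
theorem exists_seq_of_eventually {U : Type*} {P : ℕ+ → U → Prop} {Q : ℝ → ℕ+ → U → Prop}
    (hP : ∀ n, ∃ u, P n u) (hQ : ∀ ε ε' n u, ε ≤ ε' → Q ε n u → Q ε' n u)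
    (h : ∀ ε > 0, ∀ᶠ n in atTop, ∃ u, P n u ∧ Q ε n u) :
    ∃ u : ℕ+ → U, (∀ n, P n (u n)) ∧ ∀ ε > 0, ∀ᶠ n in atTop, Q ε n (u n) := by
  classical
  -- A diagonal choice: at stage n take an object that is good at the finest level 1/(j + 1), j ≤ n,
  -- that is attained. The bound j ≤ n makes the finest level exist.
  have h1 : ∀ n : ℕ+, ∃ u, P n u ∧ ∀ j : ℕ, j ≤ n → (∃ v, P n v ∧ Q (1 / (j + 1)) n v) →
      ∃ j' : ℕ, j ≤ j' ∧ Q (1 / (j' + 1)) n u := by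
    intro n
    by_cases hj : ∃ j : ℕ, j ≤ n ∧ ∃ v, P n v ∧ Q (1 / (j + 1)) n v
    · set s := (Finset.range (n + 1)).filter fun j : ℕ => ∃ v, P n v ∧ Q (1 / (j + 1)) n v
      have hs : s.Nonempty := by
        obtain ⟨j, hj, hv⟩ := hj
        exact ⟨j, Finset.mem_filter.2 ⟨Finset.mem_range.2 (by omega), hv⟩⟩
      obtain ⟨-, v, hv, hQv⟩ := Finset.mem_filter.1 (s.max'_mem hs)
      refine ⟨v, hv, fun j hjn hjv => ⟨s.max' hs, s.le_max' j ?_, hQv⟩⟩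
      exact Finset.mem_filter.2 ⟨Finset.mem_range.2 (by omega), hjv⟩
    · obtain ⟨u, hu⟩ := hP n
      exact ⟨u, hu, fun j hjn hjv => absurd ⟨j, hjn, hjv⟩ hj⟩
  choose u hu hu2 using h1
  refine ⟨u, hu, fun ε hε => ?_⟩
  obtain ⟨j, hj⟩ := exists_nat_one_div_lt hε
  have hlarge : ∀ᶠ n : ℕ+ in atTop, j ≤ n := by
    filter_upwards [eventually_ge_atTop j.succPNat] with n hn
    rw [← PNat.coe_le_coe] at hn
    simp at hn; omega
  filter_upwards [h (1 / (j + 1)) (by positivity), hlarge] with n hn hjn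
  obtain ⟨j', hjj', hQ'⟩ := hu2 n j hjn hn
  refine hQ _ _ _ _ ?_ hQ'
  refine le_trans ?_ hj.le
  gcongr

end Criterion

/-! ### Averages over translations of the lattice -/

/-- The half-open lattice cell with lowest corner `0`. -/
def unitCell (h : ℝ) : Set E3 := {t | cell h t = 0}

theorem measurableSet_unitCell (h : ℝ) : MeasurableSet (unitCell h) :=
  measurable_cell h (measurableSet_singleton 0)

theorem volume_unitCell {h : ℝ} (hh : 0 < h) : volume (unitCell h) = ENNReal.ofReal (h ^ 3) :=
  volume_cell_eq hh 0

theorem norm_le_of_mem_unitCell {h : ℝ} (hh : 0 < h) {t : E3} (ht : t ∈ unitCell h) :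
    ‖t‖ ≤ 2 * h := by
  have h1 := norm_sub_pt_cell_le hh t
  rw [show cell h t = 0 from ht] at h1
  have : pt h 0 = 0 := by ext i; simp [pt_apply]
  rwa [this, sub_zero] at h1

/-- Unfolding: the translates of the unit cell by the lattice tile the space. A lattice sum averaged
over the offset is thus an integral over the space. -/
theorem lintegral_unitCell_tsum {h : ℝ} (hh : 0 < h) {F : E3 → ℝ≥0∞} (hF : Measurable F) :
    ∫⁻ t in unitCell h, ∑' k, F (pt h k + t) = ∫⁻ x, F x := by
  have h0 : ∀ k, Measurable fun t => F (pt h k + t) := fun k => hF.comp (measurable_const_add _)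
  rw [lintegral_tsum fun k => (h0 k).aemeasurable]
  have h1 : ∀ k, ∫⁻ t in unitCell h, F (pt h k + t) = ∫⁻ x in {x | cell h x = k}, F x := by
    intro k
    simp_rw [add_comm (pt h k)]
    rw [setLIntegral_add_right (measurableSet_unitCell h)]
    congr 2
    ext x
    have h2 := cell_add_pt hh (x - pt h k) k
    rw [sub_add_cancel] at h2
    simp [unitCell, h2]
  simp_rw [h1]
  rw [← lintegral_iUnion (s := fun k => {x : E3 | cell h x = k})
    (fun k => measurable_cell h (measurableSet_singleton k))]
  · have : ⋃ k, {x : E3 | cell h x = k} = Set.univ := by ext x; simp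
    rw [this, setLIntegral_univ]
  · intro k l hkl
    refine Set.disjoint_left.2 fun x hx hx' => hkl ?_
    exact hx.symm.trans hx'

theorem exists_mem_unitCell_le {h : ℝ} (hh : 0 < h) {G : E3 → ℝ≥0∞}
    (hG : AEMeasurable G (volume.restrict (unitCell h))) {B : ℝ≥0∞}
    (hB : ∫⁻ t in unitCell h, G t ≤ ENNReal.ofReal (h ^ 3) * B) : ∃ t ∈ unitCell h, G t ≤ B := by
  have hv := volume_unitCell hh
  have h0 : volume (unitCell h) ≠ 0 := by
    rw [hv]; exact (ENNReal.ofReal_pos.2 (by positivity)).ne'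
  have h1 : volume (unitCell h) ≠ ⊤ := by rw [hv]; exact ENNReal.ofReal_ne_top
  obtain ⟨t, ht, htG⟩ := exists_le_setLAverage h0 h1 hG
  refine ⟨t, ht, htG.trans ?_⟩
  rw [setLAverage_eq]
  refine ENNReal.div_le_of_le_mul ?_
  rwa [hv, mul_comm]

/-- The field of the values of `m` at the points of the lattice translated by `t`. -/
noncomputable def sample (h : ℝ) (f : E3 → E3) (t : E3) (k : Fin 3 → ℤ) : E3 := f (pt h k + t)

theorem pt_add_stp (h : ℝ) (k : Fin 3 → ℤ) (i : Fin 3) : pt h (k + stp i) = pt h k + h • bz i := by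
  rw [pt_add, pt_stp]

theorem lipschitz_infDist (S : Set E3) (x y : E3) :
    Metric.infDist x S ≤ Metric.infDist y S + dist x y :=
  Metric.infDist_le_infDist_add_dist

/-- On average, the energy of the translated samples at some depth is bounded by the Dirichlet
energy. -/
theorem SobolevH1.lintegral_unitCell_dq_le {Ω : Set E3} (hΩ : IsCompact Ω) (m : SobolevH1 Ω)
    (hm : Measurable m.toFun) {h : ℝ} (hh : 0 < h) (i : Fin 3) :
    ∫⁻ t in unitCell h, ∫⁻ x in {x | 5 * h < Metric.infDist x Ωᶜ}, ‖dq h (sample h m.toFun t) i x‖ₑ ^ 2 ≤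
      ENNReal.ofReal (h ^ 3) * ∫⁻ x in Ω, ‖m.pd i x‖ₑ ^ 2 := by
  set U : Set E3 := {y | h < Metric.infDist y Ωᶜ}
  have hU : IsOpen U := isOpen_lt continuous_const (Metric.continuous_infDist_pt _)
  -- The squared difference quotient of m over the step h; its integral is at most the Dirichlet
  -- energy by `SobolevH1.lintegral_sub_sq_le`. Unfolding then yields the constant one that the
  -- sharp upper bound requires.
  set F : E3 → ℝ≥0∞ := fun y => U.indicator
    (fun y => ENNReal.ofReal (h⁻¹ ^ 2) * ‖m.toFun (y + h • bz i) - m.toFun y‖ₑ ^ 2) y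
  have hF : Measurable F := by
    refine Measurable.indicator ?_ hU.measurableSet
    exact (((hm.comp (measurable_add_const _)).sub hm).enorm.pow_const 2).const_mul _
  have hint : ∫⁻ y, F y ≤ ∫⁻ x in Ω, ‖m.pd i x‖ₑ ^ 2 := by
    rw [lintegral_indicator hU.measurableSet, lintegral_const_mul' _ _ ENNReal.ofReal_ne_top]
    have h1 := m.lintegral_sub_sq_le hΩ i h hU (W := interior Ω) subset_rfl (fun x hx s hs => by
      have h2 : Metric.ball x (Metric.infDist x Ωᶜ) ⊆ Ω := fun y hy => by
        by_contra hc
        have h3 := Metric.infDist_le_dist_of_mem (x := x) (s := Ωᶜ) hc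
        rw [Metric.mem_ball, dist_comm] at hy
        linarith
      refine interior_maximal h2 Metric.isOpen_ball ?_
      rw [Metric.mem_ball, dist_eq_norm, add_sub_cancel_left, norm_smul, norm_bz, mul_one,
        Real.norm_eq_abs, abs_of_nonneg (mul_nonneg hs.1 hh.le)]
      have : h < Metric.infDist x Ωᶜ := hx
      nlinarith [hs.2])
    calc ENNReal.ofReal (h⁻¹ ^ 2) * ∫⁻ x in U, ‖m.toFun (x + h • bz i) - m.toFun x‖ₑ ^ 2
        ≤ ENNReal.ofReal (h⁻¹ ^ 2) * (ENNReal.ofReal (h ^ 2) * ∫⁻ x in Ω, ‖m.pd i x‖ₑ ^ 2) := by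
          gcongr
          exact h1.trans (by gcongr; exact interior_subset)
      _ = _ := by
          rw [← mul_assoc, ← ENNReal.ofReal_mul (by positivity), ← mul_pow,
            inv_mul_cancel₀ hh.ne']
          simp
  calc ∫⁻ t in unitCell h, ∫⁻ x in {x | 5 * h < Metric.infDist x Ωᶜ},
        ‖dq h (sample h m.toFun t) i x‖ₑ ^ 2
      ≤ ∫⁻ t in unitCell h, ∫⁻ x, F (pt h (cell h x) + t) := by
        refine setLIntegral_mono' (measurableSet_unitCell h) fun t ht => ?_
        rw [← lintegral_indicator (isOpen_lt continuous_const
          (Metric.continuous_infDist_pt _)).measurableSet]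
        refine lintegral_mono fun x => Set.indicator_apply_le' (fun hx => ?_) fun _ => zero_le
        -- Of the depth 5h, the distance to the corner of the cell takes 2h and the offset t another
        -- 2h. The remaining h is the length of the step.
        have h1 : pt h (cell h x) + t ∈ U := by
          have h2 := lipschitz_infDist Ωᶜ x (pt h (cell h x) + t)
          have h3 := dist_triangle x (pt h (cell h x)) (pt h (cell h x) + t)
          rw [dist_self_add_right] at h3
          have h4 := norm_le_of_mem_unitCell hh ht
          have h5 := dist_pt_cell_le hh x
          rw [dist_comm] at h5
          have h6 : 5 * h < Metric.infDist x Ωᶜ := hx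
          have h7 := dist_comm x (pt h (cell h x))
          change h < Metric.infDist _ _
          linarith
        simp only [F]
        rw [Set.indicator_of_mem h1, dq, sample, sample, pt_add_stp, enorm_smul, mul_pow,
          add_right_comm, Real.enorm_eq_ofReal (by positivity), ENNReal.ofReal_pow (by positivity)]
    _ = ENNReal.ofReal (h ^ 3) * ∫⁻ y, F y := by
        rw [← lintegral_unitCell_tsum hh hF, ← lintegral_const_mul' _ _ ENNReal.ofReal_ne_top]
        refine lintegral_congr fun t => ?_
        exact lintegral_cell hh fun k => F (pt h k + t)
    _ ≤ _ := by gcongr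

theorem measurable_dq_sample {h : ℝ} {f : E3 → E3} (hf : Measurable f) (i : Fin 3) :
    Measurable (Function.uncurry fun t x => dq h (sample h f t) i x) := by
  simp only [dq, sample]
  have h1 : ∀ v : Fin 3 → ℤ, Measurable fun p : E3 × E3 => f (pt h (cell h p.2 + v) + p.1) := by
    intro v
    refine hf.comp (Measurable.add ?_ measurable_fst)
    exact (measurable_comp_cell h fun k => pt h (k + v)).comp measurable_snd
  have h2 := (h1 (stp i)).sub (h1 0)
  simp only [add_zero] at h2
  exact h2.const_smul h⁻¹

theorem volume_cthickening_sdiff_tendsto {Ω : Set E3} (hΩ : IsCompact Ω) :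
    Tendsto (fun r => volume (Metric.cthickening r Ω \ Ω)) (𝓝 0) (𝓝 0) := by
  have hV : volume Ω ≠ ⊤ := hΩ.measure_ne_top
  have h1 := tendsto_measure_cthickening_of_isCompact (μ := (volume : Measure E3)) hΩ
  have h2 := ENNReal.Tendsto.sub h1 (tendsto_const_nhds (x := volume Ω)) (Or.inl hV)
  rw [tsub_self] at h2
  refine h2.congr fun r => ?_
  rw [measure_sdiff (Metric.self_subset_cthickening Ω)
    hΩ.measurableSet.nullMeasurableSet hV]

theorem tendsto_volume_strip {Ω : Set E3} (hΩ : IsCompact Ω) (h0 : volume (frontier Ω) = 0) :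
    Tendsto (fun r => volume (strip Ω r)) (𝓝 0) (𝓝 0) := by
  have := tendsto_setLIntegral_strip hΩ h0 (F := 1) (by simpa using hΩ.measure_ne_top)
  simpa using this

section

/-! ### Recovery sequences of Lipschitz fields -/

theorem exists_recoverySequence {a A : ℝ} (ha : 0 < a) (hA : 0 < A) {Ω : Set E3} (hΩ : IsCompact Ω)
    (h0 : volume (frontier Ω) = 0) (m : SobolevH1 Ω) (P : ℕ+ → ((Fin 3 → ℤ) → E3) → Prop)
    (hP : ∀ n, ∃ u, P n u) (h : ∀ ε > 0, ∀ᶠ n : ℕ+ in atTop, ∃ u, P n u ∧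
      ∑ i, ∫⁻ x in Metric.cthickening (4 * (a / ((n : ℕ) : ℝ))) Ω,
        ‖dq (a / ((n : ℕ) : ℝ)) u i x‖ₑ ^ 2 ≤ ENNReal.ofReal ((∫ x in Ω, ∑ i, ‖m.pd i x‖ ^ 2) + ε) ∧
      ∫⁻ x in Ω, ‖u (cell (a / ((n : ℕ) : ℝ)) x) - m.toFun x‖ₑ ^ 2 ≤ ENNReal.ofReal ε) :
    ∃ u : ℕ+ → (Fin 3 → ℤ) → E3, (∀ n, P n (u n)) ∧
      IsRecoverySequence a A Ω (fun n x => u n x.1) m := by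
  obtain ⟨u, hu, hQ⟩ := exists_seq_of_eventually (Q := fun ε n u =>
      ∑ i, ∫⁻ x in Metric.cthickening (4 * (a / ((n : ℕ) : ℝ))) Ω,
        ‖dq (a / ((n : ℕ) : ℝ)) u i x‖ₑ ^ 2 ≤ ENNReal.ofReal ((∫ x in Ω, ∑ i, ‖m.pd i x‖ ^ 2) + ε) ∧
      ∫⁻ x in Ω, ‖u (cell (a / ((n : ℕ) : ℝ)) x) - m.toFun x‖ₑ ^ 2 ≤ ENNReal.ofReal ε) hP
    (fun ε ε' n u hε h => ⟨h.1.trans (ENNReal.ofReal_le_ofReal (by linarith)),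
      h.2.trans (ENNReal.ofReal_le_ofReal hε)⟩) h
  refine ⟨u, hu, EnergyBound.isRecoverySequence ha hA hΩ h0 (fun ε hε => ?_) ?_⟩
  · filter_upwards [hQ ε hε] with n hn using hn.1
  · rw [ENNReal.tendsto_nhds_zero]
    intro η hη
    obtain ⟨c, hc, hcη⟩ := ENNReal.lt_iff_exists_nnreal_btwn.1 hη
    filter_upwards [hQ c (by exact_mod_cast hc)] with n hn
    refine hn.2.trans ?_
    rw [ENNReal.ofReal_coe_nnreal]
    exact hcη.le

/-- The denominators need only vary less than the vectors. This covers the norms themselves as well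
as the truncated norms max ‖v‖ (1/2). -/
theorem norm_inv_smul_sub_inv_smul_le {x y : E3} {r s : ℝ} (hr : 0 < r) (hs : 0 < s)
    (hy : ‖y‖ ≤ s) (hrs : |r - s| ≤ ‖x - y‖) :
    ‖r⁻¹ • x - s⁻¹ • y‖ ≤ 2 * r⁻¹ * ‖x - y‖ := by
  have h1 : r⁻¹ • x - s⁻¹ • y = r⁻¹ • (x - y) + (r⁻¹ - s⁻¹) • y := by
    rw [smul_sub, sub_smul]; abel
  have h2 : r⁻¹ - s⁻¹ = r⁻¹ * s⁻¹ * (s - r) := by field_simp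
  have h3 : ‖(r⁻¹ - s⁻¹) • y‖ ≤ r⁻¹ * ‖x - y‖ := by
    rw [norm_smul, h2, Real.norm_eq_abs, abs_mul, abs_of_pos (by positivity), abs_sub_comm]
    calc r⁻¹ * s⁻¹ * |r - s| * ‖y‖ ≤ r⁻¹ * s⁻¹ * ‖x - y‖ * s := by gcongr
      _ = r⁻¹ * ‖x - y‖ * (s⁻¹ * s) := by ring
      _ = r⁻¹ * ‖x - y‖ := by rw [inv_mul_cancel₀ hs.ne', mul_one]
  calc ‖r⁻¹ • x - s⁻¹ • y‖ ≤ ‖r⁻¹ • (x - y)‖ + ‖(r⁻¹ - s⁻¹) • y‖ := by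
        rw [h1]; exact norm_add_le _ _
    _ ≤ r⁻¹ * ‖x - y‖ + r⁻¹ * ‖x - y‖ := by
        gcongr
        rw [norm_smul, Real.norm_eq_abs, abs_of_pos (by positivity)]
    _ = _ := by ring

/-- Since cos α < 1, the points y + s v on the axis of the cone at y are interior to the cone, hence
to Ω, and they tend to y. A continuous field of unit norm a.e. thus has unit norm at every point of
Ω, boundary nodes included. -/
theorem HasConeProperty.subset_closure_interior {Ω : Set E3} (h : HasConeProperty Ω) :
    Ω ⊆ closure (interior Ω) := by
  obtain ⟨α, r, hα, hα2, hr, h⟩ := h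
  intro y hy
  obtain ⟨v, hv, hc⟩ := h y hy
  have hcos : Real.cos α < 1 := by
    rw [← Real.cos_zero]
    exact Real.cos_lt_cos_of_nonneg_of_le_pi le_rfl (by linarith [Real.pi_pos]) hα
  have hmem : ∀ s ∈ Set.Ioo 0 r, y + s • v ∈ interior Ω := by
    intro s hs
    rw [mem_interior]
    refine ⟨Metric.ball y r ∩ {z | Real.cos α * ‖z - y‖ < inner ℝ (z - y) v}, fun z hz =>
      hc z hz.1 (le_of_lt hz.2), Metric.isOpen_ball.inter (isOpen_lt (by fun_prop) (by fun_prop)),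
      ?_, ?_⟩
    · rw [Metric.mem_ball, dist_eq_norm, add_sub_cancel_left, norm_smul, hv, mul_one,
        Real.norm_eq_abs, abs_of_pos hs.1]
      exact hs.2
    · change Real.cos α * ‖y + s • v - y‖ < inner ℝ (y + s • v - y) v
      rw [add_sub_cancel_left, norm_smul, hv, mul_one, Real.norm_eq_abs, abs_of_pos hs.1,
        real_inner_smul_left, real_inner_self_eq_norm_sq, hv]
      nlinarith [hs.1]
  have hlim : Tendsto (fun s : ℝ => y + s • v) (𝓝[>] 0) (𝓝 y) := by
    have : Continuous fun s : ℝ => y + s • v := by fun_prop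
    have h1 := this.tendsto 0
    simp only [zero_smul, add_zero] at h1
    exact h1.mono_left nhdsWithin_le_nhds
  refine mem_closure_of_tendsto hlim ?_
  filter_upwards [Ioo_mem_nhdsGT hr] with s hs using hmem s hs

variable {a A : ℝ} {Ω : Set E3} {m : SobolevH1 Ω}

/-- A Lipschitz Sobolev field extends to a Lipschitz field on the space, which has unit norm near
`Ω` if the given one has. -/
theorem IsLipschitz.exists_extension (hΩ : IsCompact Ω) (hcone : HasConeProperty Ω)
    (hm : IsLipschitz m) : ∃ (K : NNReal) (W : E3 → E3), LipschitzWith K W ∧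
      m.toFun =ᵐ[volume.restrict Ω] W ∧
      (UnitNorm m → (∀ x ∈ Ω, ‖W x‖ = 1) ∧ ∃ r > 0, ∀ x ∈ Ω, ∀ y, dist y x ≤ r → ‖W y‖ = 1) := by
  obtain ⟨K, u, hu, hae⟩ := hm
  obtain ⟨v, hv, huv⟩ := hu.extend_finite_dimension
  set L := lipschitzExtensionConstant E3 * K
  have hae' : m.toFun =ᵐ[volume.restrict Ω] v := by
    filter_upwards [hae, ae_restrict_mem hΩ.measurableSet] with x hx hxΩ
    rw [hx, huv hxΩ]
  by_cases hunit : UnitNorm m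
  · have hv1 : ∀ x ∈ Ω, ‖v x‖ = 1 := by
      have hi : ∀ x ∈ interior Ω, ‖v x‖ = 1 := by
        have h1 : ∀ᵐ x ∂(volume.restrict (interior Ω)), ‖v x‖ = 1 := by
          refine ae_mono (Measure.restrict_mono interior_subset le_rfl) ?_
          filter_upwards [hunit, hae'] with x h1 h2
          rw [← h2, h1]
        intro x hx
        have h2 : (fun x => ‖v x‖) =ᵐ[volume.restrict (interior Ω)] fun _ => 1 := h1
        exact Measure.eqOn_open_of_ae_eq h2 isOpen_interior hv.continuous.norm.continuousOn
          continuousOn_const hx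
      have hcl : IsClosed {x | ‖v x‖ = 1} := isClosed_eq hv.continuous.norm continuous_const
      intro x hx
      exact closure_minimal hi hcl (hcone.subset_closure_interior hx)
    -- Normalization, stopped at norm 1/2: W is a unit field where ‖v‖ ≥ 1/2, which includes Ω, and
    -- remains Lipschitz where v vanishes.
    set W : E3 → E3 := fun x => (max ‖v x‖ (1 / 2))⁻¹ • v x
    have hW : ∀ x y, ‖W x - W y‖ ≤ 4 * (L * dist x y) := by
      intro x y
      have hpos : ∀ x, 0 < max ‖v x‖ (1 / 2) := fun x => lt_max_of_lt_right (by norm_num)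
      have h1 := norm_inv_smul_sub_inv_smul_le (x := v x) (y := v y) (hpos x) (hpos y)
        (le_max_left _ _) ((abs_max_sub_max_le_abs _ _ _).trans (abs_norm_sub_norm_le _ _))
      refine h1.trans ?_
      have h2 : (max ‖v x‖ (1 / 2))⁻¹ ≤ 2 := by
        rw [inv_le_comm₀ (hpos x) (by norm_num)]
        exact le_max_of_le_right (by norm_num)
      have h3 := hv.dist_le_mul x y
      rw [dist_eq_norm] at h3
      nlinarith [norm_nonneg (v x - v y)]
    have hWu : ∀ x, 1 / 2 ≤ ‖v x‖ → ‖W x‖ = 1 := by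
      intro x hx
      have : ‖v x‖ ≠ 0 := by linarith
      simp only [W]
      rw [max_eq_left hx, norm_smul, norm_inv, norm_norm, inv_mul_cancel₀ this]
    refine ⟨4 * L, W, LipschitzWith.of_dist_le_mul fun x y => ?_, ?_, fun _ => ⟨?_, ?_⟩⟩
    · rw [dist_eq_norm]
      refine (hW x y).trans_eq ?_
      push_cast; ring
    · filter_upwards [hae', ae_restrict_mem hΩ.measurableSet] with x hx hxΩ
      simp only [W]
      rw [hx, hv1 x hxΩ]
      norm_num
    · intro x hx
      exact hWu x (by rw [hv1 x hx]; norm_num)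
    -- At this distance from Ω the extension v has changed by at most 1/2, so its norm is still at
    -- least 1/2.
    · refine ⟨1 / (2 * (L + 1)), by positivity, fun x hx y hy => hWu y ?_⟩
      have h1 := hv.dist_le_mul y x
      rw [dist_eq_norm] at h1
      have h2 := norm_sub_norm_le (v x) (v y)
      rw [hv1 x hx, norm_sub_rev] at h2
      have h3 : (L : ℝ) * dist y x ≤ 1 / 2 := by
        rw [le_div_iff₀ (by positivity)] at hy
        nlinarith [dist_nonneg (x := y) (y := x), L.2]
      linarith
  · exact ⟨L, v, hv, hae', fun h => absurd h hunit⟩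

/-- At depth more than 5h some translation has at most the mean energy, hence at most the Dirichlet
energy. On the rest of the 4h-neighbourhood the quotients are bounded by the Lipschitz constant, and
the volume of this layer tends to zero. -/
theorem exists_sample_of_lipschitz (ha : 0 < a) (hΩ : IsCompact Ω) (h0 : volume (frontier Ω) = 0)
    {K : NNReal} (hW : LipschitzWith K m.toFun) {ε : ℝ} (hε : 0 < ε) :
    ∀ᶠ n : ℕ+ in atTop, ∃ t ∈ unitCell (a / ((n : ℕ) : ℝ)),
      ∑ i, ∫⁻ x in Metric.cthickening (4 * (a / ((n : ℕ) : ℝ))) Ω,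
        ‖dq (a / ((n : ℕ) : ℝ)) (sample (a / ((n : ℕ) : ℝ)) m.toFun t) i x‖ₑ ^ 2 ≤
        ENNReal.ofReal ((∫ x in Ω, ∑ i, ‖m.pd i x‖ ^ 2) + ε) ∧
      ∫⁻ x in Ω, ‖sample (a / ((n : ℕ) : ℝ)) m.toFun t (cell (a / ((n : ℕ) : ℝ)) x) -
        m.toFun x‖ₑ ^ 2 ≤ ENNReal.ofReal ε := by
  have hm : Measurable m.toFun := hW.continuous.measurable
  have hV : volume Ω ≠ ⊤ := hΩ.measure_ne_top
  have hbad : Tendsto (fun n : ℕ+ => 3 * (ENNReal.ofReal (K ^ 2) *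
      (volume (Metric.cthickening (4 * (a / ((n : ℕ) : ℝ))) Ω \ Ω) +
      volume (strip Ω (5 * (a / ((n : ℕ) : ℝ))))))) atTop (𝓝 0) := by
    have t1 := (volume_cthickening_sdiff_tendsto hΩ).comp (tendsto_spacing_mul a 4)
    have t2 := (tendsto_volume_strip hΩ h0).comp (tendsto_spacing_mul a 5)
    have t3 := ENNReal.Tendsto.const_mul (a := ENNReal.ofReal (K ^ 2)) (t1.add t2)
      (Or.inr ENNReal.ofReal_ne_top)
    have t4 := ENNReal.Tendsto.const_mul (a := 3) t3 (Or.inr (by norm_num))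
    simpa using t4
  have hclose : Tendsto (fun n : ℕ+ => ENNReal.ofReal ((K * (4 * (a / ((n : ℕ) : ℝ)))) ^ 2) *
      volume Ω) atTop (𝓝 0) := by
    have t1 := ((tendsto_spacing_mul a 4).const_mul (K : ℝ)).pow 2
    have t2 := ENNReal.Tendsto.mul_const (b := volume Ω) (ENNReal.tendsto_ofReal t1) (Or.inr hV)
    simpa using t2
  have hε' : (0 : ℝ≥0∞) < ENNReal.ofReal ε := ENNReal.ofReal_pos.2 hε
  filter_upwards [hbad.eventually_le_const hε', hclose.eventually_le_const hε'] with n hn1 hn2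
  have hh := spacing_pos ha n
  set h := a / ((n : ℕ) : ℝ)
  set G : Set E3 := {x | 5 * h < Metric.infDist x Ωᶜ}
  have hGm : MeasurableSet G :=
    (isOpen_lt continuous_const (Metric.continuous_infDist_pt _)).measurableSet
  have hGi : ∀ i, Measurable fun t => ∫⁻ x in G, ‖dq h (sample h m.toFun t) i x‖ₑ ^ 2 := fun i =>
    ((measurable_dq_sample hm i).enorm.pow_const 2).lintegral_prod_right'
  obtain ⟨t, ht, hB⟩ := exists_mem_unitCell_le hh
    (G := fun t => ∑ i, ∫⁻ x in G, ‖dq h (sample h m.toFun t) i x‖ₑ ^ 2)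
    (Finset.measurable_fun_sum _ fun i _ => hGi i).aemeasurable
    (B := ∑ i, ∫⁻ x in Ω, ‖m.pd i x‖ₑ ^ 2) (by
      rw [lintegral_finsetSum _ fun i _ => hGi i, Finset.mul_sum]
      exact Finset.sum_le_sum fun i _ => m.lintegral_unitCell_dq_le hΩ hm hh i)
  refine ⟨t, ht, ?_, ?_⟩
  · have hD : ∑ i, ∫⁻ x in Ω, ‖m.pd i x‖ₑ ^ 2 = ENNReal.ofReal (∫ x in Ω, ∑ i, ‖m.pd i x‖ ^ 2) := by
      rw [m.integral_sum_eq, ENNReal.ofReal_sum_of_nonneg fun i _ =>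
        integral_nonneg fun x => by positivity]
      exact Finset.sum_congr rfl fun i _ => (ofReal_integral_norm_sq (m.memLp_pd i)).symm
    rw [ENNReal.ofReal_add (integral_nonneg fun x => Finset.sum_nonneg fun i _ => by positivity)
      hε.le, ← hD]
    have hpt : ∀ i x, ‖dq h (sample h m.toFun t) i x‖ₑ ^ 2 ≤ ENNReal.ofReal (K ^ 2) := by
      intro i x
      rw [← ofReal_norm, ← ENNReal.ofReal_pow (norm_nonneg _)]
      refine ENNReal.ofReal_le_ofReal (pow_le_pow_left₀ (norm_nonneg _) ?_ 2)
      have h1 := hW.dist_le_mul (pt h (cell h x + stp i) + t) (pt h (cell h x) + t)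
      rw [dist_add_right, dist_pt_add_stp hh, dist_eq_norm] at h1
      rw [dq, sample, sample, norm_smul, norm_inv, Real.norm_eq_abs, abs_of_pos hh,
        inv_mul_le_iff₀ hh, mul_comm h]
      exact h1
    have hsub : Metric.cthickening (4 * h) Ω ⊆
        G ∪ ((Metric.cthickening (4 * h) Ω \ Ω) ∪ strip Ω (5 * h)) := by
      intro x hx
      by_cases hxG : x ∈ G
      · exact Or.inl hxG
      · by_cases hxΩ : x ∈ Ω
        · exact Or.inr (Or.inr ⟨hxΩ, not_lt.1 hxG⟩)
        · exact Or.inr (Or.inl ⟨hx, hxΩ⟩)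
    calc ∑ i, ∫⁻ x in Metric.cthickening (4 * h) Ω, ‖dq h (sample h m.toFun t) i x‖ₑ ^ 2
        ≤ ∑ i, ((∫⁻ x in G, ‖dq h (sample h m.toFun t) i x‖ₑ ^ 2) + ENNReal.ofReal (K ^ 2) *
          (volume (Metric.cthickening (4 * h) Ω \ Ω) + volume (strip Ω (5 * h)))) := by
          refine Finset.sum_le_sum fun i _ => ?_
          refine (lintegral_mono_set hsub).trans ((lintegral_union_le _ _ _).trans ?_)
          gcongr
          refine (lintegral_mono (hpt i)).trans ?_
          rw [setLIntegral_const]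
          gcongr
          exact measure_union_le _ _
      _ = (∑ i, ∫⁻ x in G, ‖dq h (sample h m.toFun t) i x‖ₑ ^ 2) + 3 * (ENNReal.ofReal (K ^ 2) *
          (volume (Metric.cthickening (4 * h) Ω \ Ω) + volume (strip Ω (5 * h)))) := by
          rw [Finset.sum_add_distrib]; simp
      _ ≤ _ := add_le_add hB hn1
  · refine le_trans ?_ hn2
    rw [← setLIntegral_const]
    refine lintegral_mono fun x => ?_
    rw [← ofReal_norm, ← ENNReal.ofReal_pow (norm_nonneg _)]
    refine ENNReal.ofReal_le_ofReal (pow_le_pow_left₀ (norm_nonneg _) ?_ 2)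
    have h1 := hW.dist_le_mul (pt h (cell h x) + t) x
    rw [dist_eq_norm] at h1
    refine h1.trans ?_
    gcongr
    have h3 := dist_triangle (pt h (cell h x) + t) (pt h (cell h x)) x
    rw [dist_self_add_left] at h3
    have h4 := dist_pt_cell_le hh x
    rw [dist_comm] at h4
    linarith [norm_le_of_mem_unitCell hh ht, dist_comm x (pt h (cell h x))]

/-- No defects are needed: c = (L a)² + 1 works at every node, the 1 making c positive. -/
theorem nearAligned_of_le {L : ℝ} {u : ℕ+ → (Fin 3 → ℤ) → E3}
    (hu : ∀ (n : ℕ+) k i, ‖u n (k + stp i) - u n k‖ ≤ L * (a / ((n : ℕ) : ℝ))) :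
    NearAligned a Ω fun n x => u n x.1 := by
  refine ⟨(L * a) ^ 2 + 1, by positivity, fun _ => ∅, ⟨0, fun n => by simp⟩, ?_, fun _ => 0,
    tendsto_const_nhds, fun n x hx => absurd hx (Set.notMem_empty x)⟩
  intro n x _ y hxy
  have hn : (0 : ℝ) < ((n : ℕ) : ℝ) := by exact_mod_cast n.pos
  have h1 : ‖u n x.1 - u n y.1‖ ≤ L * (a / ((n : ℕ) : ℝ)) := by
    obtain ⟨i, hi | hi⟩ := (adj_iff _ _).1 hxy
    · rw [hi, norm_sub_rev]; exact hu n _ i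
    · rw [hi]; exact hu n _ i
  refine (pow_le_pow_left₀ (norm_nonneg _) h1 2).trans ?_
  rw [← mul_div_assoc, div_pow]
  gcongr
  linarith

/-- Lipschitz fields have near-aligned recovery sequences, of unit norm if the field has. -/
theorem IsLipschitz.exists_recoverySequence (ha : 0 < a) (hA : 0 < A) (hΩ : IsCompact Ω)
    (h0 : volume (frontier Ω) = 0) (hcone : HasConeProperty Ω) (hm : IsLipschitz m) :
    ∃ μ : ∀ n, SpinField a Ω n, NearAligned a Ω μ ∧ (UnitNorm m → UnitSpins a Ω μ) ∧
      IsRecoverySequence a A Ω μ m := by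
  obtain ⟨K, W, hW, hae, hunit⟩ := hm.exists_extension hΩ hcone
  let m' : SobolevH1 Ω := ⟨W, m.pd, m.memLp_toFun.ae_eq hae, m.memLp_pd, fun φ h1 h2 h3 i => by
    rw [← m.integral_by_parts φ h1 h2 h3 i]
    refine integral_congr_ae ?_
    filter_upwards [hae] with x hx
    rw [hx]⟩
  have hstep : ∀ (n : ℕ+) t k i, ‖sample (a / ((n : ℕ) : ℝ)) W t (k + stp i) -
      sample (a / ((n : ℕ) : ℝ)) W t k‖ ≤ K * (a / ((n : ℕ) : ℝ)) := by
    intro n t k i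
    have h1 := hW.dist_le_mul (pt (a / ((n : ℕ) : ℝ)) (k + stp i) + t)
      (pt (a / ((n : ℕ) : ℝ)) k + t)
    rwa [dist_add_right, dist_pt_add_stp (spacing_pos ha n), dist_eq_norm] at h1
  obtain ⟨u, hu, hr⟩ := _root_.exists_recoverySequence ha hA hΩ h0 m'
    (fun n u => (∀ k i, ‖u (k + stp i) - u k‖ ≤ K * (a / ((n : ℕ) : ℝ))) ∧
      (UnitNorm m → ∀ k, pt (a / ((n : ℕ) : ℝ)) k ∈ Ω → ‖u k‖ = 1))
    (fun n => ⟨sample (a / ((n : ℕ) : ℝ)) W 0, hstep n 0, fun hu k hk => by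
      rw [sample, add_zero]; exact (hunit hu).1 _ hk⟩) (fun ε hε => by
      -- The translated node may lie outside Ω, but by at most 2h, where the extension still has
      -- unit norm.
      have hev : ∀ᶠ n : ℕ+ in atTop, UnitNorm m → ∀ t ∈ unitCell (a / ((n : ℕ) : ℝ)), ∀ k,
          pt (a / ((n : ℕ) : ℝ)) k ∈ Ω → ‖sample (a / ((n : ℕ) : ℝ)) W t k‖ = 1 := by
        by_cases hU : UnitNorm m
        · obtain ⟨r, hr, hrW⟩ := (hunit hU).2
          filter_upwards [(tendsto_spacing_mul a 2).eventually_le_const hr] with n hn _ t ht k hk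
          refine hrW _ hk _ ?_
          rw [dist_self_add_left]
          exact (norm_le_of_mem_unitCell (spacing_pos ha n) ht).trans hn
        · exact Eventually.of_forall fun n h => absurd h hU
      filter_upwards [exists_sample_of_lipschitz ha hΩ h0 (m := m') hW hε, hev] with n hn hn2
      obtain ⟨t, ht, h1, h2⟩ := hn
      exact ⟨_, ⟨hstep n t, fun hU => hn2 hU t ht⟩, h1, h2⟩)
  exact ⟨_, nearAligned_of_le fun n => (hu n).1, fun hU n x => (hu n).2 hU _ x.2,
    hr.congr hae rfl⟩

end

/-! ### The boundary and the singular curves -/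

/-- A C¹ image of the plane has Hausdorff dimension at most 2, and Lebesgue measure is absolutely
continuous with respect to the Hausdorff measure of dimension 3. -/
theorem volume_range_eq_zero {φ : EuclideanSpace ℝ (Fin 2) → E3} (hφ : ContDiff ℝ 1 φ) :
    volume (Set.range φ) = 0 := by
  have h1 : dimH (Set.range φ) < ((3 : NNReal) : ℝ≥0∞) := by
    refine hφ.dimH_range_le.trans_lt ?_
    rw [finrank_euclideanSpace_fin]
    norm_num
  have h2 := hausdorffMeasure_of_dimH_lt h1
  have h3 : (volume : Measure E3) ≪ μH[((3 : NNReal) : ℝ)] := by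
    have h4 := isAddHaarMeasure_hausdorffMeasure (E := E3)
    rw [finrank_euclideanSpace_fin] at h4
    have h5 : (μH[((3 : NNReal) : ℝ)] : Measure E3) = μH[((3 : ℕ) : ℝ)] := by norm_num
    rw [h5]
    exact Measure.absolutelyContinuous_isAddHaarMeasure _ _
  exact h3 h2

theorem HasPiecewiseC1Boundary.volume_frontier {Ω : Set E3} (h : HasPiecewiseC1Boundary Ω) :
    volume (frontier Ω) = 0 := by
  obtain ⟨⟨N, φ, hφ, hcov⟩, -⟩ := h
  refine measure_mono_null hcov (measure_iUnion_null fun j => ?_)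
  exact measure_mono_null (Set.image_subset_range _ _) (volume_range_eq_zero (hφ j))

theorem volume_closedBall_le (x : E3) {r : ℝ} (hr : 0 ≤ r) :
    volume (Metric.closedBall x r) ≤ ENNReal.ofReal (5 * r ^ 3) := by
  rw [EuclideanSpace.volume_closedBall_fin_three, ← ENNReal.ofReal_pow hr,
    ← ENNReal.ofReal_mul (by positivity)]
  refine ENNReal.ofReal_le_ofReal ?_
  have h1 := Real.pi_lt_d2
  have h2 : 0 ≤ r ^ 3 := by positivity
  nlinarith

/-- The tube of radius `r` around a `C¹` curve has volume of order `r²`. -/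
theorem exists_volume_cthickening_curve_le {γ : ℝ → E3} (hγ : ContDiff ℝ 1 γ) :
    ∃ C : ℝ, 0 ≤ C ∧ ∀ r ∈ Set.Ioc (0 : ℝ) 1,
      volume (Metric.cthickening r (γ '' Set.Icc 0 1)) ≤ ENNReal.ofReal (C * r ^ 2) := by
  obtain ⟨L, hL⟩ := hγ.contDiffOn.exists_lipschitzOnWith one_ne_zero (convex_Icc (0 : ℝ) 1)
    isCompact_Icc
  refine ⟨2 * (5 * (L + 2) ^ 3), by positivity, fun r hr => ?_⟩
  have hr0 := hr.1
  set N := ⌈1 / r⌉₊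
  have hN : 1 / r ≤ N := Nat.le_ceil _
  have hN0 : (0 : ℝ) < N := (by positivity : (0 : ℝ) < 1 / r).trans_le hN
  -- About 1/r points of the curve are r-dense in parameter. The tube is covered by as many balls of
  -- radius (L + 2) r, with total volume of order r³ / r = r².
  have hcov : Metric.cthickening r (γ '' Set.Icc 0 1) ⊆
      ⋃ j ∈ Finset.range N, Metric.closedBall (γ (j / N)) ((L + 2) * r) := by
    intro x hx
    rw [(isCompact_Icc.image hγ.continuous).cthickening_eq_biUnion_closedBall hr0.le] at hx
    simp only [Set.mem_iUnion] at hx ⊢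
    obtain ⟨_, ⟨t, ht, rfl⟩, hxt⟩ := hx
    obtain ⟨j, hj, hjt⟩ : ∃ j ∈ Finset.range N, |t - j / N| ≤ r := by
      have hr1 : 1 / (N : ℝ) ≤ r := by rw [div_le_comm₀ hN0 hr0]; exact hN
      by_cases h1 : t < 1
      · refine ⟨⌊t * N⌋₊, Finset.mem_range.2 ?_, ?_⟩
        · rw [Nat.floor_lt (mul_nonneg ht.1 hN0.le)]
          nlinarith
        · have h2 := Nat.floor_le (mul_nonneg ht.1 hN0.le)
          have h3 := Nat.lt_floor_add_one (t * N)
          refine le_trans ?_ hr1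
          rw [abs_of_nonneg, sub_le_iff_le_add, ← add_div, le_div_iff₀ hN0]
          · linarith
          · rw [sub_nonneg, div_le_iff₀ hN0]; exact h2
      · have ht1 : t = 1 := le_antisymm ht.2 (not_lt.1 h1)
        have hNpos : 0 < N := by exact_mod_cast hN0
        refine ⟨N - 1, Finset.mem_range.2 (by omega), le_trans (le_of_eq ?_) hr1⟩
        rw [Nat.cast_sub hNpos, ht1]
        push_cast
        rw [show (1 : ℝ) - (N - 1) / N = 1 / N by field_simp; ring, abs_of_pos (by positivity)]
    refine ⟨j, hj, ?_⟩
    have hj' : (j : ℝ) / N ∈ Set.Icc (0 : ℝ) 1 := by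
      refine ⟨by positivity, ?_⟩
      rw [div_le_one hN0]
      exact_mod_cast (Finset.mem_range.1 hj).le
    have h1 := hL.dist_le_mul t ht _ hj'
    rw [Real.dist_eq] at h1
    rw [Metric.mem_closedBall] at hxt ⊢
    have h2 := dist_triangle x (γ t) (γ (j / N))
    have h3 : (L : ℝ) * |t - j / N| ≤ L * r := by gcongr
    nlinarith
  refine (measure_mono hcov).trans ((measure_biUnion_finset_le _ _).trans ?_)
  calc ∑ j ∈ Finset.range N, volume (Metric.closedBall (γ (j / N)) ((L + 2) * r))
      ≤ ∑ j ∈ Finset.range N, ENNReal.ofReal (5 * ((L + 2) * r) ^ 3) :=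
        Finset.sum_le_sum fun j _ => volume_closedBall_le _ (by positivity)
    _ = ENNReal.ofReal (N * (5 * ((L + 2) * r) ^ 3)) := by
        rw [Finset.sum_const, Finset.card_range, nsmul_eq_mul,
          ENNReal.ofReal_mul (p := (N : ℝ)) (by positivity), ENNReal.ofReal_natCast]
    _ ≤ _ := by
        refine ENNReal.ofReal_le_ofReal ?_
        have h1 : (N : ℝ) ≤ 2 / r := by
          have h1 := Nat.ceil_lt_add_one (by positivity : 0 ≤ 1 / r)
          have h2 : 1 ≤ 1 / r := by rw [le_div_iff₀ hr0]; linarith [hr.2]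
          have h3 : 2 / r = 2 * (1 / r) := by ring
          linarith
        calc (N : ℝ) * (5 * ((L + 2) * r) ^ 3) ≤ 2 / r * (5 * ((L + 2) * r) ^ 3) := by gcongr
          _ = _ := by field_simp

/-- The singular set of the boundary is contained in a compact set, around which tubes of radius
`r` have volume of order `r²`. -/
theorem HasPiecewiseC1Boundary.exists_singular {Ω : Set E3} (h : HasPiecewiseC1Boundary Ω) :
    ∃ Γ : Set E3, IsCompact Γ ∧ Γ.Nonempty ∧ (∀ p ∈ frontier Ω, p ∉ Γ → IsC1BoundaryPoint Ω p) ∧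
      ∃ C : ℝ, 0 ≤ C ∧ ∀ r ∈ Set.Ioc (0 : ℝ) 1,
        volume (Metric.cthickening r Γ) ≤ ENNReal.ofReal (C * r ^ 2) := by
  obtain ⟨-, M, γ, hγ, hreg⟩ := h
  -- An additional constant curve keeps Γ nonempty even without singular curves, so that `infDist`
  -- to Γ is a genuine distance.
  let γ' : Option (Fin M) → ℝ → E3 := fun o => o.elim (fun _ => 0) γ
  have hγ' : ∀ o, ContDiff ℝ 1 (γ' o) := fun o => by
    cases o with
    | none => exact contDiff_const
    | some j => exact hγ j
  choose C hC hCr using fun o => exists_volume_cthickening_curve_le (hγ' o)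
  have hcomp : ∀ o, IsCompact (γ' o '' Set.Icc 0 1) := fun o =>
    isCompact_Icc.image (hγ' o).continuous
  refine ⟨⋃ o, γ' o '' Set.Icc 0 1, isCompact_iUnion hcomp,
    ⟨0, Set.mem_iUnion.2 ⟨none, 0, by simp, rfl⟩⟩, fun p hp hpΓ => hreg p hp fun hp' => hpΓ ?_,
    ∑ o, C o, Finset.sum_nonneg fun o _ => hC o, fun r hr => ?_⟩
  · obtain ⟨j, hj⟩ := Set.mem_iUnion.1 hp'
    exact Set.mem_iUnion.2 ⟨some j, hj⟩
  · have hcov : Metric.cthickening r (⋃ o, γ' o '' Set.Icc 0 1) ⊆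
        ⋃ o, Metric.cthickening r (γ' o '' Set.Icc 0 1) := by
      intro x hx
      rw [(isCompact_iUnion hcomp).cthickening_eq_biUnion_closedBall hr.1.le] at hx
      simp only [Set.mem_iUnion] at hx ⊢
      obtain ⟨y, ⟨o, hyo⟩, hxy⟩ := hx
      exact ⟨o, Metric.mem_cthickening_of_dist_le _ _ _ _ hyo hxy⟩
    refine (measure_mono hcov).trans ((measure_iUnion_fintype_le _ _).trans ?_)
    rw [Finset.sum_mul, ENNReal.ofReal_sum_of_nonneg fun o _ => mul_nonneg (hC o) (sq_nonneg _)]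
    exact Finset.sum_le_sum fun o _ => hCr o r hr

section

/-! ### Cut-off functions of small energy -/

/-- A cut-off that vanishes at distance at most `r` of `Γ`, and is `1` at distance at least `2r`. -/
noncomputable def ramp (Γ : Set E3) (r : ℝ) (x : E3) : ℝ :=
  min 1 (max 0 (Metric.infDist x Γ / r - 1))

theorem ramp_mem_Icc (Γ : Set E3) (r : ℝ) (x : E3) : ramp Γ r x ∈ Set.Icc (0 : ℝ) 1 :=
  ⟨le_min zero_le_one (le_max_left _ _), min_le_left _ _⟩

theorem continuous_ramp (Γ : Set E3) (r : ℝ) : Continuous (ramp Γ r) := by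
  have := Metric.continuous_infDist_pt Γ
  unfold ramp
  fun_prop

variable {Γ : Set E3} {r : ℝ} {x y : E3}

theorem ramp_eq_zero (hr : 0 < r) (hx : Metric.infDist x Γ ≤ r) : ramp Γ r x = 0 := by
  have : Metric.infDist x Γ / r ≤ 1 := by rwa [div_le_one hr]
  rw [ramp, max_eq_left (by linarith), min_eq_right zero_le_one]

theorem ramp_eq_one (hr : 0 < r) (hx : 2 * r ≤ Metric.infDist x Γ) : ramp Γ r x = 1 := by
  have : 2 ≤ Metric.infDist x Γ / r := by rwa [le_div_iff₀ hr]
  rw [ramp, max_eq_right (by linarith), min_eq_left (by linarith)]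

theorem abs_ramp_sub_le (hr : 0 < r) (x y : E3) : |ramp Γ r x - ramp Γ r y| ≤ dist x y / r := by
  have h1 : |Metric.infDist x Γ - Metric.infDist y Γ| ≤ dist x y := by
    rw [abs_le]
    have h1 := lipschitz_infDist Γ x y
    have h2 := lipschitz_infDist Γ y x
    rw [dist_comm] at h2
    constructor <;> linarith
  calc |ramp Γ r x - ramp Γ r y|
      ≤ |max 0 (Metric.infDist x Γ / r - 1) - max 0 (Metric.infDist y Γ / r - 1)| := by
        refine (abs_min_sub_min_le_max _ _ _ _).trans_eq ?_
        rw [sub_self, abs_zero, max_eq_right (abs_nonneg _)]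
    _ ≤ |(Metric.infDist x Γ / r - 1) - (Metric.infDist y Γ / r - 1)| := by
        simp only [max_comm (0 : ℝ)]
        exact abs_max_sub_max_le_abs _ _ _
    _ = |Metric.infDist x Γ - Metric.infDist y Γ| / r := by
        rw [sub_sub_sub_cancel_right, ← sub_div, abs_div, abs_of_pos hr]
    _ ≤ _ := by gcongr

theorem ramp_ne_imp (hr : 0 < r) {z : E3} {e : ℝ} (her : e ≤ r / 2) (hx : dist x z ≤ e)
    (hy : dist y z ≤ e) (hne : ramp Γ r x - ramp Γ r y ≠ 0) :
    r / 2 ≤ Metric.infDist z Γ ∧ Metric.infDist z Γ ≤ 3 * r := by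
  have h1 := lipschitz_infDist Γ x z
  have h2 := lipschitz_infDist Γ y z
  have h3 := lipschitz_infDist Γ z x
  have h4 := lipschitz_infDist Γ z y
  rw [dist_comm] at h3 h4
  constructor
  · by_contra! hc
    refine hne ?_
    rw [ramp_eq_zero hr (by linarith), ramp_eq_zero hr (by linarith), sub_self]
  · by_contra! hc
    refine hne ?_
    rw [ramp_eq_one hr (by linarith), ramp_eq_one hr (by linarith), sub_self]

theorem sq_sum_eq_of_pairwise {ι : Type*} (s : Finset ι) (f : ι → ℝ)
    (h : ∀ j ∈ s, ∀ k ∈ s, f j ≠ 0 → f k ≠ 0 → j = k) : (∑ j ∈ s, f j) ^ 2 = ∑ j ∈ s, f j ^ 2 := by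
  by_cases h0 : ∃ j ∈ s, f j ≠ 0
  · obtain ⟨j, hj, hfj⟩ := h0
    have hz : ∀ k ∈ s, k ≠ j → f k = 0 := fun k hk hkj => by
      by_contra hfk
      exact hkj (h k hk j hj hfk hfj)
    rw [Finset.sum_eq_single_of_mem j hj hz, Finset.sum_eq_single_of_mem j hj fun k hk hkj => by
      rw [hz k hk hkj]; norm_num]
  · push Not at h0
    rw [Finset.sum_eq_zero h0, Finset.sum_eq_zero fun j hj => by rw [h0 j hj]; norm_num]
    norm_num

/-- A set with tubes of volume O(r²) has zero capacity for the Dirichlet energy. The cut-off is the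
mean of J ramps at the scales s j = r₀ / 8^j. One ramp has energy at most s⁻² times the volume of a
tube of radius 3s, that is 9C, whatever the scale. The ramps vary in disjoint annuli, so the energy
of their mean is at most J · 9C / J² = 9C / J. -/
theorem exists_cutoff (hΓ : IsCompact Γ) (hΓne : Γ.Nonempty) {C : ℝ} (hC : 0 ≤ C)
    (htube : ∀ r ∈ Set.Ioc (0 : ℝ) 1, volume (Metric.cthickening r Γ) ≤ ENNReal.ofReal (C * r ^ 2))
    {ε ρ : ℝ} (hε : 0 < ε) (hρ : 0 < ρ) :
    ∃ η : E3 → ℝ, Continuous η ∧ (∀ x, η x ∈ Set.Icc (0 : ℝ) 1) ∧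
      (∃ r > 0, ∀ x, Metric.infDist x Γ ≤ r → η x = 0) ∧ (∀ x, ρ ≤ Metric.infDist x Γ → η x = 1) ∧
      ∃ h₀ > 0, ∀ h ∈ Set.Ioo 0 h₀, ∀ i, ∫⁻ x, ‖η (pt h (cell h x + stp i)) - η (pt h (cell h x))‖ₑ ^ 2
        ≤ ENNReal.ofReal (h ^ 2 * ε) := by
  obtain ⟨J, hJ⟩ := exists_nat_gt (9 * C / ε)
  have hJ0 : (0 : ℝ) < J := lt_of_le_of_lt (by positivity) hJ
  have hJpos : 0 < J := by exact_mod_cast hJ0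
  -- This makes 2 s j ≤ ρ, so every ramp is 1 at distance ρ, and 3 s j ≤ 1, where the bound on the
  -- tubes applies.
  set r₀ := min ρ 1 / 4
  have hr₀ : 0 < r₀ := by positivity
  let s : ℕ → ℝ := fun j => r₀ / 8 ^ j
  have hs : ∀ j, 0 < s j := fun j => by positivity
  have hs_anti : ∀ {j k}, j ≤ k → s k ≤ s j := fun {j k} hjk => by
    simp only [s]
    gcongr
    norm_num
  have hs_lt : ∀ {j k}, j < k → 8 * s k ≤ s j := fun {j k} hjk => by
    have h1 : s (j + 1) = s j / 8 := by simp only [s, pow_succ]; field_simp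
    have h2 := hs_anti (Nat.succ_le_of_lt hjk)
    rw [Nat.succ_eq_add_one, h1] at h2
    linarith
  have hs0 : ∀ j, s j ≤ r₀ := fun j => by simpa [s] using hs_anti (Nat.zero_le j)
  refine ⟨fun x => (J : ℝ)⁻¹ * ∑ j ∈ Finset.range J, ramp Γ (s j) x, ?_, fun x => ⟨?_, ?_⟩,
    ⟨s J, hs J, fun x hx => ?_⟩, fun x hx => ?_, s J / 8, by have := hs J; positivity,
    fun h hh i => ?_⟩
  · exact continuous_const.mul (continuous_finsetSum _ fun j _ => continuous_ramp Γ (s j))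
  · exact mul_nonneg (by positivity) (Finset.sum_nonneg fun j _ => (ramp_mem_Icc Γ _ x).1)
  · rw [inv_mul_le_iff₀ hJ0, mul_one]
    refine (Finset.sum_le_sum fun j _ => (ramp_mem_Icc Γ (s j) x).2).trans_eq ?_
    simp
  · dsimp only
    rw [Finset.sum_eq_zero fun j hj => ramp_eq_zero (hs j)
      (hx.trans (hs_anti (Finset.mem_range.1 hj).le)), mul_zero]
  · have h1 : ∀ j ∈ Finset.range J, ramp Γ (s j) x = 1 := fun j _ => ramp_eq_one (hs j) (by
      have h1 := hs0 j
      have h2 := min_le_left ρ 1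
      simp only [r₀] at h1
      linarith)
    dsimp only
    rw [Finset.sum_congr rfl h1]
    simp [hJ0.ne']
  · have hh0 := hh.1
    set a : ℕ → E3 → ℝ := fun j x => ramp Γ (s j) (pt h (cell h x + stp i)) -
      ramp Γ (s j) (pt h (cell h x))
    have hd : ∀ x, dist (pt h (cell h x)) x ≤ 3 * h ∧ dist (pt h (cell h x + stp i)) x ≤ 3 * h := by
      intro x
      have h1 := dist_pt_cell_le hh0 x
      rw [dist_comm] at h1
      have h2 := dist_triangle (pt h (cell h x + stp i)) (pt h (cell h x)) x
      rw [dist_pt_add_stp hh0] at h2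
      constructor <;> linarith
    have hsmall : ∀ j ∈ Finset.range J, 3 * h ≤ s j / 2 := fun j hj => by
      have h1 := hs_anti (Finset.mem_range.1 hj).le
      linarith [hh.2]
    have hne : ∀ x, ∀ j ∈ Finset.range J, a j x ≠ 0 →
        s j / 2 ≤ Metric.infDist x Γ ∧ Metric.infDist x Γ ≤ 3 * s j := fun x j hj hja =>
      ramp_ne_imp (hs j) (hsmall j hj) (hd x).2 (hd x).1 hja
    -- The j-th ramp changes across the cell of x only if s j / 2 ≤ dist(x, Γ) ≤ 3 s j. For distinct
    -- scales, with ratio at least 8, these ranges are disjoint, since 3/8 < 1/2.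
    have hdisj : ∀ x, ∀ j ∈ Finset.range J, ∀ k ∈ Finset.range J, a j x ≠ 0 → a k x ≠ 0 → j = k := by
      intro x j hj k hk hja hka
      have h1 := hne x j hj hja
      have h2 := hne x k hk hka
      rcases lt_trichotomy j k with hjk | hjk | hjk
      · linarith [hs_lt hjk, hs k, h1.1, h2.2]
      · exact hjk
      · linarith [hs_lt hjk, hs j, h2.1, h1.2]
    have hpt : ∀ x, ‖(J : ℝ)⁻¹ * ∑ j ∈ Finset.range J, ramp Γ (s j) (pt h (cell h x + stp i)) -
        (J : ℝ)⁻¹ * ∑ j ∈ Finset.range J, ramp Γ (s j) (pt h (cell h x))‖ₑ ^ 2 ≤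
        ∑ j ∈ Finset.range J, (Metric.cthickening (3 * s j) Γ).indicator
          (fun _ => ENNReal.ofReal ((J : ℝ)⁻¹ ^ 2 * (h / s j) ^ 2)) x := by
      intro x
      rw [← mul_sub, ← Finset.sum_sub_distrib, ← ofReal_norm, ← ENNReal.ofReal_pow (norm_nonneg _),
        Real.norm_eq_abs, sq_abs, mul_pow]
      have h1 := sq_sum_eq_of_pairwise (Finset.range J) (fun j => a j x) (hdisj x)
      simp only [a] at h1
      rw [h1, Finset.mul_sum, ENNReal.ofReal_sum_of_nonneg fun j _ => by positivity]
      refine Finset.sum_le_sum fun j hj => ?_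
      by_cases hja : a j x = 0
      · simp only [a] at hja
        rw [hja]
        simp
      · obtain ⟨y, hy, hxy⟩ := hΓ.exists_infDist_eq_dist hΓne x
        rw [Set.indicator_of_mem (Metric.mem_cthickening_of_dist_le x y _ _ hy
          (hxy ▸ (hne x j hj hja).2))]
        refine ENNReal.ofReal_le_ofReal ?_
        have h2 := abs_ramp_sub_le (Γ := Γ) (hs j) (pt h (cell h x + stp i)) (pt h (cell h x))
        rw [dist_pt_add_stp hh0] at h2
        have h3 := pow_le_pow_left₀ (abs_nonneg _) h2 2
        rw [sq_abs] at h3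
        gcongr
    refine (lintegral_mono hpt).trans ?_
    have hcm : ∀ j, MeasurableSet (Metric.cthickening (3 * s j) Γ) := fun j =>
      Metric.isClosed_cthickening.measurableSet
    rw [lintegral_finsetSum _ fun j _ => measurable_const.indicator (hcm j)]
    simp_rw [lintegral_indicator_const (hcm _)]
    calc ∑ j ∈ Finset.range J, ENNReal.ofReal ((J : ℝ)⁻¹ ^ 2 * (h / s j) ^ 2) *
          volume (Metric.cthickening (3 * s j) Γ)
        ≤ ∑ j ∈ Finset.range J, ENNReal.ofReal ((J : ℝ)⁻¹ ^ 2 * (9 * C * h ^ 2)) := by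
          refine Finset.sum_le_sum fun j _ => ?_
          have h1 : 3 * s j ≤ 1 := by
            have h2 := hs0 j
            have h3 := min_le_right ρ 1
            simp only [r₀] at h2
            linarith
          refine (mul_le_mul_right (htube _ ⟨by have := hs j; positivity, h1⟩) _).trans_eq ?_
          rw [← ENNReal.ofReal_mul (by positivity)]
          congr 1
          have := (hs j).ne'
          field_simp
          ring
      _ = ENNReal.ofReal ((J : ℝ)⁻¹ * (9 * C * h ^ 2)) := by
          rw [Finset.sum_const, Finset.card_range, nsmul_eq_mul, ← ENNReal.ofReal_natCast,
            ← ENNReal.ofReal_mul (by positivity)]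
          congr 1
          field_simp
      _ ≤ ENNReal.ofReal (h ^ 2 * ε) := by
          refine ENNReal.ofReal_le_ofReal ?_
          rw [inv_mul_le_iff₀ hJ0]
          rw [div_lt_iff₀ hε] at hJ
          nlinarith [sq_nonneg h]

end

section

/-! ### A vector field that points into the domain -/

variable {Ω Γ : Set E3}

/-- With dg(v) = -1 at p, the move by s v lowers g by s to first order. The remainder costs at most
s/2, and so does a further displacement by c s; hence g stays nonpositive. Strict differentiability
makes the remainder uniform in the starting point near p. -/
theorem IsC1BoundaryPoint.exists_inward {p : E3} (hp : IsC1BoundaryPoint Ω p) :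
    ∃ (v : E3) (c ρ : ℝ), 0 < c ∧ 0 < ρ ∧ ∀ x ∈ Ω, dist x p < ρ → ∀ s, 0 ≤ s → s ≤ ρ → ∀ z,
      dist z (x + s • v) ≤ c * s → z ∈ Ω := by
  obtain ⟨g, hg, hgp, hg', hev⟩ := hp
  set ℓ := fderiv ℝ g p
  obtain ⟨w, hw⟩ : ∃ w, ℓ w ≠ 0 := by
    by_contra! hc
    exact hg' (ContinuousLinearMap.ext hc)
  set v := -(ℓ w)⁻¹ • w
  have hv : ℓ v = -1 := by simp [v, hw]
  have hstrict : HasStrictFDerivAt g ℓ p := hg.contDiffAt.hasStrictFDerivAt one_ne_zero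
  set κ : ℝ := 1 / (2 * (‖v‖ + 1))
  have hκ : 0 < κ := by positivity
  have h1 := hstrict.isLittleO.def hκ
  rw [nhds_prod_eq] at h1
  obtain ⟨ρ, hρ, hρs⟩ : ∃ ρ > 0, ∀ x y, dist x p < ρ → dist y p < ρ →
      ‖g x - g y - ℓ (x - y)‖ ≤ κ * ‖x - y‖ ∧ (x ∈ Ω ↔ g x ≤ 0) := by
    obtain ⟨U, hU, h2⟩ := (Filter.eventually_prod_self_iff (la := 𝓝 p)
      (r := fun x y => ‖g x - g y - ℓ (x - y)‖ ≤ κ * ‖x - y‖)).1 h1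
    obtain ⟨ρ, hρ, h3⟩ := Metric.mem_nhds_iff.1 (Filter.inter_mem hU hev)
    exact ⟨ρ, hρ, fun x y hx hy => ⟨h2 x (h3 hx).1 y (h3 hy).1, (h3 hx).2⟩⟩
  set c : ℝ := 1 / (2 * (‖ℓ‖ + 1))
  have hc : 0 < c := by positivity
  have hc1 : c ≤ 1 := by
    rw [div_le_one (by positivity)]
    linarith [norm_nonneg ℓ]
  -- The point z is at most s (‖v‖ + 1) away from x. The divisor ‖v‖ + 3 keeps both x and z in the
  -- ball of radius ρ around p.
  refine ⟨v, c, ρ / (‖v‖ + 3), hc, by positivity, fun x hx hxp s hs hsρ z hz => ?_⟩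
  have hnv := norm_nonneg v
  have hρ' : ρ / (‖v‖ + 3) * (‖v‖ + 3) = ρ := div_mul_cancel₀ _ (by positivity)
  have hzx : ‖z - x‖ ≤ s * (‖v‖ + 1) := by
    have h2 : z - x = (z - (x + s • v)) + s • v := by abel
    rw [dist_eq_norm] at hz
    have h3 := norm_add_le (z - (x + s • v)) (s • v)
    rw [← h2, norm_smul, Real.norm_eq_abs, abs_of_nonneg hs] at h3
    nlinarith
  have hxρ : dist x p < ρ := by nlinarith [div_pos hρ (by positivity : 0 < ‖v‖ + 3)]
  have hzρ : dist z p < ρ := by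
    have h2 := dist_triangle z x p
    rw [dist_eq_norm z x] at h2
    nlinarith
  have h2 := (hρs z x hzρ hxρ).1
  have hgx := (hρs x x hxρ hxρ).2.1 hx
  refine (hρs z x hzρ hxρ).2.2 ?_
  have h3 : ℓ (z - x) = ℓ (z - (x + s • v)) - s := by
    rw [show z - x = (z - (x + s • v)) + s • v by abel, map_add, map_smul, hv]
    simp [sub_eq_add_neg]
  have h4 : ℓ (z - (x + s • v)) ≤ s / 2 := by
    have h5 := ℓ.le_opNorm (z - (x + s • v))
    rw [dist_eq_norm] at hz
    have h6 : ‖ℓ‖ * c ≤ 1 / 2 := by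
      simp only [c]
      rw [mul_one_div, div_le_div_iff₀ (by positivity) (by norm_num)]
      linarith
    have h7 := (le_abs_self _).trans h5
    have h8 : ‖ℓ‖ * ‖z - (x + s • v)‖ ≤ ‖ℓ‖ * (c * s) := by gcongr
    nlinarith
  have h5 : κ * ‖z - x‖ ≤ s / 2 := by
    calc κ * ‖z - x‖ ≤ κ * (s * (‖v‖ + 1)) := by gcongr
      _ = s / 2 := by simp only [κ]; field_simp
  have h6 := (le_abs_self _).trans h2
  linarith

/-- Finitely many balls cover the part of ∂Ω at distance at least r from Γ, and V = ∑ χ_p v_p with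
tents χ_p. A combination of inward vectors need not be visibly inward. But the move s V(x) is the
composition of the moves s χ_p(x) v_p, each of which keeps points of Ω in Ω; the ball gained by one
of them is carried along by the others. -/
theorem exists_inward_field (hΩ : IsCompact Ω)
    (hreg : ∀ p ∈ frontier Ω, p ∉ Γ → IsC1BoundaryPoint Ω p)
    {r δ : ℝ} (hr : 0 < r) (hδ : 0 < δ) :
    ∃ (V : E3 → E3) (M L : ℝ), 0 ≤ M ∧ 0 ≤ L ∧ (∀ x, ‖V x‖ ≤ M) ∧
      (∀ x y, dist (V x) (V y) ≤ L * dist x y) ∧ (∀ x, δ < Metric.infDist x Ωᶜ → V x = 0) ∧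
      ∃ c > 0, ∃ s₀ > 0, ∀ s ∈ Set.Ioo 0 s₀, ∀ x ∈ Ω, r ≤ Metric.infDist x Γ →
        Metric.closedBall (x + s • V x) (c * s) ⊆ Ω := by
  classical
  set K : Set E3 := {p ∈ frontier Ω | r ≤ Metric.infDist p Γ}
  have hfar : IsClosed {p : E3 | r ≤ Metric.infDist p Γ} :=
    isClosed_le continuous_const (Metric.continuous_infDist_pt _)
  have hK : IsCompact K :=
    (hΩ.of_isClosed_subset isClosed_frontier hΩ.isClosed.frontier_subset).inter_right hfar
  have hKreg : ∀ p : K, IsC1BoundaryPoint Ω p.1 := fun p => hreg p.1 p.2.1 fun hpΓ => by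
    have := p.2.2
    rw [Metric.infDist_zero_of_mem hpΓ] at this
    linarith
  choose v c ρ' hc hρ' hin' using fun p : K => (hKreg p).exists_inward
  -- The minimum with δ confines the tents, hence V, to points of depth at most δ.
  set ρ : K → ℝ := fun p => min (ρ' p) δ
  have hρ : ∀ p, 0 < ρ p := fun p => lt_min (hρ' p) hδ
  have hin : ∀ p, ∀ x ∈ Ω, dist x p.1 < ρ p → ∀ s, 0 ≤ s → s ≤ ρ p → ∀ z,
      dist z (x + s • v p) ≤ c p * s → z ∈ Ω := fun p x hx hxp s hs hsρ =>
    hin' p x hx (hxp.trans_le (min_le_left _ _)) s hs (hsρ.trans (min_le_left _ _))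
  obtain ⟨T, hT⟩ := hK.elim_finite_subcover (fun p : K => Metric.ball p.1 (ρ p / 4))
    (fun p => Metric.isOpen_ball)
    (fun p hp => Set.mem_iUnion.2 ⟨⟨p, hp⟩, Metric.mem_ball_self (by linarith [hρ ⟨p, hp⟩])⟩)
  set χ : K → E3 → ℝ := fun p x => max 0 (ρ p / 2 - dist x p.1)
  have hχ0 : ∀ p x, 0 ≤ χ p x := fun p x => le_max_left _ _
  have hχ1 : ∀ p x, χ p x ≤ ρ p := fun p x =>
    max_le (hρ p).le (by linarith [hρ p, dist_nonneg (x := x) (y := p.1)])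
  have hχL : ∀ p x y, |χ p x - χ p y| ≤ dist x y := by
    intro p x y
    refine (abs_max_sub_max_le_max _ _ _ _).trans ?_
    rw [sub_self, abs_zero, max_eq_right (abs_nonneg _), sub_sub_sub_cancel_left, abs_sub_comm]
    exact abs_dist_sub_le x y p.1
  have hχs : ∀ p x, χ p x ≠ 0 → dist x p.1 < ρ p / 2 := by
    intro p x h
    by_contra! hcon
    exact h (max_eq_left (by linarith))
  set M : ℝ := ∑ p ∈ T, ρ p * ‖v p‖
  have hM : 0 ≤ M := Finset.sum_nonneg fun p _ => mul_nonneg (hρ p).le (norm_nonneg _)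
  have hMsub : ∀ I ⊆ T, ∀ x, ‖∑ p ∈ I, χ p x • v p‖ ≤ M := by
    intro I hI x
    refine (norm_sum_le _ _).trans ((Finset.sum_le_sum fun p _ => ?_).trans
      (Finset.sum_le_sum_of_subset_of_nonneg hI fun p _ _ => mul_nonneg (hρ p).le (norm_nonneg _)))
    rw [norm_smul, Real.norm_eq_abs, abs_of_nonneg (hχ0 p x)]
    gcongr
    exact hχ1 p x
  set C : ℝ := ∑ p ∈ T, c p * ρ p
  have hC : 0 ≤ C := Finset.sum_nonneg fun p _ => mul_nonneg (hc p).le (hρ p).le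
  have hCle : ∀ p ∈ T, ∀ x, c p * χ p x ≤ C := fun p hp x =>
    (mul_le_mul_of_nonneg_left (hχ1 p x) (hc p).le).trans
      (Finset.single_le_sum (f := fun p => c p * ρ p)
        (fun p _ => mul_nonneg (hc p).le (hρ p).le) hp)
  set V : E3 → E3 := fun x => ∑ p ∈ T, χ p x • v p
  obtain ⟨e, he, heρ⟩ : ∃ e > 0, ∀ p ∈ T, e ≤ ρ p := by
    rcases T.eq_empty_or_nonempty with hTe | hTne
    · exact ⟨1, one_pos, fun p hp => by simp [hTe] at hp⟩
    · obtain ⟨p, hp, hpm⟩ := T.exists_min_image ρ hTne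
      exact ⟨ρ p, hρ p, hpm⟩
  obtain ⟨c₁, hc₁, hc₁c⟩ : ∃ c₁ > 0, ∀ p ∈ T, c₁ ≤ c p := by
    rcases T.eq_empty_or_nonempty with hTe | hTne
    · exact ⟨1, one_pos, fun p hp => by simp [hTe] at hp⟩
    · obtain ⟨p, hp, hpm⟩ := T.exists_min_image c hTne
      exact ⟨c p, hc p, hpm⟩
  -- the moves along the fields `χ p • v p` are made one after another
  have hmove : ∀ s, 0 ≤ s → s ≤ 1 → s * (M + C) < e / 2 → ∀ x ∈ Ω, ∀ I ⊆ T,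
      x + s • ∑ p ∈ I, χ p x • v p ∈ Ω ∧ ∀ p ∈ I,
        Metric.closedBall (x + s • ∑ p ∈ I, χ p x • v p) (s * (c p * χ p x)) ⊆ Ω := by
    intro s hs hs1 hse x hx I
    induction I using Finset.induction_on with
    | empty => exact fun _ => ⟨by simpa using hx, fun p hp => by simp at hp⟩
    | insert q I hq ih =>
      intro hI
      have hqT : q ∈ T := hI (Finset.mem_insert_self _ _)
      have hIT : I ⊆ T := (Finset.subset_insert _ _).trans hI
      obtain ⟨h1, h2⟩ := ih hIT
      set z := x + s • ∑ p ∈ I, χ p x • v p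
      have hz : x + s • ∑ p ∈ insert q I, χ p x • v p = z + (s * χ q x) • v q := by
        rw [Finset.sum_insert hq, smul_add, smul_smul]
        simp only [z]
        abel
      rw [hz]
      have hsχ : 0 ≤ s * χ q x := mul_nonneg hs (hχ0 q x)
      have hsχρ : s * χ q x ≤ ρ q := by
        have := hχ1 q x
        nlinarith [hχ0 q x]
      -- The move q is applied to z and also to the points y of the ball already gained around z.
      -- All of them are within ρ q of q: x is within ρ q / 2, and the displacements so far add up
      -- to at most s (M + C) < e/2 ≤ ρ q / 2.
      have hstep : χ q x ≠ 0 → ∀ y ∈ Ω, dist y z ≤ s * C → ∀ w,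
          dist w (y + (s * χ q x) • v q) ≤ c q * (s * χ q x) → w ∈ Ω := by
        intro hne y hy hyz w hw
        refine hin q y hy ?_ _ hsχ hsχρ w hw
        have h3 := hχs q x hne
        have h4 : dist z x ≤ s * M := by
          rw [dist_eq_norm, add_sub_cancel_left, norm_smul, Real.norm_eq_abs, abs_of_nonneg hs]
          gcongr
          exact hMsub I hIT x
        have h5 := dist_triangle4 y z x q.1
        have h6 := heρ q hqT
        linarith
      have hmem : z + (s * χ q x) • v q ∈ Ω := by
        by_cases hne : χ q x = 0
        · simpa [hne] using h1
        · refine hstep hne z h1 (by simpa using mul_nonneg hs hC) _ ?_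
          rw [dist_self]
          exact mul_nonneg (hc q).le hsχ
      refine ⟨hmem, fun p hp w hw => ?_⟩
      rw [Metric.mem_closedBall] at hw
      by_cases hne : χ q x = 0
      · rw [hne, mul_zero, zero_smul, add_zero] at hw
        rcases Finset.mem_insert.1 hp with rfl | hpI
        · rw [hne, mul_zero, mul_zero] at hw
          rw [dist_le_zero.1 hw]
          exact h1
        · exact h2 p hpI hw
      · rcases Finset.mem_insert.1 hp with rfl | hpI
        · refine hstep hne z h1 (by simpa using mul_nonneg hs hC) w ?_
          linarith [mul_left_comm (c p) s (χ p x)]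
        · have hyz : dist (w - (s * χ q x) • v q) z ≤ s * (c p * χ p x) := by
            rwa [dist_eq_norm, sub_sub, add_comm ((s * χ q x) • v q), ← dist_eq_norm]
          refine hstep hne (w - (s * χ q x) • v q) (h2 p hpI hyz)
            (hyz.trans (mul_le_mul_of_nonneg_left (hCle p (hIT hpI) x) hs)) w ?_
          rw [sub_add_cancel, dist_self]
          exact mul_nonneg (hc q).le hsχ
  -- the points far from the regular boundary
  have hN : IsCompact ((Ω ∩ {p | r ≤ Metric.infDist p Γ}) \ ⋃ p ∈ T, Metric.ball p.1 (ρ p / 4)) :=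
    (hΩ.inter_right hfar).diff (isOpen_biUnion fun p _ => Metric.isOpen_ball)
  obtain ⟨d, hd, hdN⟩ := exists_closedBall_subset (Ω := Ω) hN (by
    rintro x ⟨⟨hxΩ, hxr⟩, hxT⟩
    by_contra hxi
    exact hxT (hT ⟨⟨subset_closure hxΩ, hxi⟩, hxr⟩))
  -- On a covering ball χ_p ≥ ρ_p / 4 ≥ e / 4 and c_p ≥ c₁, which is the origin of c₁ (e / 4). In s₀
  -- the bound by e is used in the successive moves. The bound by d serves the points off the
  -- covering balls, which have a ball of radius d in Ω to spare.
  refine ⟨V, M, ∑ p ∈ T, ‖v p‖, hM, Finset.sum_nonneg fun p _ => norm_nonneg _,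
    hMsub T subset_rfl, fun x y => ?_, fun x hx => ?_, min 1 (c₁ * (e / 4)), by positivity,
    min 1 (min (e / 2 / (M + C + 1)) (d / (M + 1))), by positivity, fun s hs x hx hxr => ?_⟩
  · rw [dist_eq_norm, ← Finset.sum_sub_distrib, Finset.sum_mul]
    refine (norm_sum_le _ _).trans (Finset.sum_le_sum fun p _ => ?_)
    rw [← sub_smul, norm_smul, Real.norm_eq_abs, mul_comm]
    gcongr
    exact hχL p x y
  · refine Finset.sum_eq_zero fun p _ => ?_
    by_cases hne : χ p x = 0
    · rw [hne, zero_smul]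
    · exfalso
      have h1 := hχs p x hne
      have h2 : Metric.infDist p.1 Ωᶜ = 0 := by
        rw [← Metric.infDist_closure]
        refine Metric.infDist_zero_of_mem ?_
        rw [closure_compl]
        exact p.2.1.2
      have h3 := lipschitz_infDist Ωᶜ x p.1
      have h4 : ρ p ≤ δ := min_le_right _ _
      linarith [hρ p]
  · have hs0 := hs.1
    have hs1 : s ≤ 1 := hs.2.le.trans (min_le_left _ _)
    have hs2 : s * (M + C) < e / 2 := by
      have h1 := hs.2.trans_le ((min_le_right _ _).trans (min_le_left _ _))
      rw [lt_div_iff₀ (by positivity)] at h1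
      nlinarith
    have hs3 : s * (M + 1) ≤ d := by
      have h1 := hs.2.le.trans ((min_le_right _ _).trans (min_le_right _ _))
      rwa [le_div_iff₀ (by positivity)] at h1
    by_cases hxT : x ∈ ⋃ p ∈ T, Metric.ball p.1 (ρ p / 4)
    · simp only [Set.mem_iUnion] at hxT
      obtain ⟨p, hp, hxp⟩ := hxT
      refine (Metric.closedBall_subset_closedBall ?_).trans
        ((hmove s hs0.le hs1 hs2 x hx T subset_rfl).2 p hp)
      rw [mul_comm]
      refine mul_le_mul_of_nonneg_left ((min_le_right _ _).trans ?_) hs0.le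
      have h1 : ρ p / 4 ≤ χ p x := by
        rw [Metric.mem_ball] at hxp
        exact le_max_of_le_right (by linarith)
      have h2 := heρ p hp
      exact mul_le_mul (hc₁c p hp) (by linarith) (by positivity) (hc p).le
    · refine (Metric.closedBall_subset_closedBall' ?_).trans
        ((hdN x ⟨⟨hx, hxr⟩, hxT⟩).trans interior_subset)
      rw [dist_self_add_left, norm_smul, Real.norm_eq_abs, abs_of_pos hs0]
      have h1 := mul_le_mul_of_nonneg_left (hMsub T subset_rfl x) hs0.le
      have h2 : min 1 (c₁ * (e / 4)) * s ≤ 1 * s := by gcongr; exact min_le_left _ _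
      linarith

end

section

/-! ### Sampling at displaced lattice points -/

theorem lintegral_cell_ball_le {h R : ℝ} (hh : 0 < h) {N : ℕ} (hRN : 4 * R ≤ N)
    {y : (Fin 3 → ℤ) → E3} (hy : ∀ k l i, h / 2 * |((k i - l i : ℤ) : ℝ)| ≤ dist (y k) (y l))
    {T W : Set E3} (hTm : MeasurableSet T)
    (hT : ∀ x ∈ T, Metric.ball (y (cell h x)) (R * h) ⊆ W) {F : E3 → ℝ≥0∞}
    (hF : AEMeasurable F (volume.restrict W)) :
    ∫⁻ x in T, ∫⁻ z in Metric.ball (y (cell h x)) (R * h), F z ≤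
      ENNReal.ofReal (h ^ 3) * (((2 * N + 1) ^ 3 : ℕ) * ∫⁻ z in W, F z) := by
  set S : Set (Fin 3 → ℤ) := cell h '' T
  set G : (Fin 3 → ℤ) → ℝ≥0∞ := fun k => ∫⁻ z in Metric.ball (y k) (R * h), F z
  calc ∫⁻ x in T, G (cell h x) ≤ ∫⁻ x in T, S.indicator G (cell h x) :=
        setLIntegral_mono' hTm fun x hx => by
          rw [Set.indicator_of_mem (Set.mem_image_of_mem _ hx)]
    _ ≤ ∫⁻ x, S.indicator G (cell h x) := setLIntegral_le_lintegral _ _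
    _ = ENNReal.ofReal (h ^ 3) * ∑' k : S, G k := by
        rw [lintegral_cell hh (S.indicator G), tsum_subtype]
    _ ≤ _ := by
        refine mul_le_mul_right (tsum_setLIntegral_ball_le hh N hRN y hy S W ?_ F hF) _
        rintro _ ⟨x, hx, rfl⟩
        exact hT x hx

variable {Ω : Set E3}

/-- Three axis moves of length at most 2h, started at points of the 3h-ball shifted by at most 4h,
stay within 12h of p. Each contributes (2h)², and the square of a sum of three terms another factor
3. -/
theorem SobolevH1.lintegral_ball_sub_sq_le (hΩ : IsCompact Ω) (m : SobolevH1 Ω)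
    (hm : Measurable m.toFun) {h : ℝ} {p z : E3} (hp : Metric.ball p (12 * h) ⊆ interior Ω)
    (hz : ‖z‖ ≤ 2 * h) :
    ∫⁻ x in Metric.ball p (3 * h), ‖m.toFun (x + z) - m.toFun x‖ₑ ^ 2 ≤
      ENNReal.ofReal (12 * h ^ 2) * ∑ i, ∫⁻ x in Metric.ball p (12 * h), ‖m.pd i x‖ₑ ^ 2 := by
  have hh : 0 ≤ h := by linarith [norm_nonneg z]
  set f := m.toFun
  set W := Metric.ball p (12 * h)
  have hzi : ∀ i, |z i| ≤ 2 * h := fun i => (abs_apply_le_norm z i).trans hz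
  have hn : ∀ i, ‖z i • bz i‖ ≤ 2 * h := fun i => by
    rw [norm_smul, norm_bz, mul_one]; exact hzi i
  have hmeas : ∀ v w : E3, Measurable fun x => ‖f (x + v) - f (x + w)‖ₑ ^ 2 := fun v w =>
    ((hm.comp (measurable_add_const _)).sub (hm.comp (measurable_add_const _))).enorm.pow_const 2
  have hstep : ∀ (v : E3) i, ‖v‖ ≤ 4 * h → ∫⁻ x in Metric.ball p (3 * h),
      ‖f (x + (v + z i • bz i)) - f (x + v)‖ₑ ^ 2 ≤
      ENNReal.ofReal (4 * h ^ 2) * ∫⁻ x in W, ‖m.pd i x‖ₑ ^ 2 := by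
    intro v i hv
    have h1 : ∀ x, ‖f (x + (v + z i • bz i)) - f (x + v)‖ₑ ^ 2 =
        (fun y => ‖f (y + z i • bz i) - f y‖ₑ ^ 2) (x + v) := fun x => by simp only [add_assoc]
    simp_rw [h1]
    rw [setLIntegral_add_right Metric.isOpen_ball.measurableSet
      (fun y => ‖f (y + z i • bz i) - f y‖ₑ ^ 2) v]
    refine (m.lintegral_sub_sq_le hΩ i (z i) (Metric.isOpen_ball.preimage (by fun_prop)) hp
      fun x hx s hs => ?_).trans ?_
    · have h2 : dist (x - v) p < 3 * h := hx
      have h3 := dist_triangle4 (x + (s * z i) • bz i) x (x - v) p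
      rw [dist_self_add_left, dist_eq_norm x (x - v), sub_sub_cancel, norm_smul, norm_bz, mul_one,
        Real.norm_eq_abs, abs_mul, abs_of_nonneg hs.1] at h3
      rw [Metric.mem_ball]
      have h4 : s * |z i| ≤ 1 * (2 * h) := mul_le_mul hs.2 (hzi i) (abs_nonneg _) zero_le_one
      linarith
    · gcongr
      have := pow_le_pow_left₀ (abs_nonneg _) (hzi i) 2
      rw [sq_abs] at this
      linarith
  have hz3 : z = z 0 • bz 0 + z 1 • bz 1 + z 2 • bz 2 := by
    ext j; fin_cases j <;> simp
  have e0 := hstep 0 0 (by simpa using hh)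
  have e1 := hstep (z 0 • bz 0) 1 ((hn 0).trans (by linarith))
  have e2 := hstep (z 0 • bz 0 + z 1 • bz 1) 2 ((norm_add_le _ _).trans
    (by linarith [hn 0, hn 1]))
  rw [← hz3] at e2
  simp only [zero_add, add_zero] at e0
  calc ∫⁻ x in Metric.ball p (3 * h), ‖f (x + z) - f x‖ₑ ^ 2
      ≤ ∫⁻ x in Metric.ball p (3 * h), (3 * ‖f (x + z 0 • bz 0) - f x‖ₑ ^ 2 +
        (3 * ‖f (x + (z 0 • bz 0 + z 1 • bz 1)) - f (x + z 0 • bz 0)‖ₑ ^ 2 +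
        3 * ‖f (x + z) - f (x + (z 0 • bz 0 + z 1 • bz 1))‖ₑ ^ 2)) := by
        refine lintegral_mono fun x => ?_
        have h1 : f (x + z) - f x = (f (x + z 0 • bz 0) - f x) +
          (f (x + (z 0 • bz 0 + z 1 • bz 1)) - f (x + z 0 • bz 0)) +
          (f (x + z) - f (x + (z 0 • bz 0 + z 1 • bz 1))) := by abel
        rw [h1]
        refine (pow_le_pow_left₀ zero_le ((enorm_add_le _ _).trans
          (add_le_add_left (enorm_add_le _ _) _)) 2).trans ?_
        refine (ennreal_add_add_sq_le _ _ _).trans_eq ?_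
        ring
    _ ≤ 3 * (ENNReal.ofReal (4 * h ^ 2) * ∫⁻ x in W, ‖m.pd 0 x‖ₑ ^ 2) +
        (3 * (ENNReal.ofReal (4 * h ^ 2) * ∫⁻ x in W, ‖m.pd 1 x‖ₑ ^ 2) +
        3 * (ENNReal.ofReal (4 * h ^ 2) * ∫⁻ x in W, ‖m.pd 2 x‖ₑ ^ 2)) := by
        have m0 : Measurable fun x => ‖f (x + z 0 • bz 0) - f x‖ₑ ^ 2 := by
          simpa using hmeas (z 0 • bz 0) 0
        rw [lintegral_add_left (m0.const_mul 3), lintegral_add_left ((hmeas _ _).const_mul 3),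
          lintegral_const_mul' _ _ (by norm_num), lintegral_const_mul' _ _ (by norm_num),
          lintegral_const_mul' _ _ (by norm_num)]
        gcongr
    _ = _ := by
        rw [Fin.sum_univ_three, show 12 * h ^ 2 = 3 * (4 * h ^ 2) by ring,
          ENNReal.ofReal_mul (p := 3) (by norm_num), show ENNReal.ofReal 3 = 3 by norm_num]
        ring

/-- The values of `f` at the points `y k + t`. -/
def sampleAt (f : E3 → E3) (y : (Fin 3 → ℤ) → E3) (t : E3) (k : Fin 3 → ℤ) : E3 := f (y k + t)

theorem measurable_sampleAt {f : E3 → E3} (hf : Measurable f) (h : ℝ) (y : (Fin 3 → ℤ) → E3)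
    (v : Fin 3 → ℤ) : Measurable fun p : E3 × E3 => sampleAt f y p.1 (cell h p.2 + v) :=
  hf.comp (((measurable_comp_cell h fun k => y (k + v)).comp measurable_snd).add measurable_fst)

theorem measurable_dq_sampleAt {h : ℝ} {f : E3 → E3} (hf : Measurable f) (y : (Fin 3 → ℤ) → E3)
    (i : Fin 3) : Measurable (Function.uncurry fun t x => dq h (sampleAt f y t) i x) := by
  have h2 := (measurable_sampleAt hf h y (stp i)).sub (measurable_sampleAt hf h y 0)
  simp only [add_zero] at h2
  exact h2.const_smul h⁻¹

theorem setLIntegral_unitCell_add_le {h : ℝ} (hh : 0 < h) (F : E3 → ℝ≥0∞) (p : E3) :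
    ∫⁻ t in unitCell h, F (p + t) ≤ ∫⁻ x in Metric.ball p (3 * h), F x := by
  simp_rw [add_comm p]
  rw [setLIntegral_add_right (measurableSet_unitCell h)]
  refine lintegral_mono_set fun x hx => ?_
  have h1 := norm_le_of_mem_unitCell hh (t := x - p) hx
  rw [Metric.mem_ball, dist_eq_norm]
  linarith

variable {h : ℝ} {y : (Fin 3 → ℤ) → E3} {T W : Set E3}

/-- Neighbouring displaced points no longer differ by an axis step, so unfolding is not available
and the constant one is lost. Instead, each difference is bounded by the energy in a 12h-ball, and
the overlap of these balls is at most 97³ with 97 = 2 · 48 + 1, 48 = 4 · 12. This is sufficient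
where m has little energy. -/
theorem SobolevH1.lintegral_unitCell_sampleAt_le (hΩ : IsCompact Ω) (m : SobolevH1 Ω)
    (hm : Measurable m.toFun) (hh : 0 < h)
    (hy : ∀ k l i, h / 2 * |((k i - l i : ℤ) : ℝ)| ≤ dist (y k) (y l))
    (hy2 : ∀ k i, dist (y (k + stp i)) (y k) ≤ 2 * h) (hTm : MeasurableSet T)
    (hW : W ⊆ interior Ω) (hT : ∀ x ∈ T, Metric.ball (y (cell h x)) (12 * h) ⊆ W) (i : Fin 3) :
    ∫⁻ t in unitCell h, ∫⁻ x in T, ‖dq h (sampleAt m.toFun y t) i x‖ₑ ^ 2 ≤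
      ENNReal.ofReal (h ^ 3) * (((12 * 97 ^ 3 : ℕ) : ℝ≥0∞) * ∫⁻ x in W, ∑ i, ‖m.pd i x‖ₑ ^ 2) := by
  have hpm : ∀ i, AEMeasurable (fun x => ‖m.pd i x‖ₑ ^ 2) (volume.restrict W) := fun i =>
    ((m.memLp_pd i).aestronglyMeasurable.enorm.pow_const 2).mono_measure
      (Measure.restrict_mono (hW.trans interior_subset) le_rfl)
  rw [lintegral_lintegral_swap
    ((measurable_dq_sampleAt hm y i).enorm.pow_const 2).aemeasurable]
  calc ∫⁻ x in T, ∫⁻ t in unitCell h, ‖dq h (sampleAt m.toFun y t) i x‖ₑ ^ 2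
      ≤ ∫⁻ x in T, 12 * ∫⁻ z in Metric.ball (y (cell h x)) (12 * h), ∑ i, ‖m.pd i z‖ₑ ^ 2 := by
        refine setLIntegral_mono' hTm fun x hx => ?_
        set p := y (cell h x)
        set z := y (cell h x + stp i) - p
        have hz : ‖z‖ ≤ 2 * h := by rw [← dist_eq_norm]; exact hy2 _ i
        calc ∫⁻ t in unitCell h, ‖dq h (sampleAt m.toFun y t) i x‖ₑ ^ 2
            = ∫⁻ t in unitCell h, ENNReal.ofReal (h⁻¹ ^ 2) *
              ‖m.toFun (p + t + z) - m.toFun (p + t)‖ₑ ^ 2 := by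
              refine lintegral_congr fun t => ?_
              rw [dq, sampleAt, sampleAt, enorm_smul, mul_pow, Real.enorm_eq_ofReal (by positivity),
                ENNReal.ofReal_pow (by positivity)]
              congr 5
              simp only [z, p]
              abel
          _ ≤ ENNReal.ofReal (h⁻¹ ^ 2) * ∫⁻ x in Metric.ball p (3 * h),
              ‖m.toFun (x + z) - m.toFun x‖ₑ ^ 2 := by
              rw [lintegral_const_mul' _ _ ENNReal.ofReal_ne_top]
              refine mul_le_mul_right ?_ _
              exact setLIntegral_unitCell_add_le hh
                (fun x => ‖m.toFun (x + z) - m.toFun x‖ₑ ^ 2) p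
          _ ≤ ENNReal.ofReal (h⁻¹ ^ 2) * (ENNReal.ofReal (12 * h ^ 2) *
              ∑ i, ∫⁻ x in Metric.ball p (12 * h), ‖m.pd i x‖ₑ ^ 2) := by
              gcongr
              exact m.lintegral_ball_sub_sq_le hΩ hm ((hT x hx).trans hW) hz
          _ = _ := by
              rw [← mul_assoc, ← ENNReal.ofReal_mul (by positivity), lintegral_finsetSum' _
                fun i _ => (hpm i).mono_measure (Measure.restrict_mono (hT x hx) le_rfl)]
              congr 1
              rw [show h⁻¹ ^ 2 * (12 * h ^ 2) = 12 by field_simp]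
              norm_num
    _ = 12 * ∫⁻ x in T, ∫⁻ z in Metric.ball (y (cell h x)) (12 * h), ∑ i, ‖m.pd i z‖ₑ ^ 2 :=
        lintegral_const_mul' _ _ (by norm_num)
    _ ≤ 12 * (ENNReal.ofReal (h ^ 3) * (((2 * 48 + 1) ^ 3 : ℕ) * ∫⁻ x in W, ∑ i, ‖m.pd i x‖ₑ ^ 2)) := by
        gcongr
        exact lintegral_cell_ball_le hh (by norm_num) hy hTm hT
          (Finset.aemeasurable_fun_sum _ fun i _ => hpm i)
    _ = _ := by push_cast; ring

theorem lintegral_unitCell_sampleAt_sub_le {f φ : E3 → E3} (hf : Measurable f) (hφ : Measurable φ)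
    (hh : 0 < h) (hy : ∀ k l i, h / 2 * |((k i - l i : ℤ) : ℝ)| ≤ dist (y k) (y l))
    (hTm : MeasurableSet T) (hT : ∀ x ∈ T, Metric.ball (y (cell h x)) (12 * h) ⊆ W) :
    ∫⁻ t in unitCell h, ∫⁻ x in T,
      ‖sampleAt f y t (cell h x) - sampleAt φ y t (cell h x)‖ₑ ^ 2 ≤
      ENNReal.ofReal (h ^ 3) * (((12 * 97 ^ 3 : ℕ) : ℝ≥0∞) * ∫⁻ x in W, ‖f x - φ x‖ₑ ^ 2) := by
  have hFm : Measurable fun x => ‖f x - φ x‖ₑ ^ 2 := (hf.sub hφ).enorm.pow_const 2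
  have hm := ((measurable_sampleAt hf h y 0).sub (measurable_sampleAt hφ h y 0)).enorm.pow_const 2
  simp only [add_zero] at hm
  rw [lintegral_lintegral_swap hm.aemeasurable]
  calc ∫⁻ x in T, ∫⁻ t in unitCell h,
        ‖sampleAt f y t (cell h x) - sampleAt φ y t (cell h x)‖ₑ ^ 2
      ≤ ∫⁻ x in T, ∫⁻ z in Metric.ball (y (cell h x)) (12 * h), ‖f z - φ z‖ₑ ^ 2 := by
        refine lintegral_mono fun x => ?_
        refine (setLIntegral_unitCell_add_le hh (fun z => ‖f z - φ z‖ₑ ^ 2) _).trans ?_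
        exact lintegral_mono_set (Metric.ball_subset_ball (by linarith))
    _ ≤ ENNReal.ofReal (h ^ 3) * (((2 * 48 + 1) ^ 3 : ℕ) * ∫⁻ x in W, ‖f x - φ x‖ₑ ^ 2) :=
        lintegral_cell_ball_le hh (by norm_num) hy hTm hT hFm.aemeasurable
    _ ≤ _ := by
        gcongr
        norm_num

end

/-! ### The choice of one good translation -/

section

variable {Ω : Set E3} {h : ℝ} {y : (Fin 3 → ℤ) → E3}

theorem SobolevH1.sum_lintegral_eq (m : SobolevH1 Ω) :
    ∑ i, ∫⁻ x in Ω, ‖m.pd i x‖ₑ ^ 2 = ENNReal.ofReal (∫ x in Ω, ∑ i, ‖m.pd i x‖ ^ 2) := by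
  rw [m.integral_sum_eq, ENNReal.ofReal_sum_of_nonneg fun i _ =>
    integral_nonneg fun x => by positivity]
  exact Finset.sum_congr rfl fun i _ => (ofReal_integral_norm_sq (m.memLp_pd i)).symm

theorem ENNReal.le_ofReal_div_of_mul_le {x : ℝ≥0∞} {l b : ℝ} (hl : 0 < l)
    (hx : ENNReal.ofReal l * x ≤ ENNReal.ofReal b) : x ≤ ENNReal.ofReal (b / l) := by
  rw [ENNReal.ofReal_div_of_pos hl, ENNReal.le_div_iff_mul_le
    (Or.inl (ENNReal.ofReal_pos.2 hl).ne') (Or.inl ENNReal.ofReal_ne_top), mul_comm]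
  exact hx

/-- The translation of the lattice can be chosen so that the samples have almost the Dirichlet
energy, little energy on `B`, and are close to `φ` on `T`. -/
theorem SobolevH1.exists_sampleAt (hΩ : IsCompact Ω) (m : SobolevH1 Ω) (hm : Measurable m.toFun)
    {φ : E3 → E3} (hφ : Measurable φ) (hh : 0 < h)
    (hy : ∀ k l i, h / 2 * |((k i - l i : ℤ) : ℝ)| ≤ dist (y k) (y l))
    (hy2 : ∀ k i, dist (y (k + stp i)) (y k) ≤ 2 * h) {S B T W : Set E3}
    (hBm : MeasurableSet B) (hTm : MeasurableSet T) (hW : W ⊆ interior Ω)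
    (hB : ∀ x ∈ B, Metric.ball (y (cell h x)) (12 * h) ⊆ W)
    (hT : ∀ x ∈ T, Metric.ball (y (cell h x)) (12 * h) ⊆ Ω)
    (hS : ∀ x ∈ S, x ∉ B → 5 * h < Metric.infDist x Ωᶜ ∧ y (cell h x) = pt h (cell h x) ∧
      ∀ i, y (cell h x + stp i) = pt h (cell h x + stp i))
    {ε lam : ℝ} (hε : 0 ≤ ε) (hlam : 1 ≤ lam)
    (hWε : ((12 * 97 ^ 3 : ℕ) : ℝ≥0∞) * ∫⁻ x in W, ∑ i, ‖m.pd i x‖ₑ ^ 2 ≤ ENNReal.ofReal ε)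
    (hφε : ((12 * 97 ^ 3 : ℕ) : ℝ≥0∞) * ∫⁻ x in Ω, ‖m.toFun x - φ x‖ₑ ^ 2 ≤ ENNReal.ofReal ε) :
    ∃ t ∈ unitCell h,
      ∑ i, ∫⁻ x in S, ‖dq h (sampleAt m.toFun y t) i x‖ₑ ^ 2 ≤
        ENNReal.ofReal ((∫ x in Ω, ∑ i, ‖m.pd i x‖ ^ 2) + 4 * lam * ε) ∧
      ∑ i, ∫⁻ x in B, ‖dq h (sampleAt m.toFun y t) i x‖ₑ ^ 2 ≤
        ENNReal.ofReal (((∫ x in Ω, ∑ i, ‖m.pd i x‖ ^ 2) + 4 * lam * ε) / lam) ∧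
      ∫⁻ x in T, ‖sampleAt m.toFun y t (cell h x) - sampleAt φ y t (cell h x)‖ₑ ^ 2 ≤
        ENNReal.ofReal (((∫ x in Ω, ∑ i, ‖m.pd i x‖ ^ 2) + 4 * lam * ε) / lam) := by
  set D := ∫ x in Ω, ∑ i, ‖m.pd i x‖ ^ 2
  have hD : 0 ≤ D := integral_nonneg fun x => Finset.sum_nonneg fun i _ => by positivity
  have hlam0 : 0 < lam := by linarith
  set G : Set E3 := {x | 5 * h < Metric.infDist x Ωᶜ}
  set X1 : E3 → ℝ≥0∞ := fun t => ∑ i, ∫⁻ x in G, ‖dq h (sample h m.toFun t) i x‖ₑ ^ 2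
  set X2 : E3 → ℝ≥0∞ := fun t => ∑ i, ∫⁻ x in B, ‖dq h (sampleAt m.toFun y t) i x‖ₑ ^ 2
  set X3 : E3 → ℝ≥0∞ := fun t =>
    ∫⁻ x in T, ‖sampleAt m.toFun y t (cell h x) - sampleAt φ y t (cell h x)‖ₑ ^ 2
  have hm1 : ∀ i, Measurable fun t => ∫⁻ x in G, ‖dq h (sample h m.toFun t) i x‖ₑ ^ 2 := fun i =>
    ((measurable_dq_sample hm i).enorm.pow_const 2).lintegral_prod_right'
  have hm2 : ∀ i, Measurable fun t => ∫⁻ x in B, ‖dq h (sampleAt m.toFun y t) i x‖ₑ ^ 2 := fun i =>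
    ((measurable_dq_sampleAt hm y i).enorm.pow_const 2).lintegral_prod_right'
  have hX1 : Measurable X1 := Finset.measurable_fun_sum _ fun i _ => hm1 i
  have hX2 : Measurable X2 := Finset.measurable_fun_sum _ fun i _ => hm2 i
  have hX3 : Measurable X3 := by
    have h1 := ((measurable_sampleAt hm h y 0).sub (measurable_sampleAt hφ h y 0)).enorm.pow_const 2
    simp only [add_zero] at h1
    exact h1.lintegral_prod_right'
  have e1 : ∫⁻ t in unitCell h, X1 t ≤ ENNReal.ofReal (h ^ 3) * ENNReal.ofReal D := by
    rw [lintegral_finsetSum _ fun i _ => hm1 i, ← m.sum_lintegral_eq, Finset.mul_sum]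
    exact Finset.sum_le_sum fun i _ => m.lintegral_unitCell_dq_le hΩ hm hh i
  have e2 : ∫⁻ t in unitCell h, X2 t ≤ ENNReal.ofReal (h ^ 3) * ENNReal.ofReal (3 * ε) := by
    rw [lintegral_finsetSum _ fun i _ => hm2 i]
    calc ∑ i, ∫⁻ t in unitCell h, ∫⁻ x in B, ‖dq h (sampleAt m.toFun y t) i x‖ₑ ^ 2
        ≤ ∑ _i : Fin 3, ENNReal.ofReal (h ^ 3) * ENNReal.ofReal ε :=
          Finset.sum_le_sum fun i _ =>
            (m.lintegral_unitCell_sampleAt_le hΩ hm hh hy hy2 hBm hW hB i).trans (by gcongr)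
      _ = _ := by
          rw [Finset.sum_const, Finset.card_univ, Fintype.card_fin, nsmul_eq_mul,
            ENNReal.ofReal_mul (p := 3) (by norm_num), show ENNReal.ofReal 3 = 3 by norm_num]
          push_cast
          ring
  have e3 : ∫⁻ t in unitCell h, X3 t ≤ ENNReal.ofReal (h ^ 3) * ENNReal.ofReal ε :=
    (lintegral_unitCell_sampleAt_sub_le hm hφ hh hy hTm hT).trans (by gcongr)
  -- One weighted sum is averaged, so that a single t serves all three estimates. Its mean is at
  -- most D + 4λε, hence X2 and X3 are at most (D + 4λε)/λ, which is small for λ large and λε small.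
  obtain ⟨t, ht, htX⟩ := exists_mem_unitCell_le hh
    (G := fun t => X1 t + ENNReal.ofReal lam * (X2 t + X3 t))
    (hX1.add ((hX2.add hX3).const_mul _)).aemeasurable
    (B := ENNReal.ofReal (D + 4 * lam * ε)) (by
      rw [lintegral_add_left hX1, lintegral_const_mul' _ _ ENNReal.ofReal_ne_top,
        lintegral_add_left hX2]
      calc _ ≤ ENNReal.ofReal (h ^ 3) * ENNReal.ofReal D + ENNReal.ofReal lam *
            (ENNReal.ofReal (h ^ 3) * ENNReal.ofReal (3 * ε) +
            ENNReal.ofReal (h ^ 3) * ENNReal.ofReal ε) := by gcongr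
        _ = ENNReal.ofReal (h ^ 3) * (ENNReal.ofReal D + ENNReal.ofReal lam *
            (ENNReal.ofReal (3 * ε) + ENNReal.ofReal ε)) := by ring
        _ = _ := by
            rw [← ENNReal.ofReal_add (by positivity) hε, ← ENNReal.ofReal_mul hlam0.le,
              ← ENNReal.ofReal_add hD (by positivity)]
            congr 2
            ring)
  refine ⟨t, ht, ?_, ENNReal.le_ofReal_div_of_mul_le hlam0 (le_trans ?_ htX),
    ENNReal.le_ofReal_div_of_mul_le hlam0 (le_trans ?_ htX)⟩
  · refine le_trans ?_ htX
    -- Off B the points are not displaced, so the samples are those of the translated lattice and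
    -- the sharp bound applies; B enters with its small energy.
    have h1 : ∀ i, ∫⁻ x in S, ‖dq h (sampleAt m.toFun y t) i x‖ₑ ^ 2 ≤
        (∫⁻ x in G, ‖dq h (sample h m.toFun t) i x‖ₑ ^ 2) +
        ∫⁻ x in B, ‖dq h (sampleAt m.toFun y t) i x‖ₑ ^ 2 := by
      intro i
      have h2 : S ⊆ (S \ B) ∪ B := fun x hx => by
        by_cases hxB : x ∈ B
        · exact Or.inr hxB
        · exact Or.inl ⟨hx, hxB⟩
      refine (lintegral_mono_set h2).trans ((lintegral_union_le _ _ _).trans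
        (add_le_add_left ?_ _))
      refine le_trans ?_ (lintegral_mono_set (s := S \ B) (t := G) fun x hx => (hS x hx.1 hx.2).1)
      have hne : Measurable fun x => ‖dq h (sample h m.toFun t) i x‖ₑ ^ 2 :=
        (measurable_dq h _ i).enorm.pow_const 2
      refine setLIntegral_mono hne fun x hx => le_of_eq ?_
      obtain ⟨-, h3, h4⟩ := hS x hx.1 hx.2
      rw [dq, dq, sampleAt, sampleAt, sample, sample, h3, h4]
    refine (Finset.sum_le_sum fun i _ => h1 i).trans ?_
    rw [Finset.sum_add_distrib]
    gcongr
    calc X2 t = ENNReal.ofReal 1 * X2 t := by simp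
      _ ≤ ENNReal.ofReal lam * (X2 t + X3 t) := by
          gcongr
          exact le_self_add
  · exact le_trans (by gcongr; exact le_self_add) le_add_self
  · exact le_trans (by gcongr; exact le_add_self) le_add_self

end

/-! ### Samples at points displaced into the domain -/

section Samples

variable {Ω Γ : Set E3}

/-- As δ tends to zero the strips and the tubes around Γ shrink to null sets, and the integral is
absolutely continuous. -/
theorem exists_collar (hΩ : IsCompact Ω) (h0 : volume (frontier Ω) = 0) (hΓ : IsCompact Γ)
    (hΓne : Γ.Nonempty) (hΓ0 : volume Γ = 0) {F : E3 → ℝ≥0∞} (hF : ∫⁻ x in Ω, F x ≠ ⊤) {ε : ℝ}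
    (hε : 0 < ε) : ∃ δ > 0, ∫⁻ x in {x ∈ interior Ω | Metric.infDist x Ωᶜ ≤ δ ∨ Metric.infDist x Γ ≤ δ},
      F x ≤ ENNReal.ofReal ε := by
  have t1 := tendsto_setLIntegral_strip hΩ h0 hF
  have t2 : Tendsto (fun r => ∫⁻ x in Metric.cthickening r Γ, F x ∂(volume.restrict Ω)) (𝓝 0)
      (𝓝 0) := by
    refine tendsto_setLIntegral_zero hF ?_
    have h1 := tendsto_measure_cthickening_of_isCompact (μ := (volume : Measure E3)) hΓ
    rw [hΓ0] at h1
    exact tendsto_of_tendsto_of_tendsto_of_le_of_le tendsto_const_nhds h1 (fun _ => zero_le)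
      fun r => Measure.restrict_apply_le _ _
  have t3 := t1.add t2
  rw [add_zero] at t3
  have h1 := (t3.eventually_le_const (ENNReal.ofReal_pos.2 hε)).filter_mono
    (nhdsWithin_le_nhds (s := Set.Ioi 0))
  obtain ⟨δ, hδ, hδ0⟩ := (h1.and self_mem_nhdsWithin).exists
  refine ⟨δ, hδ0, le_trans ?_ hδ⟩
  have hsub : {x ∈ interior Ω | Metric.infDist x Ωᶜ ≤ δ ∨ Metric.infDist x Γ ≤ δ} ⊆
      strip Ω δ ∪ (Metric.cthickening δ Γ ∩ Ω) := by
    rintro x ⟨hx, hx1 | hx1⟩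
    · exact Or.inl ⟨interior_subset hx, hx1⟩
    · refine Or.inr ⟨?_, interior_subset hx⟩
      obtain ⟨y, hy, hxy⟩ := hΓ.exists_infDist_eq_dist hΓne x
      exact Metric.mem_cthickening_of_dist_le _ _ _ _ hy (hxy ▸ hx1)
  refine (lintegral_mono_set hsub).trans ((lintegral_union_le _ _ _).trans ?_)
  rw [Measure.restrict_restrict Metric.isClosed_cthickening.measurableSet]

theorem exists_mem_dist_le_of_mem_cthickening (hΩ : IsCompact Ω) {r : ℝ} (hr : 0 ≤ r) {x : E3}
    (hx : x ∈ Metric.cthickening r Ω) : ∃ y ∈ Ω, dist x y ≤ r := by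
  rw [hΩ.cthickening_eq_biUnion_closedBall hr] at hx
  simpa using hx

/-- Samples of `m` at points of `Ω` near the lattice points, away from the singular set. -/
theorem SobolevH1.exists_samples (hΩ : IsCompact Ω) (h0 : volume (frontier Ω) = 0)
    (m : SobolevH1 Ω) (hm : Measurable m.toFun) (hΓ : IsCompact Γ) (hΓne : Γ.Nonempty)
    (hΓ0 : volume Γ = 0) (hreg : ∀ p ∈ frontier Ω, p ∉ Γ → IsC1BoundaryPoint Ω p)
    {ε : ℝ} (hε : 0 < ε) : ∃ ρ₀ > 0, ∀ ρ ∈ Set.Ioo 0 ρ₀, ∀ r ∈ Set.Ioo 0 ρ, ∃ h₀ > 0,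
    ∀ h ∈ Set.Ioo 0 h₀, ∃ s : (Fin 3 → ℤ) → E3, (∀ k, ∃ x, s k = m.toFun x) ∧
      ∑ i, ∫⁻ x in {x ∈ Metric.cthickening (4 * h) Ω | r / 2 ≤ Metric.infDist x Γ},
        ‖dq h s i x‖ₑ ^ 2 ≤ ENNReal.ofReal ((∫ x in Ω, ∑ i, ‖m.pd i x‖ ^ 2) + ε) ∧
      ∑ i, ∫⁻ x in {x ∈ Metric.cthickening (4 * h) Ω | r / 2 ≤ Metric.infDist x Γ ∧
        Metric.infDist x Γ ≤ 2 * ρ}, ‖dq h s i x‖ₑ ^ 2 ≤ ENNReal.ofReal ε ∧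
      ∫⁻ x in {x ∈ Ω | r / 2 ≤ Metric.infDist x Γ}, ‖s (cell h x) - m.toFun x‖ₑ ^ 2 ≤
        ENNReal.ofReal ε := by
  set D := ∫ x in Ω, ∑ i, ‖m.pd i x‖ ^ 2
  have hD : 0 ≤ D := integral_nonneg fun x => Finset.sum_nonneg fun i _ => by positivity
  -- First λ is taken so large that (D + ε)/λ ≤ ε/18, then ε₁ so small that 4λε₁ is still less than
  -- ε.
  set lam := 1 + 18 * (D + ε) / ε
  have hlam : 1 ≤ lam := le_add_of_nonneg_right (by positivity)
  have hlam0 : 0 < lam := by linarith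
  set ε₁ := ε / (9 * lam)
  have hε₁ : 0 < ε₁ := by positivity
  have hlamε : lam * ε₁ = ε / 9 := by simp only [ε₁]; field_simp
  have hε₁9 : ε₁ ≤ ε / 9 := by nlinarith
  have hlamD : (D + 4 * lam * ε₁) / lam ≤ ε / 18 := by
    rw [div_le_iff₀ hlam0]
    have : lam * ε = ε + 18 * (D + ε) := by simp only [lam]; field_simp
    nlinarith
  have hCC : (0 : ℝ) < ((12 * 97 ^ 3 : ℕ) : ℝ) := by norm_num
  have hCCmul : ∀ X : ℝ≥0∞, X ≤ ENNReal.ofReal (ε₁ / ((12 * 97 ^ 3 : ℕ) : ℝ)) →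
      ((12 * 97 ^ 3 : ℕ) : ℝ≥0∞) * X ≤ ENNReal.ofReal ε₁ := fun X hX => by
    calc ((12 * 97 ^ 3 : ℕ) : ℝ≥0∞) * X ≤ ((12 * 97 ^ 3 : ℕ) : ℝ≥0∞) *
          ENNReal.ofReal (ε₁ / ((12 * 97 ^ 3 : ℕ) : ℝ)) := by gcongr
      _ = ENNReal.ofReal ε₁ := by
          rw [← ENNReal.ofReal_natCast, ← ENNReal.ofReal_mul hCC.le, mul_div_cancel₀ _ hCC.ne']
  have hFfin : ∫⁻ x in Ω, ∑ i, ‖m.pd i x‖ₑ ^ 2 ≠ ⊤ := by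
    rw [lintegral_finsetSum' _ fun i _ => (m.memLp_pd i).aestronglyMeasurable.enorm.pow_const 2]
    exact ENNReal.sum_ne_top.2 fun i _ => MemLp.lintegral_sq_ne_top (m.memLp_pd i)
  obtain ⟨δ₀, hδ₀, hδW⟩ := exists_collar hΩ h0 hΓ hΓne hΓ0 hFfin (div_pos hε₁ hCC)
  -- Points of B have depth at most 2δ or are within 2ρ < 2δ of Γ. Sampling moves them by less than
  -- δ, hence into the collar of width δ₀ = 3δ, where m has little energy.
  set δ := δ₀ / 3
  have hδ : 0 < δ := by positivity
  have hδ3 : 3 * δ = δ₀ := by simp only [δ]; ring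
  obtain ⟨φ, hφs, hφc, -, hφ⟩ := exists_contDiff_approx isOpen_interior
    (f := m.toFun) (U := interior Ω) (m.memLp_toFun.mono_measure
      (Measure.restrict_mono interior_subset le_rfl)) (div_pos hε₁ hCC)
  rw [← restrict_eq_restrict_interior h0] at hφ
  set V := (volume Ω).toReal
  have hV : volume Ω = ENNReal.ofReal V := (ENNReal.ofReal_toReal hΩ.measure_ne_top).symm
  have hV0 : 0 ≤ V := ENNReal.toReal_nonneg
  set w₀ := Real.sqrt (ε / 9 / (V + 1))
  have hw : 0 < w₀ := Real.sqrt_pos.2 (by positivity)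
  obtain ⟨τ, hτ, hτφ⟩ := Metric.uniformContinuous_iff.1
    (hφc.uniformContinuous_of_continuous hφs.continuous) w₀ hw
  refine ⟨δ, hδ, fun ρ hρ r hr => ?_⟩
  obtain ⟨Vf, M, L, hM, hL, hVM, hVL, hVδ, c, hc, s₀, hs₀, hin⟩ :=
    exists_inward_field hΩ hreg (r := r / 4) (by linarith [hr.1]) hδ
  set κ := min (min δ r) τ
  have hκ : 0 < κ := lt_min (lt_min hδ hr.1) hτ
  have hκδ : κ ≤ δ := (min_le_left _ _).trans (min_le_left _ _)
  have hκr : κ ≤ r := (min_le_left _ _).trans (min_le_right _ _)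
  have hκτ : κ ≤ τ := min_le_right _ _
  -- The bound sL ≤ 1/2 makes x ↦ x + s V x bi-Lipschitz, so the displaced lattice has spacing
  -- between h/2 and 2h in the sense required above. The bound sM ≤ κ/2 keeps the displacement below
  -- the scales δ, r and τ.
  set s := min (s₀ / 2) (min (1 / (2 * (L + 1))) (κ / (2 * (M + 1))))
  have hs : 0 < s := by positivity
  have hss₀ : s < s₀ := (min_le_left _ _).trans_lt (by linarith)
  have hsL : s * L ≤ 1 / 2 := by
    have h1 : s ≤ 1 / (2 * (L + 1)) := (min_le_right _ _).trans (min_le_left _ _)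
    rw [le_div_iff₀ (by positivity)] at h1
    nlinarith
  have hsM : s * M ≤ κ / 2 := by
    have h1 : s ≤ κ / (2 * (M + 1)) := (min_le_right _ _).trans (min_le_right _ _)
    rw [le_div_iff₀ (by positivity)] at h1
    nlinarith
  -- The displacement s is fixed before h: the room c s gained in Ω must exceed a fixed multiple of
  -- h.
  refine ⟨min (κ / 100) (c * s / 100), by positivity, fun h hh' => ?_⟩
  have hh : 0 < h := hh'.1
  have hhκ : 100 * h < κ := by
    have := hh'.2.trans_le (min_le_left _ _)
    linarith
  have hhc : 100 * h < c * s := by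
    have := hh'.2.trans_le (min_le_right _ _)
    linarith
  set y : (Fin 3 → ℤ) → E3 := fun k => pt h k + s • Vf (pt h k)
  have hshift : ∀ p q : E3, dist (s • Vf p) (s • Vf q) ≤ 1 / 2 * dist p q := fun p q => by
    rw [dist_smul₀, Real.norm_eq_abs, abs_of_pos hs]
    nlinarith [hVL p q, dist_nonneg (x := p) (y := q)]
  have hdist : ∀ p q : E3, dist (p + s • Vf p) (q + s • Vf q) ≤ 3 / 2 * dist p q := fun p q => by
    linarith [dist_add_add_le p (s • Vf p) q (s • Vf q), hshift p q]
  have hymove : ∀ p : E3, dist (p + s • Vf p) p ≤ κ / 2 := fun p => by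
    rw [dist_self_add_left, norm_smul, Real.norm_eq_abs, abs_of_pos hs]
    nlinarith [hVM p]
  have hy : ∀ k l i, h / 2 * |((k i - l i : ℤ) : ℝ)| ≤ dist (y k) (y l) := by
    intro k l i
    have h1 : h * |((k i - l i : ℤ) : ℝ)| ≤ dist (pt h k) (pt h l) := by
      rw [dist_eq_norm, ← pt_sub]
      refine le_trans (le_of_eq ?_) (abs_apply_le_norm _ i)
      rw [pt_apply, abs_mul, abs_of_pos hh]
      rfl
    have h2 : dist (pt h k) (pt h l) ≤ dist (y k) (y l) + 1 / 2 * dist (pt h k) (pt h l) := by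
      have h3 : pt h k - pt h l = (y k - y l) - (s • Vf (pt h k) - s • Vf (pt h l)) := by
        simp only [y]; abel
      have h4 := hshift (pt h k) (pt h l)
      rw [dist_eq_norm] at h4
      rw [dist_eq_norm (y k)]
      calc dist (pt h k) (pt h l) = ‖(y k - y l) - (s • Vf (pt h k) - s • Vf (pt h l))‖ := by
            rw [dist_eq_norm, h3]
        _ ≤ _ := (norm_sub_le _ _).trans (by linarith)
    linarith
  have hy2 : ∀ k i, dist (y (k + stp i)) (y k) ≤ 2 * h := fun k i => by
    have := hdist (pt h (k + stp i)) (pt h k)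
    rw [dist_pt_add_stp hh] at this
    simp only [y]
    linarith
  set S : Set E3 := {x ∈ Metric.cthickening (4 * h) Ω | r / 2 ≤ Metric.infDist x Γ}
  set B : Set E3 := {x ∈ S | Metric.infDist x Ωᶜ ≤ 2 * δ ∨ Metric.infDist x Γ ≤ 2 * ρ}
  set T : Set E3 := {x ∈ Ω | r / 2 ≤ Metric.infDist x Γ}
  set W : Set E3 := {x ∈ interior Ω | Metric.infDist x Ωᶜ ≤ δ₀ ∨ Metric.infDist x Γ ≤ δ₀}
  have hcΓ : Continuous fun x : E3 => Metric.infDist x Γ := Metric.continuous_infDist_pt _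
  have hcΩ : Continuous fun x : E3 => Metric.infDist x Ωᶜ := Metric.continuous_infDist_pt _
  have hTm : MeasurableSet T :=
    hΩ.measurableSet.inter (isClosed_le continuous_const hcΓ).measurableSet
  have hSm : MeasurableSet S := Metric.isClosed_cthickening.measurableSet.inter
    (isClosed_le continuous_const hcΓ).measurableSet
  have hBm : MeasurableSet B := hSm.inter ((isClosed_le hcΩ continuous_const).measurableSet.union
    (isClosed_le hcΓ continuous_const).measurableSet)
  -- The node may lie outside Ω. It is compared with a point x' of Ω within 6h; the displaced points
  -- are then within 9h of each other, and 9h + 12h is less than the room c s around the displaced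
  -- x'.
  have hball : ∀ x ∈ S, Metric.ball (y (cell h x)) (12 * h) ⊆ Ω := by
    intro x hx z hz
    obtain ⟨x', hx', hxx'⟩ := exists_mem_dist_le_of_mem_cthickening hΩ (by positivity) hx.1
    have h1 := lipschitz_infDist Γ x x'
    refine hin s ⟨hs, hss₀⟩ x' hx' (by linarith [hx.2]) ?_
    have h2 := hdist (pt h (cell h x)) x'
    have h3 := dist_triangle (pt h (cell h x)) x x'
    have h4 := dist_pt_cell_le hh x
    rw [dist_comm] at h4
    rw [Metric.mem_ball] at hz
    rw [Metric.mem_closedBall]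
    have h5 := dist_triangle z (y (cell h x)) (x' + s • Vf x')
    simp only [y] at h5 hz
    linarith
  have hnear : ∀ x, ∀ z ∈ Metric.ball (y (cell h x)) (12 * h), dist z x ≤ 14 * h + κ / 2 := by
    intro x z hz
    rw [Metric.mem_ball] at hz
    have h1 := dist_triangle4 z (y (cell h x)) (pt h (cell h x)) x
    have h2 := hymove (pt h (cell h x))
    have h3 := dist_pt_cell_le hh x
    rw [dist_comm] at h3
    simp only [y] at h1 hz
    linarith
  have hB : ∀ x ∈ B, Metric.ball (y (cell h x)) (12 * h) ⊆ W := by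
    intro x hx z hz
    refine ⟨interior_maximal (hball x hx.1) Metric.isOpen_ball hz, ?_⟩
    have h1 := hnear x z hz
    refine hx.2.imp (fun h2 => ?_) fun h2 => ?_
    · linarith [lipschitz_infDist Ωᶜ z x]
    · linarith [lipschitz_infDist Γ z x, hρ.2, hr.2]
  have hTS : T ⊆ S := fun x hx => ⟨Metric.self_subset_cthickening Ω hx.1, hx.2⟩
  have hS : ∀ x ∈ S, x ∉ B → 5 * h < Metric.infDist x Ωᶜ ∧ y (cell h x) = pt h (cell h x) ∧
      ∀ i, y (cell h x + stp i) = pt h (cell h x + stp i) := by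
    intro x hx hxB
    have h1 : 2 * δ < Metric.infDist x Ωᶜ := by
      by_contra! hc
      exact hxB ⟨hx, Or.inl hc⟩
    have h2 : ∀ p, dist x p ≤ 3 * h → p + s • Vf p = p := fun p hp => by
      rw [hVδ p (by linarith [lipschitz_infDist Ωᶜ x p]), smul_zero, add_zero]
    have h3 := dist_pt_cell_le hh x
    refine ⟨by linarith, h2 _ (by linarith), fun i => h2 _ ?_⟩
    have h4 := dist_pt_add_stp hh (cell h x) i
    have h5 := dist_triangle x (pt h (cell h x)) (pt h (cell h x + stp i))
    rw [dist_comm (pt h (cell h x))] at h5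
    linarith
  obtain ⟨t, ht, e1, e2, e3⟩ := m.exists_sampleAt hΩ hm hφs.continuous.measurable hh hy hy2 (S := S)
    hBm hTm (fun x hx => hx.1) hB (fun x hx => hball x (hTS hx)) hS hε₁.le hlam
    (hCCmul _ hδW) (hCCmul _ hφ)
  refine ⟨sampleAt m.toFun y t, fun k => ⟨y k + t, rfl⟩, e1.trans ?_, le_trans ?_ (e2.trans ?_), ?_⟩
  · exact ENNReal.ofReal_le_ofReal (by nlinarith)
  · exact Finset.sum_le_sum fun i _ => lintegral_mono_set fun x hx =>
      ⟨⟨hx.1, hx.2.1⟩, Or.inr hx.2.2⟩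
  · exact ENNReal.ofReal_le_ofReal (by linarith)
  -- The displacement does not tend to zero with h, so samples of m are compared with samples of the
  -- continuous φ; all displacements together are below τ, which φ does not feel beyond w₀.
  · have hφmove : ∀ x, ‖sampleAt φ y t (cell h x) - φ x‖ₑ ^ 2 ≤ ENNReal.ofReal (w₀ ^ 2) := by
      intro x
      rw [← ofReal_norm, ← ENNReal.ofReal_pow (norm_nonneg _)]
      refine ENNReal.ofReal_le_ofReal (pow_le_pow_left₀ (norm_nonneg _) ?_ 2)
      rw [← dist_eq_norm]
      refine (hτφ ?_).le
      have h1 := dist_triangle4 (y (cell h x) + t) (y (cell h x)) (pt h (cell h x)) x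
      rw [dist_self_add_left] at h1
      have h2 := hymove (pt h (cell h x))
      have h3 := dist_pt_cell_le hh x
      rw [dist_comm] at h3
      have h4 := norm_le_of_mem_unitCell hh ht
      simp only [y] at h1 ⊢
      linarith
    have hm1 : Measurable fun x =>
        3 * ‖sampleAt m.toFun y t (cell h x) - sampleAt φ y t (cell h x)‖ₑ ^ 2 :=
      (measurable_comp_cell h fun k =>
        ‖sampleAt m.toFun y t k - sampleAt φ y t k‖ₑ ^ 2).const_mul 3
    calc ∫⁻ x in T, ‖sampleAt m.toFun y t (cell h x) - m.toFun x‖ₑ ^ 2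
        ≤ ∫⁻ x in T, (3 * ‖sampleAt m.toFun y t (cell h x) - sampleAt φ y t (cell h x)‖ₑ ^ 2 +
          (3 * ENNReal.ofReal (w₀ ^ 2) + 3 * ‖m.toFun x - φ x‖ₑ ^ 2)) := by
          refine lintegral_mono fun x => ?_
          have h1 : sampleAt m.toFun y t (cell h x) - m.toFun x =
            (sampleAt m.toFun y t (cell h x) - sampleAt φ y t (cell h x)) +
            (sampleAt φ y t (cell h x) - φ x) + (φ x - m.toFun x) := by abel
          dsimp only
          rw [h1]
          refine (pow_le_pow_left₀ zero_le ((enorm_add_le _ _).trans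
            (add_le_add_left (enorm_add_le _ _) _)) 2).trans ?_
          refine (ennreal_add_add_sq_le _ _ _).trans ?_
          rw [enorm_sub_rev (φ x), add_assoc]
          gcongr
          exact hφmove x
      _ ≤ 3 * ENNReal.ofReal (ε / 18) + (3 * ENNReal.ofReal (ε / 9) + 3 * ENNReal.ofReal (ε / 9)) := by
          rw [lintegral_add_left hm1, lintegral_add_left measurable_const,
            lintegral_const_mul' 3 (fun x => ‖m.toFun x - φ x‖ₑ ^ 2) (by norm_num),
            lintegral_const_mul' 3 (fun x => ‖sampleAt m.toFun y t (cell h x) -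
              sampleAt φ y t (cell h x)‖ₑ ^ 2) (by norm_num),
            setLIntegral_const, mul_assoc]
          gcongr
          · exact e3.trans (ENNReal.ofReal_le_ofReal hlamD)
          · refine (mul_le_mul_right (measure_mono fun x hx => hx.1) _).trans (b := _ * volume Ω) ?_
            rw [hV, ← ENNReal.ofReal_mul (by positivity)]
            refine ENNReal.ofReal_le_ofReal ?_
            rw [Real.sq_sqrt (by positivity), div_mul_eq_mul_div, div_le_iff₀ (by positivity)]
            nlinarith
          · refine (lintegral_mono_set (fun x hx => hx.1)).trans (hφ.trans
              (ENNReal.ofReal_le_ofReal ?_))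
            refine le_trans ?_ hε₁9
            exact div_le_self hε₁.le (by norm_num)
      _ ≤ ENNReal.ofReal ε := by
          rw [show (3 : ℝ≥0∞) = ENNReal.ofReal 3 by norm_num, ← ENNReal.ofReal_mul (by norm_num),
            ← ENNReal.ofReal_mul (by norm_num), ← ENNReal.ofReal_add (by positivity) (by positivity),
            ← ENNReal.ofReal_add (by positivity) (by positivity)]
          exact ENNReal.ofReal_le_ofReal (by linarith)

end Samples

/-! ### Cutting off near the singular set -/

section CutoffSamples

variable {Ω Γ : Set E3}

theorem norm_dq_le_of_norm_sub_le {h : ℝ} {u v : (Fin 3 → ℤ) → E3} {i : Fin 3} {x : E3}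
    (huv : ‖u (cell h x + stp i) - u (cell h x)‖ ≤ ‖v (cell h x + stp i) - v (cell h x)‖) :
    ‖dq h u i x‖ₑ ^ 2 ≤ ‖dq h v i x‖ₑ ^ 2 := by
  rw [dq, dq, enorm_smul, enorm_smul]
  gcongr
  rw [enorm_le_iff_norm_le]
  exact huv

/-- Bounded samples of `m` with a cutoff around the singular set. A field built from them has
almost the Dirichlet energy and is close to `m`, up to its energy in the set `B` where the cutoff
acts. -/
theorem SobolevH1.exists_cutoff_samples (hΩ : IsCompact Ω) (h0 : volume (frontier Ω) = 0)
    (m : SobolevH1 Ω) (hm : Measurable m.toFun) (hΓ : IsCompact Γ) (hΓne : Γ.Nonempty)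
    (hreg : ∀ p ∈ frontier Ω, p ∉ Γ → IsC1BoundaryPoint Ω p) {C : ℝ} (hC : 0 ≤ C)
    (htube : ∀ r ∈ Set.Ioc (0 : ℝ) 1, volume (Metric.cthickening r Γ) ≤ ENNReal.ofReal (C * r ^ 2))
    {c : E3 → E3} (hc : ∀ x y, ‖c x - c y‖ ≤ ‖x - y‖) {M : ℝ} {ε : ℝ} (hε : 0 < ε)
    (hcm : ∫⁻ x in Ω, ‖c (m.toFun x) - m.toFun x‖ₑ ^ 2 ≤ ENNReal.ofReal (ε / 4))
    {ε' : ℝ} (hε' : 0 < ε') :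
    ∃ h₀ > 0, ∀ h ∈ Set.Ioo 0 h₀, ∃ (s : (Fin 3 → ℤ) → E3) (η : (Fin 3 → ℤ) → ℝ) (B : Set E3),
      (∀ k, ∃ x, s k = c (m.toFun x)) ∧ (∀ k, η k ∈ Set.Icc (0 : ℝ) 1) ∧ MeasurableSet B ∧
      ∑ i, ∫⁻ x in B, ‖dq h s i x‖ₑ ^ 2 ≤ ENNReal.ofReal ε ∧
      (∀ i, ∫⁻ x, ‖η (cell h x + stp i) - η (cell h x)‖ₑ ^ 2 ≤ ENNReal.ofReal (h ^ 2 * ε')) ∧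
      (∀ w : (Fin 3 → ℤ) → E3,
        (∀ k i, η k = 1 → η (k + stp i) = 1 → ‖w (k + stp i) - w k‖ ≤ ‖s (k + stp i) - s k‖) →
        (∀ k i, η k = 0 → η (k + stp i) = 0 → w (k + stp i) = w k) →
        ∑ i, ∫⁻ x in Metric.cthickening (4 * h) Ω, ‖dq h w i x‖ₑ ^ 2 ≤
          ENNReal.ofReal ((∫ x in Ω, ∑ i, ‖m.pd i x‖ ^ 2) + ε) +
          ∑ i, ∫⁻ x in B, ‖dq h w i x‖ₑ ^ 2) ∧
      ∀ w : (Fin 3 → ℤ) → E3, (∀ k, η k = 1 → w k = s k) → (∀ k, ‖w k‖ ≤ M) →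
        ∫⁻ x in Ω, ‖w (cell h x) - m.toFun x‖ₑ ^ 2 ≤ ENNReal.ofReal ε := by
  have hΓ0 : volume Γ = 0 := by
    have h1 : Tendsto (fun r : ℝ => ENNReal.ofReal (C * r ^ 2)) (𝓝[>] 0) (𝓝 0) := by
      have h2 : Continuous fun r : ℝ => ENNReal.ofReal (C * r ^ 2) :=
        ENNReal.continuous_ofReal.comp (by fun_prop)
      have h3 := h2.tendsto 0
      simp only [ne_eq, OfNat.ofNat_ne_zero, not_false_eq_true, zero_pow, mul_zero,
        ENNReal.ofReal_zero] at h3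
      exact h3.mono_left nhdsWithin_le_nhds
    refine le_antisymm (ge_of_tendsto h1 ?_) zero_le
    filter_upwards [Ioc_mem_nhdsGT one_pos] with r hr
    exact (measure_mono (Metric.self_subset_cthickening Γ)).trans (htube r hr)
  set D := ∫ x in Ω, ∑ i, ‖m.pd i x‖ ^ 2
  set F : E3 → ℝ≥0∞ := fun x => 2 * ENNReal.ofReal (M ^ 2) + 2 * ‖m.toFun x‖ₑ ^ 2
  have hFfin : ∫⁻ x in Ω, F x ≠ ⊤ := by
    rw [lintegral_add_left measurable_const, setLIntegral_const,
      lintegral_const_mul' _ _ (by norm_num)]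
    exact ENNReal.add_ne_top.2 ⟨ENNReal.mul_ne_top (ENNReal.mul_ne_top (by norm_num)
      ENNReal.ofReal_ne_top) hΩ.measure_ne_top,
      ENNReal.mul_ne_top (by norm_num) (MemLp.lintegral_sq_ne_top m.memLp_toFun)⟩
  obtain ⟨δ, hδ, hδF⟩ := exists_collar hΩ h0 hΓ hΓne hΓ0 hFfin (ε := ε / 8) (by positivity)
  obtain ⟨ρ₀, hρ₀, hsamp⟩ := m.exists_samples hΩ h0 hm hΓ hΓne hΓ0 hreg (ε := ε / 16) (by positivity)
  set ρ := min ρ₀ δ / 2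
  have hρ : 0 < ρ := by positivity
  have hρρ₀ : ρ < ρ₀ := by
    have := min_le_left ρ₀ δ
    simp only [ρ]
    linarith
  have hρδ : 2 * ρ ≤ δ := by
    have := min_le_right ρ₀ δ
    simp only [ρ]
    linarith
  obtain ⟨η, -, hη, ⟨r', hr', hη0⟩, hη1, h₁, hh₁, hηE⟩ := exists_cutoff hΓ hΓne hC htube hε' hρ
  -- The cut-off is fixed first. Then r is taken below the radius r' within which it vanishes, so
  -- that for h small the samples are controlled wherever the cut-off is not zero.
  set r := min r' (ρ / 2)
  have hr : 0 < r := by positivity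
  have hrρ : r < ρ := (min_le_right _ _).trans_lt (by linarith)
  obtain ⟨h₂, hh₂, hsamp⟩ := hsamp ρ ⟨hρ, hρρ₀⟩ r ⟨hr, hrρ⟩
  refine ⟨min (min h₁ h₂) (r / 100), by positivity, fun h hh' => ?_⟩
  have hh : 0 < h := hh'.1
  have hhr : 100 * h < r := by
    have := hh'.2.trans_le (min_le_right _ _)
    linarith
  obtain ⟨s, hs, e1, e2, e3⟩ := hsamp h ⟨hh, hh'.2.trans_le
    ((min_le_left _ _).trans (min_le_right _ _))⟩
  set S := Metric.cthickening (4 * h) Ω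
  set B : Set E3 := {x ∈ S | r / 2 ≤ Metric.infDist x Γ ∧ Metric.infDist x Γ ≤ 2 * ρ}
  set A : Set E3 := {x ∈ S | r / 2 ≤ Metric.infDist x Γ}
  set T : Set E3 := {x ∈ Ω | r / 2 ≤ Metric.infDist x Γ}
  have hcΓ : Continuous fun x : E3 => Metric.infDist x Γ := Metric.continuous_infDist_pt _
  have hBm : MeasurableSet B := Metric.isClosed_cthickening.measurableSet.inter
    ((isClosed_le continuous_const hcΓ).measurableSet.inter
    (isClosed_le hcΓ continuous_const).measurableSet)
  have hAm : MeasurableSet A := Metric.isClosed_cthickening.measurableSet.inter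
    (isClosed_le continuous_const hcΓ).measurableSet
  have hd2 : ∀ x i, dist (pt h (cell h x + stp i)) x ≤ 3 * h := fun x i => by
    have h1 := dist_pt_add_stp hh (cell h x) i
    have h2 := dist_triangle (pt h (cell h x + stp i)) (pt h (cell h x)) x
    have h3 := dist_pt_cell_le hh x
    rw [dist_comm] at h3
    linarith
  have hd1 : ∀ x, dist (pt h (cell h x)) x ≤ 3 * h := fun x => by
    have h3 := dist_pt_cell_le hh x
    rw [dist_comm] at h3
    linarith
  have hne0 : ∀ x p, dist p x ≤ 3 * h → η p ≠ 0 → r / 2 ≤ Metric.infDist x Γ := by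
    intro x p hp hηp
    by_contra! hcon
    refine hηp (hη0 p ?_)
    linarith [lipschitz_infDist Γ p x, min_le_left r' (ρ / 2)]
  have hne1 : ∀ x p, dist p x ≤ 3 * h → η p ≠ 1 → Metric.infDist x Γ ≤ 2 * ρ := by
    intro x p hp hηp
    by_contra! hcon
    refine hηp (hη1 p ?_)
    rw [dist_comm] at hp
    linarith [lipschitz_infDist Γ x p]
  -- The contraction c will be a truncation for general fields and the identity for unit fields; it
  -- does not increase difference quotients.
  have hdqs : ∀ i x, ‖dq h (fun k => c (s k)) i x‖ₑ ^ 2 ≤ ‖dq h s i x‖ₑ ^ 2 := fun i x =>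
    norm_dq_le_of_norm_sub_le (hc _ _)
  refine ⟨fun k => c (s k), fun k => η (pt h k), B, fun k => (hs k).imp fun x hx => congrArg c hx,
    fun k => hη _, hBm, ?_, fun i => hηE h ⟨hh, hh'.2.trans_le
    ((min_le_left _ _).trans (min_le_left _ _))⟩ i, fun w hw1 hw0 => ?_, fun w hw1 hwM => ?_⟩
  · exact (Finset.sum_le_sum fun i _ => lintegral_mono (hdqs i)).trans
      (e2.trans (ENNReal.ofReal_le_ofReal (by linarith)))
  · refine le_trans ?_ (add_le_add_left (e1.trans (ENNReal.ofReal_le_ofReal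
      (q := D + ε) (by linarith))) _)
    rw [← Finset.sum_add_distrib]
    refine Finset.sum_le_sum fun i _ => ?_
    rw [← lintegral_indicator hAm, ← lintegral_indicator hBm, ← lintegral_indicator
      Metric.isClosed_cthickening.measurableSet, ← lintegral_add_left
      (((measurable_dq h s i).enorm.pow_const 2).indicator hAm)]
    refine lintegral_mono fun x => Set.indicator_apply_le' (fun hx => ?_) fun _ => zero_le
    -- Three regions: B, whose energy appears in the conclusion; the rest of the points far from Γ,
    -- where the cut-off is 1 at both nodes and w varies no more than s; the points near Γ, where it
    -- is 0 at both nodes and w is constant.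
    by_cases hxB : x ∈ B
    · rw [Set.indicator_of_mem hxB]
      exact le_add_self
    by_cases hxr : r / 2 ≤ Metric.infDist x Γ
    · rw [Set.indicator_of_mem (show x ∈ A from ⟨hx, hxr⟩)]
      refine le_trans ?_ le_self_add
      refine (norm_dq_le_of_norm_sub_le (v := fun k => c (s k)) ?_).trans (hdqs i x)
      refine hw1 _ i ?_ ?_
      · by_contra hcon
        exact hxB ⟨hx, hxr, hne1 x _ (hd1 x) hcon⟩
      · by_contra hcon
        exact hxB ⟨hx, hxr, hne1 x _ (hd2 x i) hcon⟩
    · have h1 : w (cell h x + stp i) = w (cell h x) := by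
        refine hw0 _ i ?_ ?_
        · by_contra hcon
          exact hxr (hne0 x _ (hd1 x) hcon)
        · by_contra hcon
          exact hxr (hne0 x _ (hd2 x i) hcon)
      rw [dq, h1]
      simp
  · set Z : Set E3 := {x ∈ interior Ω | Metric.infDist x Ωᶜ ≤ δ ∨ Metric.infDist x Γ ≤ δ}
    -- Where w may differ from the samples only the crude bound by F is used, on the collar Z of
    -- small F-mass. Elsewhere the distance splits into that of the samples from m and that of c ∘ m
    -- from m.
    have hsub : Ω ⊆ frontier Ω ∪ (Z ∪ {x ∈ Ω | 2 * ρ < Metric.infDist x Γ}) := by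
      intro x hx
      by_cases hxi : x ∈ interior Ω
      · by_cases hxρ : Metric.infDist x Γ ≤ 2 * ρ
        · exact Or.inr (Or.inl ⟨hxi, Or.inr (hxρ.trans hρδ)⟩)
        · exact Or.inr (Or.inr ⟨hx, not_le.1 hxρ⟩)
      · exact Or.inl ⟨subset_closure hx, hxi⟩
    have hsm : Measurable fun x => 2 * ‖s (cell h x) - m.toFun x‖ₑ ^ 2 :=
      (((measurable_comp_cell h s).sub hm).enorm.pow_const 2).const_mul 2
    have hZ : ∫⁻ x in Z, ‖w (cell h x) - m.toFun x‖ₑ ^ 2 ≤ ENNReal.ofReal (ε / 8) := by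
      refine le_trans (lintegral_mono fun x => ?_) hδF
      rw [sub_eq_add_neg]
      refine (enorm_sq_add_le _ _).trans ?_
      rw [enorm_neg]
      simp only [F]
      gcongr
      rw [← ofReal_norm, ← ENNReal.ofReal_pow (norm_nonneg _)]
      exact ENNReal.ofReal_le_ofReal (pow_le_pow_left₀ (norm_nonneg _) (hwM _) 2)
    have hT : ∫⁻ x in {x ∈ Ω | 2 * ρ < Metric.infDist x Γ}, ‖w (cell h x) - m.toFun x‖ₑ ^ 2 ≤
        2 * ENNReal.ofReal (ε / 16) + 2 * ENNReal.ofReal (ε / 4) := by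
      calc _ ≤ ∫⁻ x in {x ∈ Ω | 2 * ρ < Metric.infDist x Γ},
            (2 * ‖s (cell h x) - m.toFun x‖ₑ ^ 2 + 2 * ‖c (m.toFun x) - m.toFun x‖ₑ ^ 2) := by
            refine setLIntegral_mono' (hΩ.measurableSet.inter
              (isOpen_lt continuous_const hcΓ).measurableSet) fun x hx => ?_
            have h1 : η (pt h (cell h x)) = 1 := by
              by_contra hcon
              linarith [hne1 x _ (hd1 x) hcon, hx.2]
            rw [hw1 _ h1]
            have h2 : c (s (cell h x)) - m.toFun x = (c (s (cell h x)) - c (m.toFun x)) +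
              (c (m.toFun x) - m.toFun x) := by abel
            rw [h2]
            refine (enorm_sq_add_le _ _).trans ?_
            gcongr
            rw [enorm_le_iff_norm_le]
            exact hc _ _
        _ ≤ (∫⁻ x in T, 2 * ‖s (cell h x) - m.toFun x‖ₑ ^ 2) +
              ∫⁻ x in Ω, 2 * ‖c (m.toFun x) - m.toFun x‖ₑ ^ 2 := by
            rw [lintegral_add_left hsm]
            refine add_le_add (lintegral_mono_set fun x hx => ⟨hx.1, ?_⟩)
              (lintegral_mono_set fun x hx => hx.1)
            linarith [hx.2]
        _ ≤ _ := by
            rw [lintegral_const_mul' _ _ (by norm_num), lintegral_const_mul' _ _ (by norm_num)]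
            gcongr
    calc ∫⁻ x in Ω, ‖w (cell h x) - m.toFun x‖ₑ ^ 2
        ≤ 0 + (ENNReal.ofReal (ε / 8) + (2 * ENNReal.ofReal (ε / 16) +
          2 * ENNReal.ofReal (ε / 4))) := by
          refine (lintegral_mono_set hsub).trans ((lintegral_union_le _ _ _).trans ?_)
          refine add_le_add (setLIntegral_measure_zero _ _ h0).le ?_
          exact (lintegral_union_le _ _ _).trans (add_le_add hZ hT)
      _ ≤ ENNReal.ofReal ε := by
          rw [zero_add, show (2 : ℝ≥0∞) = ENNReal.ofReal 2 by norm_num,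
            ← ENNReal.ofReal_mul (by norm_num), ← ENNReal.ofReal_mul (by norm_num),
            ← ENNReal.ofReal_add (by positivity) (by positivity),
            ← ENNReal.ofReal_add (by positivity) (by positivity)]
          exact ENNReal.ofReal_le_ofReal (by linarith)

end CutoffSamples

/-! ### Truncation of unbounded fields -/

section Truncation

/-- The coordinates of `x`, truncated at height `M`. -/
noncomputable def clamp (M : ℝ) (x : E3) : E3 := WithLp.toLp 2 fun i => max (-M) (min M (x i))

theorem clamp_apply (M : ℝ) (x : E3) (i : Fin 3) : clamp M x i = max (-M) (min M (x i)) := rfl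

theorem norm_le_norm_of_abs_le {x y : E3} (hxy : ∀ i, |x i| ≤ |y i|) : ‖x‖ ≤ ‖y‖ := by
  rw [EuclideanSpace.norm_eq, EuclideanSpace.norm_eq]
  gcongr with i
  exact hxy i

theorem norm_clamp_sub_le (M : ℝ) (x y : E3) : ‖clamp M x - clamp M y‖ ≤ ‖x - y‖ := by
  refine norm_le_norm_of_abs_le fun i => ?_
  rw [PiLp.sub_apply, PiLp.sub_apply, clamp_apply, clamp_apply]
  refine (abs_max_sub_max_le_max _ _ _ _).trans ?_
  rw [sub_self, abs_zero, max_eq_right (abs_nonneg _)]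
  refine (abs_min_sub_min_le_max _ _ _ _).trans ?_
  rw [sub_self, abs_zero, max_eq_right (abs_nonneg _)]

theorem norm_clamp_le {M : ℝ} (hM : 0 ≤ M) (x : E3) : ‖clamp M x‖ ≤ 2 * M := by
  refine norm_le_of_forall_abs_le fun i => ?_
  rw [clamp_apply, abs_le]
  exact ⟨le_max_left _ _, max_le (by linarith) (min_le_left _ _)⟩

theorem clamp_eq_self {M : ℝ} {x : E3} (hx : ‖x‖ ≤ M) : clamp M x = x := by
  ext i
  have h1 := (abs_le.1 ((abs_apply_le_norm x i).trans hx))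
  rw [clamp_apply, min_eq_right h1.2, max_eq_right h1.1]

/-- Dominated convergence, with the truncation error bounded by 2 |f|. A bounded field is needed
because the cut-off contributes the square of the field times the energy of the cut-off. -/
theorem exists_lintegral_clamp_le {Ω : Set E3} {f : E3 → E3} (hfm : Measurable f)
    (hf : MemLp f 2 (volume.restrict Ω)) {ε : ℝ} (hε : 0 < ε) :
    ∃ M, 0 ≤ M ∧ ∫⁻ x in Ω, ‖clamp M (f x) - f x‖ₑ ^ 2 ≤ ENNReal.ofReal ε := by
  have hcl : ∀ M, Continuous (clamp M) := fun M =>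
    (LipschitzWith.of_dist_le_mul (K := 1) fun x y => by
      rw [dist_eq_norm, dist_eq_norm, NNReal.coe_one, one_mul]
      exact norm_clamp_sub_le M x y).continuous
  have h1 : Tendsto (fun N : ℕ => ∫⁻ x in Ω, ‖clamp N (f x) - f x‖ₑ ^ 2) atTop
      (𝓝 (∫⁻ x in Ω, 0)) := by
    refine tendsto_lintegral_of_dominated_convergence (fun x => 4 * ‖f x‖ₑ ^ 2) (fun N =>
      ((((hcl N).measurable.comp hfm).sub hfm).enorm.pow_const 2)) (fun N => ?_) ?_ ?_
    · refine Eventually.of_forall fun x => ?_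
      have h2 : ‖clamp N (f x) - f x‖ ≤ 2 * ‖f x‖ := by
        have h3 := norm_clamp_sub_le N (f x) 0
        rw [sub_zero, clamp_eq_self (x := 0) (by simp), sub_zero] at h3
        linarith [norm_sub_le (clamp N (f x)) (f x)]
      dsimp only
      rw [← ofReal_norm, ← ofReal_norm, ← ENNReal.ofReal_pow (norm_nonneg _),
        ← ENNReal.ofReal_pow (norm_nonneg _), show (4 : ℝ≥0∞) = ENNReal.ofReal 4 by norm_num,
        ← ENNReal.ofReal_mul (by norm_num)]
      refine ENNReal.ofReal_le_ofReal ((pow_le_pow_left₀ (norm_nonneg _) h2 2).trans_eq ?_)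
      ring
    · rw [lintegral_const_mul' _ _ (by norm_num)]
      exact ENNReal.mul_ne_top (by norm_num) (MemLp.lintegral_sq_ne_top hf)
    · refine Eventually.of_forall fun x => tendsto_const_nhds.congr' ?_
      obtain ⟨N₀, hN₀⟩ := exists_nat_ge ‖f x‖
      filter_upwards [eventually_ge_atTop N₀] with N hN
      rw [clamp_eq_self (hN₀.trans (by exact_mod_cast hN)), sub_self]
      simp
  rw [lintegral_zero] at h1
  obtain ⟨N, hN⟩ := (h1.eventually_le_const (ENNReal.ofReal_pos.2 hε)).exists
  exact ⟨N, Nat.cast_nonneg N, hN⟩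

end Truncation

/-! ### Recovery fields for general Sobolev functions -/

section Recovery

variable {Ω Γ : Set E3}

/-- A bound for the squared difference quotients of a field obtained from `s` by a cutoff. -/
noncomputable def cutoffDensity (h M : ℝ) (s : (Fin 3 → ℤ) → E3) (η : (Fin 3 → ℤ) → ℝ) (i : Fin 3)
    (x : E3) : ℝ≥0∞ :=
  ‖dq h s i x‖ₑ ^ 2 +
    ENNReal.ofReal ((h⁻¹ * M) ^ 2) * ‖η (cell h x + stp i) - η (cell h x)‖ₑ ^ 2

theorem measurable_cutoffDensity (h M : ℝ) (s : (Fin 3 → ℤ) → E3) (η : (Fin 3 → ℤ) → ℝ)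
    (i : Fin 3) : Measurable (cutoffDensity h M s η i) :=
  ((measurable_dq h s i).enorm.pow_const 2).add
    ((measurable_comp_cell h fun k => ‖η (k + stp i) - η k‖ₑ ^ 2).const_mul _)

theorem sum_lintegral_cutoffDensity_le {h M ε ε' : ℝ} (hh : 0 < h) (hε : 0 ≤ ε) (hε' : 0 ≤ ε')
    {s : (Fin 3 → ℤ) → E3} {η : (Fin 3 → ℤ) → ℝ} {B : Set E3}
    (hs : ∑ i, ∫⁻ x in B, ‖dq h s i x‖ₑ ^ 2 ≤ ENNReal.ofReal ε)
    (hη : ∀ i, ∫⁻ x, ‖η (cell h x + stp i) - η (cell h x)‖ₑ ^ 2 ≤ ENNReal.ofReal (h ^ 2 * ε')) :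
    ∑ i, ∫⁻ x in B, cutoffDensity h M s η i x ≤ ENNReal.ofReal (ε + 3 * (M ^ 2 * ε')) := by
  have h1 : ∀ i, ∫⁻ x in B, cutoffDensity h M s η i x ≤
      (∫⁻ x in B, ‖dq h s i x‖ₑ ^ 2) + ENNReal.ofReal (M ^ 2 * ε') := by
    intro i
    simp only [cutoffDensity]
    rw [lintegral_add_left ((measurable_dq h s i).enorm.pow_const 2),
      lintegral_const_mul' _ _ ENNReal.ofReal_ne_top]
    refine add_le_add_right ?_ _
    calc _ ≤ ENNReal.ofReal ((h⁻¹ * M) ^ 2) * ENNReal.ofReal (h ^ 2 * ε') :=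
          mul_le_mul_right ((setLIntegral_le_lintegral _ _).trans (hη i)) _
      _ = _ := by
          rw [← ENNReal.ofReal_mul (by positivity)]
          congr 1
          field_simp
  refine (Finset.sum_le_sum fun i _ => h1 i).trans ?_
  rw [Finset.sum_add_distrib, ENNReal.ofReal_add hε (by positivity),
    ENNReal.ofReal_mul (p := 3) (by norm_num)]
  refine add_le_add hs ?_
  simp

/-- The hypothesis is the discrete product rule, in a form shared by the cut-off to zero and by the
transition to a constant vector; M bounds what is multiplied by the increment of the cut-off. -/
theorem enorm_dq_sq_le_cutoffDensity {h M : ℝ} (hh : 0 < h) (hM : 0 ≤ M)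
    {w s : (Fin 3 → ℤ) → E3} {η : (Fin 3 → ℤ) → ℝ} {i : Fin 3} {x : E3}
    (hw : ‖w (cell h x + stp i) - w (cell h x)‖ₑ ≤ ‖s (cell h x + stp i) - s (cell h x)‖ₑ +
      ENNReal.ofReal M * ‖η (cell h x + stp i) - η (cell h x)‖ₑ) :
    ‖dq h w i x‖ₑ ^ 2 ≤ 2 * cutoffDensity h M s η i x := by
  rw [cutoffDensity, mul_add, dq, dq, enorm_smul, enorm_smul]
  refine (pow_le_pow_left₀ zero_le (mul_le_mul_right hw _) 2).trans ?_
  rw [mul_add]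
  refine (ennreal_add_sq_le _ _).trans (add_le_add_right (le_of_eq ?_) _)
  rw [Real.enorm_eq_ofReal (inv_nonneg.2 hh.le), ENNReal.ofReal_pow (by positivity),
    ENNReal.ofReal_mul (by positivity)]
  ring

theorem two_mul_ofReal (x : ℝ) : 2 * ENNReal.ofReal x = ENNReal.ofReal (2 * x) := by
  rw [ENNReal.ofReal_mul (by norm_num)]
  norm_num

/-- Fields with almost the Dirichlet energy of `m` that are close to `m`. -/
theorem SobolevH1.exists_field (hΩ : IsCompact Ω) (h0 : volume (frontier Ω) = 0)
    (m : SobolevH1 Ω) (hm : Measurable m.toFun) (hΓ : IsCompact Γ) (hΓne : Γ.Nonempty)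
    (hreg : ∀ p ∈ frontier Ω, p ∉ Γ → IsC1BoundaryPoint Ω p) {C : ℝ} (hC : 0 ≤ C)
    (htube : ∀ r ∈ Set.Ioc (0 : ℝ) 1, volume (Metric.cthickening r Γ) ≤ ENNReal.ofReal (C * r ^ 2))
    {ε : ℝ} (hε : 0 < ε) :
    ∃ h₀ > 0, ∀ h ∈ Set.Ioo 0 h₀, ∃ w : (Fin 3 → ℤ) → E3,
      ∑ i, ∫⁻ x in Metric.cthickening (4 * h) Ω, ‖dq h w i x‖ₑ ^ 2 ≤
        ENNReal.ofReal ((∫ x in Ω, ∑ i, ‖m.pd i x‖ ^ 2) + ε) ∧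
      ∫⁻ x in Ω, ‖w (cell h x) - m.toFun x‖ₑ ^ 2 ≤ ENNReal.ofReal ε := by
  obtain ⟨N, hN, hcl⟩ := exists_lintegral_clamp_le hm m.memLp_toFun (ε := ε / 10 / 4)
    (by positivity)
  set M := 2 * N
  have hM : 0 ≤ M := by positivity
  -- The energy of the cut-off is chosen after the height M, so that M² ε' ≤ ε/10. The total excess
  -- is then ε/10 + 2 (ε/10 + 3ε/10) < ε.
  have hε' : 0 < ε / (10 * (M ^ 2 + 1)) := by positivity
  have hMε : M ^ 2 * (ε / (10 * (M ^ 2 + 1))) ≤ ε / 10 := by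
    rw [mul_div_assoc', div_le_div_iff₀ (by positivity) (by positivity)]
    nlinarith
  obtain ⟨h₀, hh₀, hsamp⟩ := m.exists_cutoff_samples hΩ h0 hm hΓ hΓne hreg hC htube
    (norm_clamp_sub_le N) (M := M) (ε := ε / 10) (by positivity) hcl hε'
  refine ⟨h₀, hh₀, fun h hh' => ?_⟩
  obtain ⟨s, η, B, hs, hη, hBm, e1, e2, e3, e4⟩ := hsamp h hh'
  have hsM : ∀ k, ‖s k‖ ≤ M := fun k => by
    obtain ⟨x, hx⟩ := hs k
    rw [hx]
    exact norm_clamp_le hN _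
  have a1 : ∀ k, η k = 1 → η k • s k = s k := fun k hk => by rw [hk, one_smul]
  have a2 : ∀ k, ‖η k • s k‖ ≤ M := fun k => by
    rw [norm_smul, Real.norm_eq_abs, abs_of_nonneg (hη k).1]
    exact (mul_le_of_le_one_left (norm_nonneg _) (hη k).2).trans (hsM k)
  have a3 : ∀ k (i : Fin 3), η k = 1 → η (k + stp i) = 1 →
      ‖η (k + stp i) • s (k + stp i) - η k • s k‖ ≤ ‖s (k + stp i) - s k‖ := fun k i h1 h2 => by
    rw [h1, h2, one_smul, one_smul]
  have a4 : ∀ k (i : Fin 3), η k = 0 → η (k + stp i) = 0 →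
      η (k + stp i) • s (k + stp i) = η k • s k := fun k i h1 h2 => by
    rw [h1, h2, zero_smul, zero_smul]
  refine ⟨fun k => η k • s k, ?_, (e4 (fun k => η k • s k) a1 a2).trans
    (ENNReal.ofReal_le_ofReal (by linarith))⟩
  · refine (e3 (fun k => η k • s k) a3 a4).trans ?_
    have h1 : ∑ i, ∫⁻ x in B, ‖dq h (fun k => η k • s k) i x‖ₑ ^ 2 ≤
        2 * ENNReal.ofReal (ε / 10 + 3 * (M ^ 2 * (ε / (10 * (M ^ 2 + 1))))) := by
      refine le_trans ?_ (mul_le_mul_right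
        (sum_lintegral_cutoffDensity_le hh'.1 (by positivity) hε'.le e1 e2) 2)
      rw [Finset.mul_sum]
      refine Finset.sum_le_sum fun i _ => ?_
      rw [← lintegral_const_mul' _ _ (by norm_num)]
      refine lintegral_mono fun x => enorm_dq_sq_le_cutoffDensity hh'.1 hM ?_
      set l := cell h x + stp i
      set k := cell h x
      have h2 : η l • s l - η k • s k = η l • (s l - s k) + (η l - η k) • s k := by
        rw [smul_sub, sub_smul]; abel
      rw [h2]
      refine (enorm_add_le _ _).trans ?_
      rw [enorm_smul, enorm_smul, mul_comm (ENNReal.ofReal M)]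
      gcongr
      · refine mul_le_of_le_one_left' ?_
        rw [Real.enorm_eq_ofReal (hη l).1]
        exact ENNReal.ofReal_le_one.2 (hη l).2
      · rw [← ofReal_norm]
        exact ENNReal.ofReal_le_ofReal (hsM k)
    refine (add_le_add_right h1 _).trans ?_
    rw [two_mul_ofReal, ← ENNReal.ofReal_add (add_nonneg (integral_nonneg fun x => Finset.sum_nonneg fun i _ =>
        by positivity) (by positivity)) (by positivity)]
    exact ENNReal.ofReal_le_ofReal (by linarith)

end Recovery

/-! ### Recovery fields under the unit-norm constraint -/

section Normalization

theorem lintegral_ball_inv_sq_ne_top : ∫⁻ x in Metric.ball (0 : E3) 1, (‖x‖ₑ ^ 2)⁻¹ ≠ ⊤ := by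
  have hr : Module.finrank ℝ E3 = 3 := by simp
  have h1 : IntegrableOn (fun x : E3 => ‖x‖ ^ (-2 : ℝ)) (Metric.ball 0 1) :=
    integrableOn_ball_of_norm_le_rpow (by rw [hr]; norm_num) (C := 1) (α := 2) (by rw [hr]; norm_num)
      (Eventually.of_forall fun x => by
        rw [one_mul, Real.norm_of_nonneg (Real.rpow_nonneg (norm_nonneg x) _)])
      (Measurable.aestronglyMeasurable (by fun_prop))
  have h2 := h1.2
  rw [hasFiniteIntegral_iff_enorm] at h2
  refine ne_of_lt (lt_of_le_of_lt (lintegral_mono_ae ?_) h2)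
  have h3 : ∀ᵐ x : E3, x ≠ 0 := by
    rw [ae_iff]
    simp
  filter_upwards [ae_restrict_of_ae h3] with x hx
  have hx' : 0 < ‖x‖ := norm_pos_iff.2 hx
  rw [Real.enorm_eq_ofReal (Real.rpow_nonneg hx'.le _), Real.rpow_neg hx'.le, Real.rpow_ofNat,
    ENNReal.ofReal_inv_of_pos (by positivity), ENNReal.ofReal_pow hx'.le, ofReal_norm]

theorem ENNReal.inv_le_mul_inv {a b c : ℝ≥0∞} (hc : c ≠ 0) (hc' : c ≠ ⊤) (h : a ≤ c * b) :
    b⁻¹ ≤ c * a⁻¹ := by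
  calc b⁻¹ = c * (c * b)⁻¹ := by
        rw [ENNReal.mul_inv (Or.inl hc) (Or.inl hc'), ← mul_assoc, ENNReal.mul_inv_cancel hc hc',
          one_mul]
    _ ≤ c * a⁻¹ := by gcongr

/-- On average over `e` in the unit ball, convex combinations of `e` and a unit vector are not
close to the origin. -/
theorem exists_lintegral_ball_inv_sq_le : ∃ K : ℝ, 0 ≤ K ∧ ∀ p : E3, ‖p‖ = 1 → ∀ t ∈ Set.Icc (0 : ℝ) 1,
    ∫⁻ e in Metric.ball (0 : E3) 1, (‖t • p + (1 - t) • e‖ₑ ^ 2)⁻¹ ≤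
      volume (Metric.ball (0 : E3) 1) * ENNReal.ofReal K := by
  set J := ∫⁻ x in Metric.ball (0 : E3) 1, (‖x‖ₑ ^ 2)⁻¹
  set v := volume (Metric.ball (0 : E3) 1)
  have hv0 : v ≠ 0 := (Metric.measure_ball_pos volume _ one_pos).ne'
  have hv : v ≠ ⊤ := measure_ball_lt_top.ne
  have hfin : 16 * (J + v) / v ≠ ⊤ := ENNReal.div_ne_top (ENNReal.mul_ne_top (by norm_num)
    (ENNReal.add_ne_top.2 ⟨lintegral_ball_inv_sq_ne_top, hv⟩)) hv0
  refine ⟨(16 * (J + v) / v).toReal, ENNReal.toReal_nonneg, fun p hp t ht => ?_⟩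
  rw [ENNReal.ofReal_toReal hfin, ENNReal.mul_div_cancel hv0 hv]
  -- For t ≥ 3/4 the vector has norm at least 2t - 1 ≥ 1/2, and the integrand is bounded. Otherwise
  -- 1 - t > 1/4 can be divided out, and what remains is a translate of |x|⁻², bounded by its
  -- integral over the unit ball plus 1 outside.
  by_cases h34 : 3 / 4 ≤ t
  · calc ∫⁻ e in Metric.ball (0 : E3) 1, (‖t • p + (1 - t) • e‖ₑ ^ 2)⁻¹
        ≤ ∫⁻ _e in Metric.ball (0 : E3) 1, 16 := by
          refine setLIntegral_mono' Metric.isOpen_ball.measurableSet fun e he => ?_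
          rw [mem_ball_zero_iff] at he
          have h1 : 1 ≤ 4 * ‖t • p + (1 - t) • e‖ := by
            have h2 := norm_sub_le (t • p + (1 - t) • e) ((1 - t) • e)
            rw [add_sub_cancel_right, norm_smul, hp, norm_smul, Real.norm_of_nonneg ht.1,
              Real.norm_of_nonneg (sub_nonneg.2 ht.2)] at h2
            nlinarith [ht.2, norm_nonneg e]
          have h2 : (1 : ℝ≥0∞) ≤ 16 * ‖t • p + (1 - t) • e‖ₑ ^ 2 := by
            rw [← ofReal_norm, ← ENNReal.ofReal_pow (norm_nonneg _),
              show (16 : ℝ≥0∞) = ENNReal.ofReal 16 by norm_num, ← ENNReal.ofReal_mul (by norm_num),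
              ENNReal.one_le_ofReal]
            nlinarith
          simpa using ENNReal.inv_le_mul_inv (by norm_num) (by norm_num) h2
      _ = 16 * v := setLIntegral_const _ _
      _ ≤ 16 * (J + v) := by gcongr; exact le_add_self
  · push Not at h34
    have h1t : 0 < 1 - t := by linarith
    set q := (t / (1 - t)) • p
    set G : E3 → ℝ≥0∞ := (Metric.ball (0 : E3) 1).indicator fun x => (‖x‖ₑ ^ 2)⁻¹
    have hpt : ∀ e, (‖t • p + (1 - t) • e‖ₑ ^ 2)⁻¹ ≤ 16 * (G (e + q) + 1) := by
      intro e
      have h2 : t • p + (1 - t) • e = (1 - t) • (e + q) := by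
        simp only [q]
        rw [smul_add, smul_smul, mul_div_cancel₀ _ h1t.ne', add_comm]
      have h3 : ‖e + q‖ₑ ^ 2 ≤ 16 * ‖t • p + (1 - t) • e‖ₑ ^ 2 := by
        rw [h2, ← ofReal_norm, ← ofReal_norm, ← ENNReal.ofReal_pow (norm_nonneg _),
          ← ENNReal.ofReal_pow (norm_nonneg _), show (16 : ℝ≥0∞) = ENNReal.ofReal 16 by norm_num,
          ← ENNReal.ofReal_mul (by norm_num), norm_smul, Real.norm_of_nonneg h1t.le]
        refine ENNReal.ofReal_le_ofReal ?_
        have h4 : ‖e + q‖ ≤ 4 * ((1 - t) * ‖e + q‖) := by nlinarith [norm_nonneg (e + q)]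
        nlinarith [norm_nonneg (e + q)]
      refine (ENNReal.inv_le_mul_inv (by norm_num) (by norm_num) h3).trans ?_
      gcongr
      by_cases hx : e + q ∈ Metric.ball (0 : E3) 1
      · simp only [G]
        rw [Set.indicator_of_mem hx]
        exact le_self_add
      · refine le_trans ?_ le_add_self
        rw [mem_ball_zero_iff, not_lt] at hx
        refine ENNReal.inv_le_one.2 (one_le_pow₀ ?_)
        rw [← ofReal_norm]
        exact ENNReal.one_le_ofReal.2 hx
    calc ∫⁻ e in Metric.ball (0 : E3) 1, (‖t • p + (1 - t) • e‖ₑ ^ 2)⁻¹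
        ≤ ∫⁻ e in Metric.ball (0 : E3) 1, 16 * (G (e + q) + 1) := lintegral_mono hpt
      _ = 16 * ((∫⁻ e in Metric.ball (0 : E3) 1, G (e + q)) + v) := by
          rw [lintegral_const_mul' _ _ (by norm_num), lintegral_add_right _ measurable_const,
            setLIntegral_const, one_mul]
      _ ≤ 16 * (J + v) := by
          gcongr
          refine (setLIntegral_le_lintegral _ _).trans ?_
          rw [lintegral_add_right_eq_self G, lintegral_indicator Metric.isOpen_ball.measurableSet]

open Classical in
/-- The unit vector in the direction of `v`. -/
noncomputable def unitVector (v : E3) : E3 := if v = 0 then bz 0 else ‖v‖⁻¹ • v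

theorem norm_unitVector (v : E3) : ‖unitVector v‖ = 1 := by
  rw [unitVector]
  split_ifs with hv
  · exact norm_bz 0
  · rw [norm_smul, norm_inv, norm_norm, inv_mul_cancel₀ (norm_ne_zero_iff.2 hv)]

theorem unitVector_of_norm_eq_one {v : E3} (hv : ‖v‖ = 1) : unitVector v = v := by
  have : v ≠ 0 := by
    rintro rfl
    simp at hv
  rw [unitVector, if_neg this, hv, inv_one, one_smul]

/-- Only one of the vectors must be nonzero. For w = 0 the right side is 2, the largest distance of
unit vectors, so the default value at zero is harmless. -/
theorem norm_unitVector_sub_le {v : E3} (hv : v ≠ 0) (w : E3) :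
    ‖unitVector w - unitVector v‖ ≤ 2 * ‖v‖⁻¹ * ‖w - v‖ := by
  have hv' : 0 < ‖v‖ := norm_pos_iff.2 hv
  by_cases hw : w = 0
  · rw [hw, zero_sub, norm_neg, mul_assoc, inv_mul_cancel₀ hv'.ne']
    linarith [norm_sub_le (unitVector 0) (unitVector v), norm_unitVector 0, norm_unitVector v]
  · rw [norm_sub_rev, norm_sub_rev w, unitVector, unitVector, if_neg hv, if_neg hw]
    exact norm_inv_smul_sub_inv_smul_le hv' (norm_pos_iff.2 hw) le_rfl (abs_norm_sub_norm_le v w)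

/-- If v vanishes at the lower node, either the difference is zero or the right side is ∞. So no e
has to be excluded later. -/
theorem enorm_dq_unitVector_sq_le {h : ℝ} (hh : 0 < h) (v : (Fin 3 → ℤ) → E3) (i : Fin 3) (x : E3) :
    ‖dq h (fun k => unitVector (v k)) i x‖ₑ ^ 2 ≤
      4 * ((‖v (cell h x)‖ₑ ^ 2)⁻¹ * ‖dq h v i x‖ₑ ^ 2) := by
  by_cases hv : v (cell h x) = 0
  · by_cases hw : v (cell h x + stp i) = 0
    · simp [dq, hv, hw]
    · have h1 : ‖dq h v i x‖ₑ ≠ 0 := by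
        rw [enorm_ne_zero, dq, hv, sub_zero]
        exact smul_ne_zero (inv_ne_zero hh.ne') hw
      have h2 : (‖v (cell h x)‖ₑ ^ 2)⁻¹ = ⊤ := by rw [hv]; simp
      rw [h2, ENNReal.top_mul (pow_ne_zero 2 h1), ENNReal.mul_top (by norm_num)]
      exact le_top
  · have h1 := norm_unitVector_sub_le hv (v (cell h x + stp i))
    have hv' : 0 < ‖v (cell h x)‖ := norm_pos_iff.2 hv
    rw [← ofReal_norm, ← ofReal_norm, ← ofReal_norm, ← ENNReal.ofReal_pow (norm_nonneg _),
      ← ENNReal.ofReal_pow (norm_nonneg _), ← ENNReal.ofReal_pow (norm_nonneg _),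
      ← ENNReal.ofReal_inv_of_pos (by positivity), ← ENNReal.ofReal_mul (by positivity),
      show (4 : ℝ≥0∞) = ENNReal.ofReal 4 by norm_num, ← ENNReal.ofReal_mul (by norm_num)]
    refine ENNReal.ofReal_le_ofReal ?_
    rw [dq, dq, norm_smul, norm_smul, mul_pow, mul_pow]
    calc ‖h⁻¹‖ ^ 2 * ‖unitVector (v (cell h x + stp i)) - unitVector (v (cell h x))‖ ^ 2
        ≤ ‖h⁻¹‖ ^ 2 * (2 * ‖v (cell h x)‖⁻¹ * ‖v (cell h x + stp i) - v (cell h x)‖) ^ 2 := by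
          gcongr
      _ = _ := by ring

/-- The convex combination of the field `s` and the constant field `e` with weight `η`. -/
noncomputable def mix (s : (Fin 3 → ℤ) → E3) (η : (Fin 3 → ℤ) → ℝ) (e : E3) (k : Fin 3 → ℤ) : E3 :=
  η k • s k + (1 - η k) • e

theorem measurable_mix_cell (h : ℝ) (s : (Fin 3 → ℤ) → E3) (η : (Fin 3 → ℤ) → ℝ) :
    Measurable fun p : E3 × E3 => mix s η p.1 (cell h p.2) := by
  have h1 : Measurable fun x : E3 => η (cell h x) • s (cell h x) :=
    measurable_comp_cell h fun k => η k • s k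
  have h2 : Measurable fun x : E3 => 1 - η (cell h x) := measurable_comp_cell h fun k => 1 - η k
  exact (h1.comp measurable_snd).add ((h2.comp measurable_snd).smul measurable_fst)

theorem measurable_mix (s : (Fin 3 → ℤ) → E3) (η : (Fin 3 → ℤ) → ℝ) (k : Fin 3 → ℤ) :
    Measurable fun e => mix s η e k :=
  (measurable_id.const_smul (1 - η k)).const_add (η k • s k)

/-- The weight Q does not depend on e. By Fubini, the mean over e of the weighted integrals is at
most K times the integral of Q, and some e does not exceed the mean. -/
theorem exists_sum_lintegral_mix_le {h K : ℝ} {s : (Fin 3 → ℤ) → E3} {η : (Fin 3 → ℤ) → ℝ}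
    (hK : ∀ k, ∫⁻ e in Metric.ball (0 : E3) 1, (‖mix s η e k‖ₑ ^ 2)⁻¹ ≤
      volume (Metric.ball (0 : E3) 1) * ENNReal.ofReal K) (B : Set E3) {Q : Fin 3 → E3 → ℝ≥0∞}
    (hQ : ∀ i, Measurable (Q i)) : ∃ e : E3, ‖e‖ < 1 ∧
      ∑ i, ∫⁻ x in B, (‖mix s η e (cell h x)‖ₑ ^ 2)⁻¹ * Q i x ≤
        ENNReal.ofReal K * ∑ i, ∫⁻ x in B, Q i x := by
  have hFm : ∀ i, Measurable fun p : E3 × E3 => (‖mix s η p.1 (cell h p.2)‖ₑ ^ 2)⁻¹ * Q i p.2 :=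
    fun i => ((measurable_mix_cell h s η).enorm.pow_const 2).inv.mul ((hQ i).comp measurable_snd)
  have hXi : ∀ i, Measurable fun e => ∫⁻ x in B, (‖mix s η e (cell h x)‖ₑ ^ 2)⁻¹ * Q i x := fun i =>
    (hFm i).lintegral_prod_right'
  obtain ⟨e, he, heX⟩ := exists_le_setLAverage (μ := volume)
    (Metric.measure_ball_pos volume (0 : E3) one_pos).ne' measure_ball_lt_top.ne
    (Finset.measurable_fun_sum Finset.univ fun i _ => hXi i).aemeasurable
  refine ⟨e, by simpa using he, heX.trans ?_⟩
  rw [setLAverage_eq]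
  refine ENNReal.div_le_of_le_mul ?_
  rw [lintegral_finsetSum _ fun i _ => hXi i, mul_right_comm, mul_comm (ENNReal.ofReal K),
    Finset.mul_sum]
  refine Finset.sum_le_sum fun i _ => ?_
  rw [lintegral_lintegral_swap (hFm i).aemeasurable, ← lintegral_const_mul _ (hQ i)]
  refine lintegral_mono fun x => ?_
  have h2 : Measurable fun e => (‖mix s η e (cell h x)‖ₑ ^ 2)⁻¹ :=
    ((measurable_mix s η (cell h x)).enorm.pow_const 2).inv
  rw [lintegral_mul_const _ h2]
  exact mul_le_mul_left (hK _) _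

variable {Ω Γ : Set E3}

/-- Unit fields with almost the Dirichlet energy of the unit field `m` that are close to `m`. -/
theorem SobolevH1.exists_unit_field (hΩ : IsCompact Ω) (h0 : volume (frontier Ω) = 0)
    (m : SobolevH1 Ω) (hm : Measurable m.toFun) (hm1 : ∀ x, ‖m.toFun x‖ = 1) (hΓ : IsCompact Γ)
    (hΓne : Γ.Nonempty) (hreg : ∀ p ∈ frontier Ω, p ∉ Γ → IsC1BoundaryPoint Ω p) {C : ℝ}
    (hC : 0 ≤ C)
    (htube : ∀ r ∈ Set.Ioc (0 : ℝ) 1, volume (Metric.cthickening r Γ) ≤ ENNReal.ofReal (C * r ^ 2))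
    {ε : ℝ} (hε : 0 < ε) :
    ∃ h₀ > 0, ∀ h ∈ Set.Ioo 0 h₀, ∃ w : (Fin 3 → ℤ) → E3, (∀ k, ‖w k‖ = 1) ∧
      ∑ i, ∫⁻ x in Metric.cthickening (4 * h) Ω, ‖dq h w i x‖ₑ ^ 2 ≤
        ENNReal.ofReal ((∫ x in Ω, ∑ i, ‖m.pd i x‖ ^ 2) + ε) ∧
      ∫⁻ x in Ω, ‖w (cell h x) - m.toFun x‖ₑ ^ 2 ≤ ENNReal.ofReal ε := by
  obtain ⟨K, hK, hKp⟩ := exists_lintegral_ball_inv_sq_le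
  -- The excess of energy will be ε₁ + 8K (ε₁ + 12ε₁) = (1 + 104K) ε₁ < ε.
  set ε₁ := ε / (1000 * (K + 1))
  have hε₁ : 0 < ε₁ := by positivity
  have hKε : (K + 1) * ε₁ = ε / 1000 := by simp only [ε₁]; field_simp
  obtain ⟨h₀, hh₀, hsamp⟩ := m.exists_cutoff_samples hΩ h0 hm hΓ hΓne hreg hC htube (c := id)
    (fun x y => le_rfl) (M := 1) (ε := ε₁) hε₁ (by simp) hε₁
  refine ⟨h₀, hh₀, fun h hh' => ?_⟩
  have hh : 0 < h := hh'.1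
  obtain ⟨s, η, B, hs, hη, hBm, e1, e2, e3, e4⟩ := hsamp h hh'
  have hs1 : ∀ k, ‖s k‖ = 1 := fun k => by
    obtain ⟨x, hx⟩ := hs k
    rw [hx]
    exact hm1 x
  -- The 2 bounds ‖s k - e‖, as s k is a unit vector and ‖e‖ < 1.
  set Q := cutoffDensity h 2 s η
  have hQ : ∑ i, ∫⁻ x in B, Q i x ≤ ENNReal.ofReal (ε₁ + 3 * (2 ^ 2 * ε₁)) :=
    sum_lintegral_cutoffDensity_le hh hε₁.le hε₁.le e1 e2
  obtain ⟨e, he1, heX⟩ := exists_sum_lintegral_mix_le (h := h)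
    (fun k => hKp (s k) (hs1 k) (η k) (hη k)) B (measurable_cutoffDensity h 2 s η)
  have heX' : ∑ i, ∫⁻ x in B, (‖mix s η e (cell h x)‖ₑ ^ 2)⁻¹ * Q i x ≤
      ENNReal.ofReal (K * (ε₁ + 3 * (2 ^ 2 * ε₁))) := by
    rw [ENNReal.ofReal_mul hK]
    exact heX.trans (mul_le_mul_right hQ _)
  have a1 : ∀ k, η k = 1 → unitVector (mix s η e k) = s k := fun k hk => by
    simp only [mix]
    rw [hk, sub_self, zero_smul, add_zero, one_smul, unitVector_of_norm_eq_one (hs1 k)]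
  have a3 : ∀ k (i : Fin 3), η k = 1 → η (k + stp i) = 1 →
      ‖unitVector (mix s η e (k + stp i)) - unitVector (mix s η e k)‖ ≤ ‖s (k + stp i) - s k‖ :=
    fun k i h1 h2 => by rw [a1 _ h1, a1 _ h2]
  have a4 : ∀ k (i : Fin 3), η k = 0 → η (k + stp i) = 0 →
      unitVector (mix s η e (k + stp i)) = unitVector (mix s η e k) := fun k i h1 h2 => by
    simp only [mix]
    rw [h1, h2, zero_smul, zero_smul]
  refine ⟨fun k => unitVector (mix s η e k), fun k => norm_unitVector _,
    (e3 (fun k => unitVector (mix s η e k)) a3 a4).trans ?_,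
    (e4 (fun k => unitVector (mix s η e k)) a1 fun k => (norm_unitVector _).le).trans
      (ENNReal.ofReal_le_ofReal (by nlinarith))⟩
  have hB : ∑ i, ∫⁻ x in B, ‖dq h (fun k => unitVector (mix s η e k)) i x‖ₑ ^ 2 ≤
      8 * ∑ i, ∫⁻ x in B, (‖mix s η e (cell h x)‖ₑ ^ 2)⁻¹ * Q i x := by
    rw [Finset.mul_sum]
    refine Finset.sum_le_sum fun i _ => ?_
    rw [← lintegral_const_mul' _ _ (by norm_num)]
    refine lintegral_mono fun x => (enorm_dq_unitVector_sq_le hh (mix s η e) i x).trans ?_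
    have h1 : ‖dq h (mix s η e) i x‖ₑ ^ 2 ≤ 2 * Q i x := by
      refine enorm_dq_sq_le_cutoffDensity hh (by norm_num) ?_
      set l := cell h x + stp i
      set k := cell h x
      have h2 : mix s η e l - mix s η e k = η l • (s l - s k) + (η l - η k) • (s k - e) := by
        simp only [mix]
        module
      rw [h2]
      refine (enorm_add_le _ _).trans ?_
      rw [enorm_smul, enorm_smul, mul_comm (ENNReal.ofReal 2)]
      gcongr
      · refine mul_le_of_le_one_left' ?_
        rw [Real.enorm_eq_ofReal (hη l).1]
        exact ENNReal.ofReal_le_one.2 (hη l).2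
      · rw [← ofReal_norm]
        refine ENNReal.ofReal_le_ofReal ((norm_sub_le _ _).trans ?_)
        linarith [hs1 k]
    calc 4 * ((‖mix s η e (cell h x)‖ₑ ^ 2)⁻¹ * ‖dq h (mix s η e) i x‖ₑ ^ 2)
        ≤ 4 * ((‖mix s η e (cell h x)‖ₑ ^ 2)⁻¹ * (2 * Q i x)) := by gcongr
      _ = _ := by ring
  refine (add_le_add_right (hB.trans (mul_le_mul_right heX' 8)) _).trans ?_
  have h8 : (8 : ℝ≥0∞) * ENNReal.ofReal (K * (ε₁ + 3 * (2 ^ 2 * ε₁))) =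
      ENNReal.ofReal (8 * (K * (ε₁ + 3 * (2 ^ 2 * ε₁)))) := by
    rw [ENNReal.ofReal_mul (p := 8) (by norm_num)]
    norm_num
  rw [h8, ← ENNReal.ofReal_add (add_nonneg (integral_nonneg fun x => Finset.sum_nonneg fun i _ =>
    by positivity) hε₁.le) (by positivity)]
  exact ENNReal.ofReal_le_ofReal (by nlinarith)

end Normalization

/-! ### The Γ-convergence theorem -/

theorem mainTheorem1 (a A : ℝ) (ha : 0 < a) (hA : 0 < A) (Ω : Set E3)
    (hcompact : IsCompact Ω) (hzero : (0 : E3) ∈ interior Ω)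
    (hboundary : HasPiecewiseC1Boundary Ω) (hcone : HasConeProperty Ω) :
    -- lower bound, for all convergent sequences, with or without near-alignment
    (∀ (μ : ∀ n, SpinField a Ω n) (m : SobolevH1 Ω), ConvergesTo a Ω μ m →
      (continuumExchangeEnergy A m : EReal) ≤
        liminf (fun n => (discreteExchangeEnergy a A Ω n (μ n) : EReal)) atTop) ∧
    -- upper bound
    (∀ m : SobolevH1 Ω, ∃ μ : ∀ n, SpinField a Ω n, IsRecoverySequence a A Ω μ m) ∧
    -- upper bound by near-aligned sequences
    (∀ m : SobolevH1 Ω, IsLipschitz m →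
      ∃ μ : ∀ n, SpinField a Ω n, NearAligned a Ω μ ∧ IsRecoverySequence a A Ω μ m) ∧
    -- compatibility with the unit-norm constraint
    (∀ (μ : ∀ n, SpinField a Ω n) (m : SobolevH1 Ω), UnitSpins a Ω μ → ConvergesTo a Ω μ m →
      UnitNorm m) ∧
    (∀ m : SobolevH1 Ω, UnitNorm m →
      ∃ μ : ∀ n, SpinField a Ω n, UnitSpins a Ω μ ∧ IsRecoverySequence a A Ω μ m) ∧
    (∀ m : SobolevH1 Ω, UnitNorm m → IsLipschitz m →
      ∃ μ : ∀ n, SpinField a Ω n, NearAligned a Ω μ ∧ UnitSpins a Ω μ ∧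
        IsRecoverySequence a A Ω μ m) := by
  have h0 := hboundary.volume_frontier
  obtain ⟨Γ, hΓ, hΓne, hreg, C, hC, htube⟩ := hboundary.exists_singular
  have hev : ∀ h₀ > 0, ∀ᶠ n : ℕ+ in atTop, a / ((n : ℕ) : ℝ) ∈ Set.Ioo 0 h₀ := fun h₀ hh₀ => by
    filter_upwards [(tendsto_spacing a).eventually_lt_const hh₀] with n hn
      using ⟨spacing_pos ha n, hn⟩
  refine ⟨fun μ m hm => hm.energy_le_liminf ha hA hcompact h0, fun m => ?_, fun m hm => ?_,
    fun μ m hu hc => hu.unitNorm ha hcompact h0 hc, fun m hm => ?_, fun m hu hm => ?_⟩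
  -- Point values are sampled and averaged over translations, so a measurable representative is
  -- needed. Changes on null sets affect neither the convergence nor the energy.
  · obtain ⟨m', hm', hae, hpd, -⟩ := m.exists_measurable_rep
    obtain ⟨u, -, hu⟩ := exists_recoverySequence ha hA hcompact h0 m' (fun _ _ => True)
      (fun _ => ⟨0, trivial⟩) fun ε hε => by
        obtain ⟨h₀, hh₀, hf⟩ := m'.exists_field hcompact h0 hm' hΓ hΓne hreg hC htube hε
        filter_upwards [hev h₀ hh₀] with n hn
        obtain ⟨w, hw⟩ := hf _ hn
        exact ⟨w, trivial, hw⟩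
    exact ⟨_, hu.congr hae.symm hpd.symm⟩
  · obtain ⟨μ, h1, -, h2⟩ := hm.exists_recoverySequence ha hA hcompact h0 hcone
    exact ⟨μ, h1, h2⟩
  · obtain ⟨m', hm', hae, hpd, hunit⟩ := m.exists_measurable_rep
    obtain ⟨u, hu1, hu⟩ := exists_recoverySequence ha hA hcompact h0 m'
      (fun _ u => ∀ k, ‖u k‖ = 1) (fun _ => ⟨fun _ => bz 0, fun _ => norm_bz 0⟩) fun ε hε => by
        obtain ⟨h₀, hh₀, hf⟩ := m'.exists_unit_field hcompact h0 hm' (hunit hm) hΓ hΓne hreg hC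
          htube hε
        filter_upwards [hev h₀ hh₀] with n hn using hf _ hn
    exact ⟨_, fun n x => hu1 n x.1, hu.congr hae.symm hpd.symm⟩
  · obtain ⟨μ, h1, h2, h3⟩ := hm.exists_recoverySequence ha hA hcompact h0 hcone
    exact ⟨μ, h1, h2 hu, h3⟩
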